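/- **Setting.** For functions on $(0,\infty)$ write $(f*g)(t)=\int_0^t f(t-\tau)g(\tau)\,d\tau$. Let $k,l$ be a pair of kernels satisfying (K0) $k,l\in L_{1,loc}([0,\infty))\cap C^1((0,\infty))$ are nonnegative and nonincreasing, $k$ is convex, and $k*l=1$ on $(0,\infty)$; (K1) with some $p_0>1$, $\bar t>0$, $\bar c>1$: $l\in L_{p_0}((0,\bar t))$ and $\frac1t\int_0^t l(s)^{p_0}ds\le \bar c\, l(t)^{p_0}$ for $0<t\le\bar t$; (K3) with some $c_0,\omega>0$ and a nondecreasing function $c:(0,\infty)\to(0,\infty)$: $-\dot k(y)\le \frac{c_0}{y(1*l)(y)}$ for $0<y\le1$, and, for all $M>0$, $-\dot k(xy)\le c(M)\,y^{-\omega}[-\dot k(x)]$ whenever $0<y\le 1$ and $0<x(1-y)\le M$. Put $k_1=1/(1*l)$, $r_0=(\int_0^\infty l\,dt)^{1/2}\in(0,\infty]$, and for $0<r<r_0$ let $\Phi(r)>0$ be the unique time with $k_1(\Phi(r))=r^{-2}$. Let $T>0$, let $\Omega\subset\mathbb R$ be a bounded domain (open interval), $\Omega_T=(0,T)\times\Omega$,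 $A\in L_\infty(\Omega_T)$ with $\Lambda=\operatorname{ess\,sup}_{\Omega_T}|A|$ and $A\ge\nu>0$ a.e. in $\Omega_T$, and $u_0\in L_2(\Omega)$. For $t_0\in(0,T]$ and an open interval $B\subset\Omega$, a *weak subsolution* of $\partial_t(k*(u-u_0))-(Au_x)_x=0$ in $(0,t_0)\times B$ is a function $u\in L_2((0,t_0);H^1_2(B))$ with $k*u\in C([0,t_0];L_2(B))$, $(k*u)|_{t=0}=0$, such that $$\int_0^{t_0}\!\!\int_B\big(-\zeta_t\,[k*(u-u_0)]+A\,u_x\,\zeta_x\big)\,dx\,dt\le0$$ for all nonnegative $\zeta\in H^1_2((0,t_0);L_2(B))\cap L_2((0,t_0);\mathring H^1_2(B))$ with $\zeta|_{t=t_0}=0$. **Theorem 4.2.** Let $\eta>0$ and $\delta\in(0,1)$ be fixed. There exists $r^*\in(0,r_0)$ such that for any $0<r\le r^*$, any $t_0\in(0,T]$ with $t_0-\eta\Phi(r)\ge0$, any ball $B_r(x_0)\subset\Omega$, any weak subsolution $u\ge0$ in $(0,t_0)\times B_r(x_0)$ with $u_0\ge0$ in $B_r(x_0)$, and all $\delta\le\sigma'<\sigma\le1$,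 $$\operatorname*{ess\,sup}_{U_{\sigma'}}u\le\frac{C}{(\sigma-\sigma')^{\tau_0}}\Big(\frac1{\Phi(r)}\int_{t_0-\sigma\eta\Phi(r)}^{t_0}\operatorname*{ess\,sup}_{x\in B_{r\sigma}(x_0)}u(t,x)\,dt+k(t_0-\sigma\eta\Phi(r))\,r\int_{B_{r\sigma}(x_0)}u_0\,dx+r\int_0^{t_0-\sigma'\eta\Phi(r)}[-\dot k(t_0-\tau)]\int_{B_{r\sigma}(x_0)}u(\tau,x)\,dx\,d\tau\Big),$$ where $U_\sigma=(t_0-\sigma\eta\Phi(r),t_0)\times B_{r\sigma}(x_0)$, and $k(0)$ is read as $k(0+)=\infty$ with $\infty\cdot0=0$. Here $\tau_0>0$ depends only on $\omega$ and $p_0$, and $C>0$ depends only on $\nu,\Lambda,\delta,\eta,\bar c$ and on the remaining parameters $p_0$, $\omega$ and $c(\cdot)$ of (K1) and (K3); both are otherwise independent of $k,l,T,\Omega,A,u_0,r,t_0,x_0,u,\sigma,\sigma'$. -/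

import Mathlib

open Set Filter Topology MeasureTheory
open scoped ENNReal

namespace Subdiffusion

/-! ### Kernels -/

/-- Convolution on the positive half-line with respect to time,
`(f * g)(t) = ∫₀ᵗ f (t - τ) g τ dτ`. -/
noncomputable def conv (f g : ℝ → ℝ) (t : ℝ) : ℝ :=
  ∫ τ in (0 : ℝ)..t, f (t - τ) * g τ

/-- (K0): `k` and `l` are locally integrable on `[0, ∞)`, continuously differentiable on `(0, ∞)`,
nonnegative and nonincreasing there, `k` is convex, and `k * l = 1`. -/
structure AssumptionK0 (k l : ℝ → ℝ) : Prop where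
  locInt_k : LocallyIntegrableOn k (Ici 0)
  locInt_l : LocallyIntegrableOn l (Ici 0)
  contDiff_k : ContDiffOn ℝ 1 k (Ioi 0)
  contDiff_l : ContDiffOn ℝ 1 l (Ioi 0)
  nonneg_k : ∀ t, 0 < t → 0 ≤ k t
  nonneg_l : ∀ t, 0 < t → 0 ≤ l t
  antitone_k : AntitoneOn k (Ioi 0)
  antitone_l : AntitoneOn l (Ioi 0)
  convex_k : ConvexOn ℝ (Ioi 0) k
  conv_eq_one : ∀ t, 0 < t → conv k l t = 1

/-- (K1) with its parameters: exponent `p₀ > 1`, time `tK > 0`, constant `cbar > 1`. -/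
structure AssumptionK1 (l : ℝ → ℝ) (p₀ tK cbar : ℝ) : Prop where
  one_lt_p : 1 < p₀
  pos_tK : 0 < tK
  one_lt_cbar : 1 < cbar
  memLp_l : MemLp l (ENNReal.ofReal p₀) (volume.restrict (Ioo 0 tK))
  average_le : ∀ t, 0 < t → t ≤ tK →
    (1 / t) * ∫ s in (0 : ℝ)..t, l s ^ p₀ ≤ cbar * l t ^ p₀

/-- (K3) with its parameters: constants `c₀, ω > 0` and a nondecreasing function
`c : (0, ∞) → (0, ∞)`. -/
structure AssumptionK3 (k l : ℝ → ℝ) (c₀ ω : ℝ) (c : ℝ → ℝ) : Prop where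
  pos_c₀ : 0 < c₀
  pos_ω : 0 < ω
  pos_c : ∀ M, 0 < M → 0 < c M
  mono_c : MonotoneOn c (Ioi 0)
  neg_deriv_le : ∀ y, 0 < y → y ≤ 1 → -deriv k y ≤ c₀ / (y * ∫ s in (0 : ℝ)..y, l s)
  neg_deriv_mul_le : ∀ M, 0 < M → ∀ x y, 0 < y → y ≤ 1 → 0 < x * (1 - y) → x * (1 - y) ≤ M →
    -deriv k (x * y) ≤ c M * y ^ (-ω) * (-deriv k x)

/-- `k₁(t) = 1 / (1 * l)(t)`. -/
noncomputable def k₁ (l : ℝ → ℝ) (t : ℝ) : ℝ := (∫ s in (0 : ℝ)..t, l s)⁻¹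

/-- `r₀ = (∫₀^∞ l)^{1/2} ∈ (0, ∞]`. -/
noncomputable def r₀ (l : ℝ → ℝ) : ℝ≥0∞ :=
  (∫⁻ t in Ioi (0 : ℝ), ENNReal.ofReal (l t)) ^ (1 / 2 : ℝ)

/-- For `0 < r < r₀`, `Φ(r)` is the (unique) time `t > 0` with `k₁(t) = r⁻²`. -/
noncomputable def Φ (l : ℝ → ℝ) (r : ℝ) : ℝ := sInf {t : ℝ | 0 < t ∧ k₁ l t = (r ^ 2)⁻¹}

/-- The value of the nonincreasing kernel `k` at `t ≥ 0` as an element of `[0, ∞]`: this is `k t`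
for `t > 0` (where `k` is continuous), and the limit `k(0+)` for `t = 0`. -/
noncomputable def kernelVal (k : ℝ → ℝ) (t : ℝ) : ℝ≥0∞ := ⨆ s ∈ Ioi t, ENNReal.ofReal (k s)

/-! ### Function spaces on the cylinder `(0, T) × Ω` -/

/-- The cylinder `Ω_T = (0, T) × Ω`. -/
def cyl (T : ℝ) (Ω : Set ℝ) : Set (ℝ × ℝ) := Ioo 0 T ×ˢ Ω

/-- `φ ∈ C₀^∞(Ω)`. -/
def IsTestFn (Ω : Set ℝ) (φ : ℝ → ℝ) : Prop :=
  ContDiff ℝ (⊤ : ℕ∞) φ ∧ HasCompactSupport φ ∧ tsupport φ ⊆ Ω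

/-- `v ∈ H¹₂(Ω)` with weak derivative `w`. -/
def IsH1 (Ω : Set ℝ) (v w : ℝ → ℝ) : Prop :=
  MemLp v 2 (volume.restrict Ω) ∧ MemLp w 2 (volume.restrict Ω) ∧
  ∀ φ, IsTestFn Ω φ → ∫ x in Ω, v x * deriv φ x = -∫ x in Ω, w x * φ x

/-- `v` belongs to the closure of `C₀^∞(Ω)` in `H¹₂(Ω)`, with weak derivative `w`. -/
def IsH1Zero (Ω : Set ℝ) (v w : ℝ → ℝ) : Prop :=
  IsH1 Ω v w ∧ ∃ φ : ℕ → ℝ → ℝ, (∀ n, IsTestFn Ω (φ n)) ∧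
    Tendsto (fun n => eLpNorm (fun x => φ n x - v x) 2 (volume.restrict Ω)) atTop (𝓝 0) ∧
    Tendsto (fun n => eLpNorm (fun x => deriv (φ n) x - w x) 2 (volume.restrict Ω)) atTop (𝓝 0)

/-- `v ∈ L₂((0,T); H¹₂(Ω))` with spatial weak derivative `Dv`. -/
def IsL2H1 (T : ℝ) (Ω : Set ℝ) (v Dv : ℝ → ℝ → ℝ) : Prop :=
  MemLp (Function.uncurry v) 2 (volume.restrict (cyl T Ω)) ∧
  MemLp (Function.uncurry Dv) 2 (volume.restrict (cyl T Ω)) ∧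
  ∀ᵐ t ∂(volume.restrict (Ioo 0 T)), IsH1 Ω (v t) (Dv t)

/-- `v ∈ Z`, with spatial weak derivative `Dv`: `v ∈ L₂((0,T); H¹₂(Ω))`, and `k * v` has a
representative in `C([0,T]; L₂(Ω))` which vanishes at `t = 0`. -/
def IsInZ (k : ℝ → ℝ) (T : ℝ) (Ω : Set ℝ) (v Dv : ℝ → ℝ → ℝ) : Prop :=
  IsL2H1 T Ω v Dv ∧
  ∃ W : ℝ → Lp ℝ 2 (volume.restrict Ω), ContinuousOn W (Icc 0 T) ∧ W 0 = 0 ∧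
    ∀ᵐ t ∂(volume.restrict (Ioo 0 T)),
      (W t : ℝ → ℝ) =ᵐ[volume.restrict Ω] fun x => conv k (fun τ => v τ x) t

/-- Nonnegative test functions of the weak formulation:
`ζ ∈ H¹₂((0,T); L₂(Ω)) ∩ L₂((0,T); H̊¹₂(Ω))`, `ζ ≥ 0`, with time derivative `ζt`, spatial
derivative `Dζ`, and `ζ|_{t=T} = 0`. Membership in `H¹₂((0,T); L₂(Ω))` with zero trace at `t = T`
means that `ζ(t) = -∫ₜᵀ ζt(s) ds` for some `ζt ∈ L₂((0,T); L₂(Ω))`. -/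
structure IsNonnegTest (T : ℝ) (Ω : Set ℝ) (ζ ζt Dζ : ℝ → ℝ → ℝ) : Prop where
  nonneg : ∀ᵐ z ∂(volume.restrict (cyl T Ω)), 0 ≤ ζ z.1 z.2
  memLp : MemLp (Function.uncurry ζ) 2 (volume.restrict (cyl T Ω))
  memLp_t : MemLp (Function.uncurry ζt) 2 (volume.restrict (cyl T Ω))
  memLp_x : MemLp (Function.uncurry Dζ) 2 (volume.restrict (cyl T Ω))
  primitive : ∀ᵐ z ∂(volume.restrict (cyl T Ω)), ζ z.1 z.2 = -∫ s in z.1..T, ζt s z.2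
  space : ∀ᵐ t ∂(volume.restrict (Ioo 0 T)), IsH1Zero Ω (ζ t) (Dζ t)

/-- `u` is a weak subsolution of `∂ₜ(k * (u - u₀)) - (A uₓ)ₓ = 0` in `(0, T) × Ω`. -/
def IsWeakSubsolution (k : ℝ → ℝ) (A : ℝ → ℝ → ℝ) (u₀ : ℝ → ℝ) (T : ℝ) (Ω : Set ℝ)
    (u : ℝ → ℝ → ℝ) : Prop :=
  ∃ Du : ℝ → ℝ → ℝ, IsInZ k T Ω u Du ∧
    ∀ ζ ζt Dζ : ℝ → ℝ → ℝ, IsNonnegTest T Ω ζ ζt Dζ →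
      ∫ z in cyl T Ω, (-ζt z.1 z.2 * conv k (fun τ => u τ z.2 - u₀ z.2) z.1
        + A z.1 z.2 * Du z.1 z.2 * Dζ z.1 z.2) ≤ 0

/-! ### Assumptions on the coefficient and the initial datum -/

/-- (H1)-(H3): `A ∈ L_∞(Ω_T)` with `Λ = ess sup |A|`, `A ≥ ν > 0` a.e. in `Ω_T`, and
`u₀ ∈ L₂(Ω)`. -/
structure AssumptionH (T : ℝ) (Ω : Set ℝ) (A : ℝ → ℝ → ℝ) (u₀ : ℝ → ℝ) (ν Λ : ℝ) : Prop where
  memLp_A : MemLp (Function.uncurry A) ∞ (volume.restrict (cyl T Ω))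
  Λ_eq : Λ = (eLpNorm (Function.uncurry A) ∞ (volume.restrict (cyl T Ω))).toReal
  pos_ν : 0 < ν
  elliptic : ∀ᵐ z ∂(volume.restrict (cyl T Ω)), ν ≤ A z.1 z.2
  memLp_u₀ : MemLp u₀ 2 (volume.restrict Ω)

end Subdiffusion

open Subdiffusion

/-!
The estimate is proved by De Giorgi's method for the nonlocal time derivative, in one space
dimension, where the Sobolev embedding controls the supremum of `u(t, ·)` over an interval.

*Regularization.* The formulation with `k` is inverted by `l`, since `k * l = 1`. The functions
`h_ε = ∂ₜ(k(· + ε) * l)` are nonnegative (`l` is nonincreasing), they form an approximate identity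
as `ε → 0`, and `h_ε * k = k(· + ε)`. Testing the weak inequality with averages in time of a
function `φ` therefore replaces `k` by the regular kernel `k(· + ε)`, and convolves only the flux
with `h_ε` (`regularized_inequality`); `φ` needs no regularity in time.

*Energy estimates.* Let `w = θ ψ² (u - κ)₊²` with cutoffs `θ(t)`, `ψ(x)`. The test function is
`ρ(t) θ ψ² (u - κ)₊` with a bounded weight `ρ ≥ 0`. Pointwise in `x`, the convexity inequality
`truncated_history_le` bounds its product with the nonlocal derivative of `u` from below by half
of the nonlocal derivative of `w` times `ρ`, up to an error from the cutoff in time and the history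
of `u` before the cylinder. The weight `ρ = 1` gives the gradient estimate `gradient_le`. The weight
`ρ(s) = ∫_E l(t - s) dt`, for a set `E` of times, is inverted by the nonlocal derivative and gives
`∫_E ∫ w ≤ 2 sup ρ · (error)` (`localSquare_on_le`). By (K1) and Hölder's inequality, `sup ρ` is
at most a constant times `r² (|E| / Φ(r)) ^ β` with `β = 1 - 1 / p₀` (`KernelScale.corr_l_le`),
which is small if `u` exceeds the level `κ` only at few times.

*Iteration.* Let `Y(s, κ)` be the integral in time of the square of `sup (u - κ)₊` over the ball of
radius `r s`. The Sobolev inequality and the two energy estimates give, for `s' < s` and `κ < κ'`,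
`Y(s', κ') ≤ C (s - s') ^ (-(2 + ω)) (1 + F / (κ' - κ)) Y (Y / (Φ(r) (κ' - κ)²)) ^ (β / 2)`, where
`Y = Y(s, κ)` (`KernelScale.step`). Here `F` bounds the terms of the initial datum and of the
history: (K3) compares `-k'` at the current time with `-k'` at the final time `t₀`, at the cost of
the factor `(s - s') ^ (-ω)`. Fast geometric convergence yields `u ≤ κ` on the smaller cylinder as
soon as `κ ≥ F` and `Φ(r) κ² ≥ C (s - s') ^ (-τ₀) Y(s, 0)`, with `τ₀ = (2 + ω) / (β / 2)`. Since
`Y(s, 0)` is at most the supremum over the cylinder of parameter `s` times `∫ sup u dt`, an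
absorption argument replaces the `L₂` norm in time by the `L₁` norm (`KernelScale.boundedOn`).

These arguments are carried out for representatives that are jointly measurable and absolutely
continuous in space at every time (`RegularSub`); `exists_regularSub` provides them, and
`KernelScale.essSup_le` translates the result back to essential suprema and integrals in `[0, ∞]`.
-/

namespace Subdiffusion

/-! ### Correlation operators and translations -/

/-- The correlation operator `(T_f c)(z) = ∫ f(a) c(z + a) da`, the adjoint of convolution
with `f`. -/
noncomputable def corr (f c : ℝ → ℝ) (z : ℝ) : ℝ := ∫ a, f a * c (z + a)

lemma abs_corr_le {f c : ℝ → ℝ} {C : ℝ} (hf : Integrable f) (hc : ∀ y, |c y| ≤ C) (z : ℝ) :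
    |corr f c z| ≤ (∫ a, |f a|) * C := by
  unfold corr
  rw [← integral_mul_const, ← Real.norm_eq_abs]
  refine norm_integral_le_of_norm_le (hf.abs.mul_const C) (Eventually.of_forall fun a => ?_)
  rw [norm_mul, Real.norm_eq_abs, Real.norm_eq_abs]
  exact mul_le_mul_of_nonneg_left (hc _) (abs_nonneg _)

lemma integrable_mul_shift {f c : ℝ → ℝ} {C : ℝ} (hf : Integrable f) (hcm : Measurable c)
    (hc : ∀ y, |c y| ≤ C) (z : ℝ) : Integrable fun a => f a * c (z + a) := by
  refine hf.mul_bdd (c := C) (hcm.comp (by fun_prop)).aestronglyMeasurable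
    (Eventually.of_forall fun a => ?_)
  exact hc _

lemma measurable_corr {f c : ℝ → ℝ} (hf : Measurable f) (hc : Measurable c) :
    Measurable (corr f c) := by
  refine StronglyMeasurable.measurable (StronglyMeasurable.integral_prod_right
    (f := fun z a => f a * c (z + a)) (Measurable.stronglyMeasurable ?_))
  simp only [Function.uncurry_def]
  fun_prop

lemma continuous_corr {f c : ℝ → ℝ} {C : ℝ} (hf : Integrable f) (hcc : Continuous c)
    (hc : ∀ y, |c y| ≤ C) : Continuous (corr f c) := by
  refine continuous_of_dominated (bound := fun a => |f a| * C)
    (fun z => (integrable_mul_shift hf hcc.measurable hc z).1) (fun z => Eventually.of_forall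
      fun a => ?_) (hf.abs.mul_const C) (Eventually.of_forall fun a => by fun_prop)
  rw [norm_mul, Real.norm_eq_abs, Real.norm_eq_abs]
  exact mul_le_mul_of_nonneg_left (hc _) (abs_nonneg _)

/-- Correlation operators commute. -/
lemma corr_comm {f g c : ℝ → ℝ} {C : ℝ} (hf : Integrable f) (hg : Integrable g)
    (hcm : Measurable c) (hc : ∀ y, |c y| ≤ C) (z : ℝ) :
    corr f (corr g c) z = corr g (corr f c) z := by
  have h1 : Integrable (Function.uncurry fun a b => f a * (g b * c (z + a + b)))
      (volume.prod volume) := by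
    have := (hf.mul_prod hg).mul_bdd (c := C) (g := fun p : ℝ × ℝ => c (z + p.1 + p.2))
      (hcm.comp (by fun_prop)).aestronglyMeasurable (Eventually.of_forall fun p => hc _)
    refine this.congr (Eventually.of_forall fun p => ?_)
    simp only [Function.uncurry_def]; ring
  have h2 := integral_integral_swap h1
  unfold corr
  simp_rw [integral_const_mul] at h2
  rw [h2]
  refine integral_congr_ae (Eventually.of_forall fun b => ?_)
  dsimp only
  rw [← integral_const_mul]
  refine integral_congr_ae (Eventually.of_forall fun a => ?_)
  dsimp only
  rw [show z + b + a = z + a + b by ring]; ring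

/-- Composition of two correlation operators is the correlation with the convolution. -/
lemma corr_corr {f g c : ℝ → ℝ} {C : ℝ} (hf : Integrable f) (hg : Integrable g)
    (hfm : Measurable f) (hgm : Measurable g)
    (hcm : Measurable c) (hc : ∀ y, |c y| ≤ C) (z : ℝ) :
    corr f (corr g c) z = ∫ y, (∫ a, f a * g (y - a)) * c (z + y) := by
  have h1 : Integrable (Function.uncurry fun a y => f a * (g (y - a) * c (z + y)))
      (volume.prod volume) := by
    refine (integrable_prod_iff (Measurable.aestronglyMeasurable (by
      simp only [Function.uncurry_def]; fun_prop))).2 ⟨Eventually.of_forall fun a => ?_, ?_⟩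
    · simp only [Function.uncurry_def]
      refine Integrable.const_mul ?_ _
      exact (hg.comp_sub_right a).mul_bdd (c := C)
        (hcm.comp (by fun_prop)).aestronglyMeasurable
        (Eventually.of_forall fun p => hc _)
    · simp only [Function.uncurry_def]
      refine Integrable.mono' (g := fun a => |f a| * ((∫ b, |g b|) * C))
        (hf.abs.mul_const _) ?_ (Eventually.of_forall fun a => ?_)
      · refine StronglyMeasurable.aestronglyMeasurable (StronglyMeasurable.integral_prod_right
          (f := fun a y => ‖f a * (g (y - a) * c (z + y))‖) (Measurable.stronglyMeasurable ?_))
        simp only [Function.uncurry_def]; fun_prop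
      · simp_rw [norm_mul]
        rw [integral_const_mul, norm_mul, norm_norm, Real.norm_eq_abs]
        refine mul_le_mul_of_nonneg_left ?_ (abs_nonneg _)
        rw [Real.norm_of_nonneg (integral_nonneg fun y => by positivity)]
        rw [← integral_mul_const, ← integral_sub_right_eq_self (fun b => |g b| * C) a]
        refine integral_mono_of_nonneg (Eventually.of_forall fun y => by positivity)
          ((hg.comp_sub_right a).abs.mul_const C) (Eventually.of_forall fun y => ?_)
        exact mul_le_mul_of_nonneg_left (hc _) (abs_nonneg _)
  have h2 := integral_integral_swap h1
  unfold corr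
  simp_rw [integral_const_mul] at h2
  have h3 : ∀ a, ∫ y, g (y - a) * c (z + y) = ∫ b, g b * c (z + a + b) := fun a => by
    rw [← integral_add_right_eq_self (fun y => g (y - a) * c (z + y)) a]
    refine integral_congr_ae (Eventually.of_forall fun b => ?_)
    dsimp only
    rw [add_sub_cancel_right, show z + (b + a) = z + a + b by ring]
  simp_rw [h3] at h2
  rw [h2]
  refine integral_congr_ae (Eventually.of_forall fun y => ?_)
  dsimp only
  rw [← integral_mul_const]
  refine integral_congr_ae (Eventually.of_forall fun a => ?_)
  dsimp only; ring

/-- Hölder's inequality for real functions. -/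
lemma integral_abs_mul_le {α : Type*} [MeasurableSpace α] {μ : Measure α} {p q : ℝ≥0∞}
    [p.HolderTriple q 1] {F P : α → ℝ} (hF : MemLp F p μ) (hP : MemLp P q μ) :
    (∫ z, |F z * P z| ∂μ) ≤ (eLpNorm F p μ).toReal * (eLpNorm P q μ).toReal := by
  have h2 : eLpNorm (F • P) 1 μ ≤ eLpNorm F p μ * eLpNorm P q μ :=
    eLpNorm_smul_le_mul_eLpNorm hP.1 hF.1
  rw [eLpNorm_one_eq_lintegral_enorm] at h2
  have h4 := integral_norm_eq_lintegral_enorm (f := fun z => F z * P z) (hF.1.mul hP.1)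
  simp_rw [← Real.norm_eq_abs]
  rw [h4, ← ENNReal.toReal_mul]
  exact ENNReal.toReal_mono (ENNReal.mul_ne_top hF.2.ne hP.2.ne) h2

lemma abs_integral_mul_le {α : Type*} [MeasurableSpace α] {μ : Measure α} {p q : ℝ≥0∞}
    [p.HolderTriple q 1] {F P : α → ℝ} (hF : MemLp F p μ) (hP : MemLp P q μ) :
    |∫ z, F z * P z ∂μ| ≤ (eLpNorm F p μ).toReal * (eLpNorm P q μ).toReal :=
  abs_integral_le_integral_abs.trans (integral_abs_mul_le hF hP)

lemma abs_translate_pairing_le {p q : ℝ≥0∞} [p.HolderTriple q 1] {E : Type*} [NormedAddCommGroup E]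
    [MeasurableSpace E] [BorelSpace E] {μ : Measure E} [μ.IsAddHaarMeasure] {F P : E → ℝ}
    (hF : MemLp F p μ) (hP : MemLp P q μ) (a : E) :
    (∫ z, |F (z + a) * P z| ∂μ) ≤ (eLpNorm F p μ).toReal * (eLpNorm P q μ).toReal := by
  have hF' : MemLp (fun z => F (z + a)) p μ :=
    hF.comp_measurePreserving (measurePreserving_add_right μ a)
  have hn : eLpNorm (fun z => F (z + a)) p μ = eLpNorm F p μ :=
    eLpNorm_comp_measurePreserving hF.1 (measurePreserving_add_right μ a)
  rw [← hn]
  exact integral_abs_mul_le hF' hP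

lemma abs_pairing_le {p q : ℝ≥0∞} [p.HolderTriple q 1] {E : Type*} [NormedAddCommGroup E]
    [MeasurableSpace E] [BorelSpace E] {μ : Measure E} [μ.IsAddHaarMeasure] {F P : E → ℝ}
    (hF : MemLp F p μ) (hP : MemLp P q μ) (a : E) :
    |∫ z, F (z + a) * P z ∂μ| ≤ (eLpNorm F p μ).toReal * (eLpNorm P q μ).toReal :=
  (abs_integral_le_integral_abs).trans (abs_translate_pairing_le hF hP a)

section Translation

variable {E : Type*} [NormedAddCommGroup E] [NormedSpace ℝ E] [FiniteDimensional ℝ E]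
  [MeasurableSpace E] [BorelSpace E] {μ : Measure E} [μ.IsAddHaarMeasure]

/-- The pairing of `P ∈ L_q` with translates of `F ∈ L_p` depends continuously on the translation,
because translations act continuously on `L_p` for `p < ∞`. -/
lemma continuous_translate_pairing {p q : ℝ≥0∞} (hp1 : 1 ≤ p) (hp : p ≠ ∞)
    [p.HolderTriple q 1] {F P : E → ℝ} (hF : MemLp F p μ) (hP : MemLp P q μ) (e : E) :
    Continuous fun y : ℝ => ∫ z, F (z + y • e) * P z ∂μ := by
  have : Fact (1 ≤ p) := ⟨hp1⟩
  let g : ℝ → C(E, E) := fun y => ⟨fun z => z + y • e, by fun_prop⟩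
  have hg : Continuous g := by
    refine ContinuousMap.continuous_of_continuous_uncurry _ ?_
    simp only [g, Function.uncurry_def, ContinuousMap.coe_mk]
    fun_prop
  have hgm : ∀ y, MeasurePreserving (g y) μ μ := fun y => measurePreserving_add_right μ (y • e)
  have hc : Continuous fun y => Lp.compMeasurePreserving (g y) (hgm y) (hF.toLp F) :=
    continuous_const.compMeasurePreservingLp hg hgm hp
  have hL : ∀ f : Lp ℝ p μ, Integrable (fun z => f z * P z) μ := fun f =>
    (Lp.memLp f).integrable_mul hP
  have hcont : Continuous fun f : Lp ℝ p μ => ∫ z, f z * P z ∂μ := by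
    refine Metric.continuous_iff.2 fun f ε hε => ?_
    refine ⟨ε / ((eLpNorm P q μ).toReal + 1), by positivity, fun f' hf' => ?_⟩
    rw [Real.dist_eq, ← integral_sub (hL _) (hL _)]
    have h1 : |∫ z, (f' z * P z - f z * P z) ∂μ| ≤ ‖f' - f‖ * (eLpNorm P q μ).toReal := by
      have h3 : ∫ z, (f' z * P z - f z * P z) ∂μ = ∫ z, (f' - f : Lp ℝ p μ) z * P z ∂μ := by
        refine integral_congr_ae ?_
        filter_upwards [Lp.coeFn_sub f' f] with z hz
        rw [hz, Pi.sub_apply, sub_mul]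
      rw [h3, Lp.norm_def]
      exact abs_integral_mul_le (Lp.memLp _) hP
    rw [dist_eq_norm] at hf'
    have hn : 0 ≤ (eLpNorm P q μ).toReal := ENNReal.toReal_nonneg
    calc _ ≤ ‖f' - f‖ * (eLpNorm P q μ).toReal := h1
      _ ≤ ε / ((eLpNorm P q μ).toReal + 1) * (eLpNorm P q μ).toReal := by gcongr
      _ < ε := by
        rw [div_mul_eq_mul_div, div_lt_iff₀ (by positivity)]
        nlinarith
  refine (hcont.comp hc).congr fun y => ?_
  refine integral_congr_ae ?_
  filter_upwards [Lp.coeFn_compMeasurePreserving (hF.toLp F) (hgm y),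
    (hgm y).quasiMeasurePreserving.ae_eq_comp hF.coeFn_toLp] with z h1 h2
  rw [h1, h2]; rfl

/-- The average of translates of `φ` against an integrable weight lies in `L₂` (Young). -/
lemma memLp_translate_average {f : ℝ → ℝ} {φ : E → ℝ} (hf : Integrable f) (hfm : Measurable f)
    (hφm : Measurable φ) (hφ : MemLp φ 2 μ) (e : E) :
    MemLp (fun z => ∫ a, f a * φ (z + a • e)) 2 μ := by
  have hm : Measurable fun p : E × ℝ => f p.2 * φ (p.1 + p.2 • e) := by fun_prop
  refine ⟨(StronglyMeasurable.integral_prod_right'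
    (f := fun p : E × ℝ => f p.2 * φ (p.1 + p.2 • e)) hm.stronglyMeasurable).aestronglyMeasurable,
    ?_⟩
  rw [eLpNorm_lt_top_iff_lintegral_rpow_enorm_lt_top (by norm_num) (by norm_num)]
  have hI : (∫⁻ a, ‖f a‖ₑ) < ∞ := hf.2
  have hφ2 : (∫⁻ z, ‖φ z‖ₑ ^ (2 : ℝ) ∂μ) < ∞ := by
    have := hφ.2
    rwa [eLpNorm_lt_top_iff_lintegral_rpow_enorm_lt_top (by norm_num) (by norm_num)] at this
  have key : ∀ z, ‖∫ a, f a * φ (z + a • e)‖ₑ ^ (2 : ℝ) ≤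
      (∫⁻ a, ‖f a‖ₑ) * ∫⁻ a, ‖f a‖ₑ * ‖φ (z + a • e)‖ₑ ^ (2 : ℝ) := by
    intro z
    have h1 : ‖∫ a, f a * φ (z + a • e)‖ₑ ≤ ∫⁻ a, ‖f a‖ₑ * ‖φ (z + a • e)‖ₑ := by
      refine (enorm_integral_le_lintegral_enorm _).trans_eq (lintegral_congr fun a => ?_)
      rw [enorm_mul]
    have h2 := ENNReal.lintegral_mul_le_Lp_mul_Lq volume Real.HolderConjugate.two_two
      (f := fun a => ‖f a‖ₑ ^ (1 / 2 : ℝ)) (g := fun a => ‖f a‖ₑ ^ (1 / 2 : ℝ) * ‖φ (z + a • e)‖ₑ)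
      (by fun_prop) (by fun_prop)
    have h3 : ∀ x : ℝ≥0∞, x ^ (1 / 2 : ℝ) * x ^ (1 / 2 : ℝ) = x := fun x => by
      rw [← ENNReal.rpow_add_of_nonneg _ _ (by norm_num) (by norm_num)]; norm_num
    have h4 : ∀ x : ℝ≥0∞, (x ^ (1 / 2 : ℝ)) ^ (2 : ℝ) = x := fun x => by
      rw [← ENNReal.rpow_mul]; norm_num
    simp only [Pi.mul_apply, ← mul_assoc, h3, ENNReal.mul_rpow_of_nonneg _ _ zero_le_two, h4] at h2
    calc _ ≤ ((∫⁻ a, ‖f a‖ₑ) ^ (1 / 2 : ℝ) *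
          (∫⁻ a, ‖f a‖ₑ * ‖φ (z + a • e)‖ₑ ^ (2 : ℝ)) ^ (1 / 2 : ℝ)) ^ (2 : ℝ) :=
          ENNReal.rpow_le_rpow (h1.trans h2) (by norm_num)
      _ = _ := by rw [ENNReal.mul_rpow_of_nonneg _ _ zero_le_two, h4, h4]
  refine (lintegral_mono key).trans_lt ?_
  rw [lintegral_const_mul' _ _ hI.ne, lintegral_lintegral_swap]
  · have : ∀ a : ℝ, ∫⁻ z, ‖f a‖ₑ * ‖φ (z + a • e)‖ₑ ^ (2 : ℝ) ∂μ =
        ‖f a‖ₑ * ∫⁻ z, ‖φ z‖ₑ ^ (2 : ℝ) ∂μ := fun a => by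
      rw [lintegral_const_mul' _ _ (by simp),
        lintegral_add_right_eq_self (fun z => ‖φ z‖ₑ ^ (2 : ℝ))]
    simp_rw [this]
    rw [lintegral_mul_const' _ _ hφ2.ne]
    exact ENNReal.mul_lt_top hI (ENNReal.mul_lt_top hI hφ2)
  · simp only [Function.uncurry_def]; fun_prop

lemma integrable_mul_translate {p q : ℝ≥0∞} [p.HolderTriple q 1] {f : ℝ → ℝ} {φ w : E → ℝ}
    (hf : Integrable f)
    (hfm : Measurable f) (hφm : Measurable φ) (hφ : MemLp φ p μ) (hw : MemLp w q μ) (e : E) :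
    Integrable (Function.uncurry fun (z : E) (a : ℝ) => f a * φ (z + a • e) * w z)
      (μ.prod volume) := by
  have hm : Measurable fun p : E × ℝ => f p.2 * φ (p.1 + p.2 • e) := by fun_prop
  refine (integrable_prod_iff' ?_).2 ⟨Eventually.of_forall fun a => ?_, ?_⟩
  · simp only [Function.uncurry_def]
    exact hm.aestronglyMeasurable.mul hw.1.comp_fst
  · simp only [Function.uncurry_def]
    have : Integrable (fun z => f a * (φ (z + a • e) * w z)) μ :=
      ((hφ.comp_measurePreserving (measurePreserving_add_right μ (a • e))).integrable_mul
        hw).const_mul _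
    exact this.congr (Eventually.of_forall fun z => by dsimp only; ring)
  · simp only [Function.uncurry_def]
    refine Integrable.mono' (hf.abs.mul_const ((eLpNorm φ p μ).toReal * (eLpNorm w q μ).toReal)) ?_
      (Eventually.of_forall fun a => ?_)
    · have h1 : AEStronglyMeasurable (fun p : ℝ × E => ‖f p.1 * φ (p.2 + p.1 • e) * w p.2‖)
          (volume.prod μ) :=
        ((Measurable.aestronglyMeasurable (by fun_prop)).mul hw.1.comp_snd).norm
      exact h1.integral_prod_right'
    · rw [Real.norm_of_nonneg (integral_nonneg fun y => by positivity)]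
      simp_rw [mul_assoc, norm_mul (f a), Real.norm_eq_abs]
      rw [integral_const_mul]
      exact mul_le_mul_of_nonneg_left (abs_translate_pairing_le hφ hw _) (abs_nonneg _)

/-- Pairing with an average of translates is the average of the pairings. -/
lemma integral_mul_translate_average {p q : ℝ≥0∞} [p.HolderTriple q 1] {f : ℝ → ℝ} {φ w : E → ℝ}
    (hf : Integrable f)
    (hfm : Measurable f) (hφm : Measurable φ) (hφ : MemLp φ p μ) (hw : MemLp w q μ) (e : E) :
    ∫ z, (∫ a, f a * φ (z + a • e)) * w z ∂μ = ∫ a, f a * ∫ z, φ (z + a • e) * w z ∂μ := by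
  have hI := integrable_mul_translate hf hfm hφm hφ hw e
  have h2 := integral_integral_swap hI
  simp_rw [mul_assoc (f _), integral_const_mul] at h2
  rw [← h2]
  refine integral_congr_ae (Eventually.of_forall fun z => ?_)
  dsimp only
  rw [← integral_mul_const]
  refine integral_congr_ae (Eventually.of_forall fun a => ?_)
  dsimp only; ring

end Translation

/-! ### The kernels and the approximate identity -/

/-- Restriction of a function of time to the interval `(0, T)`, extended by zero. -/
noncomputable def cut (T : ℝ) (f : ℝ → ℝ) : ℝ → ℝ := (Ioo 0 T).indicator f

lemma cut_of_mem {T y : ℝ} {f : ℝ → ℝ} (h : y ∈ Ioo 0 T) : cut T f y = f y :=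
  indicator_of_mem h f

lemma cut_of_notMem {T y : ℝ} {f : ℝ → ℝ} (h : y ∉ Ioo 0 T) : cut T f y = 0 :=
  indicator_of_notMem h f

lemma measurable_cut {T : ℝ} {f : ℝ → ℝ} (hf : ContinuousOn f (Ioi 0)) : Measurable (cut T f) := by
  classical
  have h := ContinuousOn.measurable_piecewise (f := f) (g := fun _ => (0 : ℝ)) (s := Ioo 0 T)
    (hf.mono fun x hx => hx.1) continuousOn_const measurableSet_Ioo
  unfold cut
  rwa [← piecewise_eq_indicator]

lemma integral_cut_mul {T : ℝ} (hT : 0 ≤ T) (f g : ℝ → ℝ) :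
    ∫ a, cut T f a * g a = ∫ a in (0 : ℝ)..T, f a * g a := by
  rw [intervalIntegral.integral_of_le hT, integral_Ioc_eq_integral_Ioo,
    ← integral_indicator measurableSet_Ioo]
  refine integral_congr_ae (Eventually.of_forall fun a => ?_)
  by_cases h : a ∈ Ioo 0 T
  · simp [cut, h]
  · simp [cut, h]

/-- The shifted kernel `-k'(· + ε)`. -/
noncomputable def memK (k : ℝ → ℝ) (ε : ℝ) (y : ℝ) : ℝ := -deriv k (y + ε)

namespace AssumptionK0

variable {k l : ℝ → ℝ} (h : AssumptionK0 k l)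
include h

lemma symm_conv_eq_one {t : ℝ} (ht : 0 < t) : ∫ τ in (0 : ℝ)..t, l τ * k (t - τ) = 1 := by
  rw [← h.conv_eq_one t ht]; unfold conv
  exact intervalIntegral.integral_congr fun x _ => mul_comm _ _

lemma intervalIntegrable_k {a b : ℝ} (ha : 0 ≤ a) (hb : 0 ≤ b) :
    IntervalIntegrable k volume a b := by
  rw [intervalIntegrable_iff]
  refine (h.locInt_k.integrableOn_compact_subset (fun x hx => ?_) (isCompact_uIcc (a := a)
    (b := b))).mono_set uIoc_subset_uIcc
  exact le_trans (le_min ha hb) hx.1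

lemma intervalIntegrable_l {a b : ℝ} (ha : 0 ≤ a) (hb : 0 ≤ b) :
    IntervalIntegrable l volume a b := by
  rw [intervalIntegrable_iff]
  refine (h.locInt_l.integrableOn_compact_subset (fun x hx => ?_) (isCompact_uIcc (a := a)
    (b := b))).mono_set uIoc_subset_uIcc
  exact le_trans (le_min ha hb) hx.1

lemma continuousOn_k : ContinuousOn k (Ioi 0) := h.contDiff_k.continuousOn
lemma continuousOn_l : ContinuousOn l (Ioi 0) := h.contDiff_l.continuousOn

lemma hasDerivAt_k {x : ℝ} (hx : 0 < x) : HasDerivAt k (deriv k x) x :=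
  ((h.contDiff_k.differentiableOn (by norm_num)).differentiableAt
    (isOpen_Ioi.mem_nhds hx)).hasDerivAt

lemma continuousOn_deriv_k : ContinuousOn (deriv k) (Ioi 0) :=
  h.contDiff_k.continuousOn_deriv_of_isOpen isOpen_Ioi le_rfl

lemma monotoneOn_deriv_k : MonotoneOn (deriv k) (Ioi 0) :=
  h.convex_k.monotoneOn_deriv fun _ hx => (h.hasDerivAt_k hx).differentiableAt

lemma deriv_k_nonpos {x : ℝ} (hx : 0 < x) : deriv k x ≤ 0 := by
  rw [← derivWithin_of_isOpen isOpen_Ioi hx]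
  exact h.antitone_k.derivWithin_nonpos

lemma memK_nonneg {ε y : ℝ} (hy : 0 < y + ε) : 0 ≤ memK k ε y := by
  unfold memK; linarith [h.deriv_k_nonpos hy]

lemma memK_le {ε y : ℝ} (hε : 0 ≤ ε) (hy : 0 < y) : memK k ε y ≤ -deriv k y := by
  unfold memK
  linarith [h.monotoneOn_deriv_k (mem_Ioi.2 hy) (mem_Ioi.2 (by linarith : 0 < y + ε)) (by linarith)]

lemma memK_le_memK_zero {ε y : ℝ} (hε : 0 < ε) (hy : 0 ≤ y) : memK k ε y ≤ memK k ε 0 := by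
  unfold memK
  have := h.monotoneOn_deriv_k (mem_Ioi.2 (by linarith : 0 < 0 + ε))
    (mem_Ioi.2 (by linarith : 0 < y + ε)) (by linarith)
  linarith

lemma continuousOn_memK {ε : ℝ} (hε : 0 < ε) : ContinuousOn (memK k ε) (Ici 0) := by
  unfold memK
  refine (h.continuousOn_deriv_k.comp (f := fun y => y + ε) (by fun_prop) fun y hy => ?_).neg
  simp only [mem_Ici] at hy; simp only [mem_Ioi]; linarith

lemma integral_memK {ε a b : ℝ} (hε : 0 < ε) (ha : 0 ≤ a) (hb : 0 ≤ b) :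
    ∫ y in a..b, memK k ε y = k (a + ε) - k (b + ε) := by
  have hsub : uIcc a b ⊆ Ici 0 := fun x hx => le_trans (le_min ha hb) hx.1
  rw [intervalIntegral.integral_eq_sub_of_hasDerivAt (f := fun y => -k (y + ε))]
  · ring
  · intro x hx
    have hx0 : 0 ≤ x := hsub hx
    have := (h.hasDerivAt_k (by linarith : 0 < x + ε)).comp_add_const x ε
    exact this.neg
  · exact ((h.continuousOn_memK hε).mono hsub).intervalIntegrable

lemma cut_l_nonneg (T y : ℝ) : 0 ≤ cut T l y :=
  indicator_nonneg (fun x hx => h.nonneg_l x hx.1) y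

lemma cut_memK_nonneg {ε : ℝ} (hε : 0 < ε) (T y : ℝ) : 0 ≤ cut T (memK k ε) y :=
  indicator_nonneg (fun x hx => h.memK_nonneg (by linarith [hx.1])) y

lemma measurable_cut_k (T : ℝ) : Measurable (cut T k) := measurable_cut h.continuousOn_k
lemma measurable_cut_l (T : ℝ) : Measurable (cut T l) := measurable_cut h.continuousOn_l
lemma measurable_cut_memK {ε : ℝ} (hε : 0 < ε) (T : ℝ) : Measurable (cut T (memK k ε)) :=
  measurable_cut ((h.continuousOn_memK hε).mono Ioi_subset_Ici_self)

lemma integrable_cut_k (T : ℝ) : Integrable (cut T k) :=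
  (integrable_indicator_iff measurableSet_Ioo).2
    ((h.locInt_k.integrableOn_compact_subset Icc_subset_Ici_self
      (isCompact_Icc (a := 0) (b := T))).mono_set Ioo_subset_Icc_self)

lemma integrable_cut_l (T : ℝ) : Integrable (cut T l) :=
  (integrable_indicator_iff measurableSet_Ioo).2
    ((h.locInt_l.integrableOn_compact_subset Icc_subset_Ici_self
      (isCompact_Icc (a := 0) (b := T))).mono_set Ioo_subset_Icc_self)

lemma integrable_cut_memK {ε : ℝ} (hε : 0 < ε) (T : ℝ) : Integrable (cut T (memK k ε)) :=
  (integrable_indicator_iff measurableSet_Ioo).2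
    (((h.continuousOn_memK hε).mono Icc_subset_Ici_self).integrableOn_Icc.mono_set
      Ioo_subset_Icc_self)

/-- `l * k = 1` in terms of the kernels restricted to `(0, T)`. -/
lemma integral_cut_l_mul_cut_k {T y : ℝ} (hy : 0 < y) (hyT : y < T) :
    ∫ a, cut T l a * cut T k (y - a) = 1 := by
  rw [← h.symm_conv_eq_one hy, ← integral_cut_mul hy.le]
  refine integral_congr_ae ?_
  filter_upwards [show ∀ᵐ a : ℝ, a ≠ 0 ∧ a ≠ y by
    rw [eventually_and]; exact ⟨by simp [ae_iff], by simp [ae_iff]⟩] with a ha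
  by_cases h1 : a ∈ Ioo 0 y
  · rw [cut_of_mem h1, cut_of_mem ⟨h1.1, h1.2.trans hyT⟩,
      cut_of_mem ⟨by linarith [h1.2], by linarith [h1.1]⟩]
  · rw [cut_of_notMem h1, zero_mul]
    by_cases h2 : a < 0
    · rw [cut_of_notMem (fun hh => by linarith [hh.1]), zero_mul]
    · have h3 : 0 < a := lt_of_le_of_ne (not_lt.1 h2) (Ne.symm ha.1)
      rw [cut_of_notMem (T := T) (y := y - a), mul_zero]
      exact fun hh => h1 ⟨h3, by linarith [hh.1]⟩

end AssumptionK0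

/-- The class on which the correlation operators with kernels on `(0, T)` act: bounded measurable
functions vanishing on `[T, ∞)`. -/
structure Causal (T : ℝ) (c : ℝ → ℝ) : Prop where
  meas : Measurable c
  bdd : ∃ C, ∀ y, |c y| ≤ C
  zero : ∀ y, T ≤ y → c y = 0

lemma Causal.corr {T : ℝ} {f c : ℝ → ℝ} (hc : Causal T c) (hf : Integrable f) (hfm : Measurable f)
    (hf0 : ∀ y, y ≤ 0 → f y = 0) : Causal T (corr f c) := by
  obtain ⟨C, hC⟩ := hc.bdd
  refine ⟨measurable_corr hfm hc.meas, ⟨_, fun y => abs_corr_le hf hC y⟩, fun y hy => ?_⟩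
  unfold Subdiffusion.corr
  rw [← integral_zero ℝ ℝ]
  refine integral_congr_ae (Eventually.of_forall fun a => ?_)
  dsimp only
  rcases le_or_gt a 0 with h | h
  · rw [hf0 a h, zero_mul]
  · rw [hc.zero _ (by linarith), mul_zero]

lemma cut_nonpos {T : ℝ} {f : ℝ → ℝ} : ∀ y, y ≤ 0 → cut T f y = 0 := fun _ hy =>
  cut_of_notMem fun h => by linarith [h.1]

lemma integrable_conv {f g : ℝ → ℝ} (hf : Integrable f) (hg : Integrable g) :
    Integrable fun y => ∫ a, f a * g (y - a) := by
  have := hf.integrable_convolution (ContinuousLinearMap.mul ℝ ℝ) hg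
  exact this

lemma measurable_conv {f g : ℝ → ℝ} (hf : Measurable f) (hg : Measurable g) :
    Measurable fun y => ∫ a, f a * g (y - a) := by
  refine StronglyMeasurable.measurable (StronglyMeasurable.integral_prod_right
    (f := fun y a => f a * g (y - a)) (Measurable.stronglyMeasurable ?_))
  simp only [Function.uncurry_def]
  fun_prop

/-- The convolution of two functions supported in `(0, ∞)` is supported there. -/
lemma conv_cut_nonpos {T : ℝ} {f g : ℝ → ℝ} {y : ℝ} (hy : y ≤ 0) :
    ∫ a, cut T f a * cut T g (y - a) = 0 := by
  rw [← integral_zero ℝ ℝ]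
  refine integral_congr_ae (Eventually.of_forall fun a => ?_)
  dsimp only
  rcases le_or_gt a 0 with h | h
  · rw [cut_nonpos a h, zero_mul]
  · rw [cut_nonpos (y - a) (by linarith), mul_zero]

lemma integrable_cut_one (T : ℝ) : Integrable (cut T fun _ => 1) :=
  (integrable_indicator_iff measurableSet_Ioo).2 (by simp)

lemma measurable_cut_one (T : ℝ) : Measurable (cut T fun _ => 1) :=
  measurable_cut continuousOn_const

/-- Correlating with `l` and `k` amounts to integrating forward in time. -/
lemma AssumptionK0.corr_l_corr_k {k l : ℝ → ℝ} (h : AssumptionK0 k l) {T : ℝ} {c : ℝ → ℝ}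
    (hc : Causal T c) {z : ℝ} (hz : 0 ≤ z) :
    Subdiffusion.corr (cut T l) (Subdiffusion.corr (cut T k) c) z =
      Subdiffusion.corr (cut T fun _ => 1) c z := by
  obtain ⟨C, hC⟩ := hc.bdd
  rw [corr_corr (h.integrable_cut_l T) (h.integrable_cut_k T) (h.measurable_cut_l T)
    (h.measurable_cut_k T) hc.meas hC]
  refine integral_congr_ae (Eventually.of_forall fun y => ?_)
  dsimp only
  rcases le_or_gt y 0 with h0 | h0
  · rw [conv_cut_nonpos h0, cut_nonpos y h0]
  rcases le_or_gt T y with h1 | h1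
  · rw [hc.zero _ (by linarith), mul_zero, mul_zero]
  · rw [h.integral_cut_l_mul_cut_k h0 h1, cut_of_mem ⟨h0, h1⟩]

/-- Forward integration inverts the derivative of a bump `ξ` supported in `(0, ∞)`. -/
lemma corr_one_corr_deriv {T : ℝ} {c ξ : ℝ → ℝ} (hc : Causal T c) (hξ : ContDiff ℝ 1 ξ)
    (hξc : HasCompactSupport ξ) (hξ0 : ∀ y, y ≤ 0 → ξ y = 0) {z : ℝ} (hz : 0 ≤ z) :
    corr (cut T fun _ => 1) (corr (deriv ξ) c) z = corr ξ c z := by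
  obtain ⟨C, hC⟩ := hc.bdd
  have hdc : Continuous (deriv ξ) := hξ.continuous_deriv le_rfl
  rw [corr_corr (integrable_cut_one T) (hdc.integrable_of_hasCompactSupport hξc.deriv)
    (measurable_cut_one T) hdc.measurable hc.meas hC]
  refine integral_congr_ae (Eventually.of_forall fun y => ?_)
  dsimp only
  rcases le_or_gt T y with h1 | h1
  · rw [hc.zero _ (by linarith), mul_zero, mul_zero]
  · congr 1
    rcases le_or_gt T 0 with hT | hT
    · have : ∀ a, cut T (fun _ => (1 : ℝ)) a = 0 := fun a =>
        cut_of_notMem fun hh => by linarith [hh.1, hh.2]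
      simp [this, hξ0 y (by linarith)]
    rw [integral_cut_mul hT.le]
    simp only [one_mul]
    rw [intervalIntegral.integral_comp_sub_left (fun x => deriv ξ x) y,
      intervalIntegral.integral_deriv_eq_sub (fun x _ => (hξ.differentiable (by norm_num) x))
        (hdc.intervalIntegrable _ _), hξ0 (y - T) (by linarith)]
    simp

/-- The approximate identity `h_ε = ∂ₜ(k(· + ε) * l)` on `(0, T)`. It satisfies
`h_ε * k = k(· + ε)`. -/
noncomputable def approxId (k l : ℝ → ℝ) (T ε : ℝ) : ℝ → ℝ :=
  cut T fun y => k ε * cut T l y - ∫ a, cut T (memK k ε) a * cut T l (y - a)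

namespace AssumptionK0

variable {k l : ℝ → ℝ} (h : AssumptionK0 k l)
include h

lemma measurable_approxId {ε : ℝ} (hε : 0 < ε) (T : ℝ) : Measurable (approxId k l T ε) := by
  unfold approxId cut
  refine Measurable.indicator ?_ measurableSet_Ioo
  exact ((h.measurable_cut_l T).const_mul _).sub
    (measurable_conv (h.measurable_cut_memK hε T) (h.measurable_cut_l T))

lemma integrable_approxId {ε : ℝ} (hε : 0 < ε) (T : ℝ) : Integrable (approxId k l T ε) := by
  unfold approxId
  refine Integrable.indicator ?_ measurableSet_Ioo
  exact ((h.integrable_cut_l T).const_mul _).sub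
    (integrable_conv (h.integrable_cut_memK hε T) (h.integrable_cut_l T))

/-- Correlation with `h_ε` is correlation with `l` followed by `k(ε) - T_{K_ε}`. -/
lemma corr_approxId {ε T : ℝ} (hε : 0 < ε) {c : ℝ → ℝ} (hc : Causal T c) {z : ℝ} (hz : 0 ≤ z) :
    corr (approxId k l T ε) c z =
      k ε * corr (cut T l) c z - corr (cut T (memK k ε)) (corr (cut T l) c) z := by
  obtain ⟨C, hC⟩ := hc.bdd
  rw [corr_corr (h.integrable_cut_memK hε T) (h.integrable_cut_l T) (h.measurable_cut_memK hε T)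
    (h.measurable_cut_l T) hc.meas hC]
  unfold corr
  rw [← integral_const_mul, ← integral_sub]
  · refine integral_congr_ae (Eventually.of_forall fun y => ?_)
    dsimp only
    rcases le_or_gt T y with h1 | h1
    · rw [hc.zero _ (by linarith)]; ring
    rcases le_or_gt y 0 with h0 | h0
    · rw [conv_cut_nonpos h0, cut_nonpos y h0, approxId, cut_nonpos y h0]; ring
    · rw [approxId, cut_of_mem ⟨h0, h1⟩]; ring
  · exact (integrable_mul_shift (h.integrable_cut_l T) hc.meas hC z).const_mul _
  · exact integrable_mul_shift (integrable_conv (h.integrable_cut_memK hε T)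
      (h.integrable_cut_l T)) hc.meas hC z

/-- The mass of `h_ε` on `(0, δ)` is `(k(· + ε) * l)(δ) = 1 - ∫₀^ε k(y) l(δ + ε - y) dy`. -/
lemma integral_approxId {ε T δ : ℝ} (hε : 0 < ε) (hδ : 0 ≤ δ) (hδT : δ ≤ T) :
    ∫ y in (0 : ℝ)..δ, approxId k l T ε y = 1 - ∫ y in (0 : ℝ)..ε, k y * l (δ + ε - y) := by
  have hc : Causal T ((Iio δ).indicator fun _ => (1 : ℝ)) :=
    ⟨measurable_const.indicator measurableSet_Iio, ⟨1, fun y => by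
      by_cases hy : y ∈ Iio δ <;> simp [hy]⟩, fun y hy =>
      indicator_of_notMem (by simp only [mem_Iio, not_lt]; linarith) _⟩
  obtain ⟨C, hC⟩ := hc.bdd
  have h1 := h.corr_approxId hε hc le_rfl
  rw [corr_comm (h.integrable_cut_memK hε T) (h.integrable_cut_l T) hc.meas hC] at h1
  have hcut : ∀ (f : ℝ → ℝ) (z : ℝ), 0 ≤ z → z ≤ δ →
      corr (cut T f) ((Iio δ).indicator fun _ => (1 : ℝ)) z = ∫ a in (0 : ℝ)..(δ - z), f a := by
    intro f z hz0 hz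
    rw [intervalIntegral.integral_of_le (by linarith), integral_Ioc_eq_integral_Ioo,
      ← integral_indicator measurableSet_Ioo]
    refine integral_congr_ae (Eventually.of_forall fun a => ?_)
    dsimp only
    by_cases ha : a ∈ Ioo 0 (δ - z)
    · rw [indicator_of_mem ha, cut_of_mem ⟨ha.1, by linarith [ha.2]⟩,
        indicator_of_mem (by simp only [mem_Iio]; linarith [ha.2]), mul_one]
    · rw [indicator_of_notMem ha]
      rcases le_or_gt a 0 with h0 | h0
      · rw [cut_nonpos a h0, zero_mul]
      · rw [indicator_of_notMem, mul_zero]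
        simp only [mem_Iio, not_lt]
        by_contra hh; exact ha ⟨h0, by linarith⟩
  have e1 : corr (approxId k l T ε) ((Iio δ).indicator fun _ => (1 : ℝ)) 0 =
      ∫ y in (0 : ℝ)..δ, approxId k l T ε y := by
    have e0 : approxId k l T ε = cut T (approxId k l T ε) := by
      unfold approxId cut; rw [indicator_indicator, inter_self]
    rw [e0, hcut _ 0 le_rfl hδ, sub_zero, ← e0]
  rw [e1] at h1
  rw [h1, hcut l 0 le_rfl hδ, sub_zero, ← intervalIntegral.integral_const_mul]
  have e2 : corr (cut T l) (corr (cut T (memK k ε)) ((Iio δ).indicator fun _ => (1 : ℝ))) 0 =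
      ∫ b in (0 : ℝ)..δ, l b * (k ε - k (δ - b + ε)) := by
    rw [← integral_cut_mul hδ]
    unfold Subdiffusion.corr
    refine integral_congr_ae (Eventually.of_forall fun b => ?_)
    dsimp only
    rw [zero_add]
    rcases le_or_gt b 0 with h0 | h0
    · rw [cut_nonpos b h0, cut_nonpos b h0, zero_mul, zero_mul]
    rcases lt_or_ge b δ with hb | hb
    · have := hcut (memK k ε) b h0.le hb.le
      unfold Subdiffusion.corr at this
      rw [this, h.integral_memK hε le_rfl (by linarith), cut_of_mem ⟨h0, hb⟩,
        cut_of_mem ⟨h0, by linarith⟩, zero_add]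
    · rw [cut_of_notMem (T := δ) (fun hh => by linarith [hh.2]), zero_mul]
      have : ∀ a, cut T (memK k ε) a * (Iio δ).indicator (fun _ => (1 : ℝ)) (b + a) = 0 := by
        intro a
        rcases le_or_gt a 0 with ha | ha
        · rw [cut_nonpos a ha, zero_mul]
        · rw [indicator_of_notMem, mul_zero]
          simp only [mem_Iio, not_lt]; linarith
      simp [this]
  have hil : IntervalIntegrable l volume 0 δ := h.intervalIntegrable_l le_rfl hδ
  have hik : IntervalIntegrable (fun b => l b * k (δ + ε - b)) volume 0 δ := by
    refine hil.mul_continuousOn (h.continuousOn_k.comp (by fun_prop) fun b hb => ?_)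
    rw [uIcc_of_le hδ] at hb
    simp only [mem_Ioi]; linarith [hb.2]
  have hik2 : IntervalIntegrable (fun b => l b * k (δ + ε - b)) volume δ (δ + ε) := by
    rcases hδ.eq_or_lt with rfl | hδ'
    · -- for `δ = 0` this is the integrability of the integrand of `k * l`
      by_contra hcon
      have := h.symm_conv_eq_one (by linarith : 0 < 0 + ε)
      rw [intervalIntegral.integral_undef hcon] at this
      norm_num at this
    refine IntervalIntegrable.continuousOn_mul ?_ (h.continuousOn_l.mono fun b hb => ?_)
    · have := (h.intervalIntegrable_k le_rfl hε.le).comp_sub_left (δ + ε)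
      simp only [sub_zero, add_sub_cancel_right] at this
      exact this.symm
    · rw [uIcc_of_le (by linarith)] at hb
      exact lt_of_lt_of_le hδ' hb.1
  rw [e2, ← intervalIntegral.integral_sub (hil.const_mul _) ?_]
  · have e3 : ∀ b, k ε * l b - l b * (k ε - k (δ - b + ε)) = l b * k (δ + ε - b) := fun b => by
      rw [show δ - b + ε = δ + ε - b by ring]; ring
    simp_rw [e3]
    rw [eq_sub_iff_add_eq, ← h.symm_conv_eq_one (by linarith : 0 < δ + ε),
      ← intervalIntegral.integral_add_adjacent_intervals hik hik2]
    congr 1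
    have := intervalIntegral.integral_comp_sub_left (a := δ) (b := δ + ε)
      (fun y => k y * l (δ + ε - y)) (δ + ε)
    simp only [sub_self, add_sub_cancel_left, sub_sub_cancel] at this
    rw [← this]
    exact intervalIntegral.integral_congr fun b _ => mul_comm _ _
  · refine ((hil.const_mul (k ε)).sub hik).congr fun b _ => ?_
    rw [show δ - b + ε = δ + ε - b by ring]; ring

end AssumptionK0

namespace AssumptionK0

variable {k l : ℝ → ℝ} (h : AssumptionK0 k l)
include h

lemma intervalIntegrable_defect {δ ε : ℝ} (hδ : 0 < δ) (hε : 0 ≤ ε) :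
    IntervalIntegrable (fun y => k y * l (δ + ε - y)) volume 0 ε := by
  refine (h.intervalIntegrable_k le_rfl hε).mul_continuousOn
    (h.continuousOn_l.comp (by fun_prop) fun y hy => ?_)
  rw [uIcc_of_le hε] at hy
  simp only [mem_Ioi]; linarith [hy.2]

/-- The defect `∫₀^ε k(y) l(δ + ε - y) dy` by which the mass of `h_ε` on `(0, δ)` falls short of
one is nonnegative, nonincreasing in `δ`, and at most `l(δ) ∫₀^ε k`. -/
lemma defect_nonneg {δ ε : ℝ} (hδ : 0 ≤ δ) (hε : 0 ≤ ε) :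
    0 ≤ ∫ y in (0 : ℝ)..ε, k y * l (δ + ε - y) := by
  rw [intervalIntegral.integral_of_le hε, integral_Ioc_eq_integral_Ioo]
  refine setIntegral_nonneg measurableSet_Ioo fun y hy => ?_
  exact mul_nonneg (h.nonneg_k y hy.1) (h.nonneg_l _ (by linarith [hy.2]))

lemma defect_antitone {δ δ' ε : ℝ} (hδ : 0 < δ) (hδδ : δ ≤ δ') (hε : 0 ≤ ε) :
    (∫ y in (0 : ℝ)..ε, k y * l (δ' + ε - y)) ≤ ∫ y in (0 : ℝ)..ε, k y * l (δ + ε - y) := by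
  refine intervalIntegral.integral_mono_on_of_le_Ioo hε
    (h.intervalIntegrable_defect (hδ.trans_le hδδ) hε) (h.intervalIntegrable_defect hδ hε)
    fun y hy => ?_
  refine mul_le_mul_of_nonneg_left (h.antitone_l ?_ ?_ ?_) (h.nonneg_k y hy.1)
  · simp only [mem_Ioi]; linarith [hy.2]
  · simp only [mem_Ioi]; linarith [hy.2]
  · linarith

lemma defect_le {δ ε : ℝ} (hδ : 0 < δ) (hε : 0 ≤ ε) :
    (∫ y in (0 : ℝ)..ε, k y * l (δ + ε - y)) ≤ (∫ y in (0 : ℝ)..ε, k y) * l δ := by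
  rw [← intervalIntegral.integral_mul_const]
  refine intervalIntegral.integral_mono_on_of_le_Ioo hε
    (h.intervalIntegrable_defect hδ hε) ((h.intervalIntegrable_k le_rfl hε).mul_const _)
    fun y hy => ?_
  refine mul_le_mul_of_nonneg_left (h.antitone_l hδ ?_ ?_) (h.nonneg_k y hy.1)
  · simp only [mem_Ioi]; linarith [hy.2]
  · linarith [hy.2]

/-- `h_ε ≥ 0`, since its primitive is nondecreasing because `l` is nonincreasing. -/
lemma approxId_nonneg {ε T : ℝ} (hε : 0 < ε) : ∀ᵐ y, 0 ≤ approxId k l T ε y := by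
  have hli : LocallyIntegrable (approxId k l T ε) := (h.integrable_approxId hε T).locallyIntegrable
  filter_upwards [LocallyIntegrable.ae_hasDerivAt_integral hli] with y hy
  by_cases hm : y ∈ Ioo 0 T
  · have h1 := hy 0
    have hmono : MonotoneOn (fun x => ∫ t in (0 : ℝ)..x, approxId k l T ε t) (Ioo 0 T) := by
      intro a ha b hb hab
      dsimp only
      rw [h.integral_approxId hε ha.1.le ha.2.le, h.integral_approxId hε hb.1.le hb.2.le]
      linarith [h.defect_antitone ha.1 hab hε.le]
    rw [← h1.deriv, ← derivWithin_of_isOpen isOpen_Ioo hm]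
    exact hmono.derivWithin_nonneg
  · rw [approxId, cut_of_notMem hm]

lemma tendsto_integral_k : Tendsto (fun ε => ∫ y in (0 : ℝ)..ε, k y) (𝓝[>] 0) (𝓝 0) := by
  have hc : ContinuousOn (fun ε => ∫ y in (0 : ℝ)..ε, k y) (Icc 0 1) := by
    have := intervalIntegral.continuousOn_primitive_interval (f := k) (a := 0) (b := 1)
      (μ := volume) ?_
    · rwa [uIcc_of_le zero_le_one] at this
    rw [uIcc_of_le zero_le_one]
    exact h.locInt_k.integrableOn_compact_subset Icc_subset_Ici_self isCompact_Icc
  have h0 := hc 0 (by simp)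
  unfold ContinuousWithinAt at h0
  simp only [intervalIntegral.integral_same] at h0
  refine h0.mono_left ?_
  rw [← nhdsWithin_Ioc_eq_nhdsGT zero_lt_one]
  exact nhdsWithin_mono _ Ioc_subset_Icc_self

/-- `h_ε` is an approximate identity as `ε → 0`. -/
lemma tendsto_corr_approxId {T : ℝ} (hT : 0 < T) {c : ℝ → ℝ} (hc : Causal T c)
    (hcc : Continuous c) :
    Tendsto (fun ε => corr (approxId k l T ε) c 0) (𝓝[>] 0) (𝓝 (c 0)) := by
  obtain ⟨C, hC⟩ := hc.bdd
  have hC0 : 0 ≤ C := (abs_nonneg _).trans (hC 0)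
  rw [Metric.tendsto_nhds]
  intro e he
  obtain ⟨δ, hδ, hδc⟩ := Metric.continuous_iff.1 hcc 0 (e / 3) (by positivity)
  set δ' := min (δ / 2) T with hδ'
  have hδ'0 : 0 < δ' := by positivity
  have hδ'T : δ' ≤ T := min_le_right _ _
  have hev : ∀ᶠ ε in 𝓝[>] (0 : ℝ), (∫ y in (0 : ℝ)..ε, k y) * l δ' * (3 * C) < e / 3 := by
    have := ((h.tendsto_integral_k.mul_const (l δ')).mul_const (3 * C))
    simp only [zero_mul] at this
    exact this.eventually (gt_mem_nhds (by positivity))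
  filter_upwards [hev, self_mem_nhdsWithin] with ε hε1 hε
  have hε : 0 < ε := hε
  set H := approxId k l T ε with hH
  have hHi : Integrable H := h.integrable_approxId hε T
  have hHm : Measurable H := h.measurable_approxId hε T
  have hH0 : ∀ᵐ y, 0 ≤ H y := h.approxId_nonneg hε
  have hint : ∀ δ'', 0 ≤ δ'' → δ'' ≤ T → ∫ y in Ioo 0 δ'', H y =
      1 - ∫ y in (0 : ℝ)..ε, k y * l (δ'' + ε - y) := fun δ'' h1 h2 => by
    rw [← integral_Ioc_eq_integral_Ioo, ← intervalIntegral.integral_of_le h1,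
      h.integral_approxId hε h1 h2]
  have htot : ∫ y, H y = ∫ y in Ioo 0 T, H y := by
    rw [← integral_indicator measurableSet_Ioo]
    refine integral_congr_ae (Eventually.of_forall fun y => ?_)
    rw [hH, approxId, cut, indicator_indicator, inter_self]
  have hdef1 := h.defect_le hδ'0 hε.le
  have hdef0 := h.defect_nonneg hδ'0.le hε.le
  have hdefT1 := h.defect_antitone hδ'0 hδ'T hε.le
  have hdefT0 := h.defect_nonneg hT.le hε.le
  have hm1 := hint T hT.le le_rfl
  have hm2 := hint δ' hδ'0.le hδ'T
  set q := (∫ y in (0 : ℝ)..ε, k y) * l δ' with hq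
  -- on `(0, δ')` the function `c` is close to `c 0`; the mass beyond `δ'` is small
  have hpt : ∀ᵐ y, |H y * c (0 + y) - H y * c 0| ≤
      e / 3 * H y + 2 * C * (H y - (Ioo 0 δ').indicator H y) := by
    filter_upwards [hH0] with y hy
    rw [← mul_sub, abs_mul, abs_of_nonneg hy, zero_add]
    by_cases hy1 : y ∈ Ioo 0 δ'
    · rw [indicator_of_mem hy1, sub_self, mul_zero, add_zero, mul_comm]
      refine mul_le_mul_of_nonneg_right ?_ hy
      have := hδc y (by
        rw [Real.dist_eq, sub_zero, abs_of_pos hy1.1]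
        have := min_le_left (δ / 2) T
        linarith [hy1.2])
      rw [Real.dist_eq] at this; exact this.le
    · rw [indicator_of_notMem hy1, sub_zero]
      have h1 : |c y - c 0| ≤ 2 * C := (abs_sub _ _).trans (by linarith [hC y, hC 0])
      nlinarith [mul_le_mul_of_nonneg_left h1 hy, mul_nonneg he.le hy]
  have hci : Integrable fun y => H y * c (0 + y) := integrable_mul_shift hHi hc.meas hC 0
  have hI1 : Integrable fun y => e / 3 * H y := hHi.const_mul _
  have hI2 : Integrable fun y => H y - (Ioo 0 δ').indicator H y :=
    hHi.sub (hHi.indicator measurableSet_Ioo)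
  have hI3 : Integrable fun y => 2 * C * (H y - (Ioo 0 δ').indicator H y) := hI2.const_mul _
  have hmain : |∫ y, (H y * c (0 + y) - H y * c 0)| ≤
      ∫ y, (e / 3 * H y + 2 * C * (H y - (Ioo 0 δ').indicator H y)) := by
    refine abs_integral_le_integral_abs.trans (integral_mono_ae
      (hci.sub (hHi.mul_const _)).abs (hI1.add hI3) hpt)
  rw [integral_sub hci (hHi.mul_const _), integral_mul_const,
    integral_add hI1 hI3,
    integral_const_mul, integral_const_mul, integral_sub hHi (hHi.indicator measurableSet_Ioo),
    integral_indicator measurableSet_Ioo, htot] at hmain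
  rw [Real.dist_eq]
  change |(∫ y, H y * c (0 + y)) - c 0| < e
  set I := ∫ y in Ioo 0 T, H y
  have e1 : (∫ y, H y * c (0 + y)) - c 0 =
      ((∫ y, H y * c (0 + y)) - I * c 0) + (I - 1) * c 0 := by ring
  have e2 : |(I - 1) * c 0| ≤ q * C := by
    rw [abs_mul]
    refine mul_le_mul ?_ (hC 0) (abs_nonneg _) (hdef0.trans hdef1)
    rw [abs_le]; constructor <;> linarith
  have e3 : e / 3 * I + 2 * C * (I - ∫ y in Ioo 0 δ', H y) ≤ e / 3 + 2 * C * q := by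
    have a1 : e / 3 * I ≤ e / 3 * 1 := mul_le_mul_of_nonneg_left (by linarith) (by positivity)
    have a2 : 2 * C * (I - ∫ y in Ioo 0 δ', H y) ≤ 2 * C * q :=
      mul_le_mul_of_nonneg_left (by linarith) (by positivity)
    linarith
  rw [e1]
  refine (abs_add_le _ _).trans_lt ?_
  linarith

end AssumptionK0

/-! ### Sobolev functions of one space variable -/

/-- `u` is an absolutely continuous function on `ℝ` with integrable derivative `g`, expressed by
the fundamental theorem of calculus. -/
structure IsPrimitive (u g : ℝ → ℝ) : Prop where
  integrable : Integrable g
  sub_eq : ∀ x y, u y - u x = ∫ t in x..y, g t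

namespace IsPrimitive

variable {u v g h : ℝ → ℝ}

lemma ac (hu : IsPrimitive u g) (a b : ℝ) : AbsolutelyContinuousOnInterval u a b := by
  have h1 : AbsolutelyContinuousOnInterval (fun x => ∫ t in a..x, g t) a b :=
    (hu.integrable.intervalIntegrable).absolutelyContinuousOnInterval_intervalIntegral
      left_mem_uIcc
  have h2 : AbsolutelyContinuousOnInterval (fun _ : ℝ => u a) a b :=
    LipschitzOnWith.absolutelyContinuousOnInterval (K := 0) (LipschitzWith.const _).lipschitzOnWith
  have h3 := h2.add h1
  have h4 : u = (fun _ : ℝ => u a) + fun x => ∫ t in a..x, g t := by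
    funext x
    have := hu.sub_eq a x
    simp only [Pi.add_apply]; linarith
  rwa [← h4] at h3

lemma ae_hasDerivAt (hu : IsPrimitive u g) : ∀ᵐ x, HasDerivAt u (g x) x := by
  filter_upwards [LocallyIntegrable.ae_hasDerivAt_integral hu.integrable.locallyIntegrable]
    with x hx
  have h4 : u = fun x => u 0 + ∫ t in (0 : ℝ)..x, g t := by
    funext x
    have := hu.sub_eq 0 x
    linarith
  rw [h4]
  exact (hx 0).const_add _

lemma continuous (hu : IsPrimitive u g) : Continuous u := by
  have h4 : u = fun x => u 0 + ∫ t in (0 : ℝ)..x, g t := by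
    funext x
    have := hu.sub_eq 0 x
    linarith
  rw [h4]
  exact continuous_const.add (intervalIntegral.continuous_primitive
    (fun a b => hu.integrable.intervalIntegrable) 0)

lemma of_ac (hac : ∀ a b, AbsolutelyContinuousOnInterval u a b) (hd : ∀ᵐ x, deriv u x = g x)
    (hg : Integrable g) : IsPrimitive u g := by
  refine ⟨hg, fun x y => ?_⟩
  rw [← (hac x y).integral_deriv_eq_sub]
  exact intervalIntegral.integral_congr_ae (hd.mono fun x hx _ => hx)

lemma abs_sub_le (hu : IsPrimitive u g) (x y : ℝ) : |u y - u x| ≤ ∫ t, |g t| := by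
  rw [hu.sub_eq]
  refine (intervalIntegral.norm_integral_le_integral_norm_uIoc (f := g)).trans ?_
  exact setIntegral_le_integral hu.integrable.norm (Eventually.of_forall fun x => norm_nonneg _)

lemma bounded (hu : IsPrimitive u g) : ∃ C, ∀ x, |u x| ≤ C := by
  refine ⟨|u 0| + ∫ t, |g t|, fun x => ?_⟩
  have h1 := hu.abs_sub_le 0 x
  have h2 : |u x| ≤ |u 0| + |u x - u 0| := by
    have := abs_add_le (u 0) (u x - u 0)
    simpa using this
  linarith

lemma mul (hu : IsPrimitive u g) (hv : IsPrimitive v h) :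
    IsPrimitive (fun x => u x * v x) (fun x => g x * v x + u x * h x) := by
  obtain ⟨C, hC⟩ := hu.bounded
  obtain ⟨D, hD⟩ := hv.bounded
  refine of_ac (fun a b => (hu.ac a b).mul (hv.ac a b)) ?_ ?_
  · filter_upwards [hu.ae_hasDerivAt, hv.ae_hasDerivAt] with x h1 h2
    exact (h1.mul h2).deriv
  · exact (hu.integrable.mul_bdd (c := D) hv.continuous.aestronglyMeasurable
      (Eventually.of_forall hD)).add (hv.integrable.bdd_mul (c := C)
      hu.continuous.aestronglyMeasurable (Eventually.of_forall hC))

/-- Chain rule for the truncation `(u - κ)₊`. -/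
lemma posPart (hu : IsPrimitive u g) (κ : ℝ) :
    IsPrimitive (fun x => max (u x - κ) 0) ({x | κ < u x}.indicator g) := by
  refine of_ac (fun a b => ?_) ?_ ?_
  · have h1 := hu.ac a b
    rw [absolutelyContinuousOnInterval_iff] at h1 ⊢
    intro ε hε
    obtain ⟨δ, hδ, hE⟩ := h1 ε hε
    refine ⟨δ, hδ, fun E hE1 hE2 => lt_of_le_of_lt (Finset.sum_le_sum fun i _ => ?_)
      (hE E hE1 hE2)⟩
    rw [Real.dist_eq, Real.dist_eq]
    refine (abs_max_sub_max_le_abs _ _ _).trans_eq ?_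
    congr 1; ring
  · filter_upwards [hu.ae_hasDerivAt] with x hx
    rcases lt_trichotomy (u x) κ with hlt | heq | hgt
    · rw [indicator_of_notMem (by simpa using hlt.le)]
      have : (fun y => max (u y - κ) 0) =ᶠ[𝓝 x] fun _ => 0 := by
        filter_upwards [hu.continuous.continuousAt.eventually (gt_mem_nhds hlt)] with y hy
        exact max_eq_right (by linarith)
      rw [this.deriv_eq, deriv_const]
    · -- at a zero of `(u - κ)₊` the truncation is minimal, so its derivative vanishes
      rw [indicator_of_notMem (by simp [heq])]
      refine IsLocalMin.deriv_eq_zero (Eventually.of_forall fun y => ?_)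
      simp [heq]
    · rw [indicator_of_mem (by simpa using hgt)]
      have : (fun y => max (u y - κ) 0) =ᶠ[𝓝 x] fun y => u y - κ := by
        filter_upwards [hu.continuous.continuousAt.eventually (lt_mem_nhds hgt)] with y hy
        exact max_eq_left (by linarith)
      rw [this.deriv_eq]
      exact (hx.sub_const κ).deriv
  · exact hu.integrable.indicator (measurableSet_lt measurable_const hu.continuous.measurable)

/-- The integral of the derivative of a compactly supported function vanishes. -/
lemma integral_eq_zero (hu : IsPrimitive u g) {m R : ℝ}
    (hu0 : ∀ x, x ∉ Metric.ball m R → u x = 0) (hg0 : ∀ x, x ∉ Metric.ball m R → g x = 0) :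
    ∫ x, g x = 0 := by
  rcases le_or_gt R 0 with hR | hR
  · have : ∀ x, g x = 0 := fun x => hg0 x (by rw [Metric.ball_eq_empty.2 hR]; simp)
    simp [this]
  have h1 := hu.sub_eq (m - R) (m + R)
  rw [hu0 _ (by simp [abs_of_pos hR]), hu0 _ (by simp [abs_of_pos hR]),
    intervalIntegral.integral_of_le (by linarith), integral_Ioc_eq_integral_Ioo] at h1
  rw [← setIntegral_eq_integral_of_forall_compl_eq_zero (s := Ioo (m - R) (m + R)), ← h1, sub_self]
  intro x hx
  exact hg0 x (by rwa [Real.ball_eq_Ioo])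

end IsPrimitive

lemma isPrimitive_of_contDiff {φ : ℝ → ℝ} (hφ : ContDiff ℝ 1 φ) (hc : HasCompactSupport φ) :
    IsPrimitive φ (deriv φ) := by
  have hd : Continuous (deriv φ) := hφ.continuous_deriv le_rfl
  refine ⟨hd.integrable_of_hasCompactSupport hc.deriv, fun x y => ?_⟩
  rw [intervalIntegral.integral_deriv_eq_sub (fun x _ => hφ.differentiable (by norm_num) x)
    (hd.intervalIntegrable _ _)]

lemma IsTestFn.isPrimitive {Ω : Set ℝ} {φ : ℝ → ℝ} (hφ : IsTestFn Ω φ) :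
    IsPrimitive φ (deriv φ) :=
  isPrimitive_of_contDiff (hφ.1.of_le (by exact_mod_cast le_top)) hφ.2.1

lemma IsTestFn.eq_zero {Ω : Set ℝ} {φ : ℝ → ℝ} (hφ : IsTestFn Ω φ) {x : ℝ} (hx : x ∉ Ω) :
    φ x = 0 := image_eq_zero_of_notMem_tsupport fun h => hx (hφ.2.2 h)

lemma IsTestFn.deriv_eq_zero {Ω : Set ℝ} {φ : ℝ → ℝ} (hφ : IsTestFn Ω φ) {x : ℝ} (hx : x ∉ Ω) :
    deriv φ x = 0 := by
  by_contra h
  exact hx (hφ.2.2 (tsupport_deriv_subset (subset_tsupport _ h)))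

/-- A test function of zero mean on a ball is the derivative of a test function. -/
lemma exists_primitive_testFn {m R R' : ℝ} (hR' : R' < R) {χ : ℝ → ℝ}
    (hχ : ContDiff ℝ (⊤ : ℕ∞) χ) (hs : ∀ x, x ∉ Metric.closedBall m R' → χ x = 0)
    (h0 : ∫ x, χ x = 0) :
    ∃ φ, IsTestFn (Metric.ball m R) φ ∧ deriv φ = χ ∧
      (∀ x, φ x = ∫ t in (m - R')..x, χ t) ∧ ∀ x, x ∉ Metric.closedBall m R' → φ x = 0 := by
  have hd : ∀ x, HasDerivAt (fun x => ∫ t in (m - R')..x, χ t) (χ x) x := fun x =>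
    intervalIntegral.integral_hasDerivAt_right (hχ.continuous.intervalIntegrable _ _)
      hχ.continuous.stronglyMeasurable.stronglyMeasurableAtFilter hχ.continuous.continuousAt
  have hderiv : deriv (fun x => ∫ t in (m - R')..x, χ t) = χ := funext fun x => (hd x).deriv
  have hzero : ∀ x, x ∉ Metric.closedBall m R' → (∫ t in (m - R')..x, χ t) = 0 := by
    intro x hx
    rw [Real.closedBall_eq_Icc, mem_Icc, not_and_or, not_le, not_le] at hx
    rcases le_or_gt x (m - R') with h1 | h1
    · refine intervalIntegral.integral_zero_ae ?_
      filter_upwards [show ∀ᵐ t : ℝ, t ≠ m - R' by simp [ae_iff]] with t ht0 ht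
      rw [uIoc_of_ge h1] at ht
      refine hs t ?_
      rw [Real.closedBall_eq_Icc, mem_Icc, not_and_or]
      exact Or.inl (not_le.2 (lt_of_le_of_ne ht.2 ht0))
    · have h2 : m + R' < x := by rcases hx with h | h <;> linarith
      rw [intervalIntegral.integral_of_le h1.le, ← integral_Icc_eq_integral_Ioc]
      rw [setIntegral_eq_integral_of_forall_compl_eq_zero, h0]
      intro t ht
      refine hs t ?_
      rw [Real.closedBall_eq_Icc]
      exact fun hh => ht ⟨hh.1, hh.2.trans h2.le⟩
  refine ⟨fun x => ∫ t in (m - R')..x, χ t, ⟨?_, ?_, ?_⟩, hderiv, fun x => rfl, hzero⟩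
  · refine contDiff_infty_iff_deriv.2 ⟨fun x => (hd x).differentiableAt, ?_⟩
    rw [hderiv]; exact hχ
  · exact HasCompactSupport.intro (isCompact_closedBall m R') hzero
  · refine (closure_minimal (fun x hx => ?_) Metric.isClosed_closedBall).trans
      (Metric.closedBall_subset_ball hR')
    by_contra h
    exact hx (hzero x h)

lemma memLp_two_integrableOn {s : Set ℝ} (hs : volume s ≠ ∞) {v : ℝ → ℝ}
    (hv : MemLp v 2 (volume.restrict s)) : IntegrableOn v s := by
  have : IsFiniteMeasure (volume.restrict s) := ⟨by simpa using hs.lt_top⟩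
  exact (hv.mono_exponent (by norm_num)).integrable le_rfl

/-- Integration by parts against a test function. -/
lemma IsPrimitive.setIntegral_mul_deriv {f g φ : ℝ → ℝ} (hf : IsPrimitive f g) {m R : ℝ}
    (hφ : IsTestFn (Metric.ball m R) φ) :
    ∫ x in Metric.ball m R, f x * deriv φ x = -∫ x in Metric.ball m R, g x * φ x := by
  have h1 := hf.mul hφ.isPrimitive
  have h2 := h1.integral_eq_zero (m := m) (R := R) (fun x hx => by rw [hφ.eq_zero hx, mul_zero])
    (fun x hx => by rw [hφ.eq_zero hx, hφ.deriv_eq_zero hx]; ring)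
  obtain ⟨C, hC⟩ := hf.bounded
  obtain ⟨D, hD⟩ := hφ.isPrimitive.bounded
  rw [integral_add (hf.integrable.mul_bdd (c := D)
    hφ.isPrimitive.continuous.aestronglyMeasurable (Eventually.of_forall hD))
    (hφ.isPrimitive.integrable.bdd_mul (c := C) hf.continuous.aestronglyMeasurable
    (Eventually.of_forall hC))] at h2
  rw [setIntegral_eq_integral_of_forall_compl_eq_zero fun x hx => by
      rw [hφ.deriv_eq_zero hx, mul_zero],
    setIntegral_eq_integral_of_forall_compl_eq_zero fun x hx => by rw [hφ.eq_zero hx, mul_zero]]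
  linarith

/-- An `H¹` function on an interval coincides a.e. with an absolutely continuous function. -/
lemma IsH1.exists_const {m R : ℝ} (hR : 0 < R) {v w : ℝ → ℝ} (h : IsH1 (Metric.ball m R) v w) :
    ∃ c, ∀ᵐ x ∂(volume.restrict (Metric.ball m R)),
      v x = c + ∫ t in m..x, (Metric.ball m R).indicator w t := by
  obtain ⟨hv, hw, hvw⟩ := h
  have hfin : volume (Metric.ball m R) ≠ ∞ := measure_ball_lt_top.ne
  have hvi : IntegrableOn v (Metric.ball m R) := memLp_two_integrableOn hfin hv
  have hwi : IntegrableOn w (Metric.ball m R) := memLp_two_integrableOn hfin hw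
  set wB := (Metric.ball m R).indicator w with hwB
  have hwBi : Integrable wB := hwi.integrable_indicator measurableSet_ball
  set W : ℝ → ℝ := fun x => ∫ t in m..x, wB t with hW
  have hWp : IsPrimitive W wB := ⟨hwBi, fun x y => by
    rw [hW]; simp only
    rw [intervalIntegral.integral_interval_sub_left hwBi.intervalIntegrable
      hwBi.intervalIntegrable]⟩
  set f : ℝ → ℝ := fun x => v x - W x with hf
  have hWi : IntegrableOn W (Metric.ball m R) :=
    (hWp.continuous.integrableOn_Icc (a := m - R) (b := m + R)).mono_set
      (by rw [Real.ball_eq_Ioo]; exact Ioo_subset_Icc_self)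
  have hfi : IntegrableOn f (Metric.ball m R) := hvi.sub hWi
  have key : ∀ φ, IsTestFn (Metric.ball m R) φ → ∫ x in Metric.ball m R, f x * deriv φ x = 0 := by
    intro φ hφ
    obtain ⟨D, hD⟩ := (hφ.1.continuous_deriv (by simp)).bounded_above_of_compact_support
      hφ.2.1.deriv
    have hdm : AEStronglyMeasurable (deriv φ) (volume.restrict (Metric.ball m R)) :=
      (hφ.1.continuous_deriv (by simp)).aestronglyMeasurable
    have h1 : ∫ x in Metric.ball m R, f x * deriv φ x =
        (∫ x in Metric.ball m R, v x * deriv φ x) - ∫ x in Metric.ball m R, W x * deriv φ x := by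
      rw [← integral_sub (hvi.mul_bdd (c := D) hdm (Eventually.of_forall hD))
        (hWi.mul_bdd (c := D) hdm (Eventually.of_forall hD))]
      refine integral_congr_ae (Eventually.of_forall fun x => ?_)
      simp only [hf]; ring
    rw [h1, hvw φ hφ, hWp.setIntegral_mul_deriv hφ, sub_neg_eq_add, neg_add_eq_zero]
    refine setIntegral_congr_fun measurableSet_ball fun x hx => ?_
    simp only [hwB, indicator_of_mem hx]
  let b : ContDiffBump m := ⟨R / 4, R / 2, by positivity, by linarith⟩
  set χ₀ := b.normed volume with hχ₀
  have hχ₀s : ContDiff ℝ (⊤ : ℕ∞) χ₀ := b.contDiff_normed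
  have hχ₀0 : ∀ x, x ∉ Metric.closedBall m (R / 2) → χ₀ x = 0 := fun x hx => by
    have : x ∉ Function.support χ₀ := by
      rw [hχ₀, b.support_normed_eq]; exact fun h => hx (Metric.ball_subset_closedBall h)
    simpa using this
  have hfχ : ∀ χ : ℝ → ℝ, Continuous χ → HasCompactSupport χ →
      Integrable (fun x => f x * χ x) (volume.restrict (Metric.ball m R)) := fun χ h1 h2 => by
    obtain ⟨D, hD⟩ := h1.bounded_above_of_compact_support h2
    exact hfi.mul_bdd (c := D) h1.aestronglyMeasurable (Eventually.of_forall hD)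
  set c := ∫ x in Metric.ball m R, f x * χ₀ x with hc
  refine ⟨c, ?_⟩
  have hfin2 : IntegrableOn (fun x => f x - c) (Metric.ball m R) :=
    hfi.sub (integrableOn_const hfin)
  have := Metric.isOpen_ball.ae_eq_zero_of_integral_contDiff_smul_eq_zero
    (U := Metric.ball m R) (μ := volume) hfin2.locallyIntegrableOn ?_
  · rw [ae_restrict_iff' measurableSet_ball]
    filter_upwards [this] with x hx hxB
    have := hx hxB
    simp only [hf] at this; linarith
  · intro χ hχ hχc hχB
    set I := ∫ x, χ x with hI
    -- subtract a multiple of `χ₀` to reach zero mean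
    obtain ⟨R', hR', hR'R, hχR'⟩ : ∃ R', R / 2 ≤ R' ∧ R' < R ∧ tsupport χ ⊆ Metric.closedBall m R' := by
      have hcomp : IsCompact (tsupport χ) := hχc
      rcases (tsupport χ).eq_empty_or_nonempty with he | hne
      · exact ⟨R / 2, le_rfl, by linarith, by simp [he]⟩
      obtain ⟨x, hx, hmax⟩ := hcomp.exists_isMaxOn hne (f := fun x => dist x m) (by fun_prop)
      refine ⟨max (R / 2) (dist x m), le_max_left _ _, max_lt (by linarith)
        (Metric.mem_ball.1 (hχB hx)), fun y hy => ?_⟩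
      exact Metric.mem_closedBall.2 ((hmax hy).trans (le_max_right _ _))
    obtain ⟨φ, hφ, hφd, -, -⟩ := exists_primitive_testFn (m := m) hR'R
      (χ := fun x => χ x - I * χ₀ x) (hχ.sub (contDiff_const.mul hχ₀s))
      (fun x hx => by
        rw [image_eq_zero_of_notMem_tsupport fun h => hx (hχR' h),
          hχ₀0 x fun h => hx (Metric.closedBall_subset_closedBall hR' h)]
        ring) (by
        rw [integral_sub (hχ.continuous.integrable_of_hasCompactSupport hχc)
          (b.integrable_normed.const_mul _), integral_const_mul, b.integral_normed, mul_one, hI,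
          sub_self])
    have h1 := key φ hφ
    rw [hφd] at h1
    have h2 : ∀ x, f x * (χ x - I * χ₀ x) = f x * χ x - I * (f x * χ₀ x) := fun x => by ring
    simp_rw [h2] at h1
    rw [integral_sub (hfχ χ hχ.continuous hχc) ((hfχ χ₀ b.continuous_normed
      b.hasCompactSupport_normed).const_mul _), integral_const_mul, ← hc] at h1
    have h3 : ∫ x, χ x • (f x - c) = ∫ x in Metric.ball m R, χ x • (f x - c) :=
      (setIntegral_eq_integral_of_forall_compl_eq_zero fun x hx => by
        rw [image_eq_zero_of_notMem_tsupport fun h => hx (hχB h), zero_smul]).symm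
    have h4 : ∫ x in Metric.ball m R, χ x = I :=
      setIntegral_eq_integral_of_forall_compl_eq_zero fun x hx =>
        image_eq_zero_of_notMem_tsupport fun h => hx (hχB h)
    have h5 : ∀ x, χ x • (f x - c) = f x * χ x - c * χ x := fun x => by
      rw [smul_eq_mul]; ring
    rw [h3]; simp_rw [h5]
    rw [integral_sub (hfχ χ hχ.continuous hχc) ((hχ.continuous.integrable_of_hasCompactSupport
      hχc).integrableOn.const_mul c), integral_const_mul, h4]
    linarith

lemma tendsto_eLpNorm_of_bound {α : Type*} [MeasurableSpace α] {μ : Measure α} [IsFiniteMeasure μ]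
    {f : ℕ → α → ℝ} {b : ℕ → ℝ} (hb : Tendsto b atTop (𝓝 0))
    (hf : ∀ n, ∀ x, |f n x| ≤ b n) : Tendsto (fun n => eLpNorm (f n) 2 μ) atTop (𝓝 0) := by
  have h1 : ∀ n, eLpNorm (f n) 2 μ ≤ μ univ ^ (2 : ℝ≥0∞).toReal⁻¹ * ENNReal.ofReal (b n) :=
    fun n => eLpNorm_le_of_ae_bound (Eventually.of_forall (hf n))
  have h2 : Tendsto (fun n => μ univ ^ (2 : ℝ≥0∞).toReal⁻¹ * ENNReal.ofReal (b n)) atTop (𝓝 0) := by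
    have h3 := (ENNReal.tendsto_ofReal hb)
    rw [ENNReal.ofReal_zero] at h3
    have h4 := ENNReal.Tendsto.const_mul (a := μ univ ^ (2 : ℝ≥0∞).toReal⁻¹) h3
      (Or.inr (by finiteness))
    rwa [mul_zero] at h4
  exact tendsto_of_tendsto_of_tendsto_of_le_of_le tendsto_const_nhds h2 (fun _ => zero_le) h1

/-- An absolutely continuous function with square integrable derivative and compact support in a
ball belongs to `H̊¹` of the ball. The derivative is approximated in `L₂` by test functions of zero
mean, whose primitives are the approximating test functions. -/
lemma IsPrimitive.isH1Zero {f g : ℝ → ℝ} (hf : IsPrimitive f g) (hg : MemLp g 2) {m R R' : ℝ}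
    (hR' : 0 < R') (hR : R' < R) (hf0 : ∀ x, x ∉ Metric.closedBall m R' → f x = 0)
    (hg0 : ∀ x, x ∉ Metric.closedBall m R' → g x = 0) : IsH1Zero (Metric.ball m R) f g := by
  set B := Metric.ball m R with hB
  have hfin : volume B ≠ ∞ := measure_ball_lt_top.ne
  have hfm : IsFiniteMeasure (volume.restrict B) := ⟨by simpa using hfin.lt_top⟩
  obtain ⟨C, hC⟩ := hf.bounded
  refine ⟨⟨MemLp.of_bound hf.continuous.aestronglyMeasurable C (Eventually.of_forall hC),
    hg.restrict _, fun φ hφ => hf.setIntegral_mul_deriv hφ⟩, ?_⟩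
  set R'' := (R' + R) / 2 with hR''
  let b : ContDiffBump m := ⟨R', R'', hR', by simp only [hR'']; linarith⟩
  set χ₀ := b.normed volume with hχ₀
  have hχ₀s : ContDiff ℝ (⊤ : ℕ∞) χ₀ := b.contDiff_normed
  have hbs : ContDiff ℝ (⊤ : ℕ∞) b := b.contDiff
  have hb0 : ∀ x, x ∉ Metric.closedBall m R'' → b x = 0 := fun x hx =>
    b.zero_of_le_dist (by
      have : R'' < dist x m := not_le.1 hx
      exact this.le)
  have hχ₀0 : ∀ x, x ∉ Metric.closedBall m R'' → χ₀ x = 0 := fun x hx => by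
    rw [hχ₀, b.normed_def, hb0 x hx, zero_div]
  obtain ⟨D, hD⟩ := b.continuous_normed.bounded_above_of_compact_support
    (b.hasCompactSupport_normed (μ := volume))
  have hex : ∀ n : ℕ, ∃ G : ℝ → ℝ, HasCompactSupport G ∧ ContDiff ℝ (⊤ : ℕ∞) G ∧
      eLpNorm (g - G) 2 volume ≤ ENNReal.ofReal (1 / (n + 1 : ℝ)) := fun n =>
    hg.exist_eLpNorm_sub_le (by norm_num) (by norm_num) (by positivity)
  choose G hGc hGs hGn using hex
  have hGm : ∀ n, MemLp (g - G n) 2 := fun n => hg.sub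
    ((hGs n).continuous.memLp_of_hasCompactSupport (hGc n))
  -- cut-off approximations of `g`
  set d : ℕ → ℝ → ℝ := fun n x => b x * G n x - g x with hd
  have hdb : ∀ n x, |d n x| ≤ |(g - G n) x| := by
    intro n x
    simp only [hd, Pi.sub_apply]
    by_cases hx : x ∈ Metric.closedBall m R'
    · rw [b.one_of_mem_closedBall hx, one_mul, abs_sub_comm]
    · rw [hg0 x hx, sub_zero, zero_sub, abs_neg, abs_mul, abs_of_nonneg b.nonneg]
      exact mul_le_of_le_one_left (abs_nonneg _) b.le_one
  have hbGi : ∀ n, Integrable fun x => b x * G n x := fun n =>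
    ((b.continuous.mul (hGs n).continuous)).integrable_of_hasCompactSupport
      (b.hasCompactSupport.mul_right)
  have hdi : ∀ n, Integrable (d n) := fun n => (hbGi n).sub hf.integrable
  have hd0 : ∀ n x, x ∉ B → d n x = 0 := fun n x hx => by
    have h1 : x ∉ Metric.closedBall m R'' := fun h => hx
      (Metric.closedBall_subset_ball (by simp only [hR'']; linarith) h)
    simp only [hd]
    rw [hb0 x h1, hg0 x fun h => h1 (Metric.closedBall_subset_closedBall
      (by simp only [hR'']; linarith) h)]
    ring
  set K : ℝ := ((volume.restrict B) univ ^ (1 / (2 : ℝ))).toReal with hK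
  have hd1 : ∀ n, ∫ x, |d n x| ≤ K * (1 / (n + 1 : ℝ)) := by
    intro n
    have e1 : ∫ x, |d n x| = ∫ x in B, |d n x| :=
      (setIntegral_eq_integral_of_forall_compl_eq_zero fun x hx => by
        rw [hd0 n x hx, abs_zero]).symm
    have hdm : AEStronglyMeasurable (d n) (volume.restrict B) :=
      (hdi n).aestronglyMeasurable.restrict
    have e2 := eLpNorm_le_eLpNorm_mul_rpow_measure_univ (μ := volume.restrict B) (p := 1) (q := 2)
      (by norm_num) hdm
    have e3 : eLpNorm (d n) 2 (volume.restrict B) ≤ ENNReal.ofReal (1 / (n + 1 : ℝ)) :=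
      (eLpNorm_mono_measure _ Measure.restrict_le_self).trans
        ((eLpNorm_mono (fun x => hdb n x)).trans (hGn n))
    rw [e1]
    simp_rw [← Real.norm_eq_abs]
    rw [integral_norm_eq_lintegral_enorm hdm, ← eLpNorm_one_eq_lintegral_enorm]
    have e4 : eLpNorm (d n) 1 (volume.restrict B) ≤
        ENNReal.ofReal (1 / (n + 1 : ℝ)) * (volume.restrict B) univ ^ (1 / (2 : ℝ)) := by
      refine e2.trans (mul_le_mul' e3 (le_of_eq ?_))
      congr 1; norm_num
    refine (ENNReal.toReal_mono (by finiteness) e4).trans_eq ?_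
    rw [ENNReal.toReal_mul, ENNReal.toReal_ofReal (by positivity), mul_comm]
  have hK0 : 0 ≤ K := ENNReal.toReal_nonneg
  have hD0 : 0 ≤ D := (norm_nonneg _).trans (hD m)
  -- correct the mean
  set I : ℕ → ℝ := fun n => ∫ x, b x * G n x with hI
  have hgint : ∫ x, g x = 0 := hf.integral_eq_zero (m := m) (R := R)
    (fun x hx => hf0 x fun h => hx (Metric.closedBall_subset_ball hR h))
    (fun x hx => hg0 x fun h => hx (Metric.closedBall_subset_ball hR h))
  have hIb : ∀ n, |I n| ≤ K * (1 / (n + 1 : ℝ)) := by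
    intro n
    have : I n = ∫ x, d n x := by
      simp only [hd]; rw [integral_sub (hbGi n) hf.integrable, hgint, sub_zero]
    rw [this]
    exact abs_integral_le_integral_abs.trans (hd1 n)
  have hex2 : ∀ n, ∃ φ, IsTestFn B φ ∧ deriv φ = (fun x => b x * G n x - I n * χ₀ x) ∧
      (∀ x, φ x = ∫ t in (m - R'')..x, (b t * G n t - I n * χ₀ t)) ∧
      ∀ x, x ∉ Metric.closedBall m R'' → φ x = 0 := by
    intro n
    refine exists_primitive_testFn (by simp only [hR'']; linarith)
      ((hbs.mul (hGs n)).sub (contDiff_const.mul hχ₀s)) (fun x hx => ?_) ?_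
    · rw [hb0 x hx, hχ₀0 x hx]; ring
    · rw [integral_sub (hbGi n) (b.integrable_normed.const_mul _), integral_const_mul,
        b.integral_normed, mul_one, hI, sub_self]
  choose φ hφ1 hφ2 hφ3 hφ4 using hex2
  have hlim : Tendsto (fun n : ℕ => K * (1 / (n + 1 : ℝ))) atTop (𝓝 0) := by
    have := (tendsto_one_div_add_atTop_nhds_zero_nat (𝕜 := ℝ)).const_mul K
    rwa [mul_zero] at this
  refine ⟨φ, hφ1, ?_, ?_⟩
  · refine tendsto_eLpNorm_of_bound (b := fun n : ℕ => K * (1 / (n + 1 : ℝ)) +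
      K * (1 / (n + 1 : ℝ))) (by simpa using hlim.add hlim) fun n x => ?_
    have h1 : f x = ∫ t in (m - R'')..x, g t := by
      rw [← hf.sub_eq, hf0 (m - R''), sub_zero]
      rw [Real.closedBall_eq_Icc, mem_Icc, not_and_or]
      left; simp only [hR'']; linarith
    have h2 : φ n x - f x = ∫ t in (m - R'')..x, (d n t - I n * χ₀ t) := by
      have hi : Integrable fun t => b t * G n t - I n * χ₀ t :=
        (hbGi n).sub (b.integrable_normed.const_mul _)
      rw [hφ3, h1, ← intervalIntegral.integral_sub hi.intervalIntegrable
        hf.integrable.intervalIntegrable]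
      refine intervalIntegral.integral_congr fun t _ => ?_
      simp only [hd]; ring
    have h3 : Integrable fun t => d n t - I n * χ₀ t :=
      (hdi n).sub (b.integrable_normed.const_mul _)
    rw [h2]
    refine (intervalIntegral.norm_integral_le_integral_norm_uIoc
      (f := fun t => d n t - I n * χ₀ t)).trans ?_
    refine (setIntegral_le_integral h3.norm (Eventually.of_forall fun x => norm_nonneg _)).trans ?_
    have h4 : ∫ t, ‖d n t - I n * χ₀ t‖ ≤ ∫ t, (|d n t| + |I n| * χ₀ t) := by
      refine integral_mono h3.norm ((hdi n).abs.add (b.integrable_normed.const_mul _)) fun t => ?_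
      refine (norm_sub_le _ _).trans_eq ?_
      rw [norm_mul, Real.norm_eq_abs, Real.norm_eq_abs, Real.norm_eq_abs,
        abs_of_nonneg (b.nonneg_normed t)]
    refine h4.trans ?_
    rw [integral_add (hdi n).abs (b.integrable_normed.const_mul _), integral_const_mul,
      b.integral_normed, mul_one]
    exact add_le_add (hd1 n) (hIb n)
  · have h1 : ∀ n, eLpNorm (fun x => deriv (φ n) x - g x) 2 (volume.restrict B) ≤
        ENNReal.ofReal (1 / (n + 1 : ℝ)) +
          eLpNorm (fun x => I n * χ₀ x) 2 (volume.restrict B) := by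
      intro n
      have e1 : (fun x => deriv (φ n) x - g x) = d n - fun x => I n * χ₀ x := by
        funext x; rw [hφ2 n]; simp only [hd, Pi.sub_apply]; ring
      rw [e1]
      refine (eLpNorm_sub_le (hdi n).aestronglyMeasurable.restrict
        (b.continuous_normed.const_mul _).aestronglyMeasurable (by norm_num)).trans ?_
      gcongr
      exact (eLpNorm_mono_measure _ Measure.restrict_le_self).trans
        ((eLpNorm_mono (fun x => hdb n x)).trans (hGn n))
    have h2 : Tendsto (fun n => eLpNorm (fun x => I n * χ₀ x) 2 (volume.restrict B)) atTop
        (𝓝 0) := by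
      refine tendsto_eLpNorm_of_bound (b := fun n : ℕ => K * (1 / (n + 1 : ℝ)) * D)
        (by simpa using hlim.mul_const D) fun n x => ?_
      rw [abs_mul]
      exact mul_le_mul (hIb n) (hD x) (abs_nonneg _) (by positivity)
    have h3 : Tendsto (fun n : ℕ => ENNReal.ofReal (1 / (n + 1 : ℝ))) atTop (𝓝 0) := by
      have := ENNReal.tendsto_ofReal (tendsto_one_div_add_atTop_nhds_zero_nat (𝕜 := ℝ))
      rwa [ENNReal.ofReal_zero] at this
    have h4 := h3.add h2
    rw [add_zero] at h4
    exact tendsto_of_tendsto_of_tendsto_of_le_of_le tendsto_const_nhds h4 (fun _ => zero_le) h1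

/-! ### The time-regularized weak inequality -/

/-- Functions `φ ≥ 0` on space-time, with spatial derivative `Dφ`, which need no regularity in
time and are supported in `(0, T) × [m - R', m + R']`. -/
structure SpaceTest (T m R' : ℝ) (φ Dφ : ℝ × ℝ → ℝ) : Prop where
  meas : Measurable φ
  meas_D : Measurable Dφ
  nonneg : ∀ z, 0 ≤ φ z
  memLp : MemLp φ 2
  memLp_D : MemLp Dφ 2
  prim : ∀ s, IsPrimitive (fun x => φ (s, x)) (fun x => Dφ (s, x))
  supp : ∀ z : ℝ × ℝ, z ∉ Ioo 0 T ×ˢ Metric.closedBall m R' → φ z = 0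
  supp_D : ∀ z : ℝ × ℝ, z ∉ Ioo 0 T ×ˢ Metric.closedBall m R' → Dφ z = 0

lemma integrable_of_memLp_two_of_supp {T m R' : ℝ} {φ : ℝ × ℝ → ℝ} (hφ : MemLp φ 2)
    (h0 : ∀ z : ℝ × ℝ, z ∉ Ioo 0 T ×ˢ Metric.closedBall m R' → φ z = 0) : Integrable φ := by
  have hms : MeasurableSet (Ioo 0 T ×ˢ Metric.closedBall m R') :=
    measurableSet_Ioo.prod measurableSet_closedBall
  rw [← integrableOn_iff_integrable_of_support_subset (s := Ioo 0 T ×ˢ Metric.closedBall m R')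
    (fun z hz => by by_contra h; exact hz (h0 z h))]
  have hfin : volume (Ioo 0 T ×ˢ Metric.closedBall m R') < ∞ := by
    rw [Measure.volume_eq_prod, Measure.prod_prod]
    exact ENNReal.mul_lt_top (by simp) (measure_closedBall_lt_top)
  have : IsFiniteMeasure (volume.restrict (Ioo 0 T ×ˢ Metric.closedBall m R')) :=
    ⟨by simpa using hfin⟩
  exact ((hφ.restrict _).mono_exponent (by norm_num)).integrable le_rfl

/-- Translation in time on space-time. -/
lemma add_smul_time (z : ℝ × ℝ) (a : ℝ) : z + a • ((1, 0) : ℝ × ℝ) = (z.1 + a, z.2) := by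
  ext <;> simp

lemma add_smul_neg_time (z : ℝ × ℝ) (a : ℝ) : z + a • ((-1, 0) : ℝ × ℝ) = (z.1 - a, z.2) := by
  ext <;> simp [sub_eq_add_neg]

/-- The correlation `y ↦ ∫ φ(t + y, x) v(t, x) dt dx`. -/
noncomputable def timeCorr (φ v : ℝ × ℝ → ℝ) (y : ℝ) : ℝ := ∫ z : ℝ × ℝ, φ (z.1 + y, z.2) * v z

lemma timeCorr_eq (φ v : ℝ × ℝ → ℝ) (y : ℝ) :
    timeCorr φ v y = ∫ z : ℝ × ℝ, φ (z + y • ((1, 0) : ℝ × ℝ)) * v z := by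
  simp_rw [add_smul_time]; rfl

lemma continuous_timeCorr {φ v : ℝ × ℝ → ℝ} (hφ : MemLp φ 2) (hv : MemLp v 2) :
    Continuous (timeCorr φ v) := by
  have := continuous_translate_pairing (p := 2) (q := 2) (μ := (volume : Measure (ℝ × ℝ)))
    (by norm_num) (by norm_num) hφ hv (1, 0)
  refine this.congr fun y => ?_
  rw [timeCorr_eq]

lemma causal_timeCorr {T : ℝ} {φ v : ℝ × ℝ → ℝ} (hφ : MemLp φ 2) (hv : MemLp v 2)
    (hφ0 : ∀ z : ℝ × ℝ, T ≤ z.1 → φ z = 0) (hv0 : ∀ z : ℝ × ℝ, z.1 ≤ 0 → v z = 0) :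
    Causal T (timeCorr φ v) := by
  refine ⟨(continuous_timeCorr hφ hv).measurable, ⟨(eLpNorm φ 2).toReal * (eLpNorm v 2).toReal,
    fun y => ?_⟩, fun y hy => ?_⟩
  · rw [timeCorr_eq]
    exact abs_pairing_le hφ hv _
  · unfold timeCorr
    rw [← integral_zero (ℝ × ℝ) ℝ]
    refine integral_congr_ae (Eventually.of_forall fun z => ?_)
    dsimp only
    rcases le_or_gt z.1 0 with h | h
    · rw [hv0 z h, mul_zero]
    · rw [hφ0 _ (by dsimp only; linarith), zero_mul]

/-- The time average of a space test function with a smooth causal weight `g`, `g' = J`, is a test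
function of the weak formulation. -/
lemma SpaceTest.isNonnegTest {T m R R' : ℝ} {φ Dφ : ℝ × ℝ → ℝ} (hφ : SpaceTest T m R' φ Dφ)
    (hR' : 0 < R') (hR : R' < R) {g J : ℝ → ℝ} (hg0 : ∀ y, 0 ≤ g y)
    (hgd : ∀ y, HasDerivAt g (J y) y) (hJc : Continuous J) (hgi : Integrable g) (hJi : Integrable J)
    {C : ℝ} (hgC : ∀ y, |g y| ≤ C) (hJC : ∀ y, |J y| ≤ C) (hgneg : ∀ y, y ≤ 0 → g y = 0) :
    IsNonnegTest T (Metric.ball m R) (fun t x => ∫ a, g a * φ (t + a, x))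
      (fun t x => -∫ a, J a * φ (t + a, x)) (fun t x => ∫ a, g a * Dφ (t + a, x)) := by
  have hgc : Continuous g := continuous_iff_continuousAt.2 fun y => (hgd y).continuousAt
  have hDi : Integrable Dφ := integrable_of_memLp_two_of_supp hφ.memLp_D hφ.supp_D
  have hDi' : Integrable Dφ (volume.prod volume) := hDi
  have hNi : Integrable fun s => ∫ x, |Dφ (s, x)| := hDi'.norm.integral_prod_left
  have hφN : ∀ s x, |φ (s, x)| ≤ ∫ x, |Dφ (s, x)| := fun s x => by
    have h1 := (hφ.prim s).abs_sub_le (m - R' - 1) x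
    rw [hφ.supp (s, m - R' - 1) (fun h => by
      have := h.2; rw [Real.closedBall_eq_Icc] at this; dsimp only at this; linarith [this.1]),
      sub_zero] at h1
    exact h1
  have hφi : ∀ x, Integrable fun s => φ (s, x) := fun x =>
    hNi.mono' (hφ.meas.comp (by fun_prop)).aestronglyMeasurable
      (Eventually.of_forall fun s => hφN s x)
  have hYg := memLp_translate_average hgi hgc.measurable hφ.meas hφ.memLp (1, 0)
  have hYJ := memLp_translate_average hJi hJc.measurable hφ.meas hφ.memLp (1, 0)
  have hYD := memLp_translate_average hgi hgc.measurable hφ.meas_D hφ.memLp_D (1, 0)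
  simp_rw [add_smul_time] at hYg hYJ hYD
  refine ⟨Eventually.of_forall fun z => ?_, hYg.restrict _, hYJ.neg.restrict _, hYD.restrict _,
    ?_, ?_⟩
  · exact integral_nonneg fun a => mul_nonneg (hg0 a) (hφ.nonneg _)
  · refine (ae_restrict_iff' ((measurableSet_Ioo).prod measurableSet_ball)).2
      (Eventually.of_forall fun z hz => ?_)
    obtain ⟨t, x⟩ := z
    have ht : t < T := hz.1.2
    dsimp only
    rw [intervalIntegral.integral_neg, neg_neg]
    have hsub : ∀ (w : ℝ → ℝ) (s : ℝ), ∫ a, w a * φ (s + a, x) = ∫ σ, w (σ - s) * φ (σ, x) := by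
      intro w s
      rw [← integral_sub_right_eq_self (fun a => w a * φ (s + a, x)) s]
      refine integral_congr_ae (Eventually.of_forall fun σ => ?_)
      dsimp only; rw [add_sub_cancel]
    simp_rw [hsub]
    rw [intervalIntegral.integral_of_le ht.le, integral_integral_swap]
    · refine integral_congr_ae (Eventually.of_forall fun σ => ?_)
      dsimp only
      rw [integral_mul_const, ← intervalIntegral.integral_of_le ht.le,
        intervalIntegral.integral_comp_sub_left (fun y => J y) σ,
        intervalIntegral.integral_eq_sub_of_hasDerivAt (fun y _ => hgd y)
          (hJc.intervalIntegrable _ _)]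
      rcases le_or_gt T σ with h | h
      · rw [hφ.supp (σ, x) fun hh => by linarith [hh.1.2]]; ring
      · rw [hgneg (σ - T) (by linarith), sub_zero]
    · have h1 : Integrable (fun p : ℝ × ℝ => (1 : ℝ) * φ (p.2, x))
          ((volume.restrict (Ioc t T)).prod volume) :=
        (integrable_const (1 : ℝ)).mul_prod (hφi x)
      have h2 := h1.bdd_mul (c := C) (f := fun p : ℝ × ℝ => J (p.2 - p.1))
        (Continuous.aestronglyMeasurable (by fun_prop)) (Eventually.of_forall fun p => hJC _)
      refine h2.congr (Eventually.of_forall fun p => ?_)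
      simp only [Function.uncurry_def, one_mul]
  · have hYD2 : Integrable (fun z : ℝ × ℝ => (∫ a, g a * Dφ (z.1 + a, z.2)) ^ 2)
        (volume.prod volume) := hYD.integrable_sq
    have hae : ∀ᵐ t : ℝ, MemLp (fun x => ∫ a, g a * Dφ (t + a, x)) 2 := by
      filter_upwards [hYD2.prod_right_ae] with t ht
      refine (memLp_two_iff_integrable_sq ?_).2 ht
      exact (StronglyMeasurable.integral_prod_right (f := fun x a => g a * Dφ (t + a, x))
        (Measurable.stronglyMeasurable ((hgc.measurable.comp measurable_snd).mul
          (hφ.meas_D.comp (by fun_prop))))).aestronglyMeasurable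
    refine ae_restrict_of_ae (hae.mono fun t ht => ?_)
    have hz0 : ∀ x, x ∉ Metric.closedBall m R' → (∫ a, g a * Dφ (t + a, x)) = 0 := fun x hx => by
      rw [← integral_zero ℝ ℝ]
      refine integral_congr_ae (Eventually.of_forall fun a => ?_)
      dsimp only; rw [hφ.supp_D _ fun hh => hx hh.2, mul_zero]
    have hz1 : ∀ x, x ∉ Metric.closedBall m R' → (∫ a, g a * φ (t + a, x)) = 0 := fun x hx => by
      rw [← integral_zero ℝ ℝ]
      refine integral_congr_ae (Eventually.of_forall fun a => ?_)
      dsimp only; rw [hφ.supp _ fun hh => hx hh.2, mul_zero]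
    refine IsPrimitive.isH1Zero ⟨?_, fun x y => ?_⟩ ht hR' hR hz1 hz0
    · rw [← integrableOn_iff_integrable_of_support_subset (s := Metric.closedBall m R')
        (fun z hz => by by_contra h; exact hz (hz0 z h))]
      exact memLp_two_integrableOn measure_closedBall_lt_top.ne (ht.restrict _)
    · have hgφ : ∀ x, Integrable fun a => g a * φ (t + a, x) := fun x =>
        ((hφi x).comp_add_left t).bdd_mul (c := C) hgc.aestronglyMeasurable
          (Eventually.of_forall hgC)
      rw [← integral_sub (hgφ y) (hgφ x)]
      have h1 : ∀ a, g a * φ (t + a, y) - g a * φ (t + a, x) =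
          ∫ ξ in x..y, g a * Dφ (t + a, ξ) := fun a => by
        rw [intervalIntegral.integral_const_mul, ← (hφ.prim (t + a)).sub_eq]; ring
      simp_rw [h1]
      have h2 : Integrable (fun p : ℝ × ℝ => g p.1 * Dφ (t + p.1, p.2))
          (volume.prod volume) := by
        have h3 : Integrable (fun p : ℝ × ℝ => Dφ (t + p.1, p.2)) := by
          have := hDi.comp_add_left ((t, 0) : ℝ × ℝ)
          refine this.congr (Eventually.of_forall fun p => ?_)
          dsimp only; congr 1; ext <;> simp
        exact h3.bdd_mul (c := C) (hgc.comp continuous_fst).aestronglyMeasurable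
          (Eventually.of_forall fun p => hgC _)
      have h4 : ∀ x y : ℝ, ∫ a, ∫ ξ in Ioc x y, g a * Dφ (t + a, ξ) =
          ∫ ξ in Ioc x y, ∫ a, g a * Dφ (t + a, ξ) := fun x y => by
        refine integral_integral_swap ?_
        refine h2.mono_measure ?_
        exact Measure.prod_mono le_rfl Measure.restrict_le_self
      simp only [intervalIntegral]
      rw [integral_sub, h4, h4]
      · have h5 := (h2.mono_measure (Measure.prod_mono (le_refl (volume : Measure ℝ))
          (Measure.restrict_le_self (s := Ioc x y)))).integral_prod_left
        exact h5
      · have h5 := (h2.mono_measure (Measure.prod_mono (le_refl (volume : Measure ℝ))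
          (Measure.restrict_le_self (s := Ioc y x)))).integral_prod_left
        exact h5

lemma conv_eq_integral_cut {T : ℝ} {k : ℝ → ℝ} {v : ℝ × ℝ → ℝ}
    (hv0 : ∀ z : ℝ × ℝ, z.1 ≤ 0 → v z = 0) {z : ℝ × ℝ} (hz : z.1 ∈ Ioo 0 T) :
    conv k (fun τ => v (τ, z.2)) z.1 = ∫ b, cut T k b * v (z.1 - b, z.2) := by
  unfold conv
  have h1 := intervalIntegral.integral_comp_sub_left (a := 0) (b := z.1)
    (fun b => k b * v (z.1 - b, z.2)) z.1
  simp only [sub_sub_cancel, sub_self, sub_zero] at h1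
  rw [h1, ← integral_cut_mul hz.1.le]
  refine integral_congr_ae (Eventually.of_forall fun b => ?_)
  dsimp only
  by_cases hb : b ∈ Ioo 0 z.1
  · rw [cut_of_mem hb, cut_of_mem ⟨hb.1, hb.2.trans hz.2⟩]
  · rw [cut_of_notMem hb, zero_mul]
    rcases le_or_gt b 0 with h | h
    · rw [cut_nonpos b h, zero_mul]
    · rw [hv0 _ (by dsimp only; by_contra hh; exact hb ⟨h, by linarith⟩), mul_zero]

/-- The weak inequality tested with a time average of `φ`, written with correlations. -/
lemma weak_correlation {k : ℝ → ℝ} {T m R R' : ℝ} {v F φ Dφ : ℝ × ℝ → ℝ}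
    (hki : Integrable (cut T k)) (hkm : Measurable (cut T k)) (hvm : Measurable v)
    (hv : MemLp v 2) (hF : MemLp F 2) (hv0 : ∀ z : ℝ × ℝ, z ∉ Ioo 0 T ×ˢ Metric.ball m R → v z = 0)
    (hweak : ∀ ζ ζt Dζ : ℝ → ℝ → ℝ, IsNonnegTest T (Metric.ball m R) ζ ζt Dζ →
      ∫ z in cyl T (Metric.ball m R), (-ζt z.1 z.2 * conv k (fun τ => v (τ, z.2)) z.1
        + F z * Dζ z.1 z.2) ≤ 0)
    (hF0 : ∀ z : ℝ × ℝ, z ∉ Ioo 0 T ×ˢ Metric.ball m R → F z = 0)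
    (hφ : SpaceTest T m R' φ Dφ)
    (hR' : 0 < R') (hR : R' < R) {g J : ℝ → ℝ} (hg0 : ∀ y, 0 ≤ g y)
    (hgd : ∀ y, HasDerivAt g (J y) y) (hJc : Continuous J) (hgi : Integrable g) (hJi : Integrable J)
    {C : ℝ} (hgC : ∀ y, |g y| ≤ C) (hJC : ∀ y, |J y| ≤ C) (hgneg : ∀ y, y ≤ 0 → g y = 0)
    (hJneg : ∀ y, y ≤ 0 → J y = 0) :
    corr J (corr (cut T k) (timeCorr φ v)) 0 + corr g (timeCorr Dφ F) 0 ≤ 0 := by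
  have hgc : Continuous g := continuous_iff_continuousAt.2 fun y => (hgd y).continuousAt
  have hv0' : ∀ z : ℝ × ℝ, z.1 ≤ 0 → v z = 0 := fun z hz => hv0 z fun h => by linarith [h.1.1]
  have hw := hweak _ _ _ (hφ.isNonnegTest hR' hR hg0 hgd hJc hgi hJi hgC hJC hgneg)
  set Cv : ℝ × ℝ → ℝ := fun z => ∫ b, cut T k b * v (z.1 - b, z.2) with hCv
  have hCv2 : MemLp Cv 2 := by
    have := memLp_translate_average hki hkm hvm hv (-1, 0)
    simp_rw [add_smul_neg_time] at this
    exact this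
  have hYJ := memLp_translate_average hJi hJc.measurable hφ.meas hφ.memLp (1, 0)
  have hYD := memLp_translate_average hgi hgc.measurable hφ.meas_D hφ.memLp_D (1, 0)
  have e1 := integral_mul_translate_average hJi hJc.measurable hφ.meas hφ.memLp hCv2 (1, 0)
  have e2 := integral_mul_translate_average hgi hgc.measurable hφ.meas_D hφ.memLp_D hF (1, 0)
  have hi1 : Integrable fun z => (∫ a, J a * φ (z + a • ((1, 0) : ℝ × ℝ))) * Cv z :=
    hYJ.integrable_mul hCv2
  have hi2 : Integrable fun z => (∫ a, g a * Dφ (z + a • ((1, 0) : ℝ × ℝ))) * F z :=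
    hYD.integrable_mul hF
  have e3 : ∫ z in cyl T (Metric.ball m R), (-(-∫ a, J a * φ (z.1 + a, z.2)) *
      conv k (fun τ => v (τ, z.2)) z.1 + F z * ∫ a, g a * Dφ (z.1 + a, z.2)) =
      ∫ z, ((∫ a, J a * φ (z + a • ((1, 0) : ℝ × ℝ))) * Cv z +
        (∫ a, g a * Dφ (z + a • ((1, 0) : ℝ × ℝ))) * F z) := by
    have hms : MeasurableSet (cyl T (Metric.ball m R)) :=
      (measurableSet_Ioo).prod measurableSet_ball
    rw [← setIntegral_eq_integral_of_forall_compl_eq_zero (s := cyl T (Metric.ball m R))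
      (f := fun z => (∫ a, J a * φ (z + a • ((1, 0) : ℝ × ℝ))) * Cv z +
        (∫ a, g a * Dφ (z + a • ((1, 0) : ℝ × ℝ))) * F z)]
    · refine setIntegral_congr_fun hms fun z hz => ?_
      rw [conv_eq_integral_cut hv0' hz.1, neg_neg]
      simp_rw [add_smul_time]
      rw [mul_comm (F z)]
    · intro z hz
      rw [hF0 z hz, mul_zero, add_zero]
      simp_rw [add_smul_time]
      by_cases h2 : z.2 ∈ Metric.ball m R
      · by_cases h1 : z.1 ≤ 0
        · have : Cv z = 0 := by
            rw [hCv]; dsimp only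
            rw [← integral_zero ℝ ℝ]
            refine integral_congr_ae (Eventually.of_forall fun b => ?_)
            dsimp only
            rcases le_or_gt b 0 with h | h
            · rw [cut_nonpos b h, zero_mul]
            · rw [hv0' _ (by dsimp only; linarith), mul_zero]
          rw [this, mul_zero]
        · have h3 : T ≤ z.1 := by
            by_contra h3
            exact hz ⟨⟨not_le.1 h1, not_le.1 h3⟩, h2⟩
          have : ∫ a, J a * φ (z.1 + a, z.2) = 0 := by
            rw [← integral_zero ℝ ℝ]
            refine integral_congr_ae (Eventually.of_forall fun b => ?_)
            dsimp only
            rcases le_or_gt b 0 with h | h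
            · rw [hJneg b h, zero_mul]
            · rw [hφ.supp (z.1 + b, z.2) fun hh => by
                have := hh.1.2; dsimp only at this; linarith, mul_zero]
          rw [this, zero_mul]
      · have : ∫ a, J a * φ (z.1 + a, z.2) = 0 := by
          rw [← integral_zero ℝ ℝ]
          refine integral_congr_ae (Eventually.of_forall fun b => ?_)
          dsimp only
          rw [hφ.supp (z.1 + b, z.2) fun hh => h2 (Metric.closedBall_subset_ball hR hh.2), mul_zero]
        rw [this, zero_mul]
  rw [e3, integral_add hi1 hi2, e1, e2] at hw
  have e4 : ∀ a, ∫ z, φ (z + a • ((1, 0) : ℝ × ℝ)) * Cv z = corr (cut T k) (timeCorr φ v) a := by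
    intro a
    have hφa : MemLp (fun z => φ (z + a • ((1, 0) : ℝ × ℝ))) 2 :=
      hφ.memLp.comp_measurePreserving (measurePreserving_add_right volume _)
    have := integral_mul_translate_average hki hkm hvm hv hφa (-1, 0)
    simp_rw [add_smul_neg_time, add_smul_time] at this
    simp_rw [add_smul_time, mul_comm (φ _)]
    rw [hCv, this]
    unfold corr
    refine integral_congr_ae (Eventually.of_forall fun b => ?_)
    dsimp only
    congr 1
    have h1 := integral_add_right_eq_self (μ := (volume : Measure (ℝ × ℝ)))
      (fun z => v (z.1 - b, z.2) * φ (z.1 + a, z.2)) ((b, 0) : ℝ × ℝ)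
    rw [← h1]
    unfold timeCorr
    refine integral_congr_ae (Eventually.of_forall fun z => ?_)
    simp only [Prod.fst_add, Prod.snd_add, add_zero, add_sub_cancel_right]
    rw [mul_comm, show z.1 + b + a = z.1 + (a + b) by ring]
  simp_rw [e4] at hw
  have e5 : corr J (corr (cut T k) (timeCorr φ v)) 0 =
      ∫ a, J a * corr (cut T k) (timeCorr φ v) a := by
    unfold corr; simp_rw [zero_add]
  have e6 : corr g (timeCorr Dφ F) 0 =
      ∫ a, g a * ∫ z, Dφ (z + a • ((1, 0) : ℝ × ℝ)) * F z := by
    conv_lhs => unfold corr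
    simp_rw [zero_add, timeCorr_eq]
  rw [e5, e6]
  exact hw

/-- A continuous function that is nonpositive in average against all smooth bumps supported in
`(0, ∞)` is nonpositive at `0`. -/
lemma nonpos_of_bump {Ψ : ℝ → ℝ} (hΨ : Continuous Ψ)
    (h : ∀ ξ : ℝ → ℝ, ContDiff ℝ 1 ξ → HasCompactSupport ξ → (∀ y, 0 ≤ ξ y) →
      (∀ y, y ≤ 0 → ξ y = 0) → ∫ y, ξ y * Ψ y ≤ 0) : Ψ 0 ≤ 0 := by
  by_contra hcon
  push Not at hcon
  obtain ⟨δ, hδ, hδ'⟩ := Metric.continuous_iff.1 hΨ 0 (Ψ 0 / 2) (by positivity)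
  let b : ContDiffBump (δ / 2) := ⟨δ / 8, δ / 4, by positivity, by linarith⟩
  have h1 := h b b.contDiff b.hasCompactSupport (fun y => b.nonneg) (fun y hy => by
    refine b.zero_of_le_dist ?_
    rw [Real.dist_eq, abs_sub_comm, abs_of_nonneg (by linarith)]
    change δ / 4 ≤ _
    linarith)
  have h2 : ∫ y, b y * (Ψ 0 / 2) ≤ ∫ y, b y * Ψ y := by
    refine integral_mono (b.integrable.mul_const _)
      ((b.continuous.mul hΨ).integrable_of_hasCompactSupport b.hasCompactSupport.mul_right)
      fun y => ?_
    by_cases hy : b y = 0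
    · simp [hy]
    · refine mul_le_mul_of_nonneg_left ?_ b.nonneg
      have hy1 : y ∈ Metric.ball (δ / 2) (δ / 4) := by
        by_contra hcon
        exact hy (b.zero_of_le_dist (not_lt.1 hcon))
      rw [Real.ball_eq_Ioo] at hy1
      have := hδ' y (by
        rw [Real.dist_eq, sub_zero, abs_of_pos (by linarith [hy1.1])]; linarith [hy1.2])
      rw [Real.dist_eq, abs_lt] at this
      linarith [this.1]
  rw [integral_mul_const] at h2
  have h3 := b.integral_pos (μ := volume)
  have : 0 < (∫ y, b y) * (Ψ 0 / 2) := by positivity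
  linarith

/-- The weak inequality tested with `φ` itself, where `∂ₜ(k * v)` is replaced by
`∂ₜ(k(· + ε) * v)` and the flux is convolved with the approximate identity `h_ε`. -/
theorem regularized_inequality {k l : ℝ → ℝ} (hK : AssumptionK0 k l) {T m R R' : ℝ}
    {v F φ Dφ : ℝ × ℝ → ℝ} (hvm : Measurable v)
    (hv : MemLp v 2) (hF : MemLp F 2) (hv0 : ∀ z : ℝ × ℝ, z ∉ Ioo 0 T ×ˢ Metric.ball m R → v z = 0)
    (hweak : ∀ ζ ζt Dζ : ℝ → ℝ → ℝ, IsNonnegTest T (Metric.ball m R) ζ ζt Dζ →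
      ∫ z in cyl T (Metric.ball m R), (-ζt z.1 z.2 * conv k (fun τ => v (τ, z.2)) z.1
        + F z * Dζ z.1 z.2) ≤ 0)
    (hF0 : ∀ z : ℝ × ℝ, z ∉ Ioo 0 T ×ˢ Metric.ball m R → F z = 0)
    (hφ : SpaceTest T m R' φ Dφ) (hR' : 0 < R') (hR : R' < R) {ε : ℝ} (hε : 0 < ε) :
    k ε * timeCorr φ v 0 - corr (cut T (memK k ε)) (timeCorr φ v) 0
      + corr (approxId k l T ε) (timeCorr Dφ F) 0 ≤ 0 := by
  set c₁ := timeCorr φ v with hc₁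
  set c₂ := timeCorr Dφ F with hc₂
  have hv0' : ∀ z : ℝ × ℝ, z.1 ≤ 0 → v z = 0 := fun z hz => hv0 z fun h => by linarith [h.1.1]
  have hF0' : ∀ z : ℝ × ℝ, z.1 ≤ 0 → F z = 0 := fun z hz => hF0 z fun h => by linarith [h.1.1]
  have hX1 : Causal T c₁ := causal_timeCorr hφ.memLp hv
    (fun z hz => hφ.supp z fun h => by linarith [h.1.2]) hv0'
  have hX2 : Causal T c₂ := causal_timeCorr hφ.memLp_D hF
    (fun z hz => hφ.supp_D z fun h => by linarith [h.1.2]) hF0'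
  have hcc1 : Continuous c₁ := continuous_timeCorr hφ.memLp hv
  have hcc2 : Continuous c₂ := continuous_timeCorr hφ.memLp_D hF
  obtain ⟨C₁, hC₁⟩ := hX1.bdd
  obtain ⟨C₂, hC₂⟩ := hX2.bdd
  set h := approxId k l T ε with hh
  have hhi : Integrable h := hK.integrable_approxId hε T
  have hhm : Measurable h := hK.measurable_approxId hε T
  have hKi := hK.integrable_cut_memK hε T
  have hKm := hK.measurable_cut_memK hε T
  refine nonpos_of_bump (Ψ := fun y => k ε * c₁ y - corr (cut T (memK k ε)) c₁ y + corr h c₂ y)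
    (((continuous_const.mul hcc1).sub (continuous_corr hKi hcc1 hC₁)).add
      (continuous_corr hhi hcc2 hC₂)) ?_
  intro ξ hξ hξc hξ0 hξneg
  have hdc : Continuous (deriv ξ) := hξ.continuous_deriv le_rfl
  have hξi : Integrable ξ := hξ.continuous.integrable_of_hasCompactSupport hξc
  have hdi : Integrable (deriv ξ) := hdc.integrable_of_hasCompactSupport hξc.deriv
  have hdneg : ∀ y, y ≤ 0 → deriv ξ y = 0 := by
    have h1 : ∀ y, y < 0 → deriv ξ y = 0 := fun y hy => by
      have : ξ =ᶠ[𝓝 y] fun _ => 0 := by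
        filter_upwards [gt_mem_nhds hy] with z hz using hξneg z (le_of_lt hz)
      rw [this.deriv_eq, deriv_const]
    intro y hy
    rcases hy.lt_or_eq with h2 | rfl
    · exact h1 y h2
    · have : closure (Iio (0 : ℝ)) ⊆ {y | deriv ξ y = 0} :=
        closure_minimal (fun y hy => h1 y hy) (isClosed_eq hdc continuous_const)
      rw [closure_Iio] at this
      exact this (mem_Iic.2 le_rfl)
  obtain ⟨D₁, hD₁⟩ := hξ.continuous.bounded_above_of_compact_support hξc
  obtain ⟨D₂, hD₂⟩ := hdc.bounded_above_of_compact_support hξc.deriv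
  set g : ℝ → ℝ := fun y => ∫ a, h a * ξ (y - a) with hg
  set J : ℝ → ℝ := fun y => ∫ a, h a * deriv ξ (y - a) with hJ
  have hgd : ∀ y, HasDerivAt g (J y) y := fun y =>
    hξc.hasDerivAt_convolution_right (ContinuousLinearMap.mul ℝ ℝ) hhi.locallyIntegrable hξ y
  have hh0 : ∀ a, a ≤ 0 → h a = 0 := cut_nonpos
  have hbound : ∀ (w : ℝ → ℝ) (D : ℝ), (∀ y, ‖w y‖ ≤ D) →
      ∀ y, |∫ a, h a * w (y - a)| ≤ (∫ a, |h a|) * D := fun w D hw y => by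
    rw [← integral_mul_const, ← Real.norm_eq_abs]
    refine norm_integral_le_of_norm_le (hhi.abs.mul_const D) (Eventually.of_forall fun a => ?_)
    rw [norm_mul]
    exact mul_le_mul_of_nonneg_left (hw _) (abs_nonneg _)
  have hneg : ∀ w : ℝ → ℝ, (∀ y, y ≤ 0 → w y = 0) → ∀ y, y ≤ 0 → ∫ a, h a * w (y - a) = 0 := by
    intro w hw y hy
    rw [← integral_zero ℝ ℝ]
    refine integral_congr_ae (Eventually.of_forall fun a => ?_)
    dsimp only
    rcases le_or_gt a 0 with h1 | h1
    · rw [hh0 a h1, zero_mul]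
    · rw [hw _ (by linarith), mul_zero]
  have hJc : Continuous J := by
    refine continuous_of_dominated (bound := fun a => |h a| * D₂)
      (fun y => (hhm.mul (hdc.measurable.comp (by fun_prop))).aestronglyMeasurable)
      (fun y => Eventually.of_forall fun a => ?_) (hhi.abs.mul_const _)
      (Eventually.of_forall fun a => by fun_prop)
    rw [norm_mul]
    exact mul_le_mul_of_nonneg_left (hD₂ _) (abs_nonneg _)
  have hIh : 0 ≤ ∫ a, |h a| := integral_nonneg fun a => abs_nonneg _
  have hw := weak_correlation (hK.integrable_cut_k T) (hK.measurable_cut_k T) hvm hv hF hv0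
    hweak hF0 hφ hR' hR (g := g) (J := J) (fun y => integral_nonneg_of_ae (by
      filter_upwards [hK.approxId_nonneg (T := T) hε] with a ha
      exact mul_nonneg ha (hξ0 _))) hgd hJc (integrable_conv hhi hξi) (integrable_conv hhi hdi)
    (C := (∫ a, |h a|) * max D₁ D₂)
    (fun y => hbound ξ _ (fun y => (hD₁ y).trans (le_max_left _ _)) y)
    (fun y => hbound _ _ (fun y => (hD₂ y).trans (le_max_right _ _)) y)
    (hneg ξ hξneg) (hneg _ hdneg)
  -- rewrite both terms as correlations of `ξ`
  have hXk : Causal T (corr (cut T k) c₁) :=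
    hX1.corr (hK.integrable_cut_k T) (hK.measurable_cut_k T) cut_nonpos
  have hX' : Causal T (corr (deriv ξ) c₁) := hX1.corr hdi hdc.measurable hdneg
  obtain ⟨C₃, hC₃⟩ := hXk.bdd
  have e1 : corr J (corr (cut T k) c₁) 0 = corr h (corr (cut T k) (corr (deriv ξ) c₁)) 0 := by
    have h1 := corr_corr hhi hdi hhm hdc.measurable hXk.meas hC₃ 0
    have h2 : corr (deriv ξ) (corr (cut T k) c₁) = corr (cut T k) (corr (deriv ξ) c₁) :=
      funext fun z => corr_comm hdi (hK.integrable_cut_k T) hX1.meas hC₁ z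
    rw [← h2, h1]; rfl
  have e2 : corr g c₂ 0 = corr ξ (corr h c₂) 0 := by
    rw [← corr_comm hhi hξi hX2.meas hC₂, corr_corr hhi hξi hhm hξ.continuous.measurable
      hX2.meas hC₂]
    rfl
  have hXk' : Causal T (corr (cut T k) (corr (deriv ξ) c₁)) :=
    hX'.corr (hK.integrable_cut_k T) (hK.measurable_cut_k T) cut_nonpos
  have e3 : ∀ z, 0 ≤ z → corr (cut T l) (corr (cut T k) (corr (deriv ξ) c₁)) z = corr ξ c₁ z :=
    fun z hz => by
    rw [hK.corr_l_corr_k hX' hz, corr_one_corr_deriv hX1 hξ hξc hξneg hz]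
  have e4 : corr (cut T (memK k ε)) (corr (cut T l) (corr (cut T k) (corr (deriv ξ) c₁))) 0 =
      corr (cut T (memK k ε)) (corr ξ c₁) 0 := by
    conv_lhs => unfold corr
    conv_rhs => unfold corr
    refine integral_congr_ae (Eventually.of_forall fun a => ?_)
    dsimp only
    rcases le_or_gt a 0 with h1 | h1
    · rw [cut_nonpos a h1, zero_mul, zero_mul]
    · congr 1
      exact e3 (0 + a) (by linarith)
  rw [e1, e2, hK.corr_approxId hε hXk' le_rfl, e3 0 le_rfl, e4,
    corr_comm hKi hξi hX1.meas hC₁] at hw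
  refine le_trans (le_of_eq ?_) hw
  have i1 : Integrable fun a => ξ a * c₁ (0 + a) := integrable_mul_shift hξi hX1.meas hC₁ 0
  have i2 : Integrable fun a => ξ a * corr (cut T (memK k ε)) c₁ (0 + a) :=
    integrable_mul_shift hξi (measurable_corr hKm hX1.meas) (fun y => abs_corr_le hKi hC₁ y) 0
  have i4 : Integrable fun a => k ε * (ξ a * c₁ (0 + a)) -
      ξ a * corr (cut T (memK k ε)) c₁ (0 + a) := (i1.const_mul _).sub i2
  have i3 : Integrable fun a => ξ a * corr h c₂ (0 + a) :=
    integrable_mul_shift hξi (measurable_corr hhm hX2.meas) (fun y => abs_corr_le hhi hC₂ y) 0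
  have e5 : ∀ f c : ℝ → ℝ, corr f c 0 = ∫ a, f a * c (0 + a) := fun f c => rfl
  rw [e5 ξ c₁, e5 ξ (corr h c₂), e5 ξ (corr (cut T (memK k ε)) c₁), ← integral_const_mul,
    ← integral_sub (i1.const_mul _) i2, ← integral_add i4 i3]
  refine integral_congr_ae (Eventually.of_forall fun a => ?_)
  dsimp only
  rw [zero_add]; ring

/-! ### Energy estimates for truncations -/

/-- Pointwise form of the fundamental inequality for the nonlocal time derivative of a truncation:
for the function `U` of time, split the memory at `t₁`, estimate the part before `t₁` by `M`, and
use `2 w(s) w(s - a) ≤ w(s)² + w(s - a)²` on the rest. -/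
lemma AssumptionK0.truncated_history_le {k l : ℝ → ℝ} (hK : AssumptionK0 k l) {ε T t₁ t₂ κ u0 K₀ Lθ : ℝ}
    {θ M U : ℝ → ℝ} (hε : 0 < ε) (ht₁ : 0 ≤ t₁) (h12 : t₁ < t₂) (hκ : 0 ≤ κ) (hu0 : 0 ≤ u0)
    (hUm : Measurable U) (hU0 : ∀ τ, 0 ≤ U τ) (hUz : ∀ τ, τ ∉ Ioo 0 T → U τ = 0)
    (hUi : Integrable U) (hUi2 : Integrable fun τ => U τ ^ 2)
    (hθm : Measurable θ) (hθ0 : ∀ t, 0 ≤ θ t) (hθ1 : ∀ t, θ t ≤ 1)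
    (hθL : ∀ s t, s ≤ t → θ t - θ s ≤ Lθ * (t - s))
    (hMm : Measurable M) {CM : ℝ} (hM0 : ∀ τ, 0 ≤ M τ) (hMC : ∀ τ, M τ ≤ CM) {s : ℝ}
    (hMk : ∀ τ ∈ Ioc 0 t₁, -deriv k (s - τ) ≤ M τ) (hK₀ : k s ≤ K₀) (hs2 : t₂ < s) (hsT : s < T) :
    1 / 2 * (k ε * (θ s * max (U s - κ) 0 ^ 2)
        - ∫ a, cut T (memK k ε) a * (θ (s - a) * max (U (s - a) - κ) 0 ^ 2))
      - 1 / 2 * Lθ * (∫ a, cut (T - t₁) (fun a => a * memK k ε a) a *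
          (Ioo t₁ T).indicator (fun τ => max (U τ - κ) 0 ^ 2) (s - a))
      - θ s * max (U s - κ) 0 * ((∫ τ in Ioc 0 t₁, M τ * U τ) + K₀ * u0)
    ≤ θ s * max (U s - κ) 0 * (k ε * (U s - u0) -
        ∫ a, cut T (memK k ε) a * (Ioo 0 T).indicator (fun τ => U τ - u0) (s - a)) := by
  set Kc := cut T (memK k ε) with hKcd
  have hs0 : 0 < s := by linarith
  have hKi : Integrable Kc := hK.integrable_cut_memK hε T
  have hKm : Measurable Kc := hK.measurable_cut_memK hε T
  have hK0 : ∀ a, 0 ≤ Kc a := hK.cut_memK_nonneg hε T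
  have hKB : ∀ a, ‖Kc a‖ ≤ memK k ε 0 := fun a => by
    rw [Real.norm_of_nonneg (hK0 a)]
    by_cases ha : a ∈ Ioo 0 T
    · rw [hKcd, cut_of_mem ha]; exact hK.memK_le_memK_zero hε ha.1.le
    · rw [hKcd, cut_of_notMem ha]; exact hK.memK_nonneg (by linarith)
  set w : ℝ → ℝ := fun τ => max (U τ - κ) 0 with hw
  have hwm : Measurable w := (hUm.sub_const κ).max measurable_const
  have hw0 : ∀ τ, 0 ≤ w τ := fun τ => le_max_right _ _
  have hwU : ∀ τ, w τ ≤ U τ := fun τ => max_le (by linarith) (hU0 τ)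
  have hwz : ∀ τ, τ ∉ Ioo 0 T → w τ = 0 := fun τ hτ => le_antisymm ((hwU τ).trans_eq (hUz τ hτ)) (hw0 τ)
  have hwi : Integrable w := hUi.mono' hwm.aestronglyMeasurable (Eventually.of_forall fun τ => by
    rw [Real.norm_of_nonneg (hw0 τ)]; exact hwU τ)
  have hwi2 : Integrable fun τ => w τ ^ 2 := hUi2.mono' (hwm.pow_const 2).aestronglyMeasurable
    (Eventually.of_forall fun τ => by
      rw [Real.norm_of_nonneg (sq_nonneg _)]; exact pow_le_pow_left₀ (hw0 τ) (hwU τ) 2)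
  set g : ℝ → ℝ := (Ioo t₁ T).indicator w with hg
  have hgi : Integrable g := hwi.indicator measurableSet_Ioo
  have hg2 : ∀ τ, (Ioo t₁ T).indicator (fun τ => w τ ^ 2) τ = g τ ^ 2 := fun τ => by
    by_cases h : τ ∈ Ioo t₁ T
    · rw [hg, indicator_of_mem h, indicator_of_mem h]
    · rw [hg, indicator_of_notMem h, indicator_of_notMem h]; ring
  have hgi2 : Integrable fun τ => g τ ^ 2 :=
    (hwi2.indicator (measurableSet_Ioo (a := t₁) (b := T))).congr (Eventually.of_forall hg2)
  have hg0 : ∀ τ, 0 ≤ g τ := fun τ => indicator_nonneg (fun τ _ => hw0 τ) τ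
  have hmulK : ∀ {f : ℝ → ℝ}, Integrable f → Integrable fun a => Kc a * f (s - a) := fun hf =>
    (hf.comp_sub_left s).bdd_mul (c := memK k ε 0) hKm.aestronglyMeasurable
      (Eventually.of_forall hKB)
  have hKint : ∫ a, Kc a = k ε - k (T + ε) := by
    have := integral_cut_mul (hs0.trans hsT).le (memK k ε) (fun _ => 1)
    simp only [mul_one] at this
    rw [hKcd, this, hK.integral_memK hε le_rfl (hs0.trans hsT).le, zero_add]
  have hKle : ∫ a, Kc a ≤ k ε := by
    rw [hKint]; linarith [hK.nonneg_k (T + ε) (by linarith)]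
  -- the history of `U - u0`
  have hA : ∫ a, Kc a * (Ioo 0 T).indicator (fun τ => U τ - u0) (s - a) =
      (∫ a, Kc a * U (s - a)) - u0 * (k ε - k (s + ε)) := by
    have h1 : ∀ a, Kc a * (Ioo 0 T).indicator (fun τ => U τ - u0) (s - a) =
        Kc a * U (s - a) - u0 * cut s (memK k ε) a := fun a => by
      by_cases ha : a ∈ Ioo 0 T
      · by_cases h2 : a < s
        · rw [indicator_of_mem (show s - a ∈ Ioo 0 T from ⟨by linarith, by linarith [ha.1]⟩), hKcd,
            cut_of_mem ha, cut_of_mem ⟨ha.1, h2⟩]; ring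
        · have h3 : s - a ∉ Ioo 0 T := fun h => h2 (by linarith [h.1])
          rw [indicator_of_notMem h3, hUz _ h3, cut_of_notMem fun h => h2 h.2]; ring
      · rw [hKcd, cut_of_notMem ha, cut_of_notMem fun h => ha ⟨h.1, h.2.trans hsT⟩]; ring
    simp_rw [h1]
    rw [integral_sub (hmulK hUi) ((hK.integrable_cut_memK hε s).const_mul u0), integral_const_mul]
    have := integral_cut_mul hs0.le (memK k ε) (fun _ => 1)
    simp only [mul_one] at this
    rw [this, hK.integral_memK hε le_rfl hs0.le, zero_add]
  have hMUi : Integrable ((Ioc 0 t₁).indicator fun τ => M τ * U τ) :=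
    (hUi.bdd_mul (c := CM) hMm.aestronglyMeasurable (Eventually.of_forall fun τ => by
      rw [Real.norm_of_nonneg (hM0 τ)]; exact hMC τ)).indicator measurableSet_Ioc
  have hB : ∫ a, Kc a * U (s - a) ≤
      (∫ τ in Ioc 0 t₁, M τ * U τ) + κ * k ε + ∫ a, Kc a * g (s - a) := by
    have h1 : ∀ a, Kc a * U (s - a) ≤
        (Ioc 0 t₁).indicator (fun τ => M τ * U τ) (s - a) + κ * Kc a + Kc a * g (s - a) := fun a => by
      have n1 : 0 ≤ (Ioc 0 t₁).indicator (fun τ => M τ * U τ) (s - a) :=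
        indicator_nonneg (fun τ _ => mul_nonneg (hM0 τ) (hU0 τ)) _
      have n2 : 0 ≤ κ * Kc a := mul_nonneg hκ (hK0 a)
      have n3 : 0 ≤ Kc a * g (s - a) := mul_nonneg (hK0 a) (hg0 _)
      by_cases ha : a ∈ Ioo 0 T
      · rcases le_or_gt (s - a) 0 with h2 | h2
        · rw [hUz _ fun h => by linarith [h.1], mul_zero]; linarith
        · rcases le_or_gt (s - a) t₁ with h3 | h3
          · rw [indicator_of_mem (show s - a ∈ Ioc 0 t₁ from ⟨h2, h3⟩)]
            have h4 : Kc a ≤ M (s - a) := by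
              rw [hKcd, cut_of_mem ha]
              refine (hK.memK_le hε.le ha.1).trans ?_
              have := hMk (s - a) ⟨h2, h3⟩
              rwa [sub_sub_cancel] at this
            have := mul_le_mul_of_nonneg_right h4 (hU0 (s - a))
            linarith
          · have h5 : g (s - a) = w (s - a) := 
              indicator_of_mem (show s - a ∈ Ioo t₁ T from ⟨h3, by linarith [ha.1]⟩) _
            have h4 : U (s - a) ≤ κ + g (s - a) := by
              rw [h5]; linarith [le_max_left (U (s - a) - κ) 0]
            have := mul_le_mul_of_nonneg_left h4 (hK0 a)
            linarith
      · rw [hKcd, cut_of_notMem ha] at *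
        linarith
    have i1 := hMUi.comp_sub_left s
    have i2 : Integrable fun a => κ * Kc a := hKi.const_mul κ
    have i12 : Integrable fun a => (Ioc 0 t₁).indicator (fun τ => M τ * U τ) (s - a) + κ * Kc a :=
      i1.add i2
    have h6 := integral_mono (hmulK hUi) (i12.add (hmulK hgi)) h1
    have h7 : ∫ a, (fun a => (Ioc 0 t₁).indicator (fun τ => M τ * U τ) (s - a) + κ * Kc a) a
        + (fun a => Kc a * g (s - a)) a = (∫ τ in Ioc 0 t₁, M τ * U τ) + κ * (∫ a, Kc a) +
          ∫ a, Kc a * g (s - a) := by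
      rw [integral_add i12 (hmulK hgi), integral_add i1 i2, integral_const_mul,
        integral_sub_left_eq_self (fun τ => (Ioc 0 t₁).indicator (fun τ => M τ * U τ) τ) volume s,
        integral_indicator measurableSet_Ioc]
    have h8 := h6.trans_eq h7
    linarith [mul_le_mul_of_nonneg_left hKle hκ]
  -- Young's inequality for the product `w(s) g(s - a)`
  have hD : w s * (∫ a, Kc a * g (s - a)) ≤
      1 / 2 * (k ε * w s ^ 2) + 1 / 2 * ∫ a, Kc a * g (s - a) ^ 2 := by
    have i3 : Integrable fun a => 1 / 2 * w s ^ 2 * Kc a := hKi.const_mul _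
    have i4 : Integrable fun a => 1 / 2 * (Kc a * g (s - a) ^ 2) := (hmulK hgi2).const_mul _
    have i34 : Integrable fun a => 1 / 2 * w s ^ 2 * Kc a + 1 / 2 * (Kc a * g (s - a) ^ 2) :=
      i3.add i4
    have h1 := integral_mono ((hmulK hgi).const_mul (w s)) i34 fun a => by
      have := mul_nonneg (hK0 a) (sq_nonneg (w s - g (s - a)))
      dsimp only
      nlinarith
    have h2 : ∫ a, (1 / 2 * w s ^ 2 * Kc a + 1 / 2 * (Kc a * g (s - a) ^ 2))
        = 1 / 2 * w s ^ 2 * (∫ a, Kc a) + 1 / 2 * ∫ a, Kc a * g (s - a) ^ 2 := by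
      rw [integral_add i3 i4, integral_const_mul, integral_const_mul]
    rw [h2, integral_const_mul] at h1
    nlinarith [mul_le_mul_of_nonneg_left hKle (sq_nonneg (w s))]
  set b : ℝ → ℝ := cut (T - t₁) (fun a => a * memK k ε a) with hb
  have hbm : Measurable b := measurable_cut
    (continuousOn_id.mul ((hK.continuousOn_memK hε).mono Ioi_subset_Ici_self))
  have hb0 : ∀ a, 0 ≤ b a := fun a =>
    indicator_nonneg (fun x hx => mul_nonneg hx.1.le (hK.memK_nonneg (by linarith [hx.1]))) a
  have hbB : ∀ a, ‖b a‖ ≤ T * memK k ε 0 := fun a => by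
    have h0 : 0 ≤ memK k ε 0 := hK.memK_nonneg (by linarith)
    rw [Real.norm_of_nonneg (hb0 a)]
    by_cases ha : a ∈ Ioo 0 (T - t₁)
    · rw [hb, cut_of_mem ha]
      exact mul_le_mul (by linarith [ha.2]) (hK.memK_le_memK_zero hε ha.1.le)
        (hK.memK_nonneg (by linarith [ha.1])) (by linarith)
    · rw [hb, cut_of_notMem ha]; exact mul_nonneg (by linarith) h0
  have hE : θ s * (∫ a, Kc a * g (s - a) ^ 2) ≤
      (∫ a, Kc a * (θ (s - a) * w (s - a) ^ 2)) + Lθ * ∫ a, b a * g (s - a) ^ 2 := by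
    have i5 : Integrable fun τ => θ τ * w τ ^ 2 := hwi2.bdd_mul (c := 1) hθm.aestronglyMeasurable
      (Eventually.of_forall fun τ => by rw [Real.norm_of_nonneg (hθ0 τ)]; exact hθ1 τ)
    have i6 : Integrable fun a => Lθ * (b a * g (s - a) ^ 2) :=
      ((hgi2.comp_sub_left s).bdd_mul (c := T * memK k ε 0) hbm.aestronglyMeasurable
        (Eventually.of_forall hbB)).const_mul _
    have i56 : Integrable fun a => Kc a * (θ (s - a) * w (s - a) ^ 2) +
        Lθ * (b a * g (s - a) ^ 2) := (hmulK i5).add i6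
    have h1 := integral_mono ((hmulK hgi2).const_mul (θ s)) i56 fun a => by
      dsimp only
      by_cases ha : a ∈ Ioo 0 T
      · by_cases h2 : s - a ∈ Ioo t₁ T
        · have h3 : a ∈ Ioo 0 (T - t₁) := ⟨ha.1, by linarith [h2.1]⟩
          have h4 : b a = a * Kc a := by rw [hb, hKcd, cut_of_mem h3, cut_of_mem ha]
          have h5 : g (s - a) = w (s - a) := indicator_of_mem h2 _
          rw [h4, h5]
          have h6 := hθL (s - a) s (by linarith [ha.1])
          rw [sub_sub_cancel] at h6
          have h7 : θ s ≤ θ (s - a) + Lθ * a := by linarith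
          have := mul_le_mul_of_nonneg_right h7
            (mul_nonneg (hK0 a) (sq_nonneg (w (s - a))))
          linarith
        · have h5 : g (s - a) = 0 := indicator_of_notMem h2 _
          rw [h5]
          have := mul_nonneg (hK0 a) (mul_nonneg (hθ0 (s - a)) (sq_nonneg (w (s - a))))
          linarith
      · have h5 : b a = 0 := cut_of_notMem fun h => ha ⟨h.1, by linarith [h.2]⟩
        rw [h5, hKcd, cut_of_notMem ha]; linarith
    have h2 : ∫ a, (Kc a * (θ (s - a) * w (s - a) ^ 2) + Lθ * (b a * g (s - a) ^ 2))
        = (∫ a, Kc a * (θ (s - a) * w (s - a) ^ 2)) + Lθ * ∫ a, b a * g (s - a) ^ 2 := by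
      rw [integral_add (hmulK i5) i6, integral_const_mul]
    rw [h2, integral_const_mul] at h1
    exact h1
  have hks : k (s + ε) ≤ K₀ :=
    (hK.antitone_k (mem_Ioi.2 hs0) (mem_Ioi.2 (by linarith : 0 < s + ε)) (by linarith)).trans hK₀
  have hC : w s * U s = w s * (κ + w s) := by
    rcases le_or_gt (U s) κ with h | h
    · have : w s = 0 := max_eq_right (by linarith)
      rw [this]; ring
    · have : w s = U s - κ := max_eq_left (by linarith)
      rw [this]; ring
  rw [hA]
  have hg3 : ∀ a, (Ioo t₁ T).indicator (fun τ => max (U τ - κ) 0 ^ 2) (s - a) = g (s - a) ^ 2 :=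
    fun a => hg2 _
  simp_rw [hg3]
  change 1 / 2 * (k ε * (θ s * w s ^ 2) - ∫ a, Kc a * (θ (s - a) * w (s - a) ^ 2)) -
    1 / 2 * Lθ * (∫ a, b a * g (s - a) ^ 2) -
    θ s * w s * ((∫ τ in Ioc 0 t₁, M τ * U τ) + K₀ * u0) ≤
    θ s * w s * (k ε * (U s - u0) - ((∫ a, Kc a * U (s - a)) - u0 * (k ε - k (s + ε))))
  set I1 := ∫ a, Kc a * U (s - a)
  set I2 := ∫ τ in Ioc 0 t₁, M τ * U τ
  set I3 := ∫ a, Kc a * g (s - a)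
  set I4 := ∫ a, Kc a * g (s - a) ^ 2
  set I5 := ∫ a, Kc a * (θ (s - a) * w (s - a) ^ 2)
  set I6 := ∫ a, b a * g (s - a) ^ 2
  have hθw : 0 ≤ θ s * w s := mul_nonneg (hθ0 s) (hw0 s)
  have f1 := mul_le_mul_of_nonneg_left hB hθw
  have f2 := mul_le_mul_of_nonneg_left hD (hθ0 s)
  have f3 := mul_le_mul_of_nonneg_left (mul_le_mul_of_nonneg_right hks hu0) hθw
  have f4 : θ s * w s * (k ε * U s) = θ s * k ε * (w s * (κ + w s)) := by rw [← hC]; ring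
  nlinarith

/-- A weak subsolution on `(0, T) × B(m, R)` given by everywhere defined, jointly measurable
representatives: for each time, `u` is a primitive of its weak derivative `Du` on the whole line,
where `Du` is extended by zero. The function `N` dominates `u` at each time, `A` takes values in
`[ν, Λ]`, and `u₀` is extended by zero. -/
structure RegularSub (k : ℝ → ℝ) (T m R ν Λ : ℝ) (A : ℝ × ℝ → ℝ) (u₀ : ℝ → ℝ) (u Du : ℝ × ℝ → ℝ)
    (N : ℝ → ℝ) : Prop where
  T_pos : 0 < T
  R_pos : 0 < R
  meas : Measurable u
  meas_D : Measurable Du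
  prim : ∀ t, IsPrimitive (fun x => u (t, x)) (fun x => Du (t, x))
  nonneg : ∀ z, 0 ≤ u z
  zero : ∀ z : ℝ × ℝ, z.1 ∉ Ioo 0 T → u z = 0
  D_zero : ∀ z, z ∉ cyl T (Metric.ball m R) → Du z = 0
  memLp_D : MemLp Du 2
  meas_N : Measurable N
  memLp_N : MemLp N 2
  le_N : ∀ z : ℝ × ℝ, u z ≤ N z.1
  meas_A : Measurable A
  ν_pos : 0 < ν
  A_ge : ∀ z, ν ≤ A z
  A_le : ∀ z, A z ≤ Λ
  meas_u₀ : Measurable u₀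
  nonneg_u₀ : ∀ x, 0 ≤ u₀ x
  zero_u₀ : ∀ x, x ∉ Metric.ball m R → u₀ x = 0
  memLp_u₀ : MemLp u₀ 2
  weak : ∀ ζ ζt Dζ : ℝ → ℝ → ℝ, IsNonnegTest T (Metric.ball m R) ζ ζt Dζ →
    ∫ z in cyl T (Metric.ball m R), (-ζt z.1 z.2 *
      conv k (fun τ => (cyl T (Metric.ball m R)).indicator (fun z => u z - u₀ z.2) (τ, z.2)) z.1
      + (cyl T (Metric.ball m R)).indicator (fun z => A z * Du z) z * Dζ z.1 z.2) ≤ 0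

/-- The data of a localized energy estimate for the truncation `(u - κ)₊`: the cutoff `θ` in time,
which vanishes up to `t₂ > t₁`, the cutoff `ψ` in space with derivative `ψ'`, a majorant `p` of the
truncation on `(t₁, T) × supp ψ`, and majorants `M`, `K₀` of the memory kernels at times after
`t₂` of the history before `t₁`. -/
structure Localization (k : ℝ → ℝ) (u : ℝ × ℝ → ℝ) (κ T m R t₁ t₂ R' Lθ P K₀ CM : ℝ)
    (θ ψ ψ' p M : ℝ → ℝ) : Prop where
  t₁_nonneg : 0 ≤ t₁
  t₁_lt : t₁ < t₂
  t₂_lt : t₂ < T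
  κ_nonneg : 0 ≤ κ
  R'_pos : 0 < R'
  R'_lt : R' < R
  meas_θ : Measurable θ
  θ_nonneg : ∀ t, 0 ≤ θ t
  θ_le_one : ∀ t, θ t ≤ 1
  Lθ_nonneg : 0 ≤ Lθ
  θ_lip : ∀ s t, s ≤ t → θ t - θ s ≤ Lθ * (t - s)
  θ_zero : ∀ t, t ≤ t₂ → θ t = 0
  prim_ψ : IsPrimitive ψ ψ'
  meas_ψ' : Measurable ψ'
  ψ_nonneg : ∀ x, 0 ≤ ψ x
  ψ_le_one : ∀ x, ψ x ≤ 1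
  ψ_zero : ∀ x, x ∉ Metric.closedBall m R' → ψ x = 0
  ψ'_zero : ∀ x, x ∉ Metric.closedBall m R' → ψ' x = 0
  ψ'_le : ∀ x, |ψ' x| ≤ P
  meas_p : Measurable p
  p_nonneg : ∀ t, 0 ≤ p t
  p_zero : ∀ t, t ∉ Ioo t₁ T → p t = 0
  le_p : ∀ s ∈ Ioo t₁ T, ∀ x ∈ Metric.closedBall m R', max (u (s, x) - κ) 0 ≤ p s
  memLp_p : MemLp p 2
  meas_M : Measurable M
  M_nonneg : ∀ τ, 0 ≤ M τ
  M_le : ∀ τ, M τ ≤ CM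
  memory_le : ∀ s ∈ Ioo t₂ T, ∀ τ ∈ Ioc 0 t₁, -deriv k (s - τ) ≤ M τ
  initial_le : ∀ s ∈ Ioo t₂ T, k s ≤ K₀

lemma memLp_two_mul_prod {f g : ℝ → ℝ} (hfm : Measurable f) (hgm : Measurable g)
    (hf : MemLp f 2) (hg : MemLp g 2) : MemLp (fun z : ℝ × ℝ => f z.1 * g z.2) 2 := by
  refine (memLp_two_iff_integrable_sq ((hfm.comp measurable_fst).mul
    (hgm.comp measurable_snd)).aestronglyMeasurable).2 ?_
  refine (hf.integrable_sq.mul_prod hg.integrable_sq).congr (Eventually.of_forall fun z => ?_)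
  simp only [Pi.mul_apply, Function.comp_apply]; ring

lemma MemLp.of_abs_le {f g : ℝ × ℝ → ℝ} (hg : MemLp g 2) (hf : Measurable f)
    (h : ∀ z, |f z| ≤ g z) : MemLp f 2 :=
  hg.mono hf.aestronglyMeasurable (Eventually.of_forall fun z => by
    rw [Real.norm_eq_abs]; exact (h z).trans (le_abs_self _))

lemma memLp_indicator_one {s : Set ℝ} (hs : MeasurableSet s) (hfin : volume s ≠ ∞) {q : ℝ≥0∞} :
    MemLp (s.indicator fun _ => (1 : ℝ)) q :=
  memLp_indicator_const q hs 1 (Or.inr hfin)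

lemma IsPrimitive.const_mul {u g : ℝ → ℝ} (hu : IsPrimitive u g) (c : ℝ) :
    IsPrimitive (fun x => c * u x) (fun x => c * g x) :=
  ⟨hu.integrable.const_mul c, fun x y => by
    rw [intervalIntegral.integral_const_mul, ← hu.sub_eq]; ring⟩

/-- The mean of the time lag under the memory kernel is controlled by the integral of `k`. -/
lemma AssumptionK0.integral_mul_memK_le {k l : ℝ → ℝ} (hK : AssumptionK0 k l) {ε S : ℝ}
    (hε : 0 < ε) (hS : 0 ≤ S) :
    ∫ a, cut S (fun a => a * memK k ε a) a ≤ ∫ a in (0 : ℝ)..S, k a := by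
  have h0 := integral_cut_mul hS (fun a => a * memK k ε a) (fun _ => 1)
  simp only [mul_one] at h0
  rw [h0]
  have hsub : uIcc 0 S ⊆ Ici 0 := fun x hx => by rw [uIcc_of_le hS] at hx; exact hx.1
  have hc1 : ContinuousOn (fun a => a * memK k ε a) (uIcc 0 S) :=
    continuousOn_id.mul ((hK.continuousOn_memK hε).mono hsub)
  have hc2 : ContinuousOn (fun a => k (a + ε)) (uIcc 0 S) :=
    hK.continuousOn_k.comp (by fun_prop) fun a ha => by
      have : 0 ≤ a := hsub ha
      simp only [mem_Ioi]; linarith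
  have h1 : ∫ a in (0 : ℝ)..S, (a * memK k ε a - k (a + ε)) = -S * k (S + ε) := by
    rw [intervalIntegral.integral_eq_sub_of_hasDerivAt (f := fun a => -a * k (a + ε))]
    · ring
    · intro a ha
      have h2 : 0 ≤ a := hsub ha
      have h3 : HasDerivAt (fun a => -a * k (a + ε)) (-1 * k (a + ε) + -a * deriv k (a + ε)) a :=
        (hasDerivAt_neg a).mul ((hK.hasDerivAt_k (by linarith : 0 < a + ε)).comp_add_const a ε)
      refine h3.congr_deriv ?_
      unfold memK; ring
    · exact (hc1.sub hc2).intervalIntegrable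
  rw [intervalIntegral.integral_sub hc1.intervalIntegrable hc2.intervalIntegrable] at h1
  have h4 : ∫ a in (0 : ℝ)..S, k (a + ε) ≤ ∫ a in (0 : ℝ)..S, k a := by
    refine intervalIntegral.integral_mono_on_of_le_Ioo hS hc2.intervalIntegrable
      (hK.intervalIntegrable_k le_rfl hS) fun a ha => ?_
    exact hK.antitone_k (mem_Ioi.2 ha.1) (mem_Ioi.2 (by linarith [ha.1])) (by linarith)
  have h5 := mul_nonneg hS (hK.nonneg_k (S + ε) (by linarith))
  linarith

lemma measurableSet_cyl_ball {T m R : ℝ} : MeasurableSet (cyl T (Metric.ball m R)) :=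
  measurableSet_Ioo.prod measurableSet_ball

namespace RegularSub

variable {k : ℝ → ℝ} {T m R ν Λ : ℝ} {A : ℝ × ℝ → ℝ} {u₀ : ℝ → ℝ} {u Du : ℝ × ℝ → ℝ}
    {N : ℝ → ℝ} (hu : RegularSub k T m R ν Λ A u₀ u Du N)
include hu

lemma measurable_trunc (κ : ℝ) : Measurable fun z => max (u z - κ) 0 :=
  (hu.meas.sub_const κ).max measurable_const

lemma N_nonneg (t : ℝ) : 0 ≤ N t := (hu.nonneg (t, 0)).trans (hu.le_N (t, 0))

lemma measurable_slice (x : ℝ) : Measurable fun t => u (t, x) := hu.meas.comp (by fun_prop)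

lemma integrable_slice (x : ℝ) : Integrable fun t => u (t, x) := by
  have h1 : IntegrableOn N (Ioo 0 T) :=
    memLp_two_integrableOn measure_Ioo_lt_top.ne (hu.memLp_N.restrict _)
  refine (h1.integrable_indicator measurableSet_Ioo).mono'
    (hu.measurable_slice x).aestronglyMeasurable (Eventually.of_forall fun t => ?_)
  rw [Real.norm_of_nonneg (hu.nonneg _)]
  by_cases ht : t ∈ Ioo 0 T
  · rw [indicator_of_mem ht]; exact hu.le_N _
  · rw [indicator_of_notMem ht, hu.zero _ ht]

lemma integrable_slice_sq (x : ℝ) : Integrable fun t => u (t, x) ^ 2 := by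
  refine hu.memLp_N.integrable_sq.mono' ((hu.measurable_slice x).pow_const 2).aestronglyMeasurable
    (Eventually.of_forall fun t => ?_)
  rw [Real.norm_of_nonneg (sq_nonneg _)]
  exact pow_le_pow_left₀ (hu.nonneg _) (hu.le_N _) 2

lemma memLp_data : MemLp ((cyl T (Metric.ball m R)).indicator fun z => u z - u₀ z.2) 2 := by
  have h1 := memLp_two_mul_prod hu.meas_N (measurable_const.indicator measurableSet_ball)
    hu.memLp_N (memLp_indicator_one (measurableSet_ball (x := m) (ε := R)) measure_ball_lt_top.ne)
  have h2 := memLp_two_mul_prod (measurable_const.indicator measurableSet_Ioo) hu.meas_u₀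
    (memLp_indicator_one (measurableSet_Ioo (a := 0) (b := T)) measure_Ioo_lt_top.ne) hu.memLp_u₀
  refine MemLp.of_abs_le (h1.add h2) ((hu.meas.sub (hu.meas_u₀.comp measurable_snd)).indicator
    measurableSet_cyl_ball) fun z => ?_
  simp only [Pi.add_apply]
  by_cases hz : z ∈ cyl T (Metric.ball m R)
  · rw [indicator_of_mem hz, indicator_of_mem hz.1, indicator_of_mem hz.2]
    have a1 := hu.nonneg z
    have a2 := hu.le_N z
    have a3 := hu.nonneg_u₀ z.2
    rw [abs_le]; constructor <;> linarith
  · rw [indicator_of_notMem hz, abs_zero]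
    have n1 : 0 ≤ (Metric.ball m R).indicator (fun _ => (1 : ℝ)) z.2 :=
      indicator_nonneg (fun _ _ => zero_le_one) _
    have n2 : 0 ≤ (Ioo 0 T).indicator (fun _ => (1 : ℝ)) z.1 :=
      indicator_nonneg (fun _ _ => zero_le_one) _
    exact add_nonneg (mul_nonneg (hu.N_nonneg _) n1) (mul_nonneg n2 (hu.nonneg_u₀ _))

lemma memLp_flux : MemLp ((cyl T (Metric.ball m R)).indicator fun z => A z * Du z) 2 := by
  refine MemLp.of_abs_le (hu.memLp_D.norm.const_mul Λ) ((hu.meas_A.mul hu.meas_D).indicator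
    measurableSet_cyl_ball) fun z => ?_
  have a1 := (hu.ν_pos.le.trans (hu.A_ge z))
  by_cases hz : z ∈ cyl T (Metric.ball m R)
  · rw [indicator_of_mem hz, abs_mul, Real.norm_eq_abs, abs_of_nonneg a1]
    exact mul_le_mul_of_nonneg_right (hu.A_le z) (abs_nonneg _)
  · rw [indicator_of_notMem hz, abs_zero]
    exact mul_nonneg (a1.trans (hu.A_le z)) (norm_nonneg _)

end RegularSub

section Energy

variable {k l : ℝ → ℝ} {T m R ν Λ : ℝ} {A : ℝ × ℝ → ℝ} {u₀ : ℝ → ℝ} {u Du : ℝ × ℝ → ℝ}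
    {N : ℝ → ℝ} {κ t₁ t₂ R' Lθ P K₀ CM : ℝ} {θ ψ ψ' p M : ℝ → ℝ}

/-- The indicator of the support of the space cutoff. -/
noncomputable def ballInd (m R' : ℝ) : ℝ → ℝ := (Metric.closedBall m R').indicator fun _ => 1

lemma measurable_ballInd : Measurable (ballInd m R') :=
  measurable_const.indicator measurableSet_closedBall

lemma ballInd_nonneg (x : ℝ) : 0 ≤ ballInd m R' x := indicator_nonneg (fun _ _ => zero_le_one) _

lemma memLp_ballInd {q : ℝ≥0∞} : MemLp (ballInd m R') q :=
  memLp_indicator_one measurableSet_closedBall measure_closedBall_lt_top.ne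

lemma integral_ballInd (hR' : 0 ≤ R') : ∫ x, ballInd m R' x = 2 * R' := by
  unfold ballInd
  rw [integral_indicator measurableSet_closedBall]
  simp [Real.volume_real_closedBall hR']

namespace Localization

variable (hL : Localization k u κ T m R t₁ t₂ R' Lθ P K₀ CM θ ψ ψ' p M)
include hL

lemma memLp_majorant : MemLp (fun z : ℝ × ℝ => p z.1 * ballInd m R' z.2) 2 :=
  memLp_two_mul_prod hL.meas_p measurable_ballInd hL.memLp_p memLp_ballInd

variable (hu : RegularSub k T m R ν Λ A u₀ u Du N)
include hu

lemma trunc_zero {z : ℝ × ℝ} (hz : z.1 ∉ Ioo 0 T) : max (u z - κ) 0 = 0 := by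
  rw [hu.zero z hz]; exact max_eq_right (by linarith [hL.κ_nonneg])

/-- On the support of the cutoffs the truncation is bounded by `p`. -/
lemma cutoff_trunc_le (z : ℝ × ℝ) :
    θ z.1 * (ψ z.2 ^ 2 * max (u z - κ) 0) ≤ p z.1 * ballInd m R' z.2 := by
  have n1 : 0 ≤ p z.1 * ballInd m R' z.2 := mul_nonneg (hL.p_nonneg _) (ballInd_nonneg _)
  by_cases hx : z.2 ∈ Metric.closedBall m R'
  · rcases le_or_gt z.1 t₂ with h | h
    · rw [hL.θ_zero _ h, zero_mul]; exact n1
    · rcases le_or_gt T z.1 with h' | h'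
      · rw [hL.trunc_zero hu (fun h => by linarith [h.2]), mul_zero, mul_zero]; exact n1
      · have h2 := hL.le_p z.1 ⟨hL.t₁_lt.trans h, h'⟩ z.2 hx
        unfold ballInd
        rw [indicator_of_mem hx, mul_one]
        have h3 : ψ z.2 ^ 2 ≤ 1 := pow_le_one₀ (hL.ψ_nonneg _) (hL.ψ_le_one _)
        have h4 : 0 ≤ max (u z - κ) 0 := le_max_right _ _
        calc θ z.1 * (ψ z.2 ^ 2 * max (u z - κ) 0) ≤ 1 * (1 * max (u z - κ) 0) := by
              refine mul_le_mul (hL.θ_le_one _) (mul_le_mul_of_nonneg_right h3 h4)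
                (by positivity) zero_le_one
          _ ≤ p z.1 := by rw [one_mul, one_mul]; exact h2
  · rw [hL.ψ_zero _ hx]
    simpa using n1

lemma cutoff_deriv_le (z : ℝ × ℝ) :
    θ z.1 * (|ψ' z.2| * max (u z - κ) 0) ≤ P * (p z.1 * ballInd m R' z.2) := by
  have hP : 0 ≤ P := (abs_nonneg _).trans (hL.ψ'_le 0)
  have n1 : 0 ≤ P * (p z.1 * ballInd m R' z.2) :=
    mul_nonneg hP (mul_nonneg (hL.p_nonneg _) (ballInd_nonneg _))
  by_cases hx : z.2 ∈ Metric.closedBall m R'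
  · rcases le_or_gt z.1 t₂ with h | h
    · rw [hL.θ_zero _ h, zero_mul]; exact n1
    · rcases le_or_gt T z.1 with h' | h'
      · rw [hL.trunc_zero hu (fun h => by linarith [h.2]), mul_zero, mul_zero]; exact n1
      · have h2 := hL.le_p z.1 ⟨hL.t₁_lt.trans h, h'⟩ z.2 hx
        unfold ballInd
        rw [indicator_of_mem hx, mul_one]
        have h4 : 0 ≤ max (u z - κ) 0 := le_max_right _ _
        calc θ z.1 * (|ψ' z.2| * max (u z - κ) 0) ≤ 1 * (P * max (u z - κ) 0) := by
              refine mul_le_mul (hL.θ_le_one _) (mul_le_mul_of_nonneg_right (hL.ψ'_le _) h4)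
                (by positivity) zero_le_one
          _ ≤ P * p z.1 := by rw [one_mul]; exact mul_le_mul_of_nonneg_left h2 hP
  · rw [hL.ψ'_zero _ hx]
    simpa using n1

/-- The localized truncation, with a bounded weight `ρ` in time, is an admissible test function. -/
lemma spaceTest {ρ : ℝ → ℝ} {Rρ : ℝ} (hρm : Measurable ρ) (hρ0 : ∀ t, 0 ≤ ρ t)
    (hρR : ∀ t, ρ t ≤ Rρ) :
    SpaceTest T m R' (fun z => ρ z.1 * (θ z.1 * (ψ z.2 ^ 2 * max (u z - κ) 0)))
      (fun z => ρ z.1 * (θ z.1 * (ψ z.2 ^ 2 * {z | κ < u z}.indicator Du z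
        + 2 * ψ z.2 * ψ' z.2 * max (u z - κ) 0))) := by
  have hψm : Measurable ψ := hL.prim_ψ.continuous.measurable
  have hwm := hu.measurable_trunc κ
  have hDm : Measurable ({z | κ < u z}.indicator Du) :=
    hu.meas_D.indicator (measurableSet_lt measurable_const hu.meas)
  have hρm' : Measurable fun z : ℝ × ℝ => ρ z.1 := hρm.comp measurable_fst
  have hθm' : Measurable fun z : ℝ × ℝ => θ z.1 := hL.meas_θ.comp measurable_fst
  have hψm' : Measurable fun z : ℝ × ℝ => ψ z.2 := hψm.comp measurable_snd
  have hψ'm' : Measurable fun z : ℝ × ℝ => ψ' z.2 := hL.meas_ψ'.comp measurable_snd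
  have hRρ : 0 ≤ Rρ := (hρ0 0).trans (hρR 0)
  have hnn : ∀ z : ℝ × ℝ, 0 ≤ θ z.1 * (ψ z.2 ^ 2 * max (u z - κ) 0) := fun z =>
    mul_nonneg (hL.θ_nonneg _) (mul_nonneg (sq_nonneg _) (le_max_right _ _))
  have hm1 : Measurable (fun z : ℝ × ℝ => ρ z.1 * (θ z.1 * (ψ z.2 ^ 2 * max (u z - κ) 0))) :=
    hρm'.mul (hθm'.mul ((hψm'.pow_const 2).mul hwm))
  have hm2 : Measurable (fun z : ℝ × ℝ => ρ z.1 * (θ z.1 *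
      (ψ z.2 ^ 2 * {z | κ < u z}.indicator Du z + 2 * ψ z.2 * ψ' z.2 * max (u z - κ) 0))) :=
    hρm'.mul (hθm'.mul (((hψm'.pow_const 2).mul hDm).add
      (((measurable_const.mul hψm').mul hψ'm').mul hwm)))
  have hmaj := hL.memLp_majorant
  have hsupp : ∀ z : ℝ × ℝ, z ∉ Ioo 0 T ×ˢ Metric.closedBall m R' →
      max (u z - κ) 0 = 0 ∨ ψ z.2 = 0 := fun z hz => by
    by_cases hx : z.2 ∈ Metric.closedBall m R'
    · exact Or.inl (hL.trunc_zero hu fun h => hz ⟨h, hx⟩)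
    · exact Or.inr (hL.ψ_zero _ hx)
  refine ⟨hm1, hm2, fun z => mul_nonneg (hρ0 _) (hnn z), ?_, ?_, fun s => ?_, fun z hz => ?_,
    fun z hz => ?_⟩
  · refine MemLp.of_abs_le (hmaj.const_mul Rρ) hm1 fun z => ?_
    rw [abs_of_nonneg (mul_nonneg (hρ0 _) (hnn z))]
    exact mul_le_mul (hρR _) (hL.cutoff_trunc_le hu z) (hnn z) hRρ
  · refine MemLp.of_abs_le (((hu.memLp_D.norm).add (hmaj.const_mul (2 * P))).const_mul Rρ) hm2
      fun z => ?_
    rw [abs_mul, abs_of_nonneg (hρ0 _)]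
    refine mul_le_mul (hρR _) ?_ (abs_nonneg _) hRρ
    rw [abs_mul, abs_of_nonneg (hL.θ_nonneg _)]
    have h4 : 0 ≤ max (u z - κ) 0 := le_max_right _ _
    have h1 : |{z | κ < u z}.indicator Du z| ≤ |Du z| := by
      by_cases h : z ∈ {z | κ < u z}
      · rw [indicator_of_mem h]
      · rw [indicator_of_notMem h, abs_zero]; exact abs_nonneg _
    have h3 : ψ z.2 ^ 2 ≤ 1 := pow_le_one₀ (hL.ψ_nonneg _) (hL.ψ_le_one _)
    have h2 := abs_add_le (ψ z.2 ^ 2 * {z | κ < u z}.indicator Du z)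
      (2 * ψ z.2 * ψ' z.2 * max (u z - κ) 0)
    rw [abs_mul, abs_mul (2 * ψ z.2 * ψ' z.2), abs_mul (2 * ψ z.2), abs_of_nonneg h4,
      abs_of_nonneg (sq_nonneg (ψ z.2)),
      abs_of_nonneg (mul_nonneg zero_le_two (hL.ψ_nonneg z.2))] at h2
    have h5 := hL.cutoff_deriv_le hu z
    have h6 : ψ z.2 ^ 2 * |{z | κ < u z}.indicator Du z| ≤ 1 * |Du z| :=
      mul_le_mul h3 h1 (abs_nonneg _) zero_le_one
    have h7 : θ z.1 * (ψ z.2 ^ 2 * |{z | κ < u z}.indicator Du z|) ≤ 1 * (1 * |Du z|) :=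
      mul_le_mul (hL.θ_le_one _) h6 (mul_nonneg (sq_nonneg _) (abs_nonneg _)) zero_le_one
    have h8 : 2 * ψ z.2 * (θ z.1 * (|ψ' z.2| * max (u z - κ) 0)) ≤
        2 * 1 * (P * (p z.1 * ballInd m R' z.2)) :=
      mul_le_mul (by linarith [hL.ψ_le_one z.2]) h5
        (mul_nonneg (hL.θ_nonneg _) (mul_nonneg (abs_nonneg _) h4)) (by norm_num)
    have h9 := mul_le_mul_of_nonneg_left h2 (hL.θ_nonneg z.1)
    simp only [Pi.add_apply, Real.norm_eq_abs]
    nlinarith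
  · have h1 := (((hL.prim_ψ.mul hL.prim_ψ).mul ((hu.prim s).posPart κ)).const_mul
      (θ s)).const_mul (ρ s)
    convert h1 using 1
    · funext x; ring
    · funext x
      have : {z | κ < u z}.indicator Du (s, x) =
        {x | κ < u (s, x)}.indicator (fun x => Du (s, x)) x := rfl
      dsimp only
      rw [this]; ring
  · rcases hsupp z hz with h | h <;> rw [h] <;> ring
  · by_cases hx : z.2 ∈ Metric.closedBall m R'
    · have h1 : z.1 ∉ Ioo 0 T := fun h => hz ⟨h, hx⟩
      rw [hL.trunc_zero hu h1, indicator_of_notMem (fun h => by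
        have h2 : κ < u z := h
        rw [hu.zero z h1] at h2
        linarith [hL.κ_nonneg])]
      ring
    · rw [hL.ψ_zero _ hx]; ring

end Localization

end Energy

/-- Pairing with a function averaged backwards in time is a correlation. -/
lemma integral_mul_average_eq_corr {p q : ℝ≥0∞} [p.HolderTriple q 1] {f : ℝ → ℝ} {φ w : ℝ × ℝ → ℝ}
    (hf : Integrable f) (hfm : Measurable f) (hφm : Measurable φ) (hφ : MemLp φ p)
    (hw : MemLp w q) :
    ∫ z : ℝ × ℝ, (∫ a, f a * φ (z.1 - a, z.2)) * w z = corr f (timeCorr w φ) 0 := by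
  have h := integral_mul_translate_average (μ := (volume : Measure (ℝ × ℝ))) hf hfm hφm hφ hw (-1, 0)
  simp_rw [add_smul_neg_time] at h
  rw [h]
  unfold corr
  refine integral_congr_ae (Eventually.of_forall fun a => ?_)
  dsimp only
  congr 1
  have := integral_add_right_eq_self (μ := (volume : Measure (ℝ × ℝ)))
    (fun z => φ (z.1 - a, z.2) * w z) (a, 0)
  rw [← this, timeCorr]
  refine integral_congr_ae (Eventually.of_forall fun z => ?_)
  simp only [Prod.fst_add, Prod.snd_add, add_sub_cancel_right, add_zero, zero_add]
  rw [mul_comm]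
  congr 2
  exact Prod.ext (by simp) (by simp)

lemma integrable_mul_average {p q : ℝ≥0∞} [p.HolderTriple q 1] {f : ℝ → ℝ} {φ w : ℝ × ℝ → ℝ}
    (hf : Integrable f) (hfm : Measurable f) (hφm : Measurable φ) (hφ : MemLp φ p)
    (hw : MemLp w q) :
    Integrable fun z : ℝ × ℝ => (∫ a, f a * φ (z.1 - a, z.2)) * w z := by
  have h := (integrable_mul_translate (μ := (volume : Measure (ℝ × ℝ))) hf hfm hφm hφ hw
    (-1, 0)).integral_prod_left
  refine h.congr (Eventually.of_forall fun z => ?_)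
  simp only [Function.uncurry_def, add_smul_neg_time]
  rw [integral_mul_const]

lemma memLp_top_of_bounded {f : ℝ × ℝ → ℝ} {C : ℝ} (hf : Measurable f) (h : ∀ z, |f z| ≤ C) :
    MemLp f ∞ :=
  memLp_top_of_bound hf.aestronglyMeasurable C (Eventually.of_forall h)

section Energy

variable {k l : ℝ → ℝ} {T m R ν Λ : ℝ} {A : ℝ × ℝ → ℝ} {u₀ : ℝ → ℝ} {u Du : ℝ × ℝ → ℝ}
    {N : ℝ → ℝ} {κ t₁ t₂ R' Lθ P K₀ CM : ℝ} {θ ψ ψ' p M : ℝ → ℝ}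

/-- The contribution of the history before `t₁`, weighted by the majorant `M` of the memory kernel,
and of the initial datum, weighted by the bound `K₀` of `k`. -/
noncomputable def historyTerm (u : ℝ × ℝ → ℝ) (u₀ M : ℝ → ℝ) (K₀ m R' t₁ : ℝ) : ℝ → ℝ :=
  (Metric.closedBall m R').indicator fun x => (∫ τ in Ioc 0 t₁, M τ * u (τ, x)) + K₀ * u₀ x

/-- The error in the energy estimates that stems from the time derivative: the first term is due to
the cutoff in time, with Lipschitz constant `Lθ`, the second one to the history. -/
noncomputable def timeError (k : ℝ → ℝ) (u : ℝ × ℝ → ℝ) (u₀ M p : ℝ → ℝ)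
    (K₀ Lθ m R' t₁ T : ℝ) : ℝ :=
  1 / 2 * Lθ * (∫ a in (0 : ℝ)..(T - t₁), k a) * (2 * R' * ∫ s, p s ^ 2)
    + (∫ s, p s) * ∫ x, historyTerm u u₀ M K₀ m R' t₁ x

namespace Localization

variable (hL : Localization k u κ T m R t₁ t₂ R' Lθ P K₀ CM θ ψ ψ' p M)
include hL

lemma integrable_p : Integrable p := by
  have h1 : IntegrableOn p (Ioo t₁ T) :=
    memLp_two_integrableOn measure_Ioo_lt_top.ne (hL.memLp_p.restrict _)
  rwa [integrableOn_iff_integrable_of_support_subset (fun t ht => by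
    by_contra h; exact ht (hL.p_zero t h))] at h1

lemma integrable_p_sq : Integrable fun s => p s ^ 2 := hL.memLp_p.integrable_sq

lemma K₀_nonneg (hK : AssumptionK0 k l) : 0 ≤ K₀ := by
  have h1 : (t₂ + T) / 2 ∈ Ioo t₂ T := ⟨by linarith [hL.t₂_lt], by linarith [hL.t₂_lt]⟩
  refine (hK.nonneg_k _ ?_).trans (hL.initial_le _ h1)
  linarith [h1.1, hL.t₁_nonneg, hL.t₁_lt]

lemma localSquare_nonneg (z : ℝ × ℝ) : 0 ≤ θ z.1 * (ψ z.2 ^ 2 * max (u z - κ) 0 ^ 2) :=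
  mul_nonneg (hL.θ_nonneg _) (mul_nonneg (sq_nonneg _) (sq_nonneg _))

lemma integrable_sq_majorant : Integrable fun z : ℝ × ℝ => p z.1 ^ 2 * ballInd m R' z.2 :=
  hL.integrable_p_sq.mul_prod (memLp_one_iff_integrable.1 memLp_ballInd)

lemma integral_sq_majorant :
    ∫ z : ℝ × ℝ, p z.1 ^ 2 * ballInd m R' z.2 = 2 * R' * ∫ s, p s ^ 2 := by
  have := integral_prod_mul (μ := (volume : Measure ℝ)) (ν := (volume : Measure ℝ))
    (fun s => p s ^ 2) (ballInd m R')
  rw [integral_ballInd hL.R'_pos.le] at this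
  rw [mul_comm (2 * R')]
  exact this

variable (hu : RegularSub k T m R ν Λ A u₀ u Du N)
include hu

lemma measurable_historyTerm : Measurable (historyTerm u u₀ M K₀ m R' t₁) := by
  refine Measurable.indicator (Measurable.add ?_ (hu.meas_u₀.const_mul _)) measurableSet_closedBall
  exact (StronglyMeasurable.integral_prod_right (f := fun x τ => M τ * u (τ, x))
    (((hL.meas_M.comp measurable_snd).mul (hu.meas.comp measurable_swap)).stronglyMeasurable)).measurable

lemma historyTerm_nonneg (hK : AssumptionK0 k l) (x : ℝ) :
    0 ≤ historyTerm u u₀ M K₀ m R' t₁ x :=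
  indicator_nonneg (fun x _ => add_nonneg (integral_nonneg fun τ =>
    mul_nonneg (hL.M_nonneg τ) (hu.nonneg _)) (mul_nonneg (hL.K₀_nonneg hK) (hu.nonneg_u₀ x))) x

lemma integrable_memory (x : ℝ) : Integrable fun τ => M τ * u (τ, x) :=
  (hu.integrable_slice x).bdd_mul (c := CM) hL.meas_M.aestronglyMeasurable
    (Eventually.of_forall fun τ => by
      rw [Real.norm_of_nonneg (hL.M_nonneg τ)]; exact hL.M_le τ)

lemma integrable_historyTerm (hK : AssumptionK0 k l) :
    Integrable (historyTerm u u₀ M K₀ m R' t₁) := by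
  have hNi : Integrable ((Ioo 0 T).indicator N) :=
    (memLp_two_integrableOn measure_Ioo_lt_top.ne
      (hu.memLp_N.restrict _)).integrable_indicator measurableSet_Ioo
  have hCM : 0 ≤ CM := (hL.M_nonneg 0).trans (hL.M_le 0)
  have hu₀i : Integrable u₀ := by
    have h1 : IntegrableOn u₀ (Metric.ball m R) :=
      memLp_two_integrableOn measure_ball_lt_top.ne (hu.memLp_u₀.restrict _)
    rwa [integrableOn_iff_integrable_of_support_subset (fun t ht => by
      by_contra h; exact ht (hu.zero_u₀ t h))] at h1
  have hbi : Integrable (ballInd m R') := memLp_one_iff_integrable.1 memLp_ballInd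
  have hmaj : Integrable fun x => ballInd m R' x * (CM * ∫ τ, (Ioo 0 T).indicator N τ) + K₀ * u₀ x :=
    (hbi.mul_const _).add (hu₀i.const_mul K₀)
  refine hmaj.mono' (hL.measurable_historyTerm hu).aestronglyMeasurable
    (Eventually.of_forall fun x => ?_)
  rw [Real.norm_of_nonneg (hL.historyTerm_nonneg hu hK x)]
  unfold historyTerm ballInd
  by_cases hx : x ∈ Metric.closedBall m R'
  · rw [indicator_of_mem hx, indicator_of_mem hx, one_mul]
    have h1 : ∫ τ in Ioc 0 t₁, M τ * u (τ, x) ≤ ∫ τ, CM * (Ioo 0 T).indicator N τ := by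
      refine (setIntegral_le_integral (hL.integrable_memory hu x) (Eventually.of_forall fun τ =>
        mul_nonneg (hL.M_nonneg τ) (hu.nonneg _))).trans ?_
      refine integral_mono (hL.integrable_memory hu x) (hNi.const_mul CM) fun τ => ?_
      dsimp only
      by_cases ht : τ ∈ Ioo 0 T
      · rw [indicator_of_mem ht]
        exact mul_le_mul (hL.M_le τ) (hu.le_N _) (hu.nonneg _) hCM
      · rw [indicator_of_notMem ht, hu.zero _ ht, mul_zero, mul_zero]
    rw [integral_const_mul] at h1
    linarith
  · rw [indicator_of_notMem hx, indicator_of_notMem hx]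
    have := mul_nonneg (hL.K₀_nonneg hK) (hu.nonneg_u₀ x)
    linarith

/-- The localized square `θ ψ² (u - κ)₊²` is dominated by `p²` on the support of the cutoff. -/
lemma localSquare_le (z : ℝ × ℝ) : θ z.1 * (ψ z.2 ^ 2 * max (u z - κ) 0 ^ 2) ≤
    p z.1 ^ 2 * ballInd m R' z.2 := by
  have n1 : 0 ≤ p z.1 ^ 2 * ballInd m R' z.2 := mul_nonneg (sq_nonneg _) (ballInd_nonneg _)
  by_cases hx : z.2 ∈ Metric.closedBall m R'
  · rcases le_or_gt z.1 t₂ with h | h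
    · rw [hL.θ_zero _ h, zero_mul]; exact n1
    · rcases le_or_gt T z.1 with h' | h'
      · rw [hL.trunc_zero hu (fun h => by linarith [h.2])]
        simpa using n1
      · have h2 := hL.le_p z.1 ⟨hL.t₁_lt.trans h, h'⟩ z.2 hx
        unfold ballInd
        rw [indicator_of_mem hx, mul_one]
        have h3 : ψ z.2 ^ 2 ≤ 1 := pow_le_one₀ (hL.ψ_nonneg _) (hL.ψ_le_one _)
        have h4 : 0 ≤ max (u z - κ) 0 := le_max_right _ _
        calc θ z.1 * (ψ z.2 ^ 2 * max (u z - κ) 0 ^ 2) ≤ 1 * (1 * max (u z - κ) 0 ^ 2) := by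
              refine mul_le_mul (hL.θ_le_one _) (mul_le_mul_of_nonneg_right h3 (sq_nonneg _))
                (by positivity) zero_le_one
          _ ≤ p z.1 ^ 2 := by rw [one_mul, one_mul]; exact pow_le_pow_left₀ h4 h2 2
  · rw [hL.ψ_zero _ hx]
    simpa using n1

lemma measurable_localSquare :
    Measurable fun z : ℝ × ℝ => θ z.1 * (ψ z.2 ^ 2 * max (u z - κ) 0 ^ 2) :=
  (hL.meas_θ.comp measurable_fst).mul
    (((hL.prim_ψ.continuous.measurable.comp measurable_snd).pow_const 2).mul
      ((hu.measurable_trunc κ).pow_const 2))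

lemma integrable_localSquare :
    Integrable fun z : ℝ × ℝ => θ z.1 * (ψ z.2 ^ 2 * max (u z - κ) 0 ^ 2) :=
  (hL.integrable_sq_majorant).mono' (hL.measurable_localSquare hu).aestronglyMeasurable
    (Eventually.of_forall fun z => by
      rw [Real.norm_of_nonneg (hL.localSquare_nonneg z)]; exact hL.localSquare_le hu z)

/-- The regularized inequality tested with the localized truncation times a weight `ρ(t)`. The
error terms are bounded uniformly in `ε`. -/
lemma weighted_inequality (hK : AssumptionK0 k l) {ρ : ℝ → ℝ} {Rρ ε : ℝ} (hρm : Measurable ρ)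
    (hρ0 : ∀ t, 0 ≤ ρ t) (hρR : ∀ t, ρ t ≤ Rρ) (hε : 0 < ε) :
    1 / 2 * (k ε * timeCorr (fun z => ρ z.1)
          (fun z => θ z.1 * (ψ z.2 ^ 2 * max (u z - κ) 0 ^ 2)) 0
        - corr (cut T (memK k ε)) (timeCorr (fun z => ρ z.1)
          (fun z => θ z.1 * (ψ z.2 ^ 2 * max (u z - κ) 0 ^ 2))) 0)
      + corr (approxId k l T ε) (timeCorr
          (fun z => ρ z.1 * (θ z.1 * (ψ z.2 ^ 2 * {z | κ < u z}.indicator Du z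
            + 2 * ψ z.2 * ψ' z.2 * max (u z - κ) 0)))
          ((cyl T (Metric.ball m R)).indicator fun z => A z * Du z)) 0
      ≤ Rρ * timeError k u u₀ M p K₀ Lθ m R' t₁ T := by
  have hST := hL.spaceTest hu hρm hρ0 hρR
  have hvm : Measurable ((cyl T (Metric.ball m R)).indicator fun z => u z - u₀ z.2) :=
    (hu.meas.sub (hu.meas_u₀.comp measurable_snd)).indicator measurableSet_cyl_ball
  have hreg := regularized_inequality hK hvm hu.memLp_data hu.memLp_flux (fun z hz => indicator_of_notMem hz _)
    hu.weak (fun z hz => indicator_of_notMem hz _) hST hL.R'_pos hL.R'_lt hε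
  set φ : ℝ × ℝ → ℝ := fun z => ρ z.1 * (θ z.1 * (ψ z.2 ^ 2 * max (u z - κ) 0)) with hφ
  set f : ℝ × ℝ → ℝ := fun z => θ z.1 * (ψ z.2 ^ 2 * max (u z - κ) 0 ^ 2) with hf
  set v : ℝ × ℝ → ℝ := (cyl T (Metric.ball m R)).indicator fun z => u z - u₀ z.2 with hv
  set Kc := cut T (memK k ε) with hKcd
  have hRρ : 0 ≤ Rρ := (hρ0 0).trans (hρR 0)
  have hKi : Integrable Kc := hK.integrable_cut_memK hε T
  have hKm : Measurable Kc := hK.measurable_cut_memK hε T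
  have hfm : Measurable f := hL.measurable_localSquare hu
  have hfi : Integrable f := hL.integrable_localSquare hu
  have hρm' : Measurable fun z : ℝ × ℝ => ρ z.1 := hρm.comp measurable_fst
  have hρL : MemLp (fun z : ℝ × ℝ => ρ z.1) ∞ := memLp_top_of_bounded hρm' fun z => by
    rw [abs_of_nonneg (hρ0 _)]; exact hρR _
  set G : ℝ × ℝ → ℝ := fun z =>
    ψ z.2 ^ 2 * (Ioo t₁ T).indicator (fun τ => max (u (τ, z.2) - κ) 0 ^ 2) z.1 with hG
  have hGm : Measurable G := by
    have h1 : Measurable ((Prod.fst ⁻¹' Ioo t₁ T).indicator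
        fun z : ℝ × ℝ => max (u z - κ) 0 ^ 2) :=
      ((hu.measurable_trunc κ).pow_const 2).indicator (measurable_fst measurableSet_Ioo)
    exact ((hL.prim_ψ.continuous.measurable.comp measurable_snd).pow_const 2).mul h1
  have hG0 : ∀ z, 0 ≤ G z := fun z =>
    mul_nonneg (sq_nonneg _) (indicator_nonneg (fun _ _ => sq_nonneg _) _)
  have hGle : ∀ z, G z ≤ p z.1 ^ 2 * ballInd m R' z.2 := fun z => by
    have n1 : 0 ≤ p z.1 ^ 2 * ballInd m R' z.2 := mul_nonneg (sq_nonneg _) (ballInd_nonneg _)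
    by_cases hx : z.2 ∈ Metric.closedBall m R'
    · by_cases hs : z.1 ∈ Ioo t₁ T
      · have h3 : ψ z.2 ^ 2 ≤ 1 := pow_le_one₀ (hL.ψ_nonneg _) (hL.ψ_le_one _)
        have h4 := pow_le_pow_left₀ (le_max_right _ _) (hL.le_p z.1 hs z.2 hx) 2
        rw [hG]; unfold ballInd
        dsimp only
        rw [indicator_of_mem hs, indicator_of_mem hx, mul_one]
        calc _ ≤ 1 * p z.1 ^ 2 := mul_le_mul h3 h4 (sq_nonneg _) zero_le_one
          _ = _ := one_mul _
      · rw [hG]; dsimp only; rw [indicator_of_notMem hs, mul_zero]; exact n1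
    · rw [hG]; dsimp only; rw [hL.ψ_zero _ hx]
      simpa using n1
  have hGi : Integrable G := (hL.integrable_sq_majorant).mono' hGm.aestronglyMeasurable
    (Eventually.of_forall fun z => by rw [Real.norm_of_nonneg (hG0 z)]; exact hGle z)
  set b : ℝ → ℝ := cut (T - t₁) (fun a => a * memK k ε a) with hb
  have hbc : ContinuousOn (fun a => a * memK k ε a) (Ici 0) :=
    continuousOn_id.mul (hK.continuousOn_memK hε)
  have hbm : Measurable b := measurable_cut (hbc.mono Ioi_subset_Ici_self)
  have hbi : Integrable b := (integrable_indicator_iff measurableSet_Ioo).2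
    ((hbc.mono Icc_subset_Ici_self).integrableOn_Icc.mono_set Ioo_subset_Icc_self)
  have hb0 : ∀ a, 0 ≤ b a := fun a =>
    indicator_nonneg (fun x hx => mul_nonneg hx.1.le (hK.memK_nonneg (by linarith [hx.1]))) a
  set Q := historyTerm u u₀ M K₀ m R' t₁ with hQ
  have hQ0 : ∀ x, 0 ≤ Q x := hL.historyTerm_nonneg hu hK
  have hφ0 : ∀ z, 0 ≤ φ z := hST.nonneg
  -- the integrated terms
  have iφQ : Integrable fun z : ℝ × ℝ => φ z * Q z.2 := by
    refine ((hL.integrable_p.mul_prod (hL.integrable_historyTerm hu hK)).const_mul Rρ).mono'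
      (hST.meas.mul ((hL.measurable_historyTerm hu).comp measurable_snd)).aestronglyMeasurable
      (Eventually.of_forall fun z => ?_)
    rw [Real.norm_of_nonneg (mul_nonneg (hφ0 z) (hQ0 _)), ← mul_assoc]
    refine mul_le_mul_of_nonneg_right ?_ (hQ0 _)
    refine mul_le_mul (hρR _) ?_ (mul_nonneg (hL.θ_nonneg _)
      (mul_nonneg (sq_nonneg _) (le_max_right _ _))) hRρ
    refine (hL.cutoff_trunc_le hu z).trans ?_
    have : ballInd m R' z.2 ≤ 1 := indicator_le_self' (fun _ _ => zero_le_one) _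
    simpa using mul_le_mul_of_nonneg_left this (hL.p_nonneg z.1)
  have eφQ : ∫ z : ℝ × ℝ, φ z * Q z.2 ≤ Rρ * ((∫ s, p s) * ∫ x, Q x) := by
    have h1 := integral_prod_mul (μ := (volume : Measure ℝ)) (ν := (volume : Measure ℝ)) p Q
    rw [← h1, ← integral_const_mul]
    refine integral_mono iφQ
      ((hL.integrable_p.mul_prod (hL.integrable_historyTerm hu hK)).const_mul Rρ) fun z => ?_
    dsimp only
    rw [← mul_assoc]
    refine mul_le_mul_of_nonneg_right ?_ (hQ0 _)
    refine mul_le_mul (hρR _) ?_ (mul_nonneg (hL.θ_nonneg _)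
      (mul_nonneg (sq_nonneg _) (le_max_right _ _))) hRρ
    refine (hL.cutoff_trunc_le hu z).trans ?_
    have : ballInd m R' z.2 ≤ 1 := indicator_le_self' (fun _ _ => zero_le_one) _
    simpa using mul_le_mul_of_nonneg_left this (hL.p_nonneg z.1)
  have iφv : Integrable fun z => φ z * v z := hST.memLp.integrable_mul hu.memLp_data
  have iV := integrable_mul_average (p := 2) (q := 2) hKi hKm hvm hu.memLp_data hST.memLp
  have eV := integral_mul_average_eq_corr (p := 2) (q := 2) hKi hKm hvm hu.memLp_data hST.memLp
  have iF := integrable_mul_average (p := 1) (q := ∞) hKi hKm hfm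
    (memLp_one_iff_integrable.2 hfi) hρL
  have eF := integral_mul_average_eq_corr (p := 1) (q := ∞) hKi hKm hfm
    (memLp_one_iff_integrable.2 hfi) hρL
  have iG := integrable_mul_average (p := 1) (q := ∞) hbi hbm hGm
    (memLp_one_iff_integrable.2 hGi) hρL
  have eG := integral_mul_average_eq_corr (p := 1) (q := ∞) hbi hbm hGm
    (memLp_one_iff_integrable.2 hGi) hρL
  have iρf : Integrable fun z : ℝ × ℝ => ρ z.1 * f z :=
    hfi.bdd_mul (c := Rρ) hρm'.aestronglyMeasurable (Eventually.of_forall fun z => by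
      rw [Real.norm_of_nonneg (hρ0 _)]; exact hρR _)
  have bG : corr b (timeCorr (fun z => ρ z.1) G) 0 ≤
      Rρ * ((∫ a in (0 : ℝ)..(T - t₁), k a) * (2 * R' * ∫ s, p s ^ 2)) := by
    have h1 : ∀ y, timeCorr (fun z => ρ z.1) G y ≤ Rρ * (2 * R' * ∫ s, p s ^ 2) := fun y => by
      rw [← hL.integral_sq_majorant, ← integral_const_mul]
      unfold timeCorr
      refine integral_mono_of_nonneg (Eventually.of_forall fun z => mul_nonneg (hρ0 _) (hG0 z))
        ((hL.integrable_sq_majorant).const_mul Rρ) (Eventually.of_forall fun z => ?_)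
      exact mul_le_mul (hρR _) (hGle z) (hG0 z) hRρ
    have h0 : 0 ≤ 2 * R' * ∫ s, p s ^ 2 :=
      mul_nonneg (by linarith [hL.R'_pos]) (integral_nonneg fun s => sq_nonneg _)
    have h2 : corr b (timeCorr (fun z => ρ z.1) G) 0 ≤
        ∫ a, b a * (Rρ * (2 * R' * ∫ s, p s ^ 2)) := by
      unfold corr
      refine integral_mono_of_nonneg (Eventually.of_forall fun a => mul_nonneg (hb0 a) ?_)
        (hbi.mul_const _) (Eventually.of_forall fun a => mul_le_mul_of_nonneg_left (h1 _) (hb0 a))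
      exact integral_nonneg fun z => mul_nonneg (hρ0 _) (hG0 z)
    rw [integral_mul_const] at h2
    have h3 := mul_le_mul_of_nonneg_right (hK.integral_mul_memK_le hε
      (show 0 ≤ T - t₁ by linarith [hL.t₁_lt, hL.t₂_lt])) (mul_nonneg hRρ h0)
    calc _ ≤ _ := h2
      _ ≤ _ := h3
      _ = _ := by ring
  -- the pointwise inequality
  have hpt : ∀ z : ℝ × ℝ, 1 / 2 * (k ε * (ρ z.1 * f z)
      - (∫ a, Kc a * f (z.1 - a, z.2)) * ρ z.1)
      - 1 / 2 * Lθ * ((∫ a, b a * G (z.1 - a, z.2)) * ρ z.1) - φ z * Q z.2 ≤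
      k ε * (φ z * v z) - (∫ a, Kc a * v (z.1 - a, z.2)) * φ z := fun z => by
    have hKf0 : 0 ≤ ∫ a, Kc a * f (z.1 - a, z.2) := integral_nonneg fun a =>
      mul_nonneg (hK.cut_memK_nonneg hε T a) (hL.localSquare_nonneg _)
    have hbG0 : 0 ≤ ∫ a, b a * G (z.1 - a, z.2) := integral_nonneg fun a =>
      mul_nonneg (hb0 a) (hG0 _)
    by_cases hz : z.1 ∈ Ioo t₂ T ∧ z.2 ∈ Metric.closedBall m R'
    · obtain ⟨s, x⟩ := z
      obtain ⟨hs, hx⟩ := hz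
      dsimp only at hs hx
      have hxB : x ∈ Metric.ball m R := Metric.closedBall_subset_ball hL.R'_lt hx
      have h1 := hK.truncated_history_le (T := T) (κ := κ) (u0 := u₀ x) (K₀ := K₀) (Lθ := Lθ)
        (θ := θ) (M := M) (U := fun t => u (t, x)) hε hL.t₁_nonneg hL.t₁_lt hL.κ_nonneg
        (hu.nonneg_u₀ x) (hu.measurable_slice x) (fun τ => hu.nonneg _)
        (fun τ hτ => hu.zero _ hτ) (hu.integrable_slice x) (hu.integrable_slice_sq x)
        hL.meas_θ hL.θ_nonneg hL.θ_le_one hL.θ_lip hL.meas_M hL.M_nonneg hL.M_le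
        (s := s) (fun τ hτ => hL.memory_le s hs τ hτ) (hL.initial_le s hs) hs.1 hs.2
      have hvx : ∀ τ, v (τ, x) = (Ioo 0 T).indicator (fun τ => u (τ, x) - u₀ x) τ := fun τ => by
        by_cases hτ : τ ∈ Ioo 0 T
        · rw [hv, indicator_of_mem hτ, indicator_of_mem (show (τ, x) ∈ cyl T (Metric.ball m R) from
            ⟨hτ, hxB⟩)]
        · rw [hv, indicator_of_notMem hτ, indicator_of_notMem (fun h => hτ h.1)]
      have hvs : v (s, x) = u (s, x) - u₀ x := by
        rw [hvx, indicator_of_mem]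
        exact ⟨by linarith [hs.1, hL.t₁_nonneg, hL.t₁_lt], hs.2⟩
      have hQx : Q x = (∫ τ in Ioc 0 t₁, M τ * u (τ, x)) + K₀ * u₀ x := indicator_of_mem hx _
      have h2 := mul_le_mul_of_nonneg_left h1 (mul_nonneg (hρ0 s) (sq_nonneg (ψ x)))
      dsimp only
      simp_rw [hvx]
      rw [← hvx, hvs, hQx]
      have h3 : ∫ a, Kc a * f (s - a, x) =
          ψ x ^ 2 * ∫ a, Kc a * (θ (s - a) * max (u (s - a, x) - κ) 0 ^ 2) := by
        rw [← integral_const_mul]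
        refine integral_congr_ae (Eventually.of_forall fun a => ?_)
        simp only [hf]; ring
      have h4 : ∫ a, b a * G (s - a, x) = ψ x ^ 2 * ∫ a, b a *
          (Ioo t₁ T).indicator (fun τ => max (u (τ, x) - κ) 0 ^ 2) (s - a) := by
        rw [← integral_const_mul]
        refine integral_congr_ae (Eventually.of_forall fun a => ?_)
        simp only [hG]; ring
      rw [h3, h4]
      simp only [hφ, hf]
      refine le_trans (le_of_eq ?_) (h2.trans (le_of_eq ?_))
      · ring
      · ring
    · have h0 : f z = 0 ∧ φ z = 0 := by
        by_cases hx : z.2 ∈ Metric.closedBall m R'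
        · have hs : z.1 ∉ Ioo t₂ T := fun h => hz ⟨h, hx⟩
          rcases le_or_gt z.1 t₂ with h | h
          · simp only [hf, hφ, hL.θ_zero _ h]; constructor <;> ring
          · have := hL.trunc_zero hu (z := z) fun h' => hs ⟨h, h'.2⟩
            simp only [hf, hφ, this]; constructor <;> ring
        · simp only [hf, hφ, hL.ψ_zero _ hx]; constructor <;> ring
      rw [h0.1, h0.2]
      have n1 := mul_nonneg hKf0 (hρ0 z.1)
      have n2 := mul_nonneg hL.Lθ_nonneg (mul_nonneg hbG0 (hρ0 z.1))
      linarith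
  have j1 : Integrable fun z : ℝ × ℝ => 1 / 2 * (k ε * (ρ z.1 * f z)
      - (∫ a, Kc a * f (z.1 - a, z.2)) * ρ z.1) := ((iρf.const_mul _).sub iF).const_mul _
  have j2 : Integrable fun z : ℝ × ℝ => 1 / 2 * Lθ * ((∫ a, b a * G (z.1 - a, z.2)) * ρ z.1) :=
    iG.const_mul _
  have j12 : Integrable fun z : ℝ × ℝ => 1 / 2 * (k ε * (ρ z.1 * f z)
      - (∫ a, Kc a * f (z.1 - a, z.2)) * ρ z.1)
      - 1 / 2 * Lθ * ((∫ a, b a * G (z.1 - a, z.2)) * ρ z.1) := j1.sub j2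
  have hint := integral_mono (j12.sub iφQ) ((iφv.const_mul (k ε)).sub iV) hpt
  have eL : ∫ z, ((fun z : ℝ × ℝ => 1 / 2 * (k ε * (ρ z.1 * f z)
      - (∫ a, Kc a * f (z.1 - a, z.2)) * ρ z.1)
      - 1 / 2 * Lθ * ((∫ a, b a * G (z.1 - a, z.2)) * ρ z.1)) - fun z => φ z * Q z.2) z =
      1 / 2 * (k ε * timeCorr (fun z => ρ z.1) f 0 - corr Kc (timeCorr (fun z => ρ z.1) f) 0)
      - 1 / 2 * Lθ * corr b (timeCorr (fun z => ρ z.1) G) 0 - ∫ z : ℝ × ℝ, φ z * Q z.2 := by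
    rw [integral_sub' j12 iφQ, integral_sub j1 j2, integral_const_mul, integral_const_mul,
      integral_sub (iρf.const_mul _) iF, integral_const_mul, eF, eG]
    simp only [timeCorr, add_zero]
  have eR : ∫ z, ((fun z => k ε * (φ z * v z)) -
      fun z => (∫ a, Kc a * v (z.1 - a, z.2)) * φ z) z =
      k ε * timeCorr φ v 0 - corr Kc (timeCorr φ v) 0 := by
    rw [integral_sub' (iφv.const_mul (k ε)) iV, integral_const_mul, eV]
    simp only [timeCorr, add_zero]
  have hint' := (eL.symm.trans_le hint).trans_eq eR
  have h5 := mul_le_mul_of_nonneg_left bG (mul_nonneg (by norm_num : (0 : ℝ) ≤ 1 / 2) hL.Lθ_nonneg)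
  unfold timeError
  rw [← hQ]
  linarith

end Localization

end Energy

section Energy

variable {k l : ℝ → ℝ} {T m R ν Λ : ℝ} {A : ℝ × ℝ → ℝ} {u₀ : ℝ → ℝ} {u Du : ℝ × ℝ → ℝ}
    {N : ℝ → ℝ} {κ t₁ t₂ R' Lθ P K₀ CM : ℝ} {θ ψ ψ' p M : ℝ → ℝ}

namespace Localization

variable (hL : Localization k u κ T m R t₁ t₂ R' Lθ P K₀ CM θ ψ ψ' p M)
  (hu : RegularSub k T m R ν Λ A u₀ u Du N)
include hL hu

lemma integrable_gradient {ρ : ℝ → ℝ} {Rρ : ℝ} (hρm : Measurable ρ) (hρ0 : ∀ t, 0 ≤ ρ t)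
    (hρR : ∀ t, ρ t ≤ Rρ) : Integrable fun z : ℝ × ℝ =>
      ρ z.1 * (θ z.1 * (ψ z.2 ^ 2 * {z | κ < u z}.indicator Du z ^ 2)) := by
  have hRρ : 0 ≤ Rρ := (hρ0 0).trans (hρR 0)
  have hDm : Measurable ({z | κ < u z}.indicator Du) :=
    hu.meas_D.indicator (measurableSet_lt measurable_const hu.meas)
  refine (hu.memLp_D.integrable_sq.const_mul Rρ).mono' ?_ (Eventually.of_forall fun z => ?_)
  · exact ((hρm.comp measurable_fst).mul ((hL.meas_θ.comp measurable_fst).mul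
      (((hL.prim_ψ.continuous.measurable.comp measurable_snd).pow_const 2).mul
      (hDm.pow_const 2)))).aestronglyMeasurable
  · have h0 : 0 ≤ ψ z.2 ^ 2 * {z | κ < u z}.indicator Du z ^ 2 := by positivity
    have h1 : {z | κ < u z}.indicator Du z ^ 2 ≤ Du z ^ 2 := by
      by_cases h : z ∈ {z | κ < u z}
      · rw [indicator_of_mem h]
      · rw [indicator_of_notMem h]; simpa using sq_nonneg (Du z)
    have h3 : ψ z.2 ^ 2 ≤ 1 := pow_le_one₀ (hL.ψ_nonneg _) (hL.ψ_le_one _)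
    rw [Real.norm_of_nonneg (mul_nonneg (hρ0 _) (mul_nonneg (hL.θ_nonneg _) h0))]
    refine mul_le_mul (hρR _) ?_ (mul_nonneg (hL.θ_nonneg _) h0) hRρ
    calc θ z.1 * (ψ z.2 ^ 2 * {z | κ < u z}.indicator Du z ^ 2) ≤ 1 * (1 * Du z ^ 2) :=
          mul_le_mul (hL.θ_le_one _) (mul_le_mul h3 h1 (sq_nonneg _) zero_le_one) h0 zero_le_one
      _ = Du z ^ 2 := by ring

/-- The elliptic part of the weak inequality controls the gradient of the truncation. -/
lemma flux_ge {ρ : ℝ → ℝ} {Rρ : ℝ} (hρm : Measurable ρ) (hρ0 : ∀ t, 0 ≤ ρ t)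
    (hρR : ∀ t, ρ t ≤ Rρ) :
    1 / 2 * ν * (∫ z : ℝ × ℝ, ρ z.1 * (θ z.1 * (ψ z.2 ^ 2 * {z | κ < u z}.indicator Du z ^ 2)))
      - Rρ * (2 * Λ * P ^ 2 * (2 * R' * ∫ s, p s ^ 2)) ≤
    timeCorr (fun z => ρ z.1 * (θ z.1 * (ψ z.2 ^ 2 * {z | κ < u z}.indicator Du z
        + 2 * ψ z.2 * ψ' z.2 * max (u z - κ) 0)))
      ((cyl T (Metric.ball m R)).indicator fun z => A z * Du z) 0 := by
  have hST := hL.spaceTest hu hρm hρ0 hρR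
  have hRρ : 0 ≤ Rρ := (hρ0 0).trans (hρR 0)
  have hΛ : 0 ≤ Λ := hu.ν_pos.le.trans ((hu.A_ge 0).trans (hu.A_le 0))
  have i1 := hL.integrable_gradient hu hρm hρ0 hρR
  have i2 := hL.integrable_sq_majorant
  have i3 : Integrable fun z : ℝ × ℝ => (ρ z.1 * (θ z.1 * (ψ z.2 ^ 2 *
      {z | κ < u z}.indicator Du z + 2 * ψ z.2 * ψ' z.2 * max (u z - κ) 0))) *
      ((cyl T (Metric.ball m R)).indicator fun z => A z * Du z) z :=
    hST.memLp_D.integrable_mul hu.memLp_flux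
  have hint := integral_mono ((i1.const_mul (1 / 2 * ν)).sub
    (i2.const_mul (Rρ * (2 * Λ * P ^ 2)))) i3 fun z => by
    simp only [Pi.sub_apply]
    have n2 : 0 ≤ Rρ * (2 * Λ * P ^ 2) * (p z.1 ^ 2 * ballInd m R' z.2) :=
      mul_nonneg (mul_nonneg hRρ (mul_nonneg (mul_nonneg zero_le_two hΛ) (sq_nonneg _)))
        (mul_nonneg (sq_nonneg _) (ballInd_nonneg _))
    by_cases hz : z ∈ cyl T (Metric.ball m R)
    · rw [indicator_of_mem hz]
      by_cases h : z ∈ {z | κ < u z}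
      · rw [indicator_of_mem h]
        set w := max (u z - κ) 0 with hw
        have hw0 : 0 ≤ w := le_max_right _ _
        have hA := hu.A_ge z
        have hA' := hu.A_le z
        have hνp := hu.ν_pos
        have q1 : 0 ≤ A z * (ψ z.2 * Du z + 2 * ψ' z.2 * w) ^ 2 :=
          mul_nonneg (hνp.le.trans hA) (sq_nonneg _)
        have q2 : ν * (ψ z.2 ^ 2 * Du z ^ 2) ≤ A z * (ψ z.2 ^ 2 * Du z ^ 2) :=
          mul_le_mul_of_nonneg_right hA (by positivity)
        have q3 : A z * (ψ' z.2 * w) ^ 2 ≤ Λ * (ψ' z.2 * w) ^ 2 :=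
          mul_le_mul_of_nonneg_right hA' (sq_nonneg _)
        -- absorb the mixed term by Young's inequality
        have q4 : 1 / 2 * ν * (ψ z.2 ^ 2 * Du z ^ 2) - 2 * Λ * (ψ' z.2 * w) ^ 2 ≤
            (ψ z.2 ^ 2 * Du z + 2 * ψ z.2 * ψ' z.2 * w) * (A z * Du z) := by
          nlinarith
        have q5 := mul_le_mul_of_nonneg_left q4 (mul_nonneg (hρ0 z.1) (hL.θ_nonneg z.1))
        have q6 : ρ z.1 * (θ z.1 * (ψ' z.2 * w) ^ 2) ≤
            Rρ * (P ^ 2 * (p z.1 ^ 2 * ballInd m R' z.2)) := by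
          refine mul_le_mul (hρR _) ?_ (mul_nonneg (hL.θ_nonneg _) (sq_nonneg _)) hRρ
          rcases le_or_gt z.1 t₂ with hs | hs
          · rw [hL.θ_zero _ hs, zero_mul]
            exact mul_nonneg (sq_nonneg _) (mul_nonneg (sq_nonneg _) (ballInd_nonneg _))
          · by_cases hx : z.2 ∈ Metric.closedBall m R'
            · have r5 := hL.le_p z.1 ⟨hL.t₁_lt.trans hs, hz.1.2⟩ z.2 hx
              have r6 : (ψ' z.2 * w) ^ 2 ≤ (P * p z.1) ^ 2 := by
                rw [← sq_abs (ψ' z.2 * w), abs_mul, abs_of_nonneg hw0]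
                exact pow_le_pow_left₀ (mul_nonneg (abs_nonneg _) hw0)
                  (mul_le_mul (hL.ψ'_le _) r5 hw0 ((abs_nonneg _).trans (hL.ψ'_le 0))) 2
              have r7 : ballInd m R' z.2 = 1 := indicator_of_mem hx _
              rw [r7]
              have := mul_le_mul (hL.θ_le_one z.1) r6 (sq_nonneg _) zero_le_one
              linarith
            · rw [hL.ψ'_zero _ hx]
              have := mul_nonneg (sq_nonneg P) (mul_nonneg (sq_nonneg (p z.1))
                (ballInd_nonneg (m := m) (R' := R') z.2))
              simpa using this
        have q7 := mul_le_mul_of_nonneg_left q6 (mul_nonneg zero_le_two hΛ)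
        linarith
      · have hw : max (u z - κ) 0 = 0 := max_eq_right (by
          have : u z ≤ κ := not_lt.1 h
          linarith)
        rw [indicator_of_notMem h, hw]
        linarith
    · have h : {z | κ < u z}.indicator Du z = 0 := by
        by_cases h : z ∈ {z | κ < u z}
        · rw [indicator_of_mem h, hu.D_zero z hz]
        · rw [indicator_of_notMem h]
      rw [indicator_of_notMem hz, h]
      linarith
  have e1 : ∫ z : ℝ × ℝ, (1 / 2 * ν * (ρ z.1 * (θ z.1 * (ψ z.2 ^ 2 *
      {z | κ < u z}.indicator Du z ^ 2))) - Rρ * (2 * Λ * P ^ 2) *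
      (p z.1 ^ 2 * ballInd m R' z.2)) = 1 / 2 * ν * (∫ z : ℝ × ℝ, ρ z.1 * (θ z.1 *
      (ψ z.2 ^ 2 * {z | κ < u z}.indicator Du z ^ 2)))
      - Rρ * (2 * Λ * P ^ 2 * (2 * R' * ∫ s, p s ^ 2)) := by
    rw [integral_sub (i1.const_mul _) (i2.const_mul _), integral_const_mul, integral_const_mul,
      hL.integral_sq_majorant]
    ring
  have h2 := e1.symm.trans_le hint
  refine h2.trans_eq ?_
  simp only [timeCorr, add_zero]

lemma causal_flux {ρ : ℝ → ℝ} {Rρ : ℝ} (hρm : Measurable ρ) (hρ0 : ∀ t, 0 ≤ ρ t)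
    (hρR : ∀ t, ρ t ≤ Rρ) :
    Causal T (timeCorr (fun z => ρ z.1 * (θ z.1 * (ψ z.2 ^ 2 * {z | κ < u z}.indicator Du z
        + 2 * ψ z.2 * ψ' z.2 * max (u z - κ) 0)))
      ((cyl T (Metric.ball m R)).indicator fun z => A z * Du z)) :=
  causal_timeCorr (hL.spaceTest hu hρm hρ0 hρR).memLp_D hu.memLp_flux
    (fun z hz => (hL.spaceTest hu hρm hρ0 hρR).supp_D z fun h => by linarith [h.1.2])
    (fun z hz => indicator_of_notMem (fun h => by linarith [h.1.1]) _)

lemma continuous_flux {ρ : ℝ → ℝ} {Rρ : ℝ} (hρm : Measurable ρ) (hρ0 : ∀ t, 0 ≤ ρ t)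
    (hρR : ∀ t, ρ t ≤ Rρ) :
    Continuous (timeCorr (fun z => ρ z.1 * (θ z.1 * (ψ z.2 ^ 2 * {z | κ < u z}.indicator Du z
        + 2 * ψ z.2 * ψ' z.2 * max (u z - κ) 0)))
      ((cyl T (Metric.ball m R)).indicator fun z => A z * Du z)) :=
  continuous_timeCorr (hL.spaceTest hu hρm hρ0 hρR).memLp_D hu.memLp_flux

/-- The gradient estimate: the weight `ρ = 1` makes the time derivative contribute a nonnegative
term. -/
lemma gradient_le (hK : AssumptionK0 k l) :
    1 / 2 * ν * (∫ z : ℝ × ℝ, θ z.1 * (ψ z.2 ^ 2 * {z | κ < u z}.indicator Du z ^ 2)) ≤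
      timeError k u u₀ M p K₀ Lθ m R' t₁ T + 2 * Λ * P ^ 2 * (2 * R' * ∫ s, p s ^ 2) := by
  have hm : Measurable fun _ : ℝ => (1 : ℝ) := measurable_const
  have h0 : ∀ t : ℝ, (0 : ℝ) ≤ (fun _ => 1) t := fun _ => zero_le_one
  have h1 : ∀ t : ℝ, (fun _ : ℝ => (1 : ℝ)) t ≤ 1 := fun _ => le_rfl
  have hlim := hK.tendsto_corr_approxId hu.T_pos (hL.causal_flux hu hm h0 h1)
    (hL.continuous_flux hu hm h0 h1)
  have hflux := hL.flux_ge hu hm h0 h1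
  have hle := le_of_tendsto hlim (b := timeError k u u₀ M p K₀ Lθ m R' t₁ T) (by
    filter_upwards [self_mem_nhdsWithin] with ε hε
    have hε' : 0 < ε := hε
    have h2 := hL.weighted_inequality hu hK hm h0 h1 hε'
    have hI : 0 ≤ ∫ z : ℝ × ℝ, θ z.1 * (ψ z.2 ^ 2 * max (u z - κ) 0 ^ 2) :=
      integral_nonneg fun z => hL.localSquare_nonneg z
    have e1 : timeCorr (fun _ => (1 : ℝ)) (fun z => θ z.1 * (ψ z.2 ^ 2 * max (u z - κ) 0 ^ 2)) =
        fun _ => ∫ z : ℝ × ℝ, θ z.1 * (ψ z.2 ^ 2 * max (u z - κ) 0 ^ 2) := by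
      funext y; simp only [timeCorr, one_mul]
    have e2 := integral_cut_mul hu.T_pos.le (memK k ε) (fun _ => 1)
    simp only [mul_one] at e2
    rw [hK.integral_memK hε' le_rfl hu.T_pos.le, zero_add] at e2
    rw [e1] at h2
    unfold corr at h2
    rw [integral_mul_const, e2] at h2
    have := mul_nonneg (hK.nonneg_k (T + ε) (by linarith [hu.T_pos])) hI
    unfold corr
    linarith)
  simp only [one_mul] at hflux hle
  linarith

/-- Estimate of the localized square on a set `E` of times: the weight `ρ = T_l 1_E`, with
`T_l` the correlation with `l`, is inverted by the nonlocal time derivative. -/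
lemma localSquare_on_le (hK : AssumptionK0 k l) {E : Set ℝ} (hE : MeasurableSet E)
    (hET : E ⊆ Ioo t₁ T) {Rρ : ℝ} (hRρ : 0 ≤ Rρ)
    (hρE : ∀ s ∈ Ioo t₁ T, corr (cut T l) (E.indicator fun _ => 1) s ≤ Rρ) :
    1 / 2 * (∫ z : ℝ × ℝ, E.indicator (fun _ => 1) z.1 *
        (θ z.1 * (ψ z.2 ^ 2 * max (u z - κ) 0 ^ 2))) ≤
      Rρ * (timeError k u u₀ M p K₀ Lθ m R' t₁ T + 2 * Λ * P ^ 2 * (2 * R' * ∫ s, p s ^ 2)) := by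
  set e : ℝ → ℝ := E.indicator fun _ => 1 with he
  have hem : Measurable e := measurable_const.indicator hE
  have he0 : ∀ t, 0 ≤ e t := fun t => indicator_nonneg (fun _ _ => zero_le_one) t
  have he1 : ∀ t, |e t| ≤ 1 := fun t => by
    rw [abs_of_nonneg (he0 t)]; exact indicator_le_self' (fun _ _ => zero_le_one) t
  have hli := hK.integrable_cut_l T
  have hlm := hK.measurable_cut_l T
  set ρ : ℝ → ℝ := (Ioo t₁ T).indicator (corr (cut T l) e) with hρ
  have hm : Measurable ρ := (measurable_corr hlm hem).indicator measurableSet_Ioo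
  have hcorr0 : ∀ s, 0 ≤ corr (cut T l) e s := fun s =>
    integral_nonneg fun a => mul_nonneg (hK.cut_l_nonneg T a) (he0 _)
  have h0 : ∀ t, 0 ≤ ρ t := fun t => indicator_nonneg (fun s _ => hcorr0 s) t
  have h1 : ∀ t, ρ t ≤ Rρ := fun t => by
    by_cases ht : t ∈ Ioo t₁ T
    · rw [hρ, indicator_of_mem ht]; exact hρE t ht
    · rw [hρ, indicator_of_notMem ht]; exact hRρ
  set f : ℝ × ℝ → ℝ := fun z => θ z.1 * (ψ z.2 ^ 2 * max (u z - κ) 0 ^ 2) with hf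
  have hfm : Measurable f := hL.measurable_localSquare hu
  have hfi : Integrable f := hL.integrable_localSquare hu
  have hfz : ∀ z : ℝ × ℝ, z.1 ∉ Ioo t₂ T → f z = 0 := fun z hz => by
    rcases le_or_gt z.1 t₂ with h | h
    · simp only [hf, hL.θ_zero _ h]; ring
    · have := hL.trunc_zero hu (z := z) fun h' => hz ⟨h, h'.2⟩
      simp only [hf, this]; ring
  have ht2 : 0 < t₂ := hL.t₁_nonneg.trans_lt hL.t₁_lt
  set c := timeCorr (fun z => e z.1) f with hc
  have hem' : Measurable fun z : ℝ × ℝ => e z.1 := hem.comp measurable_fst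
  have heL : MemLp (fun z : ℝ × ℝ => e z.1) ∞ := memLp_top_of_bounded hem' fun z => he1 _
  have hcc : Continuous c := by
    have := continuous_translate_pairing (p := 1) (q := ∞) (μ := (volume : Measure (ℝ × ℝ)))
      le_rfl (by norm_num) (memLp_one_iff_integrable.2 hfi) heL (-1, 0)
    refine this.congr fun y => ?_
    have h3 := integral_add_right_eq_self (μ := (volume : Measure (ℝ × ℝ)))
      (fun z => f (z + y • ((-1, 0) : ℝ × ℝ)) * e z.1) (y, 0)
    rw [← h3, hc, timeCorr]
    refine integral_congr_ae (Eventually.of_forall fun z => ?_)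
    dsimp only
    rw [add_smul_neg_time, mul_comm]
    congr 2
    exact Prod.ext (by simp) (by simp)
  have hcX : Causal T c := by
    refine ⟨hcc.measurable, ⟨∫ z, |f z|, fun y => ?_⟩, fun y hy => ?_⟩
    · rw [hc, timeCorr, ← Real.norm_eq_abs]
      refine norm_integral_le_of_norm_le hfi.abs (Eventually.of_forall fun z => ?_)
      rw [norm_mul, Real.norm_eq_abs, Real.norm_eq_abs]
      simpa using mul_le_mul_of_nonneg_right (he1 (z.1 + y)) (abs_nonneg (f z))
    · rw [hc, timeCorr, ← integral_zero (ℝ × ℝ) ℝ]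
      refine integral_congr_ae (Eventually.of_forall fun z => ?_)
      dsimp only
      by_cases hz : z.1 ∈ Ioo t₂ T
      · rw [he, indicator_of_notMem (fun h => by linarith [(hET h).2, hz.1]), zero_mul]
      · rw [hfz z hz, mul_zero]
  have hd : ∀ y, 0 ≤ y → timeCorr (fun z => ρ z.1) f y = corr (cut T l) c y := fun y hy => by
    have hL1 := integral_mul_translate_average (p := ∞) (q := 1) (μ := (volume : Measure (ℝ × ℝ)))
      (φ := fun z => e (z.1 + y)) hli hlm (hem.comp (by fun_prop))
      (memLp_top_of_bounded (hem.comp (by fun_prop)) fun z => he1 _)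
      (memLp_one_iff_integrable.2 hfi) (1, 0)
    simp only [add_smul_time] at hL1
    have e3 : corr (cut T l) c y = ∫ a, cut T l a * ∫ z : ℝ × ℝ, e (z.1 + a + y) * f z := by
      unfold corr
      refine integral_congr_ae (Eventually.of_forall fun a => ?_)
      dsimp only
      rw [hc, timeCorr]
      simp only [add_comm y a, add_assoc]
    rw [e3, ← hL1, timeCorr]
    refine integral_congr_ae (Eventually.of_forall fun z => ?_)
    dsimp only
    by_cases hz : z.1 ∈ Ioo t₂ T
    · congr 1
      have e4 : ∫ a, cut T l a * e (z.1 + a + y) = corr (cut T l) e (z.1 + y) := by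
        unfold corr
        refine integral_congr_ae (Eventually.of_forall fun a => ?_)
        dsimp only; congr 2; ring
      rw [e4]
      by_cases hs : z.1 + y < T
      · exact indicator_of_mem (show z.1 + y ∈ Ioo t₁ T from
          ⟨by linarith [hz.1, hL.t₁_lt], hs⟩) _
      · rw [hρ, indicator_of_notMem fun h => hs h.2]
        unfold corr
        rw [← integral_zero ℝ ℝ]
        refine integral_congr_ae (Eventually.of_forall fun a => ?_)
        dsimp only
        rcases le_or_gt a 0 with ha | ha
        · rw [cut_nonpos a ha, zero_mul]
        · rw [he, indicator_of_notMem (fun h => hs (by linarith [(hET h).2])), mul_zero]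
    · rw [hfz z hz, mul_zero, mul_zero]
  have hlim1 := hK.tendsto_corr_approxId hu.T_pos hcX hcc
  have hlim2 := hK.tendsto_corr_approxId hu.T_pos (hL.causal_flux hu hm h0 h1)
    (hL.continuous_flux hu hm h0 h1)
  have hflux := hL.flux_ge hu hm h0 h1
  have hle := le_of_tendsto ((hlim1.const_mul (1 / 2)).add hlim2)
    (b := Rρ * timeError k u u₀ M p K₀ Lθ m R' t₁ T) (by
    filter_upwards [self_mem_nhdsWithin] with ε hε
    have hε' : 0 < ε := hε
    have h2 := hL.weighted_inequality hu hK hm h0 h1 hε'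
    have e5 : corr (cut T (memK k ε)) (timeCorr (fun z => ρ z.1) f) 0 =
        corr (cut T (memK k ε)) (corr (cut T l) c) 0 := by
      change ∫ a, cut T (memK k ε) a * timeCorr (fun z => ρ z.1) f (0 + a) =
        ∫ a, cut T (memK k ε) a * corr (cut T l) c (0 + a)
      refine integral_congr_ae (Eventually.of_forall fun a => ?_)
      dsimp only
      rcases le_or_gt a 0 with ha | ha
      · rw [cut_nonpos a ha, zero_mul, zero_mul]
      · rw [hd (0 + a) (by linarith)]
    rw [hd 0 le_rfl, e5, ← hK.corr_approxId hε' hcX le_rfl] at h2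
    exact h2)
  have hg0 : 0 ≤ ∫ z : ℝ × ℝ, ρ z.1 * (θ z.1 * (ψ z.2 ^ 2 * {z | κ < u z}.indicator Du z ^ 2)) :=
    integral_nonneg fun z => mul_nonneg (h0 _) (mul_nonneg (hL.θ_nonneg _) (by positivity))
  have hc0 : c 0 = ∫ z : ℝ × ℝ, e z.1 * f z := by rw [hc, timeCorr]; simp only [add_zero]
  rw [← hc0]
  have := mul_nonneg (mul_nonneg (by norm_num : (0 : ℝ) ≤ 1 / 2) hu.ν_pos.le) hg0
  linarith

end Localization

end Energy

/-! ### Scaling properties of the kernels -/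

lemma integral_mul_scale (l : ℝ → ℝ) {η t : ℝ} (hη : 0 < η) :
    ∫ s in (0 : ℝ)..(η * t), l s = η * ∫ s in (0 : ℝ)..t, l (η * s) := by
  have := intervalIntegral.integral_comp_mul_left (a := 0) (b := t) l hη.ne'
  rw [this, mul_zero, smul_eq_mul, ← mul_assoc, mul_inv_cancel₀ hη.ne', one_mul]

namespace AssumptionK0

variable {k l : ℝ → ℝ} (h : AssumptionK0 k l)
include h

lemma continuousOn_integral_l : ContinuousOn (fun t => ∫ s in (0 : ℝ)..t, l s) (Ici 0) := by
  intro t ht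
  have hc : ContinuousOn (fun t => ∫ s in (0 : ℝ)..t, l s) (Icc 0 (t + 1)) := by
    have := intervalIntegral.continuousOn_primitive_interval (f := l) (a := 0) (b := t + 1)
      (μ := volume) ?_
    · rwa [uIcc_of_le (by linarith [mem_Ici.1 ht])] at this
    rw [uIcc_of_le (by linarith [mem_Ici.1 ht])]
    exact h.locInt_l.integrableOn_compact_subset Icc_subset_Ici_self isCompact_Icc
  refine (hc t ⟨ht, by linarith⟩).mono_of_mem_nhdsWithin ?_
  rw [← Ici_inter_Iic]
  exact inter_mem_nhdsWithin _ (Iic_mem_nhds (by linarith))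

lemma integral_l_mono {a b : ℝ} (ha : 0 ≤ a) (hab : a ≤ b) :
    ∫ s in (0 : ℝ)..a, l s ≤ ∫ s in (0 : ℝ)..b, l s := by
  rw [← intervalIntegral.integral_add_adjacent_intervals (h.intervalIntegrable_l le_rfl ha)
    (h.intervalIntegrable_l ha (ha.trans hab))]
  have : 0 ≤ ∫ s in a..b, l s := by
    rw [intervalIntegral.integral_of_le hab]
    exact setIntegral_nonneg measurableSet_Ioc fun s hs => h.nonneg_l s (ha.trans_lt hs.1)
  linarith

lemma integral_l_pos {t : ℝ} (ht : 0 < t) : 0 < ∫ s in (0 : ℝ)..t, l s := by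
  have hnn : 0 ≤ ∫ s in (0 : ℝ)..t, l s := by
    have := h.integral_l_mono le_rfl ht.le
    simpa using this
  refine lt_of_le_of_ne hnn fun h0 => ?_
  -- otherwise `l` vanishes on `(0, t)`, contradicting `k * l = 1` at time `t`
  rw [intervalIntegral.integral_of_le ht.le, integral_Ioc_eq_integral_Ioo] at h0
  have hli : IntegrableOn l (Ioo 0 t) :=
    (h.locInt_l.integrableOn_compact_subset Icc_subset_Ici_self
      (isCompact_Icc (a := 0) (b := t))).mono_set Ioo_subset_Icc_self
  have h1 := (setIntegral_eq_zero_iff_of_nonneg_ae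
    ((ae_restrict_iff' measurableSet_Ioo).2 (Eventually.of_forall fun s hs =>
      h.nonneg_l s hs.1)) hli).1 h0.symm
  have h2 := h.conv_eq_one t ht
  unfold conv at h2
  rw [intervalIntegral.integral_of_le ht.le, integral_Ioc_eq_integral_Ioo,
    integral_congr_ae (g := fun _ => 0)] at h2
  · simp at h2
  · filter_upwards [h1] with s hs
    rw [hs]; simp

lemma intervalIntegrable_l_mul {η t : ℝ} (hη : 0 < η) (ht : 0 ≤ t) :
    IntervalIntegrable (fun s => l (η * s)) volume 0 t := by
  have := (h.intervalIntegrable_l le_rfl (mul_nonneg hη.le ht)).comp_mul_left (c := η)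
  simpa [mul_div_cancel_left₀ _ hη.ne'] using this

/-- Since `l` is nonincreasing, `(1 * l)(η t)` and `(1 * l)(t)` are comparable. -/
lemma integral_l_mul_le {η t : ℝ} (hη : 0 < η) (ht : 0 ≤ t) :
    ∫ s in (0 : ℝ)..(η * t), l s ≤ max 1 η * ∫ s in (0 : ℝ)..t, l s := by
  have h0 : 0 ≤ ∫ s in (0 : ℝ)..t, l s := by
    have := h.integral_l_mono le_rfl ht
    simpa using this
  rcases le_total η 1 with h1 | h1
  · refine (h.integral_l_mono (mul_nonneg hη.le ht) (mul_le_of_le_one_left ht h1)).trans ?_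
    exact le_mul_of_one_le_left h0 (le_max_left _ _)
  · rw [integral_mul_scale l hη, max_eq_right h1]
    refine mul_le_mul_of_nonneg_left ?_ hη.le
    refine intervalIntegral.integral_mono_on_of_le_Ioo ht (h.intervalIntegrable_l_mul hη ht)
      (h.intervalIntegrable_l le_rfl ht) fun s hs => ?_
    exact h.antitone_l (mem_Ioi.2 hs.1) (mem_Ioi.2 (mul_pos hη hs.1))
      (le_mul_of_one_le_left hs.1.le h1)

lemma le_integral_l_mul {η t : ℝ} (hη : 0 < η) (ht : 0 ≤ t) :
    min 1 η * ∫ s in (0 : ℝ)..t, l s ≤ ∫ s in (0 : ℝ)..(η * t), l s := by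
  have h0 : 0 ≤ ∫ s in (0 : ℝ)..t, l s := by
    have := h.integral_l_mono le_rfl ht
    simpa using this
  rcases le_total η 1 with h1 | h1
  · rw [integral_mul_scale l hη, min_eq_right h1]
    refine mul_le_mul_of_nonneg_left ?_ hη.le
    refine intervalIntegral.integral_mono_on_of_le_Ioo ht
      (h.intervalIntegrable_l le_rfl ht) (h.intervalIntegrable_l_mul hη ht) fun s hs => ?_
    exact h.antitone_l (mem_Ioi.2 (mul_pos hη hs.1)) (mem_Ioi.2 hs.1)
      (mul_le_of_le_one_left hs.1.le h1)
  · refine le_trans ?_ (h.integral_l_mono ht (le_mul_of_one_le_left ht h1))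
    exact mul_le_of_le_one_left h0 (min_le_left _ _)

lemma mul_l_le {t : ℝ} (ht : 0 < t) : t * l t ≤ ∫ s in (0 : ℝ)..t, l s := by
  have h1 := intervalIntegral.integral_mono_on_of_le_Ioo ht.le
    (intervalIntegrable_const (μ := volume) (c := l t)) (h.intervalIntegrable_l le_rfl ht.le)
    fun s hs => h.antitone_l (mem_Ioi.2 hs.1) (mem_Ioi.2 ht) hs.2.le
  simpa using h1

/-- `l(t) (1 * k)(t) ≤ (l * k)(t) = 1`. -/
lemma l_mul_integral_k_le {t : ℝ} (ht : 0 < t) : l t * ∫ s in (0 : ℝ)..t, k s ≤ 1 := by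
  have h1 := intervalIntegral.integral_comp_sub_left (a := 0) (b := t) k t
  simp only [sub_self, sub_zero] at h1
  rw [← h.conv_eq_one t ht, ← h1, ← intervalIntegral.integral_const_mul]
  unfold conv
  have hi : IntervalIntegrable (fun s => k (t - s)) volume 0 t := by
    have := (h.intervalIntegrable_k le_rfl ht.le).comp_sub_left t
    simpa using this.symm
  refine intervalIntegral.integral_mono_on_of_le_Ioo ht.le (hi.const_mul _) ?_ fun s hs => ?_
  · by_contra hni
    have := h.conv_eq_one t ht
    unfold conv at this
    rw [intervalIntegral.integral_undef hni] at this
    exact zero_ne_one this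
  · rw [mul_comm]
    exact mul_le_mul_of_nonneg_left (h.antitone_l (mem_Ioi.2 hs.1) (mem_Ioi.2 ht) hs.2.le)
      (h.nonneg_k _ (by linarith [hs.2]))

/-- Under (K1), the integral of `l` over a subset of `(0, S)` is controlled by its measure. -/
lemma setIntegral_l_le {p tK cbar : ℝ} (h1 : AssumptionK1 l p tK cbar) {S : ℝ} (hS : 0 < S)
    (hSK : S ≤ tK) {D : Set ℝ} (hD : MeasurableSet D) (hDS : D ⊆ Ioo 0 S) :
    ∫ s in D, l s ≤ cbar ^ (1 / p) * (S ^ (1 / p) * l S) * (volume.real D) ^ (1 - 1 / p) := by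
  have hp := h1.one_lt_p
  have hp0 : 0 < p := by linarith
  have hpq : p.HolderConjugate p.conjExponent := Real.HolderConjugate.conjExponent hp
  have hl : MemLp l (ENNReal.ofReal p) (volume.restrict (Ioo 0 S)) :=
    h1.memLp_l.mono_measure (Measure.restrict_mono (Ioo_subset_Ioo_right hSK) le_rfl)
  have hg : MemLp (D.indicator fun _ => (1 : ℝ)) (ENNReal.ofReal p.conjExponent)
      (volume.restrict (Ioo 0 S)) :=
    memLp_indicator_const _ hD 1 (Or.inr (by
      refine ne_top_of_le_ne_top ?_ (Measure.restrict_apply_le _ _)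
      exact ne_top_of_le_ne_top (measure_Ioo_lt_top (a := 0) (b := S)).ne (measure_mono hDS)))
  have hH := integral_mul_le_Lp_mul_Lq_of_nonneg hpq (μ := volume.restrict (Ioo 0 S))
    ((ae_restrict_iff' measurableSet_Ioo).2 (Eventually.of_forall fun s hs => h.nonneg_l s hs.1))
    (Eventually.of_forall fun s => indicator_nonneg (fun _ _ => zero_le_one) s) hl hg
  have e1 : ∫ s in Ioo 0 S, l s * D.indicator (fun _ => (1 : ℝ)) s = ∫ s in D, l s := by
    have : (fun s => l s * D.indicator (fun _ => (1 : ℝ)) s) = D.indicator l := by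
      funext s
      by_cases hs : s ∈ D
      · rw [indicator_of_mem hs, indicator_of_mem hs, mul_one]
      · rw [indicator_of_notMem hs, indicator_of_notMem hs, mul_zero]
    rw [this, setIntegral_indicator hD, inter_eq_self_of_subset_right hDS]
  have e2 : ∫ s in Ioo 0 S, D.indicator (fun _ => (1 : ℝ)) s ^ p.conjExponent = volume.real D := by
    have : (fun s => D.indicator (fun _ => (1 : ℝ)) s ^ p.conjExponent) =
        D.indicator fun _ => (1 : ℝ) := by
      funext s
      by_cases hs : s ∈ D
      · rw [indicator_of_mem hs, Real.one_rpow]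
      · rw [indicator_of_notMem hs, Real.zero_rpow hpq.symm.ne_zero]
    rw [this, setIntegral_indicator hD, inter_eq_self_of_subset_right hDS]
    simp
  have e3 : ∫ s in Ioo 0 S, l s ^ p ≤ cbar * (S * l S ^ p) := by
    have h2 := h1.average_le S hS hSK
    rw [intervalIntegral.integral_of_le hS.le, integral_Ioc_eq_integral_Ioo] at h2
    rw [one_div, inv_mul_le_iff₀ hS] at h2
    linarith
  have e4 : 1 / p.conjExponent = 1 - 1 / p := by
    have := hpq.inv_add_inv_eq_one
    rw [one_div, one_div]; linarith
  rw [e1, e2, e4] at hH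
  have hc : 0 < cbar := by linarith [h1.one_lt_cbar]
  have hlS := h.nonneg_l S hS
  have e5 : (∫ s in Ioo 0 S, l s ^ p) ^ (1 / p) ≤ cbar ^ (1 / p) * (S ^ (1 / p) * l S) := by
    have h3 : 0 ≤ ∫ s in Ioo 0 S, l s ^ p := setIntegral_nonneg measurableSet_Ioo fun s hs =>
      Real.rpow_nonneg (h.nonneg_l s hs.1) _
    refine (Real.rpow_le_rpow h3 e3 (by positivity)).trans_eq ?_
    rw [Real.mul_rpow hc.le (by positivity), Real.mul_rpow hS.le (by positivity),
      ← Real.rpow_mul hlS, mul_one_div_cancel hp0.ne', Real.rpow_one]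
  exact hH.trans (mul_le_mul_of_nonneg_right e5 (Real.rpow_nonneg measureReal_nonneg _))

/-- Under (K1), `l` satisfies `(1 * l)(S) ≤ C S l(S)`. -/
lemma integral_l_le_mul {p tK cbar : ℝ} (h1 : AssumptionK1 l p tK cbar) {S : ℝ} (hS : 0 < S)
    (hSK : S ≤ tK) : ∫ s in (0 : ℝ)..S, l s ≤ cbar ^ (1 / p) * (S * l S) := by
  have := h.setIntegral_l_le h1 hS hSK measurableSet_Ioo le_rfl
  rw [Real.volume_real_Ioo_of_le hS.le, sub_zero] at this
  rw [intervalIntegral.integral_of_le hS.le, integral_Ioc_eq_integral_Ioo]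
  refine this.trans_eq ?_
  have e : S = S ^ (1 / p) * S ^ (1 - 1 / p) := by
    rw [← Real.rpow_add hS]; simp
  calc _ = cbar ^ (1 / p) * ((S ^ (1 / p) * S ^ (1 - 1 / p)) * l S) := by ring
    _ = _ := by rw [← e]

end AssumptionK0

/-- The properties of the kernels on the scale of a radius `r` and the time `τ = Φ(r)` on which the
iteration rests. The integral of `l` over a set of time lags of measure `|E|` gains the factor
`(|E| / τ) ^ β`, and `-k'` at a short lag is controlled by `-k'` at a longer one. -/
structure KernelScale (k l : ℝ → ℝ) (η β Cl Ck ω cη r τ : ℝ) : Prop where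
  r_pos : 0 < r
  pos : 0 < τ
  integral_k_le : ∫ s in (0 : ℝ)..(η * τ), k s ≤ Ck * (τ / r ^ 2)
  corr_l_le : ∀ (T s : ℝ) (E : Set ℝ), MeasurableSet E → E ⊆ Iio (s + η * τ) → volume E ≠ ∞ →
    corr (cut T l) (E.indicator fun _ => 1) s ≤ Cl * r ^ 2 * (volume.real E / τ) ^ β
  memory_le : ∀ x y, 0 < y → y ≤ 1 → 0 < x * (1 - y) → x * (1 - y) ≤ η * τ →
    -deriv k (x * y) ≤ cη * y ^ (-ω) * (-deriv k x)

/-- For small `r` the kernels have the properties required for the iteration with `β = 1 - 1 / p`.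
The bound `rstar` is chosen such that `Φ(r) ≤ 1` and `η Φ(r)` lies in the range of (K1). -/
lemma AssumptionK0.exists_kernelScale {k l c : ℝ → ℝ} {p tK cbar c₀ ω η : ℝ}
    (h0 : AssumptionK0 k l) (h1 : AssumptionK1 l p tK cbar) (h3 : AssumptionK3 k l c₀ ω c)
    (hη : 0 < η) :
    ∃ rstar, 0 < rstar ∧ ENNReal.ofReal rstar < r₀ l ∧ ∀ r, 0 < r → r ≤ rstar →
      KernelScale k l η (1 - 1 / p) (cbar ^ (1 / p) * max 1 η * η ^ (-(1 - 1 / p)))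
        (cbar ^ (1 / p) * (η / min 1 η)) ω (c η) r (Φ l r) := by
  have hp := h1.one_lt_p
  have hcb : 0 < cbar := by linarith [h1.one_lt_cbar]
  set L : ℝ → ℝ := fun t => ∫ s in (0 : ℝ)..t, l s with hLdef
  set tm := min 1 tK / max 1 η with htm
  have hm1 : 0 < max 1 η := lt_of_lt_of_le one_pos (le_max_left _ _)
  have hmin : 0 < min 1 tK := lt_min one_pos h1.pos_tK
  have htm0 : 0 < tm := div_pos hmin hm1
  have htm1 : tm ≤ min 1 tK := div_le_self hmin.le (le_max_left _ _)
  have htm2 : η * tm ≤ min 1 tK := by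
    rw [htm, mul_div_assoc', div_le_iff₀ hm1, mul_comm η]
    exact mul_le_mul_of_nonneg_left (le_max_right _ _) hmin.le
  have hLpos : 0 < L tm := h0.integral_l_pos htm0
  refine ⟨Real.sqrt (L tm / 2), Real.sqrt_pos.2 (by positivity), ?_, fun r hr hrs => ?_⟩
  · unfold r₀
    have e1 : ENNReal.ofReal (L tm) ≤ ∫⁻ t in Ioi (0 : ℝ), ENNReal.ofReal (l t) := by
      have hli : IntegrableOn l (Ioc 0 tm) := (h0.intervalIntegrable_l le_rfl htm0.le).1
      simp only [hLdef]
      rw [intervalIntegral.integral_of_le htm0.le, ofReal_integral_eq_lintegral_ofReal hli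
        ((ae_restrict_iff' measurableSet_Ioc).2 (Eventually.of_forall fun s hs =>
          h0.nonneg_l s hs.1))]
      exact lintegral_mono_set Ioc_subset_Ioi_self
    refine lt_of_lt_of_le ?_ (ENNReal.rpow_le_rpow e1 (by norm_num))
    rw [ENNReal.ofReal_rpow_of_nonneg hLpos.le (by norm_num), ← Real.sqrt_eq_rpow]
    exact (ENNReal.ofReal_lt_ofReal_iff (Real.sqrt_pos.2 hLpos)).2
      (Real.sqrt_lt_sqrt (by positivity) (by linarith))
  have hr2 : 0 < r ^ 2 := by positivity
  have hrL : r ^ 2 ≤ L tm / 2 := by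
    rw [← Real.sq_sqrt (by positivity : 0 ≤ L tm / 2)]
    exact pow_le_pow_left₀ hr.le hrs 2
  have hLc : ContinuousOn L (Ici 0) := h0.continuousOn_integral_l
  have hL0 : L 0 = 0 := by simp [hLdef]
  have hset : {t : ℝ | 0 < t ∧ k₁ l t = (r ^ 2)⁻¹} = Ici 0 ∩ L ⁻¹' {r ^ 2} := by
    ext t
    simp only [mem_ofPred_eq, k₁, inv_inj, mem_inter_iff, mem_Ici, mem_preimage, mem_singleton_iff]
    refine ⟨fun ht => ⟨ht.1.le, ht.2⟩, fun ht => ⟨lt_of_le_of_ne ht.1 fun hh => ?_, ht.2⟩⟩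
    rw [← hh, hL0] at ht
    exact hr2.ne ht.2
  have hclosed : IsClosed (Ici 0 ∩ L ⁻¹' {r ^ 2}) :=
    hLc.preimage_isClosed_of_isClosed isClosed_Ici isClosed_singleton
  obtain ⟨t, ht, hLt⟩ := intermediate_value_Icc htm0.le (hLc.mono Icc_subset_Ici_self)
    (show r ^ 2 ∈ Icc (L 0) (L tm) from ⟨by rw [hL0]; exact hr2.le, by linarith⟩)
  have hbdd : BddBelow (Ici 0 ∩ L ⁻¹' {r ^ 2}) := ⟨0, fun t ht => ht.1⟩
  have hmem : Φ l r ∈ Ici 0 ∩ L ⁻¹' {r ^ 2} := by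
    unfold Φ; rw [hset]
    exact hclosed.csInf_mem ⟨t, ht.1, hLt⟩ hbdd
  have hle : Φ l r ≤ tm := by
    unfold Φ; rw [hset]
    exact (csInf_le hbdd ⟨ht.1, hLt⟩).trans ht.2
  set τ := Φ l r with hτ
  have hLτ : L τ = r ^ 2 := hmem.2
  have hτ0 : 0 < τ := lt_of_le_of_ne hmem.1 fun hh => by
    rw [← hh, hL0] at hLτ; exact hr2.ne hLτ
  have hS0 : 0 < η * τ := mul_pos hη hτ0
  have hSK : η * τ ≤ tK :=
    (mul_le_mul_of_nonneg_left hle hη.le).trans (htm2.trans (min_le_right _ _))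
  have hmη : 0 < min 1 η := lt_min one_pos hη
  have hLS1 : L (η * τ) ≤ max 1 η * r ^ 2 := by
    rw [← hLτ]; exact h0.integral_l_mul_le hη hτ0.le
  have hLS2 : min 1 η * r ^ 2 ≤ L (η * τ) := by
    rw [← hLτ]; exact h0.le_integral_l_mul hη hτ0.le
  have hcp : 0 < cbar ^ (1 / p) := Real.rpow_pos_of_pos hcb _
  have hlS := h0.nonneg_l _ hS0
  refine ⟨hr, hτ0, ?_, fun T s E hE hEs hEf => ?_, fun x y hy hy1 hxy hxy' => ?_⟩
  · have a1 := h0.integral_l_le_mul h1 hS0 hSK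
    have a2 := h0.l_mul_integral_k_le hS0
    have a3 : 0 ≤ ∫ s in (0 : ℝ)..(η * τ), k s := by
      rw [intervalIntegral.integral_of_le hS0.le]
      exact setIntegral_nonneg measurableSet_Ioc fun s hs => h0.nonneg_k s hs.1
    have a4 : min 1 η * r ^ 2 * (∫ s in (0 : ℝ)..(η * τ), k s) ≤ cbar ^ (1 / p) * (η * τ) := by
      calc _ ≤ cbar ^ (1 / p) * (η * τ * l (η * τ)) * ∫ s in (0 : ℝ)..(η * τ), k s :=
            mul_le_mul_of_nonneg_right (hLS2.trans a1) a3
        _ = cbar ^ (1 / p) * (η * τ) * (l (η * τ) * ∫ s in (0 : ℝ)..(η * τ), k s) := by ring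
        _ ≤ cbar ^ (1 / p) * (η * τ) * 1 := mul_le_mul_of_nonneg_left a2 (by positivity)
        _ = _ := mul_one _
    have a5 : cbar ^ (1 / p) * (η / min 1 η) * (τ / r ^ 2) =
        cbar ^ (1 / p) * (η * τ) / (min 1 η * r ^ 2) := by
      field_simp
    rw [a5, le_div_iff₀ (by positivity)]
    linarith
  · set D : Set ℝ := Ioo 0 (η * τ) ∩ (fun a => s + a) ⁻¹' E with hD
    have hDm : MeasurableSet D := measurableSet_Ioo.inter ((measurable_const_add s) hE)
    have b1 : corr (cut T l) (E.indicator fun _ => 1) s ≤ ∫ a in D, l a := by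
      rw [← integral_indicator hDm]
      refine integral_mono_of_nonneg (Eventually.of_forall fun a => mul_nonneg
        (h0.cut_l_nonneg T a) (indicator_nonneg (fun _ _ => zero_le_one) _)) ?_
        (Eventually.of_forall fun a => ?_)
      · refine (integrable_indicator_iff hDm).2 (IntegrableOn.mono_set ?_ inter_subset_left)
        exact (h0.locInt_l.integrableOn_compact_subset Icc_subset_Ici_self
          (isCompact_Icc (a := 0) (b := η * τ))).mono_set Ioo_subset_Icc_self
      · dsimp only
        have hnn : 0 ≤ D.indicator l a := indicator_nonneg (fun a ha => h0.nonneg_l a ha.1.1) a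
        by_cases ha : a ∈ Ioo 0 T
        · by_cases hE' : s + a ∈ E
          · have hs := hEs hE'
            rw [cut_of_mem ha, indicator_of_mem hE', mul_one, indicator_of_mem]
            exact ⟨⟨ha.1, by linarith [mem_Iio.1 hs]⟩, hE'⟩
          · rw [indicator_of_notMem hE', mul_zero]; exact hnn
        · rw [cut_of_notMem ha, zero_mul]; exact hnn
    have b2 := h0.setIntegral_l_le h1 hS0 hSK hDm inter_subset_left
    have b3 : volume.real D ≤ volume.real E := by
      refine ENNReal.toReal_mono hEf ?_
      calc volume D ≤ volume ((fun a => s + a) ⁻¹' E) := measure_mono inter_subset_right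
        _ = volume E := measure_preimage_add volume s E
    have hβ : 0 ≤ 1 - 1 / p := by
      rw [sub_nonneg, div_le_one (by linarith)]; exact hp.le
    have b4 : (η * τ) ^ (1 / p) * l (η * τ) * (η * τ) ^ (1 - 1 / p) ≤ max 1 η * r ^ 2 := by
      have e : (η * τ) ^ (1 / p) * (η * τ) ^ (1 - 1 / p) = η * τ := by
        rw [← Real.rpow_add hS0]; simp
      calc _ = ((η * τ) ^ (1 / p) * (η * τ) ^ (1 - 1 / p)) * l (η * τ) := by ring
        _ = η * τ * l (η * τ) := by rw [e]
        _ ≤ _ := (h0.mul_l_le hS0).trans hLS1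
    have b5 : volume.real D ^ (1 - 1 / p) ≤ volume.real E ^ (1 - 1 / p) :=
      Real.rpow_le_rpow measureReal_nonneg b3 hβ
    have b6 : volume.real E ^ (1 - 1 / p) = (η * τ) ^ (1 - 1 / p) *
        (η ^ (-(1 - 1 / p)) * (volume.real E / τ) ^ (1 - 1 / p)) := by
      rw [Real.div_rpow measureReal_nonneg hτ0.le, Real.mul_rpow hη.le hτ0.le,
        Real.rpow_neg hη.le]
      have := (Real.rpow_pos_of_pos hη (1 - 1 / p)).ne'
      have := (Real.rpow_pos_of_pos hτ0 (1 - 1 / p)).ne'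
      field_simp
    have hX : 0 ≤ η ^ (-(1 - 1 / p)) * (volume.real E / τ) ^ (1 - 1 / p) := by
      have : 0 ≤ volume.real E := measureReal_nonneg
      positivity
    calc _ ≤ _ := b1.trans b2
      _ ≤ cbar ^ (1 / p) * ((η * τ) ^ (1 / p) * l (η * τ)) * volume.real E ^ (1 - 1 / p) :=
          mul_le_mul_of_nonneg_left b5 (by positivity)
      _ = cbar ^ (1 / p) * ((η * τ) ^ (1 / p) * l (η * τ) * (η * τ) ^ (1 - 1 / p)) *
          (η ^ (-(1 - 1 / p)) * (volume.real E / τ) ^ (1 - 1 / p)) := by rw [b6]; ring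
      _ ≤ cbar ^ (1 / p) * (max 1 η * r ^ 2) *
          (η ^ (-(1 - 1 / p)) * (volume.real E / τ) ^ (1 - 1 / p)) :=
          mul_le_mul_of_nonneg_right (mul_le_mul_of_nonneg_left b4 hcp.le) hX
      _ = _ := by ring
  · refine h3.neg_deriv_mul_le η hη x y hy hy1 hxy (hxy'.trans ?_)
    refine mul_le_of_le_one_right hη.le (hle.trans (htm1.trans (min_le_left _ _)))

/-! ### Suprema over balls -/

/-- The supremum of `u(t, ·)` over the ball `B(m, R)`, taken over the countable dense set of points
`m + R q` with `q` rational, so that it is measurable in `t`. -/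
noncomputable def ballSup (u : ℝ × ℝ → ℝ) (m R t : ℝ) : ℝ :=
  ⨆ q : {q : ℚ // |(q : ℝ)| < 1}, u (t, m + R * (q : ℚ))

instance nonempty_rat_lt_one : Nonempty {q : ℚ // |(q : ℝ)| < 1} := ⟨⟨0, by simp⟩⟩

lemma measurable_ballSup {u : ℝ × ℝ → ℝ} (hu : Measurable u) (m R : ℝ) :
    Measurable (ballSup u m R) := by
  unfold ballSup
  exact Measurable.iSup fun q => hu.comp (by fun_prop)

lemma mem_ball_of_rat {m R : ℝ} (hR : 0 < R) (q : {q : ℚ // |(q : ℝ)| < 1}) :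
    m + R * ((q : ℚ) : ℝ) ∈ Metric.ball m R := by
  rw [Metric.mem_ball, Real.dist_eq, add_sub_cancel_left, abs_mul, abs_of_pos hR]
  exact mul_lt_of_lt_one_right hR q.2

lemma ballSup_le {u : ℝ × ℝ → ℝ} {m R t C : ℝ} (hR : 0 < R)
    (h : ∀ x ∈ Metric.ball m R, u (t, x) ≤ C) : ballSup u m R t ≤ C :=
  ciSup_le fun q => h _ (mem_ball_of_rat hR q)

lemma le_ballSup {u : ℝ × ℝ → ℝ} {m R t C x : ℝ} (hR : 0 < R)
    (hc : Continuous fun x => u (t, x)) (hC : ∀ x, u (t, x) ≤ C)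
    (hx : x ∈ Metric.closedBall m R) : u (t, x) ≤ ballSup u m R t := by
  have hcl : IsClosed {y : ℝ | u (t, m + R * y) ≤ ballSup u m R t} :=
    isClosed_le (hc.comp (by fun_prop)) continuous_const
  have h1 : Ioo (-1 : ℝ) 1 ∩ range ((↑) : ℚ → ℝ) ⊆ {y : ℝ | u (t, m + R * y) ≤ ballSup u m R t} := by
    rintro y ⟨hy, q, rfl⟩
    exact le_ciSup (f := fun q : {q : ℚ // |(q : ℝ)| < 1} => u (t, m + R * (q : ℚ)))
      ⟨C, by rintro _ ⟨q, rfl⟩; exact hC _⟩ ⟨q, abs_lt.2 hy⟩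
  have h2 : Icc (-1 : ℝ) 1 ⊆ {y : ℝ | u (t, m + R * y) ≤ ballSup u m R t} := by
    rw [← closure_Ioo (by norm_num : (-1 : ℝ) ≠ 1)]
    refine closure_minimal ?_ hcl
    exact (Rat.denseRange_cast.open_subset_closure_inter isOpen_Ioo).trans (closure_minimal h1 hcl)
  have h3 : (x - m) / R ∈ Icc (-1 : ℝ) 1 := by
    rw [Metric.mem_closedBall, Real.dist_eq, abs_le] at hx
    constructor
    · rw [le_div_iff₀ hR]; linarith
    · rw [div_le_iff₀ hR]; linarith
  have h4 := h2 h3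
  have h5 : m + R * ((x - m) / R) = x := by field_simp; ring
  have h6 : u (t, m + R * ((x - m) / R)) ≤ ballSup u m R t := h4
  rwa [h5] at h6

namespace RegularSub

variable {k : ℝ → ℝ} {T m R ν Λ : ℝ} {A : ℝ × ℝ → ℝ} {u₀ : ℝ → ℝ} {u Du : ℝ × ℝ → ℝ}
    {N : ℝ → ℝ} (hu : RegularSub k T m R ν Λ A u₀ u Du N)
include hu

lemma le_ballSup {m' R' t x : ℝ} (hR : 0 < R') (hx : x ∈ Metric.closedBall m' R') :
    u (t, x) ≤ ballSup u m' R' t :=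
  Subdiffusion.le_ballSup (C := N t) hR (hu.prim t).continuous (fun x => hu.le_N (t, x)) hx

lemma ballSup_nonneg {m' R' t : ℝ} (hR : 0 < R') : 0 ≤ ballSup u m' R' t :=
  (hu.nonneg (t, m')).trans (hu.le_ballSup hR (Metric.mem_closedBall_self hR.le))

lemma ballSup_le_N {m' R' t : ℝ} (hR : 0 < R') : ballSup u m' R' t ≤ N t :=
  ballSup_le hR fun x _ => hu.le_N (t, x)

lemma ballSup_mono {m' R₁ R₂ t : ℝ} (h1 : 0 < R₁) (h12 : R₁ ≤ R₂) :
    ballSup u m' R₁ t ≤ ballSup u m' R₂ t :=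
  ballSup_le h1 fun _ hx => hu.le_ballSup (h1.trans_le h12)
    (Metric.ball_subset_closedBall (Metric.ball_subset_ball h12 hx))

lemma ballSup_trunc_le_N {m' R' t κ : ℝ} (hR : 0 < R') (hκ : 0 ≤ κ) :
    max (ballSup u m' R' t - κ) 0 ≤ N t :=
  max_le (by linarith [hu.ballSup_le_N (m' := m') (t := t) hR]) (hu.N_nonneg t)

lemma integrable_ballSup_trunc_sq {m' R' κ : ℝ} (hR : 0 < R') (hκ : 0 ≤ κ) :
    Integrable fun t => max (ballSup u m' R' t - κ) 0 ^ 2 := by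
  refine hu.memLp_N.integrable_sq.mono' ?_ (Eventually.of_forall fun t => ?_)
  · exact ((((measurable_ballSup hu.meas m' R').sub_const κ).max
      measurable_const).pow_const 2).aestronglyMeasurable
  · rw [Real.norm_of_nonneg (sq_nonneg _)]
    exact pow_le_pow_left₀ (le_max_right _ _) (hu.ballSup_trunc_le_N hR hκ) 2

end RegularSub

/-- One-dimensional Sobolev inequality with a weight `lam` between the two norms. -/
lemma IsPrimitive.sq_le {g h : ℝ → ℝ} (hg : IsPrimitive g h) {m R : ℝ}
    (h0 : ∀ x, x ∉ Metric.closedBall m R → g x = 0) (hi : Integrable fun x => g x ^ 2)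
    (hi' : Integrable fun x => h x ^ 2) {lam : ℝ} (hlam : 0 < lam) (x : ℝ) :
    g x ^ 2 ≤ ∫ y, (lam * g y ^ 2 + 1 / lam * h y ^ 2) := by
  have h1 := hg.mul hg
  have h2 := h1.abs_sub_le (m - |R| - 1) x
  have hz : g (m - |R| - 1) = 0 := h0 _ fun hx => by
    rw [Metric.mem_closedBall, Real.dist_eq, abs_le] at hx
    linarith [hx.1, le_abs_self R]
  rw [hz, mul_zero, sub_zero, abs_of_nonneg (mul_self_nonneg _)] at h2
  rw [sq]
  refine h2.trans (integral_mono h1.integrable.abs ((hi.const_mul _).add (hi'.const_mul _))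
    fun y => ?_)
  dsimp only
  have e : h y * g y + g y * h y = 2 * (g y * h y) := by ring
  rw [e, abs_mul, abs_mul, abs_two]
  have hl : 1 / lam * lam = 1 := by field_simp
  have h3 : 0 ≤ 1 / lam * (lam * |g y| - |h y|) ^ 2 := by positivity
  have h4 : 1 / lam * (lam * |g y| - |h y|) ^ 2 =
      (1 / lam * lam) * lam * |g y| ^ 2 - 2 * (1 / lam * lam) * (|g y| * |h y|)
        + 1 / lam * |h y| ^ 2 := by ring
  rw [h4, hl, sq_abs, sq_abs] at h3
  linarith

section Energy

variable {k l : ℝ → ℝ} {T m R ν Λ : ℝ} {A : ℝ × ℝ → ℝ} {u₀ : ℝ → ℝ} {u Du : ℝ × ℝ → ℝ}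
    {N : ℝ → ℝ} {κ t₁ t₂ R' Lθ P K₀ CM : ℝ} {θ ψ ψ' p M : ℝ → ℝ}

/-- The Sobolev inequality in space turns the energy quantities into a bound for the time integral
of the squared supremum. -/
lemma Localization.integral_ballSup_sq_le
    (hL : Localization k u κ T m R t₁ t₂ R' Lθ P K₀ CM θ ψ ψ' p M)
    (hu : RegularSub k T m R ν Λ A u₀ u Du N) {t₃ R'' : ℝ} (hR'' : 0 < R'')
    (hθ3 : ∀ t, t₃ ≤ t → θ t = 1) (hψ1 : ∀ x ∈ Metric.ball m R'', ψ x = 1) {lam : ℝ}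
    (hlam : 0 < lam) :
    ∫ t in Ioo t₃ T, max (ballSup u m R'' t - κ) 0 ^ 2 ≤
      lam * (∫ z : ℝ × ℝ, θ z.1 * (ψ z.2 ^ 2 * max (u z - κ) 0 ^ 2)) +
      2 / lam * ((∫ z : ℝ × ℝ, θ z.1 * (ψ z.2 ^ 2 * {z | κ < u z}.indicator Du z ^ 2)) +
        P ^ 2 * (2 * R' * ∫ s, p s ^ 2)) := by
  have hP : 0 ≤ P := (abs_nonneg _).trans (hL.ψ'_le 0)
  have i1 := hL.integrable_localSquare hu
  have i2 : Integrable fun z : ℝ × ℝ => θ z.1 * (ψ z.2 ^ 2 * {z | κ < u z}.indicator Du z ^ 2) := by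
    have := hL.integrable_gradient hu (ρ := fun _ => 1) (Rρ := 1) measurable_const
      (fun _ => zero_le_one) (fun _ => le_rfl)
    simpa only [one_mul] using this
  have i3 := hL.integrable_sq_majorant
  set H : ℝ × ℝ → ℝ := fun z => lam * (θ z.1 * (ψ z.2 ^ 2 * max (u z - κ) 0 ^ 2)) +
    2 / lam * (θ z.1 * (ψ z.2 ^ 2 * {z | κ < u z}.indicator Du z ^ 2) +
      P ^ 2 * (p z.1 ^ 2 * ballInd m R' z.2)) with hH
  have iH : Integrable H (volume.prod volume) :=
    (i1.const_mul lam).add ((i2.add (i3.const_mul _)).const_mul _)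
  have iH0 : Integrable H := iH
  have hH0 : ∀ z, 0 ≤ H z := fun z => by
    have a1 := hL.localSquare_nonneg z
    have a2 : 0 ≤ θ z.1 * (ψ z.2 ^ 2 * {z | κ < u z}.indicator Du z ^ 2) :=
      mul_nonneg (hL.θ_nonneg _) (by positivity)
    have a3 : 0 ≤ P ^ 2 * (p z.1 ^ 2 * ballInd m R' z.2) :=
      mul_nonneg (sq_nonneg _) (mul_nonneg (sq_nonneg _) (ballInd_nonneg _))
    exact add_nonneg (mul_nonneg hlam.le a1) (mul_nonneg (by positivity) (add_nonneg a2 a3))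
  have eH : ∫ z, H z = lam * (∫ z : ℝ × ℝ, θ z.1 * (ψ z.2 ^ 2 * max (u z - κ) 0 ^ 2)) +
      2 / lam * ((∫ z : ℝ × ℝ, θ z.1 * (ψ z.2 ^ 2 * {z | κ < u z}.indicator Du z ^ 2)) +
        P ^ 2 * (2 * R' * ∫ s, p s ^ 2)) := by
    have i23 : Integrable fun z : ℝ × ℝ => θ z.1 * (ψ z.2 ^ 2 * {z | κ < u z}.indicator Du z ^ 2) +
      P ^ 2 * (p z.1 ^ 2 * ballInd m R' z.2) := i2.add (i3.const_mul _)
    rw [hH, integral_add (i1.const_mul lam) (i23.const_mul _), integral_const_mul,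
      integral_const_mul, integral_add i2 (i3.const_mul _), integral_const_mul,
      hL.integral_sq_majorant]
  rw [← eH]
  have eH' : ∫ z, H z = ∫ t, ∫ x, H (t, x) := integral_prod H iH
  rw [eH']
  have hD2 : Integrable (fun z => Du z ^ 2) (volume.prod volume) := hu.memLp_D.integrable_sq
  have hae : ∀ᵐ t, t ∈ Ioo t₃ T →
      max (ballSup u m R'' t - κ) 0 ^ 2 ≤ ∫ x, H (t, x) := by
    filter_upwards [hD2.prod_right_ae, iH.prod_right_ae] with t ht iHt htI
    have hθt : θ t = 1 := hθ3 t htI.1.le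
    have ht2 : t₂ < t := by
      by_contra hh
      rw [hL.θ_zero t (not_lt.1 hh)] at hθt
      exact zero_ne_one hθt
    have htp : t ∈ Ioo t₁ T := ⟨hL.t₁_lt.trans ht2, htI.2⟩
    set w : ℝ → ℝ := fun x => max (u (t, x) - κ) 0 with hw
    set Dw : ℝ → ℝ := fun x => {z | κ < u z}.indicator Du (t, x) with hDw
    have hwp : IsPrimitive w Dw := (hu.prim t).posPart κ
    have hgp := hL.prim_ψ.mul hwp
    have hDwm : Measurable Dw := (hu.meas_D.indicator
      (measurableSet_lt measurable_const hu.meas)).comp measurable_prodMk_left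
    have hw0 : ∀ x, 0 ≤ w x := fun x => le_max_right _ _
    have hψm := hL.prim_ψ.continuous.measurable
    have hwm : Measurable w := hwp.continuous.measurable
    have hψw : ∀ x, (ψ x * w x) ^ 2 ≤ p t ^ 2 * ballInd m R' x := fun x => by
      have := hL.localSquare_le hu (t, x)
      rw [hθt, one_mul] at this
      rw [mul_pow]; exact this
    have hψ'w : ∀ x, (ψ' x * w x) ^ 2 ≤ P ^ 2 * (p t ^ 2 * ballInd m R' x) := fun x => by
      by_cases hx : x ∈ Metric.closedBall m R'
      · have h5 := hL.le_p t htp x hx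
        have h7 : ballInd m R' x = 1 := indicator_of_mem hx _
        rw [h7, mul_one, ← mul_pow, ← sq_abs (ψ' x * w x), abs_mul, abs_of_nonneg (hw0 x)]
        exact pow_le_pow_left₀ (mul_nonneg (abs_nonneg _) (hw0 x))
          (mul_le_mul (hL.ψ'_le _) h5 (hw0 x) hP) 2
      · rw [hL.ψ'_zero _ hx]
        have := mul_nonneg (sq_nonneg P) (mul_nonneg (sq_nonneg (p t))
          (ballInd_nonneg (m := m) (R' := R') x))
        simpa using this
    have hDw2 : ∀ x, Dw x ^ 2 ≤ Du (t, x) ^ 2 := fun x => by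
      by_cases h : (t, x) ∈ {z | κ < u z}
      · simp only [hDw]; rw [indicator_of_mem h]
      · simp only [hDw]; rw [indicator_of_notMem h]; simpa using sq_nonneg (Du (t, x))
    have ibI : Integrable fun x => p t ^ 2 * ballInd m R' x :=
      (memLp_one_iff_integrable.1 memLp_ballInd).const_mul _
    have ig : Integrable fun x => (ψ x * w x) ^ 2 :=
      ibI.mono' ((hψm.mul hwm).pow_const 2).aestronglyMeasurable (Eventually.of_forall fun x => by
        rw [Real.norm_of_nonneg (sq_nonneg _)]; exact hψw x)
    have hsq : ∀ x, (ψ' x * w x + ψ x * Dw x) ^ 2 ≤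
        2 * (ψ' x * w x) ^ 2 + 2 * (ψ x ^ 2 * Dw x ^ 2) := fun x => by
      nlinarith [sq_nonneg (ψ' x * w x - ψ x * Dw x)]
    have hψ2 : ∀ x, ψ x ^ 2 ≤ 1 := fun x => pow_le_one₀ (hL.ψ_nonneg _) (hL.ψ_le_one _)
    have ih : Integrable fun x => (ψ' x * w x + ψ x * Dw x) ^ 2 := by
      refine (((ibI.const_mul (P ^ 2)).const_mul 2).add (ht.const_mul 2)).mono'
        (((hL.meas_ψ'.mul hwm).add (hψm.mul hDwm)).pow_const 2).aestronglyMeasurable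
        (Eventually.of_forall fun x => ?_)
      rw [Real.norm_of_nonneg (sq_nonneg _)]
      have b1 := hsq x
      have b2 := hψ'w x
      have b3 : ψ x ^ 2 * Dw x ^ 2 ≤ 1 * Du (t, x) ^ 2 :=
        mul_le_mul (hψ2 x) (hDw2 x) (sq_nonneg _) zero_le_one
      simp only [Pi.add_apply]
      linarith
    have hsup : ∀ x ∈ Metric.ball m R'', w x ^ 2 ≤ ∫ y, H (t, y) := fun x hx => by
      have c1 := hgp.sq_le (m := m) (R := R')
        (fun x hx => by rw [hL.ψ_zero x hx, zero_mul]) ig ih hlam x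
      rw [hψ1 x hx, one_mul] at c1
      refine c1.trans (integral_mono ((ig.const_mul _).add (ih.const_mul _)) iHt fun y => ?_)
      simp only [hH, hθt, one_mul]
      have b1 := hsq y
      have b2 := hψ'w y
      have b4 := mul_le_mul_of_nonneg_left (b1.trans (add_le_add_left
        (mul_le_mul_of_nonneg_left b2 zero_le_two) _)) (by positivity : 0 ≤ 1 / lam)
      have b5 : 2 / lam = 1 / lam * 2 := by ring
      have b6 : (ψ y * w y) ^ 2 = ψ y ^ 2 * max (u (t, y) - κ) 0 ^ 2 := by rw [mul_pow]
      rw [b5, b6]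
      simp only [hDw] at b4 ⊢
      linarith
    have hI0 : 0 ≤ ∫ y, H (t, y) := integral_nonneg fun y => hH0 _
    have hS : ballSup u m R'' t ≤ κ + Real.sqrt (∫ y, H (t, y)) := by
      refine ballSup_le hR'' fun x hx => ?_
      have := Real.le_sqrt_of_sq_le (hsup x hx)
      linarith [le_max_left (u (t, x) - κ) 0]
    have hS' : max (ballSup u m R'' t - κ) 0 ≤ Real.sqrt (∫ y, H (t, y)) :=
      max_le (by linarith) (Real.sqrt_nonneg _)
    calc _ ≤ Real.sqrt (∫ y, H (t, y)) ^ 2 := pow_le_pow_left₀ (le_max_right _ _) hS' 2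
      _ = _ := Real.sq_sqrt hI0
  refine le_trans (setIntegral_mono_ae_restrict
    (hu.integrable_ballSup_trunc_sq hR'' hL.κ_nonneg).integrableOn iH.integral_prod_left.integrableOn
    ((ae_restrict_iff' measurableSet_Ioo).2 hae)) ?_
  exact setIntegral_le_integral iH.integral_prod_left
    (Eventually.of_forall fun t => integral_nonneg fun x => hH0 _)

end Energy

/-! ### Cutoff functions -/

/-- The piecewise linear function which is `0` on `(-∞, 0]`, `1` on `[1, ∞)`. -/
noncomputable def ramp (y : ℝ) : ℝ := max 0 (min 1 y)

lemma ramp_nonneg (y : ℝ) : 0 ≤ ramp y := le_max_left _ _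
lemma ramp_le_one (y : ℝ) : ramp y ≤ 1 := max_le zero_le_one (min_le_left _ _)
lemma ramp_of_nonpos {y : ℝ} (h : y ≤ 0) : ramp y = 0 :=
  max_eq_left ((min_le_right _ _).trans h)
lemma ramp_of_one_le {y : ℝ} (h : 1 ≤ y) : ramp y = 1 := by
  unfold ramp; rw [min_eq_left h]; exact max_eq_right zero_le_one
lemma continuous_ramp : Continuous ramp := by unfold ramp; fun_prop
lemma abs_ramp_sub_le (x y : ℝ) : |ramp x - ramp y| ≤ |x - y| := by
  unfold ramp
  refine (abs_max_sub_max_le_max 0 _ 0 _).trans ?_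
  rw [sub_self, abs_zero, max_eq_right (abs_nonneg _)]
  refine (abs_min_sub_min_le_max 1 _ 1 _).trans ?_
  rw [sub_self, abs_zero, max_eq_right (abs_nonneg _)]

/-- The trapezoidal cutoff in space equal to `1` on `B(m, R'')` and `0` outside `B(m, R')`. -/
noncomputable def spaceCutoff (m R' R'' x : ℝ) : ℝ := ramp ((R' - |x - m|) / (R' - R''))

section SpaceCutoff

variable {m R' R'' : ℝ} (hR : R'' < R')
include hR

lemma lipschitz_spaceCutoff :
    LipschitzWith (Real.toNNReal (1 / (R' - R''))) (spaceCutoff m R' R'') := by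
  refine LipschitzWith.of_dist_le_mul fun x y => ?_
  have h : 0 < R' - R'' := by linarith
  rw [Real.coe_toNNReal _ (by positivity), Real.dist_eq, Real.dist_eq]
  unfold spaceCutoff
  refine (abs_ramp_sub_le _ _).trans ?_
  rw [← sub_div, abs_div, abs_of_pos h, div_eq_inv_mul, one_div]
  refine mul_le_mul_of_nonneg_left ?_ (by positivity)
  have := abs_abs_sub_abs_le_abs_sub (y - m) (x - m)
  rw [sub_sub_sub_cancel_right, abs_sub_comm y x] at this
  refine le_trans (le_of_eq ?_) this
  congr 1; ring

lemma spaceCutoff_eq_zero {x : ℝ} (hx : x ∉ Metric.closedBall m R') :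
    spaceCutoff m R' R'' x = 0 := by
  rw [Metric.mem_closedBall, Real.dist_eq, not_le] at hx
  exact ramp_of_nonpos (div_nonpos_of_nonpos_of_nonneg (by linarith) (by linarith))

lemma spaceCutoff_eq_one {x : ℝ} (hx : x ∈ Metric.ball m R'') : spaceCutoff m R' R'' x = 1 := by
  rw [Metric.mem_ball, Real.dist_eq] at hx
  refine ramp_of_one_le ((one_le_div (by linarith)).2 (by linarith))

lemma abs_deriv_spaceCutoff_le (x : ℝ) : |deriv (spaceCutoff m R' R'') x| ≤ 1 / (R' - R'') := by
  have h := norm_deriv_le_of_lipschitz (x₀ := x) (lipschitz_spaceCutoff (m := m) hR)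
  rwa [Real.coe_toNNReal _ (by have : 0 < R' - R'' := by linarith
                               positivity), Real.norm_eq_abs] at h

lemma deriv_spaceCutoff_eq_zero {x : ℝ} (hx : x ∉ Metric.closedBall m R') :
    deriv (spaceCutoff m R' R'') x = 0 := by
  have : spaceCutoff m R' R'' =ᶠ[𝓝 x] fun _ => 0 := by
    filter_upwards [Metric.isClosed_closedBall.isOpen_compl.mem_nhds hx] with y hy
    exact spaceCutoff_eq_zero hR hy
  rw [this.deriv_eq, deriv_const]

lemma isPrimitive_spaceCutoff :
    IsPrimitive (spaceCutoff m R' R'') (deriv (spaceCutoff m R' R'')) := by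
  refine IsPrimitive.of_ac (fun a b => ((lipschitz_spaceCutoff hR).lipschitzOnWith
    (s := uIcc a b)).absolutelyContinuousOnInterval) (Eventually.of_forall fun x => rfl) ?_
  have h1 : IntegrableOn (deriv (spaceCutoff m R' R'')) (Metric.closedBall m R') :=
    Measure.integrableOn_of_bounded measure_closedBall_lt_top.ne
      (measurable_deriv _).aestronglyMeasurable (M := 1 / (R' - R''))
      (Eventually.of_forall fun x => abs_deriv_spaceCutoff_le hR x)
  rwa [integrableOn_iff_integrable_of_support_subset (fun x hx => by
    by_contra h; exact hx (deriv_spaceCutoff_eq_zero hR h))] at h1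

end SpaceCutoff

/-! ### One step of the De Giorgi iteration -/

section Step

variable {k l : ℝ → ℝ} {T x₀ r ν Λ : ℝ} {A : ℝ × ℝ → ℝ} {u₀ : ℝ → ℝ} {u Du : ℝ × ℝ → ℝ}
    {N : ℝ → ℝ} {η β Cl Ck ω cη τ : ℝ}

/-- The integral of `(sup_{B(x₀, r s)} u(t, ·) - κ)₊²` over the time interval `(T - s S, T)`, the
quantity to which De Giorgi's iteration is applied. -/
noncomputable def levelEnergy (u : ℝ × ℝ → ℝ) (T x₀ r S s κ : ℝ) : ℝ :=
  ∫ t in Ioo (T - s * S) T, max (ballSup u x₀ (r * s) t - κ) 0 ^ 2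

/-- The terms of the initial datum and of the history before `T - σ' S` in the local boundedness
estimate are at most `F`. -/
structure HistoryBound (k : ℝ → ℝ) (u₀ : ℝ → ℝ) (u : ℝ × ℝ → ℝ) (T x₀ r S σ' σ F : ℝ) : Prop where
  nonneg : 0 ≤ F
  initial : ∀ t, T - σ * S < t → r * (k t * ∫ x in Metric.ball x₀ (r * σ), u₀ x) ≤ F
  memory : r * (∫ x in Metric.ball x₀ (r * σ), ∫ a in Ioc 0 (T - σ' * S),
    -deriv k (T - a) * u (a, x)) ≤ F

lemma measurable_memory_indicator (k : ℝ → ℝ) (T t : ℝ) :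
    Measurable ((Ioc 0 t).indicator fun a => -deriv k (T - a)) :=
  ((measurable_deriv k).comp (by fun_prop)).neg.indicator measurableSet_Ioc

lemma AssumptionK0.memory_indicator_nonneg (hK : AssumptionK0 k l) {t : ℝ} (ht : t < T) (a : ℝ) :
    0 ≤ (Ioc 0 t).indicator (fun a => -deriv k (T - a)) a :=
  indicator_nonneg (fun a ha => by
    have := hK.deriv_k_nonpos (show 0 < T - a by linarith [ha.2]); linarith) a

lemma AssumptionK0.memory_indicator_le (hK : AssumptionK0 k l) {t : ℝ} (ht : t < T) (a : ℝ) :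
    (Ioc 0 t).indicator (fun a => -deriv k (T - a)) a ≤ -deriv k (T - t) := by
  have h0 := hK.deriv_k_nonpos (show 0 < T - t by linarith)
  by_cases ha : a ∈ Ioc 0 t
  · rw [indicator_of_mem ha]
    have := hK.monotoneOn_deriv_k (mem_Ioi.2 (show 0 < T - t by linarith))
      (mem_Ioi.2 (show 0 < T - a by linarith [ha.2])) (by linarith [ha.2])
    linarith
  · rw [indicator_of_notMem ha]; linarith

/-- The cutoffs and majorants for the energy estimates between the cylinders of parameters `s` and
`s' < s`. The cutoff in time vanishes on the first half of the time gap, which keeps a distance to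
the history, and rises to one on the second half. -/
lemma KernelScale.localization (hK : AssumptionK0 k l) (ks : KernelScale k l η β Cl Ck ω cη r τ)
    (hη : 0 < η) (hω : 0 < ω) (hcη : 0 ≤ cη) (hu : RegularSub k T x₀ r ν Λ A u₀ u Du N)
    (hT : η * τ ≤ T) {s' s κ : ℝ} (hs' : 0 < s') (hss : s' < s) (hs1 : s ≤ 1) (hκ : 0 ≤ κ) :
    Localization k u κ T x₀ r (T - s * (η * τ)) (T - s * (η * τ) + η * τ * (s - s') / 2)
      (r * ((s + s') / 2)) (1 / (η * τ * (s - s') / 2))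
      (1 / (r * ((s + s') / 2) - r * s')) (k (T - s * (η * τ) + η * τ * (s - s') / 2))
      (cη * ((s - s') / 2) ^ (-ω) * -deriv k (T - (T - s * (η * τ))))
      (fun t => ramp ((t - (T - s * (η * τ) + η * τ * (s - s') / 2)) / (η * τ * (s - s') / 2)))
      (spaceCutoff x₀ (r * ((s + s') / 2)) (r * s'))
      (deriv (spaceCutoff x₀ (r * ((s + s') / 2)) (r * s')))
      ((Ioo (T - s * (η * τ)) T).indicator fun t => max (ballSup u x₀ (r * s) t - κ) 0)
      (fun a => cη * ((s - s') / 2) ^ (-ω) *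
        (Ioc 0 (T - s * (η * τ))).indicator (fun a => -deriv k (T - a)) a) := by
  have hr := ks.r_pos
  have hτ := ks.pos
  have hS : 0 < η * τ := mul_pos hη hτ
  set S := η * τ with hSd
  have hd : 0 < s - s' := by linarith
  have hg : 0 < S * (s - s') / 2 := by positivity
  have hs0 : 0 < s := hs'.trans hss
  have hsS : s * S ≤ S := mul_le_of_le_one_left hS.le hs1
  have hsS0 : 0 < s * S := mul_pos hs0 hS
  have hRR : r * s' < r * ((s + s') / 2) := mul_lt_mul_of_pos_left (by linarith) hr
  have hRs : r * ((s + s') / 2) ≤ r * s := mul_le_mul_of_nonneg_left (by linarith) hr.le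
  have hgap : S * (s - s') = s * S - s' * S := by ring
  have hs'S : 0 < s' * S := mul_pos hs' hS
  have ht1 : T - s * S < T := by linarith
  have hc0 : 0 ≤ cη * ((s - s') / 2) ^ (-ω) := mul_nonneg hcη (Real.rpow_nonneg (by linarith) _)
  have hSm : Measurable fun t => max (ballSup u x₀ (r * s) t - κ) 0 :=
    ((measurable_ballSup hu.meas _ _).sub_const κ).max measurable_const
  have hrs : 0 < r * s := mul_pos hr hs0
  have hp0 : ∀ t, 0 ≤ (Ioo (T - s * S) T).indicator
      (fun t => max (ballSup u x₀ (r * s) t - κ) 0) t := fun t =>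
    indicator_nonneg (fun _ _ => le_max_right _ _) t
  refine
    { t₁_nonneg := by linarith
      t₁_lt := by linarith
      t₂_lt := by linarith
      κ_nonneg := hκ
      R'_pos := mul_pos hr (by linarith)
      R'_lt := by nlinarith
      meas_θ := continuous_ramp.measurable.comp (by fun_prop)
      θ_nonneg := fun t => ramp_nonneg _
      θ_le_one := fun t => ramp_le_one _
      Lθ_nonneg := by positivity
      θ_lip := fun a b hab => ?_
      θ_zero := fun t ht => ramp_of_nonpos
        (div_nonpos_of_nonpos_of_nonneg (by linarith) hg.le)
      prim_ψ := isPrimitive_spaceCutoff hRR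
      meas_ψ' := measurable_deriv _
      ψ_nonneg := fun x => ramp_nonneg _
      ψ_le_one := fun x => ramp_le_one _
      ψ_zero := fun x hx => spaceCutoff_eq_zero hRR hx
      ψ'_zero := fun x hx => deriv_spaceCutoff_eq_zero hRR hx
      ψ'_le := fun x => abs_deriv_spaceCutoff_le hRR x
      meas_p := hSm.indicator measurableSet_Ioo
      p_nonneg := hp0
      p_zero := fun t ht => indicator_of_notMem ht _
      le_p := fun t ht x hx => ?_
      memLp_p := ?_
      meas_M := (measurable_memory_indicator k T _).const_mul _
      M_nonneg := fun a => mul_nonneg hc0 (hK.memory_indicator_nonneg ht1 a)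
      M_le := fun a => mul_le_mul_of_nonneg_left (hK.memory_indicator_le ht1 a) hc0
      memory_le := fun t ht a ha => ?_
      initial_le := fun t ht => hK.antitone_k (mem_Ioi.2 (by linarith)) (mem_Ioi.2 (by
        linarith [ht.1])) ht.1.le }
  · refine (le_abs_self _).trans ((abs_ramp_sub_le _ _).trans ?_)
    rw [← sub_div, abs_div, abs_of_pos hg, one_div, div_eq_inv_mul]
    refine mul_le_mul_of_nonneg_left (le_of_eq ?_) (by positivity)
    rw [sub_sub_sub_cancel_right, abs_of_nonneg (by linarith)]
  · rw [indicator_of_mem ht]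
    exact max_le_max (sub_le_sub_right (hu.le_ballSup hrs
      (Metric.closedBall_subset_closedBall hRs hx)) _) le_rfl
  · refine hu.memLp_N.mono (hSm.indicator measurableSet_Ioo).aestronglyMeasurable
      (Eventually.of_forall fun t => ?_)
    rw [Real.norm_of_nonneg (hp0 t), Real.norm_of_nonneg (hu.N_nonneg t)]
    by_cases ht : t ∈ Ioo (T - s * S) T
    · rw [indicator_of_mem ht]; exact hu.ballSup_trunc_le_N hrs hκ
    · rw [indicator_of_notMem ht]; exact hu.N_nonneg t
  · rw [indicator_of_mem ha]
    have hx : 0 < T - a := by linarith [ha.2]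
    have hxt : 0 < t - a := by linarith [ha.2, ht.1]
    have e1 : (T - a) * ((t - a) / (T - a)) = t - a := by field_simp
    have e2 : (T - a) * (1 - (t - a) / (T - a)) = T - t := by
      rw [mul_sub, e1]; ring
    have h1 := ks.memory_le (T - a) ((t - a) / (T - a)) (div_pos hxt hx)
      ((div_le_one hx).2 (by linarith [ht.2])) (by rw [e2]; linarith [ht.2])
      (by rw [e2]; linarith [ht.1])
    rw [e1] at h1
    refine h1.trans (mul_le_mul_of_nonneg_right (mul_le_mul_of_nonneg_left ?_ hcη) (by
      have := hK.deriv_k_nonpos hx; linarith))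
    refine Real.rpow_le_rpow_of_nonpos (by linarith) ?_ (by linarith)
    -- the ratio of the time lags is smallest when the lag is shortest
    rw [le_div_iff₀ hx]
    have q1 : T - a = s * S + (T - s * S - a) := by ring
    have q2 : S * (s - s') / 2 + (T - s * S - a) ≤ t - a := by linarith [ht.1]
    have q3 : 0 ≤ T - s * S - a := by linarith [ha.2]
    have q4 : (s - s') / 2 * (s * S) ≤ (s - s') / 2 * S :=
      mul_le_mul_of_nonneg_left hsS (by linarith)
    have q5 : (s - s') / 2 * (T - s * S - a) ≤ 1 * (T - s * S - a) :=
      mul_le_mul_of_nonneg_right (by linarith) q3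
    rw [q1, mul_add]
    linarith

/-- The contribution of the history is controlled by `F`. -/
lemma HistoryBound.integral_historyTerm_le (hK : AssumptionK0 k l)
    (hr : 0 < r) {S σ' σ s' s F C K₀ : ℝ} (hS : 0 < S)
    (hu : RegularSub k T x₀ r ν Λ A u₀ u Du N) (hF : HistoryBound k u₀ u T x₀ r S σ' σ F)
    (hσ' : 0 < σ') (hσs : σ' ≤ s) (hsσ : s ≤ σ) (hss : s' < s) {t₂ : ℝ}
    (ht₂ : T - s * S < t₂) (hK₀ : K₀ = k t₂) (hK₀' : 0 ≤ K₀) (hC : 0 ≤ C) :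
    r * (∫ x, historyTerm u u₀ (fun a => C * (Ioc 0 (T - s * S)).indicator
      (fun a => -deriv k (T - a)) a) K₀ x₀ (r * ((s + s') / 2)) (T - s * S) x) ≤ (C + 1) * F := by
  set B := Metric.ball x₀ (r * σ) with hB
  have hBm : MeasurableSet B := measurableSet_ball
  have hσ'S : 0 < σ' * S := mul_pos hσ' hS
  have ht : T - σ' * S < T := by linarith
  have htt : T - s * S ≤ T - σ' * S := by
    have := mul_le_mul_of_nonneg_right hσs hS.le; linarith
  have hts : T - s * S < T := by linarith
  have hsub : Metric.closedBall x₀ (r * ((s + s') / 2)) ⊆ B :=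
    Metric.closedBall_subset_ball (mul_lt_mul_of_pos_left (by linarith) hr)
  set Mem : ℝ → ℝ := (Ioc 0 (T - σ' * S)).indicator fun a => -deriv k (T - a) with hMem
  have hMm : Measurable Mem := measurable_memory_indicator k T _
  have hM0 : ∀ a, 0 ≤ Mem a := hK.memory_indicator_nonneg ht
  have hMi : ∀ x, Integrable fun a => Mem a * u (a, x) := fun x =>
    (hu.integrable_slice x).bdd_mul (c := -deriv k (T - (T - σ' * S))) hMm.aestronglyMeasurable
      (Eventually.of_forall fun a => by
        rw [Real.norm_of_nonneg (hM0 a)]; exact hK.memory_indicator_le ht a)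
  have hMeq : ∀ x, ∫ a in Ioc 0 (T - σ' * S), -deriv k (T - a) * u (a, x) =
      ∫ a, Mem a * u (a, x) := fun x => by
    rw [← integral_indicator measurableSet_Ioc]
    refine integral_congr_ae (Eventually.of_forall fun a => ?_)
    dsimp only
    by_cases ha : a ∈ Ioc 0 (T - σ' * S)
    · rw [hMem, indicator_of_mem ha, indicator_of_mem ha]
    · rw [hMem, indicator_of_notMem ha, indicator_of_notMem ha, zero_mul]
  set J : ℝ → ℝ := fun x => ∫ a, Mem a * u (a, x) with hJ
  have hJ0 : ∀ x, 0 ≤ J x := fun x => integral_nonneg fun a => mul_nonneg (hM0 a) (hu.nonneg _)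
  have hJm : Measurable J := (StronglyMeasurable.integral_prod_right
    (f := fun x a => Mem a * u (a, x)) (((hMm.comp measurable_snd).mul
      (hu.meas.comp measurable_swap)).stronglyMeasurable)).measurable
  have hNi : Integrable ((Ioo 0 T).indicator N) :=
    (memLp_two_integrableOn measure_Ioo_lt_top.ne
      (hu.memLp_N.restrict _)).integrable_indicator measurableSet_Ioo
  have hk0 : 0 ≤ -deriv k (T - (T - σ' * S)) := by
    have := hK.deriv_k_nonpos (show 0 < T - (T - σ' * S) by linarith); linarith
  have hJb : ∀ x, J x ≤ ∫ a, -deriv k (T - (T - σ' * S)) * (Ioo 0 T).indicator N a := fun x => by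
    refine integral_mono (hMi x) (hNi.const_mul _) fun a => ?_
    dsimp only
    by_cases ha : a ∈ Ioo 0 T
    · rw [indicator_of_mem ha]
      exact mul_le_mul (hK.memory_indicator_le ht a) (hu.le_N _) (hu.nonneg _) hk0
    · rw [indicator_of_notMem ha, hu.zero _ ha, mul_zero, mul_zero]
  have hJi : IntegrableOn J B := Measure.integrableOn_of_bounded measure_ball_lt_top.ne
    hJm.aestronglyMeasurable (Eventually.of_forall fun x => by
      rw [Real.norm_of_nonneg (hJ0 x)]; exact hJb x)
  have hu₀i : IntegrableOn u₀ B := memLp_two_integrableOn measure_ball_lt_top.ne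
    (hu.memLp_u₀.restrict _)
  have hle : ∀ x, historyTerm u u₀ (fun a => C * (Ioc 0 (T - s * S)).indicator
      (fun a => -deriv k (T - a)) a) K₀ x₀ (r * ((s + s') / 2)) (T - s * S) x ≤
      C * B.indicator J x + K₀ * B.indicator u₀ x := fun x => by
    unfold historyTerm
    by_cases hx : x ∈ Metric.closedBall x₀ (r * ((s + s') / 2))
    · rw [indicator_of_mem hx, indicator_of_mem (hsub hx), indicator_of_mem (hsub hx)]
      refine add_le_add_left ?_ _
      rw [hJ, ← integral_const_mul, ← integral_indicator measurableSet_Ioc]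
      refine integral_mono_of_nonneg (Eventually.of_forall fun a => indicator_nonneg
        (fun a _ => mul_nonneg (mul_nonneg hC (hK.memory_indicator_nonneg hts a)) (hu.nonneg _)) a)
        ((hMi x).const_mul C) (Eventually.of_forall fun a => ?_)
      dsimp only
      by_cases ha : a ∈ Ioc 0 (T - s * S)
      · rw [indicator_of_mem ha, indicator_of_mem ha, hMem,
          indicator_of_mem (show a ∈ Ioc 0 (T - σ' * S) from ⟨ha.1, ha.2.trans htt⟩), mul_assoc]
      · rw [indicator_of_notMem ha]
        exact mul_nonneg hC (mul_nonneg (hM0 a) (hu.nonneg _))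
    · rw [indicator_of_notMem hx]
      exact add_nonneg (mul_nonneg hC (indicator_nonneg (fun x _ => hJ0 x) x))
        (mul_nonneg hK₀' (indicator_nonneg (fun x _ => hu.nonneg_u₀ x) x))
  have i1 : Integrable fun x => C * B.indicator J x := (hJi.integrable_indicator hBm).const_mul C
  have i2 : Integrable fun x => K₀ * B.indicator u₀ x :=
    (hu₀i.integrable_indicator hBm).const_mul K₀
  have hn : ∀ x, 0 ≤ historyTerm u u₀ (fun a => C * (Ioc 0 (T - s * S)).indicator
      (fun a => -deriv k (T - a)) a) K₀ x₀ (r * ((s + s') / 2)) (T - s * S) x := fun x =>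
    indicator_nonneg (fun x _ => add_nonneg (integral_nonneg fun a =>
      mul_nonneg (mul_nonneg hC (hK.memory_indicator_nonneg hts a)) (hu.nonneg _))
      (mul_nonneg hK₀' (hu.nonneg_u₀ x))) x
  have h1 := integral_mono_of_nonneg (Eventually.of_forall hn) (i1.add i2)
    (Eventually.of_forall hle)
  have e1 : ∫ x, (C * B.indicator J x + K₀ * B.indicator u₀ x) =
      C * (∫ x in B, J x) + K₀ * ∫ x in B, u₀ x := by
    rw [integral_add i1 i2, integral_const_mul, integral_const_mul, integral_indicator hBm,
      integral_indicator hBm]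
  have h2 : (∫ x, historyTerm u u₀ (fun a => C * (Ioc 0 (T - s * S)).indicator
      (fun a => -deriv k (T - a)) a) K₀ x₀ (r * ((s + s') / 2)) (T - s * S) x) ≤
      C * (∫ x in B, J x) + K₀ * ∫ x in B, u₀ x := h1.trans_eq e1
  have h3 := hF.memory
  simp_rw [hMeq] at h3
  have h4 := hF.initial t₂ (by
    have := mul_le_mul_of_nonneg_right hsσ hS.le; linarith)
  rw [← hK₀] at h4
  calc _ ≤ r * (C * (∫ x in B, J x) + K₀ * ∫ x in B, u₀ x) := mul_le_mul_of_nonneg_left h2 hr.le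
    _ = C * (r * ∫ x in B, J x) + r * (K₀ * ∫ x in B, u₀ x) := by ring
    _ ≤ C * F + F := add_le_add (mul_le_mul_of_nonneg_left h3 hC) h4
    _ = _ := by ring

end Step

section Step

variable {k l : ℝ → ℝ} {T x₀ r ν Λ : ℝ} {A : ℝ × ℝ → ℝ} {u₀ : ℝ → ℝ} {u Du : ℝ × ℝ → ℝ}
    {N : ℝ → ℝ} {η β Cl Ck ω cη τ : ℝ}

lemma levelEnergy_nonneg {S s κ : ℝ} : 0 ≤ levelEnergy u T x₀ r S s κ :=
  setIntegral_nonneg measurableSet_Ioo fun _ _ => sq_nonneg _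

lemma RegularSub.levelEnergy_mono (hu : RegularSub k T x₀ r ν Λ A u₀ u Du N) (hr : 0 < r)
    {S s' s κ κ' : ℝ} (hS : 0 ≤ S) (hs' : 0 < s') (hss : s' ≤ s) (hκ : 0 ≤ κ) (hκκ : κ ≤ κ') :
    levelEnergy u T x₀ r S s' κ' ≤ levelEnergy u T x₀ r S s κ := by
  have hrs' : 0 < r * s' := mul_pos hr hs'
  have hrs : r * s' ≤ r * s := mul_le_mul_of_nonneg_left hss hr.le
  unfold levelEnergy
  refine (setIntegral_mono_set (hu.integrable_ballSup_trunc_sq hrs' (hκ.trans hκκ)).integrableOn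
    (Eventually.of_forall fun t => sq_nonneg _) (Ioo_subset_Ioo_left (by
      have := mul_le_mul_of_nonneg_right hss hS
      linarith : T - s * S ≤ T - s' * S)).eventuallyLE).trans ?_
  refine setIntegral_mono (hu.integrable_ballSup_trunc_sq hrs' (hκ.trans hκκ)).integrableOn
    (hu.integrable_ballSup_trunc_sq (hrs'.trans_le hrs) hκ).integrableOn fun t => ?_
  refine pow_le_pow_left₀ (le_max_right _ _) (max_le_max ?_ le_rfl) 2
  linarith [hu.ballSup_mono (m' := x₀) (t := t) hrs' hrs]

/-- The constant in the bound of the energy error terms: the summands stem from the cutoff in time,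
from the history, and from the cutoff in space. -/
noncomputable def energyConst (η Ck ω cη Λ : ℝ) : ℝ := 2 * Ck / η + (cη * 2 ^ ω + 1) + 16 * Λ

/-- The constant of one step of the iteration. -/
noncomputable def stepConst (η Cl Ck ω cη ν Λ : ℝ) : ℝ :=
  Real.sqrt Cl * (2 * energyConst η Ck ω cη Λ + 4 * energyConst η Ck ω cη Λ / ν + 16)

/-- All error terms of the energy estimate are bounded by
`C (s - s')^{-(2+ω)} (1 + F / (κ' - κ)) Y / r`. -/
lemma KernelScale.energyError_le (hK : AssumptionK0 k l)
    (ks : KernelScale k l η β Cl Ck ω cη r τ) (hη : 0 < η) (hω : 0 < ω) (hcη : 0 ≤ cη)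
    (hCk : 0 ≤ Ck) (hu : RegularSub k T x₀ r ν Λ A u₀ u Du N) (hT : η * τ ≤ T) {σ' σ F : ℝ}
    (hF : HistoryBound k u₀ u T x₀ r (η * τ) σ' σ F) (hσ' : 0 < σ') (hσ1 : σ ≤ 1)
    {s' s κ κ' : ℝ} (hσs : σ' ≤ s') (hss : s' < s) (hsσ : s ≤ σ) (hκ : 0 ≤ κ) (hκκ : κ < κ')
    {Jp : ℝ} (hJp : Jp = ∫ t, ((Ioo (T - s * (η * τ)) T).indicator
      (fun t => max (ballSup u x₀ (r * s) t - κ') 0) t) ^ 2) :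
    Jp ≤ levelEnergy u T x₀ r (η * τ) s κ ∧
    timeError k u u₀ (fun a => cη * ((s - s') / 2) ^ (-ω) *
        (Ioc 0 (T - s * (η * τ))).indicator (fun a => -deriv k (T - a)) a)
      ((Ioo (T - s * (η * τ)) T).indicator fun t => max (ballSup u x₀ (r * s) t - κ') 0)
      (k (T - s * (η * τ) + η * τ * (s - s') / 2)) (1 / (η * τ * (s - s') / 2)) x₀
      (r * ((s + s') / 2)) (T - s * (η * τ)) T
      + 2 * Λ * (1 / (r * ((s + s') / 2) - r * s')) ^ 2 * (2 * (r * ((s + s') / 2)) * Jp) ≤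
    energyConst η Ck ω cη Λ * ((s - s') ^ (-(2 + ω)) * (1 + F / (κ' - κ)) *
      (levelEnergy u T x₀ r (η * τ) s κ / r)) := by
  have hr := ks.r_pos
  have hτ := ks.pos
  have hS : 0 < η * τ := mul_pos hη hτ
  set S := η * τ with hSd
  set Y := levelEnergy u T x₀ r S s κ with hY
  have hs' : 0 < s' := hσ'.trans_le hσs
  have hs1 : s ≤ 1 := hsσ.trans hσ1
  have hs0 : 0 < s := hs'.trans hss
  have hd : 0 < s - s' := by linarith
  set d := s - s' with hdd
  have hd1 : d ≤ 1 := by linarith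
  have he : 0 < κ' - κ := by linarith
  set e := κ' - κ with hed
  have hY0 : 0 ≤ Y := levelEnergy_nonneg
  have hrs : 0 < r * s := mul_pos hr hs0
  have hκ' : 0 ≤ κ' := by linarith
  have hΛ : 0 ≤ Λ := hu.ν_pos.le.trans ((hu.A_ge 0).trans (hu.A_le 0))
  have hsS : s * S ≤ S := mul_le_of_le_one_left hS.le hs1
  have hsS0 : 0 < s * S := mul_pos hs0 hS
  set Sf : ℝ → ℝ := ballSup u x₀ (r * s) with hSf
  have iY : IntegrableOn (fun t => max (Sf t - κ) 0 ^ 2) (Ioo (T - s * S) T) :=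
    (hu.integrable_ballSup_trunc_sq hrs hκ).integrableOn
  have hSm : Measurable fun t => max (Sf t - κ') 0 :=
    ((measurable_ballSup hu.meas _ _).sub_const κ').max measurable_const
  have hJ : Jp ≤ Y := by
    rw [hJp, hY, levelEnergy, ← integral_indicator measurableSet_Ioo]
    refine integral_mono_of_nonneg (Eventually.of_forall fun t => sq_nonneg _)
      (iY.integrable_indicator measurableSet_Ioo) (Eventually.of_forall fun t => ?_)
    dsimp only
    by_cases ht : t ∈ Ioo (T - s * S) T
    · rw [indicator_of_mem ht, indicator_of_mem ht]
      exact pow_le_pow_left₀ (le_max_right _ _) (max_le_max (by linarith) le_rfl) 2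
    · rw [indicator_of_notMem ht, indicator_of_notMem ht]; norm_num
  have hJ0 : 0 ≤ Jp := by rw [hJp]; exact integral_nonneg fun t => sq_nonneg _
  refine ⟨hJ, ?_⟩
  have hI : (∫ t, (Ioo (T - s * S) T).indicator (fun t => max (Sf t - κ') 0) t) ≤ Y / e := by
    rw [hY, levelEnergy, ← integral_indicator measurableSet_Ioo, ← integral_div]
    refine integral_mono_of_nonneg (Eventually.of_forall fun t => indicator_nonneg
      (fun _ _ => le_max_right _ _) t)
      ((iY.integrable_indicator measurableSet_Ioo).div_const e) (Eventually.of_forall fun t => ?_)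
    dsimp only
    by_cases ht : t ∈ Ioo (T - s * S) T
    · rw [indicator_of_mem ht, indicator_of_mem ht, le_div_iff₀ he]
      -- where the left side is positive, `Sf t - κ ≥ κ' - κ`
      rcases le_or_gt (Sf t) κ' with h | h
      · rw [max_eq_right (by linarith), zero_mul]; exact sq_nonneg _
      · rw [max_eq_left (by linarith), max_eq_left (by linarith : (0 : ℝ) ≤ Sf t - κ)]
        nlinarith
    · rw [indicator_of_notMem ht, indicator_of_notMem ht]; norm_num
  set Ip := ∫ t, (Ioo (T - s * S) T).indicator (fun t => max (Sf t - κ') 0) t with hIp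
  have hIp0 : 0 ≤ Ip := integral_nonneg fun t => indicator_nonneg (fun _ _ => le_max_right _ _) t
  -- the powers of `d`
  set D := d ^ (-(2 + ω)) with hD
  have hD0 : 0 < D := Real.rpow_pos_of_pos hd _
  have hDpow : ∀ x : ℝ, -(2 + ω) ≤ x → d ^ x ≤ D := fun x hx =>
    Real.rpow_le_rpow_of_exponent_ge hd hd1 hx
  have hD1 : d⁻¹ ≤ D := by
    have := hDpow (-1) (by linarith); rwa [Real.rpow_neg_one] at this
  have hD2 : (d ^ 2)⁻¹ ≤ D := by
    have := hDpow (-2) (by linarith)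
    rwa [Real.rpow_neg hd.le, Real.rpow_two] at this
  have hDω : d ^ (-ω) ≤ D := hDpow _ (by linarith)
  have hD00 : 1 ≤ D := by
    have := hDpow 0 (by linarith); rwa [Real.rpow_zero] at this
  have hCd : cη * (d / 2) ^ (-ω) + 1 ≤ (cη * 2 ^ ω + 1) * D := by
    have h1 : (d / 2) ^ (-ω) = 2 ^ ω * d ^ (-ω) := by
      rw [Real.div_rpow hd.le zero_le_two, Real.rpow_neg zero_le_two, div_inv_eq_mul, mul_comm]
    rw [h1]
    have h2 : 0 ≤ cη * 2 ^ ω := mul_nonneg hcη (Real.rpow_nonneg zero_le_two _)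
    nlinarith [mul_le_mul_of_nonneg_left hDω h2]
  have hC0 : 0 ≤ cη * (d / 2) ^ (-ω) := mul_nonneg hcη (Real.rpow_nonneg (by linarith) _)
  have hgap : S * d = s * S - s' * S := by rw [hdd]; ring
  have hs'S : 0 < s' * S := mul_pos hs' hS
  have hSd0 : 0 < S * d / 2 := by positivity
  have hHQ := hF.integral_historyTerm_le (s := s) (s' := s') (C := cη * (d / 2) ^ (-ω))
    (K₀ := k (T - s * S + S * d / 2)) (t₂ := T - s * S + S * d / 2) hK hr hS hu hσ'
    (hσs.trans hss.le) hsσ hss (by linarith) rfl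
    (hK.nonneg_k _ (by linarith)) hC0
  have hk1 : ∫ a in (0 : ℝ)..(T - (T - s * S)), k a ≤ Ck * (τ / r ^ 2) := by
    rw [sub_sub_cancel]
    refine le_trans ?_ ks.integral_k_le
    rw [← intervalIntegral.integral_add_adjacent_intervals (hK.intervalIntegrable_k le_rfl hsS0.le)
      (hK.intervalIntegrable_k hsS0.le hS.le), intervalIntegral.integral_of_le hsS]
    have : 0 ≤ ∫ a in Ioc (s * S) S, k a :=
      setIntegral_nonneg measurableSet_Ioc fun a ha => hK.nonneg_k a (hsS0.trans ha.1)
    linarith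
  have hk0 : 0 ≤ ∫ a in (0 : ℝ)..(T - (T - s * S)), k a := by
    rw [sub_sub_cancel, intervalIntegral.integral_of_le hsS0.le]
    exact setIntegral_nonneg measurableSet_Ioc fun a ha => hK.nonneg_k a ha.1
  have hF0 := hF.nonneg
  have hR1 : r * ((s + s') / 2) ≤ r := mul_le_of_le_one_right hr.le (by linarith)
  have hR0 : 0 < r * ((s + s') / 2) := mul_pos hr (by linarith)
  have hRJ : 2 * (r * ((s + s') / 2)) * Jp ≤ 2 * r * Y :=
    mul_le_mul (by linarith) hJ hJ0 (by linarith)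
  have hRJ0 : 0 ≤ 2 * (r * ((s + s') / 2)) * Jp := mul_nonneg (by linarith) hJ0
  have hYr : 0 ≤ Y / r := div_nonneg hY0 hr.le
  -- the three terms
  have b1 : 1 / 2 * (1 / (S * d / 2)) * (∫ a in (0 : ℝ)..(T - (T - s * S)), k a) *
      (2 * (r * ((s + s') / 2)) * Jp) ≤ 2 * Ck / η * (D * (Y / r)) := by
    calc _ ≤ 1 / 2 * (1 / (S * d / 2)) * (Ck * (τ / r ^ 2)) * (2 * r * Y) := by
          refine mul_le_mul (mul_le_mul_of_nonneg_left hk1 (by positivity)) hRJ hRJ0 ?_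
          have : 0 ≤ τ / r ^ 2 := by positivity
          positivity
      _ = 2 * Ck / η * (d⁻¹ * (Y / r)) := by rw [hSd]; field_simp
      _ ≤ _ := mul_le_mul_of_nonneg_left (mul_le_mul_of_nonneg_right hD1 hYr)
          (div_nonneg (by linarith) hη.le)
  have b2 : Ip * (∫ x, historyTerm u u₀ (fun a => cη * (d / 2) ^ (-ω) *
      (Ioc 0 (T - s * S)).indicator (fun a => -deriv k (T - a)) a)
      (k (T - s * S + S * d / 2)) x₀ (r * ((s + s') / 2)) (T - s * S) x) ≤
      (cη * 2 ^ ω + 1) * (D * (F / e) * (Y / r)) := by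
    set HQ := ∫ x, historyTerm u u₀ (fun a => cη * (d / 2) ^ (-ω) *
      (Ioc 0 (T - s * S)).indicator (fun a => -deriv k (T - a)) a)
      (k (T - s * S + S * d / 2)) x₀ (r * ((s + s') / 2)) (T - s * S) x
    have h1 : HQ ≤ (cη * 2 ^ ω + 1) * D * F / r := by
      rw [le_div_iff₀ hr, mul_comm]
      exact hHQ.trans (mul_le_mul_of_nonneg_right hCd hF0)
    have h2 : 0 ≤ (cη * 2 ^ ω + 1) * D * F / r := by
      have : 0 ≤ cη * 2 ^ ω := mul_nonneg hcη (Real.rpow_nonneg zero_le_two _)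
      positivity
    calc Ip * HQ ≤ Ip * ((cη * 2 ^ ω + 1) * D * F / r) := mul_le_mul_of_nonneg_left h1 hIp0
      _ ≤ Y / e * ((cη * 2 ^ ω + 1) * D * F / r) := mul_le_mul_of_nonneg_right hI h2
      _ = _ := by field_simp
  have b3 : 2 * Λ * (1 / (r * ((s + s') / 2) - r * s')) ^ 2 *
      (2 * (r * ((s + s') / 2)) * Jp) ≤ 16 * Λ * (D * (Y / r)) := by
    have e1 : r * ((s + s') / 2) - r * s' = r * d / 2 := by rw [hdd]; ring
    rw [e1]
    calc _ ≤ 2 * Λ * (1 / (r * d / 2)) ^ 2 * (2 * r * Y) :=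
          mul_le_mul_of_nonneg_left hRJ (by positivity)
      _ = 16 * Λ * ((d ^ 2)⁻¹ * (Y / r)) := by field_simp; ring
      _ ≤ _ := mul_le_mul_of_nonneg_left (mul_le_mul_of_nonneg_right hD2 hYr) (by linarith)
  have hX0 : 0 ≤ D * (Y / r) := by positivity
  have hX1 : 0 ≤ D * (F / e) * (Y / r) := by positivity
  have hcc : 0 ≤ cη * 2 ^ ω + 1 := by
    have : 0 ≤ cη * 2 ^ ω := mul_nonneg hcη (Real.rpow_nonneg zero_le_two _)
    linarith
  have hkη : 0 ≤ 2 * Ck / η := div_nonneg (by linarith) hη.le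
  unfold timeError energyConst
  rw [← hJp]
  have e2 : (2 * Ck / η + (cη * 2 ^ ω + 1) + 16 * Λ) * (D * (1 + F / e) * (Y / r)) =
      2 * Ck / η * (D * (Y / r)) + 2 * Ck / η * (D * (F / e) * (Y / r))
      + ((cη * 2 ^ ω + 1) * (D * (Y / r)) + (cη * 2 ^ ω + 1) * (D * (F / e) * (Y / r)))
      + (16 * Λ * (D * (Y / r)) + 16 * Λ * (D * (F / e) * (Y / r))) := by ring
  rw [e2]
  have p1 := mul_nonneg hkη hX1
  have p2 := mul_nonneg hcc hX0
  have p3 := mul_nonneg (mul_nonneg (by norm_num : (0 : ℝ) ≤ 16) hΛ) hX1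
  linarith

set_option maxHeartbeats 1000000 in
/-- One step of the De Giorgi iteration. The Sobolev inequality is applied with the weight
`lam = 1 / ϱ` that balances the estimate of the localized square, which carries the factor `ϱ²`,
against the gradient estimate. -/
lemma KernelScale.step (hK : AssumptionK0 k l) (ks : KernelScale k l η β Cl Ck ω cη r τ)
    (hη : 0 < η) (hω : 0 < ω) (hβ : 0 ≤ β) (hcη : 0 ≤ cη) (hCl : 0 < Cl) (hCk : 0 ≤ Ck)
    (hu : RegularSub k T x₀ r ν Λ A u₀ u Du N) (hT : η * τ ≤ T) {σ' σ F : ℝ}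
    (hF : HistoryBound k u₀ u T x₀ r (η * τ) σ' σ F) (hσ' : 0 < σ') (hσ1 : σ ≤ 1)
    {s' s κ κ' : ℝ} (hσs : σ' ≤ s') (hss : s' < s) (hsσ : s ≤ σ) (hκ : 0 ≤ κ) (hκκ : κ < κ') :
    levelEnergy u T x₀ r (η * τ) s' κ' ≤
      stepConst η Cl Ck ω cη ν Λ * (s - s') ^ (-(2 + ω)) * (1 + F / (κ' - κ)) *
      (levelEnergy u T x₀ r (η * τ) s κ *
        (levelEnergy u T x₀ r (η * τ) s κ / (τ * (κ' - κ) ^ 2)) ^ (β / 2)) := by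
  have hr := ks.r_pos
  have hτ := ks.pos
  have hS : 0 < η * τ := mul_pos hη hτ
  have hs' : 0 < s' := hσ'.trans_le hσs
  have hs1 : s ≤ 1 := hsσ.trans hσ1
  have hs0 : 0 < s := hs'.trans hss
  have hY0 : 0 ≤ levelEnergy u T x₀ r (η * τ) s κ := levelEnergy_nonneg
  rcases hY0.eq_or_lt with hYz | hYp
  · refine (hu.levelEnergy_mono hr hS.le hs' hss.le hκ hκκ.le).trans ?_
    rw [← hYz]; simp
  have hν := hu.ν_pos
  have hκ' : 0 ≤ κ' := by linarith
  have hR1 : r * ((s + s') / 2) ≤ r := mul_le_of_le_one_right hr.le (by linarith)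
  have hrs : 0 < r * s := mul_pos hr hs0
  have hL := ks.localization hK hη hω hcη hu hT hs' hss hs1 hκ'
  obtain ⟨hJ, hG⟩ := ks.energyError_le hK hη hω hcη hCk hu hT hF hσ' hσ1 hσs hss hsσ hκ hκκ rfl
  set S := η * τ with hSd
  set Y := levelEnergy u T x₀ r S s κ with hY
  have hd : 0 < s - s' := by linarith
  have he : 0 < κ' - κ := by linarith
  have hs'S : 0 < s' * S := mul_pos hs' hS
  have hsS : s * S ≤ S := mul_le_of_le_one_left hS.le hs1
  set G0 := energyConst η Ck ω cη Λ * ((s - s') ^ (-(2 + ω)) * (1 + F / (κ' - κ)) * (Y / r))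
    with hG0
  -- the times at which the truncation is not zero; Chebyshev's inequality bounds their measure
  set E : Set ℝ := {t | κ' < ballSup u x₀ (r * s) t} ∩ Ioo (T - s * S) T with hE
  have hEm : MeasurableSet E :=
    (measurableSet_lt measurable_const (measurable_ballSup hu.meas _ _)).inter measurableSet_Ioo
  have hEf : volume E ≠ ∞ :=
    ne_top_of_le_ne_top measure_Ioo_lt_top.ne (measure_mono inter_subset_right)
  have hEY : volume.real E ≤ Y / (κ' - κ) ^ 2 := by
    rw [le_div_iff₀ (by positivity)]
    have h1 : ∫ _ in E, (κ' - κ) ^ 2 = volume.real E * (κ' - κ) ^ 2 := by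
      rw [setIntegral_const, smul_eq_mul]
    rw [← h1, hY, levelEnergy]
    have iY := hu.integrable_ballSup_trunc_sq (m' := x₀) hrs hκ
    refine (setIntegral_mono_on (by
      rw [integrableOn_const_iff]; exact Or.inr hEf.lt_top) iY.integrableOn hEm
      fun t ht => ?_).trans (setIntegral_mono_set iY.integrableOn
        (Eventually.of_forall fun t => sq_nonneg _) inter_subset_right.eventuallyLE)
    have h2 : κ' < ballSup u x₀ (r * s) t := ht.1
    exact pow_le_pow_left₀ he.le ((by linarith : κ' - κ ≤ _).trans (le_max_left _ _)) 2
  set X := Y / (τ * (κ' - κ) ^ 2) with hX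
  have hX0 : 0 < X := by positivity
  set ϱ := Real.sqrt Cl * r * X ^ (β / 2) with hϱ
  have hϱ0 : 0 < ϱ := by
    have := Real.sqrt_pos.2 hCl
    have := Real.rpow_pos_of_pos hX0 (β / 2)
    positivity
  have hϱ2 : ϱ ^ 2 = Cl * r ^ 2 * X ^ β := by
    rw [hϱ, mul_pow, mul_pow, Real.sq_sqrt hCl.le, ← Real.rpow_natCast (X ^ (β / 2)),
      ← Real.rpow_mul hX0.le]
    norm_num
  have hρE : ∀ t ∈ Ioo (T - s * S) T, corr (cut T l) (E.indicator fun _ => 1) t ≤ ϱ ^ 2 := by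
    intro t ht
    refine (ks.corr_l_le T t E hEm (fun a ha => ?_) hEf).trans ?_
    · have := ha.2.2
      simp only [mem_Iio]; linarith [ht.1]
    · rw [hϱ2]
      refine mul_le_mul_of_nonneg_left (Real.rpow_le_rpow (div_nonneg measureReal_nonneg hτ.le) ?_
        hβ) (by positivity)
      rw [hX, div_le_iff₀ hτ]
      refine hEY.trans_eq ?_
      field_simp
  have hsq := hL.localSquare_on_le hu hK hEm inter_subset_right (sq_nonneg ϱ) hρE
  have hgr := hL.gradient_le hu hK
  have hind : ∀ z : ℝ × ℝ, E.indicator (fun _ => (1 : ℝ)) z.1 *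
      (ramp ((z.1 - (T - s * S + S * (s - s') / 2)) / (S * (s - s') / 2)) *
        (spaceCutoff x₀ (r * ((s + s') / 2)) (r * s') z.2 ^ 2 * max (u z - κ') 0 ^ 2)) =
      ramp ((z.1 - (T - s * S + S * (s - s') / 2)) / (S * (s - s') / 2)) *
        (spaceCutoff x₀ (r * ((s + s') / 2)) (r * s') z.2 ^ 2 * max (u z - κ') 0 ^ 2) := fun z => by
    by_cases hz : z.1 ∈ E
    · rw [indicator_of_mem hz, one_mul]
    · rw [indicator_of_notMem hz, zero_mul]
      symm
      by_cases hx : z.2 ∈ Metric.closedBall x₀ (r * ((s + s') / 2))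
      · rcases le_or_gt z.1 (T - s * S + S * (s - s') / 2) with h | h
        · rw [hL.θ_zero _ h, zero_mul]
        · by_cases hzT : z.1 < T
          · have h1 : ¬ κ' < ballSup u x₀ (r * s) z.1 := fun h1 =>
              hz ⟨h1, by have := hL.t₁_lt; exact ⟨this.trans h, hzT⟩⟩
            have h2 := hu.le_ballSup (t := z.1) hrs (Metric.closedBall_subset_closedBall
              (mul_le_mul_of_nonneg_left (by linarith : (s + s') / 2 ≤ s) hr.le) hx)
            rw [max_eq_right (by
              have : u z = u (z.1, z.2) := rfl
              linarith)]
            ring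
          · rw [hL.trunc_zero hu fun h' => hzT h'.2]; ring
      · rw [hL.ψ_zero _ hx]; ring
  simp_rw [hind] at hsq
  have hsup := hL.integral_ballSup_sq_le hu (t₃ := T - s' * S) (R'' := r * s')
    (mul_pos hr hs') (fun t ht => ramp_of_one_le ((one_le_div (by positivity)).2 (by
      have : S * (s - s') = s * S - s' * S := by ring
      linarith))) (fun x hx => spaceCutoff_eq_one (mul_lt_mul_of_pos_left (by linarith) hr) hx)
    (lam := 1 / ϱ) (by positivity)
  set I1 := ∫ z : ℝ × ℝ, ramp ((z.1 - (T - s * S + S * (s - s') / 2)) / (S * (s - s') / 2)) *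
    (spaceCutoff x₀ (r * ((s + s') / 2)) (r * s') z.2 ^ 2 * max (u z - κ') 0 ^ 2)
  set I2 := ∫ z : ℝ × ℝ, ramp ((z.1 - (T - s * S + S * (s - s') / 2)) / (S * (s - s') / 2)) *
    (spaceCutoff x₀ (r * ((s + s') / 2)) (r * s') z.2 ^ 2 * {z | κ' < u z}.indicator Du z ^ 2)
  set Jp := ∫ t, ((Ioo (T - s * S) T).indicator
      (fun t => max (ballSup u x₀ (r * s) t - κ') 0) t) ^ 2 with hJp
  have hJ0 : 0 ≤ Jp := integral_nonneg fun t => sq_nonneg _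
  have f1 : I1 ≤ 2 * ϱ ^ 2 * G0 := by
    have := mul_le_mul_of_nonneg_left hG (sq_nonneg ϱ)
    linarith
  have f2 : I2 ≤ 2 / ν * G0 := by
    rw [div_mul_eq_mul_div, le_div_iff₀ hν]; linarith
  set H := (s - s') ^ (-(2 + ω)) * (1 + F / (κ' - κ)) * (Y / r) with hH
  have hFe : 0 ≤ F / (κ' - κ) := div_nonneg hF.nonneg he.le
  have f3 : (1 / (r * ((s + s') / 2) - r * s')) ^ 2 * (2 * (r * ((s + s') / 2)) * Jp) ≤ 8 * H := by
    have e1 : r * ((s + s') / 2) - r * s' = r * (s - s') / 2 := by ring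
    have hD2 : ((s - s') ^ 2)⁻¹ ≤ (s - s') ^ (-(2 + ω)) := by
      have := Real.rpow_le_rpow_of_exponent_ge hd (by linarith : s - s' ≤ 1)
        (by linarith : -(2 + ω) ≤ -2)
      rwa [Real.rpow_neg hd.le, Real.rpow_two] at this
    have hRJ : 2 * (r * ((s + s') / 2)) * Jp ≤ 2 * r * Y := by
      exact mul_le_mul (mul_le_mul_of_nonneg_left hR1 zero_le_two) hJ hJ0
        (mul_nonneg zero_le_two hr.le)
    have hYr : 0 ≤ Y / r := div_nonneg hY0 hr.le
    rw [e1]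
    calc _ ≤ (1 / (r * (s - s') / 2)) ^ 2 * (2 * r * Y) :=
          mul_le_mul_of_nonneg_left hRJ (by positivity)
      _ = 8 * (((s - s') ^ 2)⁻¹ * 1 * (Y / r)) := by field_simp; ring
      _ ≤ 8 * H := by
          refine mul_le_mul_of_nonneg_left ?_ (by norm_num)
          refine mul_le_mul_of_nonneg_right (mul_le_mul hD2 (by linarith) zero_le_one ?_) hYr
          exact Real.rpow_nonneg hd.le _
  have hfin : levelEnergy u T x₀ r S s' κ' ≤ 1 / ϱ * (2 * ϱ ^ 2 * G0) +
      2 / (1 / ϱ) * (2 / ν * G0 + 8 * H) := by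
    refine hsup.trans (add_le_add (mul_le_mul_of_nonneg_left f1 (by positivity))
      (mul_le_mul_of_nonneg_left (add_le_add f2 f3) (by positivity)))
  refine hfin.trans_eq ?_
  have e3 : 1 / ϱ * (2 * ϱ ^ 2 * G0) = 2 * ϱ * G0 := by field_simp
  have e4 : 2 / (1 / ϱ) = 2 * ϱ := by field_simp
  rw [e3, e4, hG0, hϱ, hH]
  unfold stepConst
  field_simp
  ring

end Step

/-! ### De Giorgi iteration and absorption -/

/-- Fast geometric convergence: a superlinear recursion makes `y n` decay geometrically if `y 0` is
small. -/
lemma geometric_decay {y : ℕ → ℝ} {A b α : ℝ} (hy : ∀ n, 0 ≤ y n) (hA : 0 ≤ A) (hb : 0 < b)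
    (hα : 0 < α) (hstep : ∀ n, y (n + 1) ≤ A * b ^ n * (y n * y n ^ α))
    (h0 : A * y 0 ^ α ≤ b ^ (-(1 / α))) (n : ℕ) : y n ≤ (b ^ (-(1 / α))) ^ n * y 0 := by
  set q := b ^ (-(1 / α)) with hq
  have hq0 : 0 < q := Real.rpow_pos_of_pos hb _
  have hqα : q ^ α = b⁻¹ := by
    rw [hq, ← Real.rpow_mul hb.le, neg_mul, one_div, inv_mul_cancel₀ hα.ne', Real.rpow_neg_one]
  induction n with
  | zero => simp
  | succ n ih =>
    have h1 : y n ^ α ≤ (b⁻¹) ^ n * y 0 ^ α := by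
      refine (Real.rpow_le_rpow (hy n) ih hα.le).trans_eq ?_
      rw [Real.mul_rpow (by positivity) (hy 0), ← hqα, ← Real.rpow_natCast, ← Real.rpow_mul hq0.le,
        mul_comm (n : ℝ), Real.rpow_mul hq0.le, Real.rpow_natCast]
    have h2 : b ^ n * (b⁻¹) ^ n = 1 := by rw [← mul_pow, mul_inv_cancel₀ hb.ne', one_pow]
    calc y (n + 1) ≤ A * b ^ n * (y n * y n ^ α) := hstep n
      _ ≤ A * b ^ n * (y n * ((b⁻¹) ^ n * y 0 ^ α)) :=
          mul_le_mul_of_nonneg_left (mul_le_mul_of_nonneg_left h1 (hy n)) (by positivity)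
      _ = (b ^ n * (b⁻¹) ^ n) * (A * y 0 ^ α) * y n := by ring
      _ = (A * y 0 ^ α) * y n := by rw [h2, one_mul]
      _ ≤ q * (q ^ n * y 0) := mul_le_mul h0 ih (hy n) hq0.le
      _ = q ^ (n + 1) * y 0 := by ring

/-- Absorption of a small multiple of a bound on a larger set, along a sequence of sets. -/
lemma absorb {Q : ℕ → ℝ → Prop} {μ B q F : ℝ} (hμ : 0 ≤ μ) (hB : 0 ≤ B) (hq : 0 ≤ q) (hF : 0 ≤ F)
    (hQ : ∀ i K, 0 ≤ K → Q (i + 1) K → Q i (μ * K + B * q ^ i + F)) (n : ℕ) :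
    ∀ K, 0 ≤ K → Q n K →
      Q 0 (μ ^ n * K + ∑ i ∈ Finset.range n, (B * (μ * q) ^ i + μ ^ i * F)) := by
  induction n with
  | zero => intro K _ h; simpa using h
  | succ n ih =>
    intro K hK h
    have h1 := ih _ (by positivity) (hQ n K hK h)
    convert h1 using 1
    rw [Finset.sum_range_succ, mul_pow]
    ring

section Iteration

variable {k l : ℝ → ℝ} {T x₀ r ν Λ : ℝ} {A : ℝ × ℝ → ℝ} {u₀ : ℝ → ℝ} {u Du : ℝ × ℝ → ℝ}
    {N : ℝ → ℝ} {η β Cl Ck ω cη τ : ℝ}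

lemma stepConst_pos (hη : 0 < η) (hcη : 0 ≤ cη) (hCl : 0 < Cl) (hCk : 0 ≤ Ck)
    (hν : 0 < ν) (hΛ : 0 ≤ Λ) : 0 < stepConst η Cl Ck ω cη ν Λ := by
  have h1 := Real.sqrt_pos.2 hCl
  have h2 : 0 ≤ energyConst η Ck ω cη Λ := by
    have : 0 ≤ cη * 2 ^ ω := mul_nonneg hcη (Real.rpow_nonneg zero_le_two _)
    have : 0 ≤ 2 * Ck / η := by positivity
    unfold energyConst
    linarith
  unfold stepConst
  positivity

/-- The ratio of the superlinear recursion to which `geometric_decay` is applied. -/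
noncomputable def iterRatio (β ω : ℝ) : ℝ := 2 ^ (3 + ω + 2 * (β / 2))

/-- The constant of the local boundedness estimate in `L₂`, from the constant `C₁` of one step. -/
noncomputable def iterConst (β ω C₁ : ℝ) : ℝ :=
  (2 * C₁ * iterRatio β ω ^ (1 + 1 / (β / 2))) ^ (1 / (β / 2))

/-- The exponent of `(σ - σ')⁻¹` in the final estimate. -/
noncomputable def iterExp (β ω : ℝ) : ℝ := (2 + ω) / (β / 2)

/-- De Giorgi's iteration: if the level `κ` is large compared with the `L₂` norm on the larger
set, then `u ≤ κ` on the smaller set. -/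
lemma KernelScale.levelEnergy_eq_zero (hK : AssumptionK0 k l)
    (ks : KernelScale k l η β Cl Ck ω cη r τ)
    (hη : 0 < η) (hω : 0 < ω) (hβ : 0 < β) (hcη : 0 ≤ cη) (hCl : 0 < Cl) (hCk : 0 ≤ Ck)
    (hu : RegularSub k T x₀ r ν Λ A u₀ u Du N) (hT : η * τ ≤ T) {σ' σ F : ℝ}
    (hF : HistoryBound k u₀ u T x₀ r (η * τ) σ' σ F) (hσ' : 0 < σ') (hσ1 : σ ≤ 1)
    {s' s κ : ℝ} (hσs : σ' ≤ s') (hss : s' < s) (hsσ : s ≤ σ) (hκ : 0 < κ) (hFκ : F ≤ κ)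
    (hbig : iterConst β ω (stepConst η Cl Ck ω cη ν Λ) * (s - s') ^ (-iterExp β ω) *
      levelEnergy u T x₀ r (η * τ) s 0 ≤ τ * κ ^ 2) :
    levelEnergy u T x₀ r (η * τ) s' κ = 0 := by
  have hr := ks.r_pos
  have hτ := ks.pos
  have hΛ : 0 ≤ Λ := hu.ν_pos.le.trans ((hu.A_ge 0).trans (hu.A_le 0))
  have hC₁ : 0 < stepConst η Cl Ck ω cη ν Λ := stepConst_pos hη hcη hCl hCk hu.ν_pos hΛ
  set C₁ := stepConst η Cl Ck ω cη ν Λ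
  have hS : 0 < η * τ := mul_pos hη hτ
  set S := η * τ with hSd
  have hs' : 0 < s' := hσ'.trans_le hσs
  set α := β / 2 with hα
  have hα0 : 0 < α := by positivity
  set D := s - s' with hD
  have hD0 : 0 < D := by linarith
  set b := iterRatio β ω with hb
  have hb0 : 0 < b := Real.rpow_pos_of_pos two_pos _
  have hb1 : 1 ≤ b := Real.one_le_rpow (by norm_num) (by linarith)
  set sn : ℕ → ℝ := fun n => s' + D * (1 / 2) ^ n with hsn
  set κn : ℕ → ℝ := fun n => κ * (1 - (1 / 2) ^ n) with hκn
  set y : ℕ → ℝ := fun n => levelEnergy u T x₀ r S (sn n) (κn n) with hy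
  have hy0 : ∀ n, 0 ≤ y n := fun n => levelEnergy_nonneg
  have hpow : ∀ n : ℕ, 0 < (1 / 2 : ℝ) ^ n := fun n => by positivity
  have hpow1 : ∀ n : ℕ, (1 / 2 : ℝ) ^ n ≤ 1 := fun n => pow_le_one₀ (by norm_num) (by norm_num)
  have hτκ : 0 < τ * κ ^ 2 := by positivity
  set Ac := 2 * C₁ * b * D ^ (-(2 + ω)) * (τ * κ ^ 2) ^ (-α) with hAc
  have hDp : 0 < D ^ (-(2 + ω)) := Real.rpow_pos_of_pos hD0 _
  have hτp : 0 < (τ * κ ^ 2) ^ (-α) := Real.rpow_pos_of_pos hτκ _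
  have hAc0 : 0 ≤ Ac := by positivity
  have hsn1 : ∀ n, s' ≤ sn n := fun n => by
    have := mul_pos hD0 (hpow n)
    simp only [hsn]; linarith
  have hκn1 : ∀ n, κn n ≤ κ := fun n => by
    have := mul_pos hκ (hpow n)
    simp only [hκn]; linarith
  have hκn0 : ∀ n, 0 ≤ κn n := fun n => mul_nonneg hκ.le (by linarith [hpow1 n])
  have hstep : ∀ n, y (n + 1) ≤ Ac * b ^ n * (y n * y n ^ α) := fun n => by
    set h := (1 / 2 : ℝ) ^ (n + 1) with hh
    have hh0 : 0 < h := hpow _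
    have hh1 : h ≤ 1 := hpow1 _
    have h2 : (1 / 2 : ℝ) ^ n = 2 * h := by rw [hh, pow_succ]; ring
    have es : sn n - sn (n + 1) = D * h := by
      simp only [hsn]; rw [h2, ← hh]; ring
    have eκ : κn (n + 1) - κn n = κ * h := by
      simp only [hκn]; rw [h2, ← hh]; ring
    have hDh : 0 < D * h := mul_pos hD0 hh0
    have hκh : 0 < κ * h := mul_pos hκ hh0
    have h3 := ks.step hK hη hω hβ.le hcη hCl hCk hu hT hF hσ' hσ1 (s' := sn (n + 1)) (s := sn n)
      (κ := κn n) (κ' := κn (n + 1)) (hσs.trans (hsn1 _)) (by linarith) (by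
        have : D * (1 / 2) ^ n ≤ D * 1 := mul_le_mul_of_nonneg_left (hpow1 n) hD0.le
        simp only [hsn]; linarith) (hκn0 n) (by linarith)
    rw [es, eκ] at h3
    refine h3.trans ?_
    have hFh : 1 + F / (κ * h) ≤ 2 / h := by
      have h4 : F / (κ * h) ≤ 1 / h := by
        rw [div_le_div_iff₀ hκh hh0]
        nlinarith
      have h5 : 1 ≤ 1 / h := (one_le_div hh0).2 hh1
      have h6 : 2 / h = 1 / h + 1 / h := by ring
      linarith
    have hX : (y n / (τ * (κ * h) ^ 2)) ^ α = y n ^ α * ((τ * κ ^ 2) ^ (-α) * h ^ (-(2 * α))) := by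
      have e1 : τ * (κ * h) ^ 2 = (τ * κ ^ 2) * h ^ (2 : ℝ) := by
        rw [Real.rpow_two]; ring
      rw [e1, Real.div_rpow (hy0 n) (by positivity), Real.mul_rpow hτκ.le (by positivity),
        ← Real.rpow_mul hh0.le, Real.rpow_neg hτκ.le, Real.rpow_neg hh0.le, div_eq_mul_inv, mul_inv]
    have hbh : h ^ (-(3 + ω + 2 * α)) = b ^ (n + 1) := by
      rw [hh, one_div, inv_pow, Real.inv_rpow (by positivity), ← Real.rpow_neg (by positivity),
        neg_neg, hb, iterRatio, ← Real.rpow_natCast, ← Real.rpow_mul zero_le_two,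
        ← Real.rpow_natCast, ← Real.rpow_mul zero_le_two, mul_comm]
    have hprod : h ^ (-(2 + ω)) * h⁻¹ * h ^ (-(2 * α)) = b ^ (n + 1) := by
      rw [← hbh, ← Real.rpow_neg_one, ← Real.rpow_add hh0, ← Real.rpow_add hh0]
      congr 1; ring
    have hyα : 0 ≤ y n ^ α := Real.rpow_nonneg (hy0 n) _
    have hlast : 0 ≤ y n * (y n / (τ * (κ * h) ^ 2)) ^ α :=
      mul_nonneg (hy0 n) (Real.rpow_nonneg (div_nonneg (hy0 n) (by positivity)) _)
    calc C₁ * (D * h) ^ (-(2 + ω)) * (1 + F / (κ * h)) * (y n * (y n / (τ * (κ * h) ^ 2)) ^ α)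
        ≤ C₁ * (D * h) ^ (-(2 + ω)) * (2 / h) * (y n * (y n / (τ * (κ * h) ^ 2)) ^ α) :=
          mul_le_mul_of_nonneg_right (mul_le_mul_of_nonneg_left hFh
            (mul_nonneg hC₁.le (Real.rpow_nonneg hDh.le _))) hlast
      _ = 2 * C₁ * D ^ (-(2 + ω)) * (τ * κ ^ 2) ^ (-α) *
          (h ^ (-(2 + ω)) * h⁻¹ * h ^ (-(2 * α))) * (y n * y n ^ α) := by
          rw [hX, Real.mul_rpow hD0.le hh0.le]; ring
      _ = Ac * b ^ n * (y n * y n ^ α) := by rw [hprod, hAc]; ring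
  have hsn0 : sn 0 = s := by simp [hsn, hD]
  have hκn00 : κn 0 = 0 := by simp [hκn]
  have hy00 : y 0 = levelEnergy u T x₀ r S s 0 := by simp only [hy]; rw [hsn0, hκn00]
  have h0 : Ac * y 0 ^ α ≤ b ^ (-(1 / α)) := by
    set Y := y 0 with hY
    have hbb : 0 < 2 * C₁ * b ^ (1 + 1 / α) := by
      have := Real.rpow_pos_of_pos hb0 (1 + 1 / α); positivity
    have h1 : 2 * C₁ * b ^ (1 + 1 / α) * D ^ (-(2 + ω)) * Y ^ α ≤ (τ * κ ^ 2) ^ α := by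
      rw [← hy00] at hbig
      have hI : 0 ≤ iterConst β ω C₁ := Real.rpow_nonneg hbb.le _
      have h2 := Real.rpow_le_rpow (mul_nonneg (mul_nonneg hI (Real.rpow_nonneg hD0.le _))
        (hy0 0)) hbig hα0.le
      rw [Real.mul_rpow (mul_nonneg hI (Real.rpow_nonneg hD0.le _)) (hy0 0),
        Real.mul_rpow hI (Real.rpow_nonneg hD0.le _)] at h2
      have e1 : iterConst β ω C₁ ^ α = 2 * C₁ * b ^ (1 + 1 / α) := by
        rw [iterConst, ← Real.rpow_mul hbb.le, one_div_mul_cancel hα0.ne', Real.rpow_one]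
      have e2 : (D ^ (-iterExp β ω)) ^ α = D ^ (-(2 + ω)) := by
        rw [← Real.rpow_mul hD0.le, iterExp]
        congr 1
        rw [neg_mul, div_mul_cancel₀ _ hα0.ne']
      rwa [e1, e2] at h2
    have e3 : Ac * Y ^ α = b ^ (-(1 / α)) * (2 * C₁ * b ^ (1 + 1 / α) * D ^ (-(2 + ω)) * Y ^ α) *
        (τ * κ ^ 2) ^ (-α) := by
      have : b = b ^ (-(1 / α)) * b ^ (1 + 1 / α) := by
        rw [← Real.rpow_add hb0]
        have : -(1 / α) + (1 + 1 / α) = 1 := by ring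
        rw [this, Real.rpow_one]
      rw [hAc]
      calc 2 * C₁ * b * D ^ (-(2 + ω)) * (τ * κ ^ 2) ^ (-α) * Y ^ α
          = 2 * C₁ * (b ^ (-(1 / α)) * b ^ (1 + 1 / α)) * D ^ (-(2 + ω)) *
            (τ * κ ^ 2) ^ (-α) * Y ^ α := by rw [← this]
        _ = _ := by ring
    rw [e3]
    have h5 : (τ * κ ^ 2) ^ α * (τ * κ ^ 2) ^ (-α) = 1 := by
      rw [← Real.rpow_add hτκ]; simp
    have hbn : 0 < b ^ (-(1 / α)) := Real.rpow_pos_of_pos hb0 _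
    calc _ ≤ b ^ (-(1 / α)) * (τ * κ ^ 2) ^ α * (τ * κ ^ 2) ^ (-α) :=
          mul_le_mul_of_nonneg_right (mul_le_mul_of_nonneg_left h1 hbn.le) hτp.le
      _ = b ^ (-(1 / α)) := by rw [mul_assoc, h5, mul_one]
  have hdec := geometric_decay hy0 hAc0 hb0 hα0 hstep h0
  have hq1 : b ^ (-(1 / α)) < 1 := by
    refine Real.rpow_lt_one_of_one_lt_of_neg ?_ ?_
    · exact Real.one_lt_rpow (by norm_num) (by linarith)
    · have := one_div_pos.2 hα0; linarith
  have hlim : Tendsto (fun n : ℕ => (b ^ (-(1 / α))) ^ n * y 0) atTop (𝓝 0) := by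
    have := (tendsto_pow_atTop_nhds_zero_of_lt_one (Real.rpow_pos_of_pos hb0 _).le
      hq1).mul_const (y 0)
    rwa [zero_mul] at this
  refine le_antisymm (ge_of_tendsto' hlim fun n => ?_) levelEnergy_nonneg
  exact (hu.levelEnergy_mono hr hS.le hs' (hsn1 n) (hκn0 n) (hκn1 n)).trans (hdec n)

/-- `u ≤ K` on the cylinder of parameter `s`, in terms of the suprema over balls. -/
def BoundedOn (u : ℝ × ℝ → ℝ) (T x₀ r S s K : ℝ) : Prop :=
  ∀ᵐ t, t ∈ Ioo (T - s * S) T → ballSup u x₀ (r * s) t ≤ K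

lemma RegularSub.boundedOn_of_levelEnergy (hu : RegularSub k T x₀ r ν Λ A u₀ u Du N)
    {S s κ : ℝ} (hrs : 0 < r * s) (hκ : 0 ≤ κ) (h : levelEnergy u T x₀ r S s κ = 0) :
    BoundedOn u T x₀ r S s κ := by
  have h1 := (setIntegral_eq_zero_iff_of_nonneg_ae (Eventually.of_forall fun t => sq_nonneg _)
    (hu.integrable_ballSup_trunc_sq hrs hκ).integrableOn).1 h
  filter_upwards [(ae_restrict_iff' measurableSet_Ioo).1 h1] with t ht htI
  have h2 : max (ballSup u x₀ (r * s) t - κ) 0 = 0 := pow_eq_zero_iff two_ne_zero |>.1 (ht htI)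
  have := le_max_left (ballSup u x₀ (r * s) t - κ) 0
  linarith

lemma RegularSub.boundedOn_mono (hu : RegularSub k T x₀ r ν Λ A u₀ u Du N) (hr : 0 < r)
    {S s s' K : ℝ} (hS : 0 ≤ S) (hs' : 0 < s') (hss : s' ≤ s) (h : BoundedOn u T x₀ r S s K) :
    BoundedOn u T x₀ r S s' K := by
  filter_upwards [h] with t ht htI
  refine (hu.ballSup_mono (mul_pos hr hs') (mul_le_mul_of_nonneg_left hss hr.le)).trans (ht ?_)
  have := mul_le_mul_of_nonneg_right hss hS
  exact ⟨by linarith [htI.1], htI.2⟩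

/-- The local boundedness estimate in terms of the `L₁`-in-time norm `I` of the supremum. -/
lemma KernelScale.boundedOn (hK : AssumptionK0 k l)
    (ks : KernelScale k l η β Cl Ck ω cη r τ)
    (hη : 0 < η) (hω : 0 < ω) (hβ : 0 < β) (hcη : 0 ≤ cη) (hCl : 0 < Cl) (hCk : 0 ≤ Ck)
    (hu : RegularSub k T x₀ r ν Λ A u₀ u Du N) (hT : η * τ ≤ T) {σ' σ F I : ℝ}
    (hF : HistoryBound k u₀ u T x₀ r (η * τ) σ' σ F) (hF0 : 0 < F) (hσ' : 0 < σ') (hσσ : σ' < σ)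
    (hσ1 : σ ≤ 1)
    (hI : I = 1 / τ * ∫ t in Ioo (T - σ * (η * τ)) T, ballSup u x₀ (r * σ) t) :
    BoundedOn u T x₀ r (η * τ) σ'
      (2 * (iterConst β ω (stepConst η Cl Ck ω cη ν Λ) * 2 ^ iterExp β ω *
        4 ^ iterExp β ω + 1) * (σ - σ') ^ (-iterExp β ω) * (I + F)) := by
  have hr := ks.r_pos
  have hτ := ks.pos
  have hΛ : 0 ≤ Λ := hu.ν_pos.le.trans ((hu.A_ge 0).trans (hu.A_le 0))
  have hC₁ : 0 < stepConst η Cl Ck ω cη ν Λ := stepConst_pos hη hcη hCl hCk hu.ν_pos hΛ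
  have hzero := @KernelScale.levelEnergy_eq_zero k l T x₀ r ν Λ A u₀ u Du N η β Cl Ck ω cη τ hK ks
    hη hω hβ hcη hCl hCk hu hT σ' σ F hF hσ' hσ1
  set C₂ := iterConst β ω (stepConst η Cl Ck ω cη ν Λ) with hC₂d
  have hC₂ : 0 < C₂ := by
    have := Real.rpow_pos_of_pos (Real.rpow_pos_of_pos two_pos (3 + ω + 2 * (β / 2)))
      (1 + 1 / (β / 2))
    refine Real.rpow_pos_of_pos ?_ _
    unfold iterRatio
    positivity
  set E := iterExp β ω with hE
  have hE0 : 0 < E := by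
    have : 0 < β / 2 := by positivity
    rw [hE, iterExp]; positivity
  have hS : 0 < η * τ := mul_pos hη hτ
  set S := η * τ with hSd
  have hσ0 : 0 < σ := hσ'.trans hσσ
  have hrσ : 0 < r * σ := mul_pos hr hσ0
  set D := σ - σ' with hD
  have hD0 : 0 < D := by linarith
  have hD1 : D ≤ 1 := by linarith
  have hSi : IntegrableOn (ballSup u x₀ (r * σ)) (Ioo (T - σ * S) T) := by
    refine Integrable.mono' (memLp_two_integrableOn measure_Ioo_lt_top.ne (hu.memLp_N.restrict _))
      (measurable_ballSup hu.meas _ _).aestronglyMeasurable (Eventually.of_forall fun t => ?_)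
    rw [Real.norm_of_nonneg (hu.ballSup_nonneg hrσ)]
    exact hu.ballSup_le_N hrσ
  have hI0 : 0 ≤ I := by
    rw [hI]
    exact mul_nonneg (by positivity) (setIntegral_nonneg measurableSet_Ioo fun t _ =>
      hu.ballSup_nonneg hrσ)
  -- a bound `K` on a larger set improves to a small multiple of `K` plus controlled terms
  have himp : ∀ s' s K, σ' ≤ s' → s' < s → s ≤ σ → 0 ≤ K → BoundedOn u T x₀ r S s K →
      BoundedOn u T x₀ r S s' (Real.sqrt (C₂ * (s - s') ^ (-E) * (K * I)) + F) := by
    intro s' s K hs1 hs2 hs3 hK0 hbd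
    have hs'0 : 0 < s' := hσ'.trans_le hs1
    have hs0 : 0 < s := hs'0.trans hs2
    have hrs : 0 < r * s := mul_pos hr hs0
    have hdp : 0 < (s - s') ^ (-E) := Real.rpow_pos_of_pos (by linarith) _
    have hκ : 0 < Real.sqrt (C₂ * (s - s') ^ (-E) * (K * I)) + F :=
      add_pos_of_nonneg_of_pos (Real.sqrt_nonneg _) hF0
    refine hu.boundedOn_of_levelEnergy (mul_pos hr hs'0) hκ.le
      (hzero hs1 hs2 hs3 hκ (by linarith [Real.sqrt_nonneg (C₂ * (s - s') ^ (-E) * (K * I))]) ?_)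
    have hsub : Ioo (T - s * S) T ⊆ Ioo (T - σ * S) T := Ioo_subset_Ioo_left (by
      have := mul_le_mul_of_nonneg_right hs3 hS.le
      linarith)
    have hY : levelEnergy u T x₀ r S s 0 ≤ τ * (K * I) := by
      have h1 : levelEnergy u T x₀ r S s 0 ≤
          ∫ t in Ioo (T - s * S) T, K * ballSup u x₀ (r * σ) t := by
        unfold levelEnergy
        refine setIntegral_mono_ae_restrict
          (hu.integrable_ballSup_trunc_sq hrs le_rfl).integrableOn
          ((hSi.mono_set hsub).const_mul K) ((ae_restrict_iff' measurableSet_Ioo).2 ?_)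
        filter_upwards [hbd] with t ht htI
        have h2 := hu.ballSup_nonneg (m' := x₀) (t := t) hrs
        rw [sub_zero, max_eq_left h2, sq]
        exact mul_le_mul (ht htI) (hu.ballSup_mono hrs (mul_le_mul_of_nonneg_left hs3 hr.le)) h2 hK0
      have h3 : ∫ t in Ioo (T - s * S) T, ballSup u x₀ (r * σ) t ≤
          ∫ t in Ioo (T - σ * S) T, ballSup u x₀ (r * σ) t :=
        setIntegral_mono_set hSi (Eventually.of_forall fun t => hu.ballSup_nonneg hrσ)
          hsub.eventuallyLE
      rw [integral_const_mul] at h1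
      refine h1.trans ((mul_le_mul_of_nonneg_left h3 hK0).trans_eq ?_)
      rw [hI]; field_simp
    have hX : 0 ≤ C₂ * (s - s') ^ (-E) * (K * I) := by positivity
    calc C₂ * (s - s') ^ (-E) * levelEnergy u T x₀ r S s 0
        ≤ C₂ * (s - s') ^ (-E) * (τ * (K * I)) := mul_le_mul_of_nonneg_left hY (by positivity)
      _ = τ * Real.sqrt (C₂ * (s - s') ^ (-E) * (K * I)) ^ 2 := by rw [Real.sq_sqrt hX]; ring
      _ ≤ _ := mul_le_mul_of_nonneg_left (pow_le_pow_left₀ (Real.sqrt_nonneg _)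
          (by linarith) 2) hτ.le
  -- some finite bound on an intermediate set, without which there is nothing to absorb
  obtain ⟨N₀, hN₀, hbd0⟩ : ∃ N₀, 0 ≤ N₀ ∧ BoundedOn u T x₀ r S (σ' + D / 2) N₀ := by
    set X := C₂ * (σ - (σ' + D / 2)) ^ (-E) * levelEnergy u T x₀ r S σ 0 / τ with hX
    have hX0 : 0 ≤ X := by
      have : 0 < (σ - (σ' + D / 2)) ^ (-E) := Real.rpow_pos_of_pos (by linarith) _
      have : 0 ≤ levelEnergy u T x₀ r S σ 0 := levelEnergy_nonneg
      positivity
    have hκ : 0 < Real.sqrt X + F := add_pos_of_nonneg_of_pos (Real.sqrt_nonneg _) hF0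
    refine ⟨Real.sqrt X + F, hκ.le, hu.boundedOn_of_levelEnergy (mul_pos hr (by linarith)) hκ.le
      (hzero (by linarith) (by linarith) le_rfl hκ (by linarith [Real.sqrt_nonneg X]) ?_)⟩
    have h1 : X ≤ (Real.sqrt X + F) ^ 2 := by
      nlinarith [Real.sq_sqrt hX0, Real.sqrt_nonneg X]
    have h2 : C₂ * (σ - (σ' + D / 2)) ^ (-E) * levelEnergy u T x₀ r S σ 0 = τ * X := by
      rw [hX]; field_simp
    rw [h2]
    exact mul_le_mul_of_nonneg_left h1 hτ.le
  set μ : ℝ := (2 : ℝ) ^ (-E) / 2 with hμ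
  have h2E : 0 < (2 : ℝ) ^ (-E) := Real.rpow_pos_of_pos two_pos _
  have h2E1 : (2 : ℝ) ^ (-E) ≤ 1 := Real.rpow_le_one_of_one_le_of_nonpos (by norm_num) (by linarith)
  have h2E' : 0 < (2 : ℝ) ^ E := Real.rpow_pos_of_pos two_pos _
  have h2EE : (2 : ℝ) ^ (-E) * 2 ^ E = 1 := by rw [← Real.rpow_add two_pos]; simp
  have hμ0 : 0 < μ := by positivity
  have hμ1 : μ ≤ 1 / 2 := by rw [hμ]; linarith
  set B := C₂ * 2 ^ E * 4 ^ E * D ^ (-E) * I with hB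
  have h4E : 0 < (4 : ℝ) ^ E := Real.rpow_pos_of_pos (by norm_num) _
  have hDE : 0 < D ^ (-E) := Real.rpow_pos_of_pos hD0 _
  have hB0 : 0 ≤ B := by positivity
  set sn : ℕ → ℝ := fun i => σ' + D / 2 * (1 - (1 / 2) ^ i) with hsn
  have hpow : ∀ n : ℕ, 0 < (1 / 2 : ℝ) ^ n := fun n => by positivity
  have hpow1 : ∀ n : ℕ, (1 / 2 : ℝ) ^ n ≤ 1 := fun n => pow_le_one₀ (by norm_num) (by norm_num)
  have hsn1 : ∀ i, σ' ≤ sn i := fun i => by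
    have := mul_nonneg (by linarith : 0 ≤ D / 2) (by linarith [hpow1 i] : 0 ≤ 1 - (1 / 2 : ℝ) ^ i)
    simp only [hsn]; linarith
  have hsn2 : ∀ i, sn i ≤ σ' + D / 2 := fun i => by
    have := mul_le_mul_of_nonneg_left (by linarith [hpow i] : 1 - (1 / 2 : ℝ) ^ i ≤ 1)
      (by linarith : 0 ≤ D / 2)
    simp only [hsn]; linarith
  have hQ : ∀ i K, 0 ≤ K → BoundedOn u T x₀ r S (sn (i + 1)) K →
      BoundedOn u T x₀ r S (sn i) (μ * K + B * ((2 : ℝ) ^ E) ^ i + F) := by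
    intro i K hK0 hbd
    have hd : sn (i + 1) - sn i = D / 4 * (1 / 2) ^ i := by
      simp only [hsn]; rw [pow_succ]; ring
    have hdpos : 0 < D / 4 * (1 / 2 : ℝ) ^ i := mul_pos (by linarith) (hpow i)
    have h1 := himp (sn i) (sn (i + 1)) K (hsn1 i) (by linarith) ((hsn2 _).trans (by linarith))
      hK0 hbd
    rw [hd] at h1
    have e1 : (D / 4 * (1 / 2 : ℝ) ^ i) ^ (-E) = 4 ^ E * D ^ (-E) * ((2 : ℝ) ^ E) ^ i := by
      rw [Real.mul_rpow (by linarith) (hpow i).le, Real.div_rpow hD0.le (by norm_num),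
        Real.rpow_neg (by norm_num : (0 : ℝ) ≤ 4), div_inv_eq_mul, one_div, inv_pow,
        Real.inv_rpow (by positivity), ← Real.rpow_neg (by positivity), neg_neg,
        ← Real.rpow_natCast, ← Real.rpow_mul zero_le_two, ← Real.rpow_natCast,
        ← Real.rpow_mul zero_le_two, mul_comm (i : ℝ) E]
      ring
    -- Young's inequality with the weight `μ`, which beats the growth `2 ^ E` of the constants
    have h2 : Real.sqrt (C₂ * (D / 4 * (1 / 2 : ℝ) ^ i) ^ (-E) * (K * I)) ≤
        μ * K + B * ((2 : ℝ) ^ E) ^ i := by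
      refine Real.sqrt_le_iff.2 ⟨by positivity, ?_⟩
      have e2 : C₂ * (D / 4 * (1 / 2 : ℝ) ^ i) ^ (-E) * (K * I) =
          2 * (μ * K) * (B * ((2 : ℝ) ^ E) ^ i) := by
        rw [e1, hB, hμ]
        calc _ = (1 : ℝ) * (C₂ * (4 ^ E * D ^ (-E) * ((2 : ℝ) ^ E) ^ i) * (K * I)) := by ring
          _ = ((2 : ℝ) ^ (-E) * 2 ^ E) *
              (C₂ * (4 ^ E * D ^ (-E) * ((2 : ℝ) ^ E) ^ i) * (K * I)) := by rw [h2EE]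
          _ = _ := by ring
      rw [e2]
      nlinarith [sq_nonneg (μ * K), sq_nonneg (B * ((2 : ℝ) ^ E) ^ i)]
    filter_upwards [h1] with t ht htI
    linarith [ht htI]
  have habs := absorb (Q := fun i K => BoundedOn u T x₀ r S (sn i) K) hμ0.le hB0 h2E'.le hF0.le hQ
  have hsn0 : sn 0 = σ' := by simp [hsn]
  have hfin : ∀ n : ℕ, BoundedOn u T x₀ r S σ' (μ ^ n * N₀ + 2 * (B + F)) := by
    intro n
    have h1 := habs n N₀ hN₀ (hu.boundedOn_mono hr hS.le (hσ'.trans_le (hsn1 n)) (hsn2 n) hbd0)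
    simp only [hsn0] at h1
    have h2 : ∑ i ∈ Finset.range n, (B * (μ * 2 ^ E) ^ i + μ ^ i * F) ≤ 2 * (B + F) := by
      have e1 : μ * 2 ^ E = 1 / 2 := by rw [hμ]; linarith
      have h3 : ∀ i ∈ Finset.range n, B * (μ * 2 ^ E) ^ i + μ ^ i * F ≤ (B + F) * (1 / 2) ^ i := by
        intro i _
        rw [e1]
        have := mul_le_mul_of_nonneg_right (pow_le_pow_left₀ hμ0.le hμ1 i) hF0.le
        linarith
      refine (Finset.sum_le_sum h3).trans ?_
      rw [← Finset.mul_sum, mul_comm 2]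
      refine mul_le_mul_of_nonneg_left ?_ (by positivity)
      have := summable_geometric_two.sum_le_tsum (Finset.range n) (fun i _ => by positivity)
      rwa [tsum_geometric_two] at this
    filter_upwards [h1] with t ht htI
    linarith [ht htI]
  have hall : ∀ᵐ t, ∀ n : ℕ, t ∈ Ioo (T - σ' * S) T →
      ballSup u x₀ (r * σ') t ≤ μ ^ n * N₀ + 2 * (B + F) := ae_all_iff.2 hfin
  filter_upwards [hall] with t ht htI
  have hlim : Tendsto (fun n : ℕ => μ ^ n * N₀ + 2 * (B + F)) atTop (𝓝 (2 * (B + F))) := by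
    have := ((tendsto_pow_atTop_nhds_zero_of_lt_one hμ0.le (by linarith)).mul_const
      N₀).add_const (2 * (B + F))
    simpa using this
  refine (ge_of_tendsto' hlim fun n => ht n htI).trans ?_
  have hDE1 : 1 ≤ D ^ (-E) :=
    Real.one_le_rpow_of_pos_of_le_one_of_nonpos hD0 hD1 (by linarith)
  have g1 : 0 ≤ C₂ * 2 ^ E * 4 ^ E * D ^ (-E) * F := by positivity
  have g2 : 0 ≤ D ^ (-E) * I := by positivity
  have g3 : F ≤ D ^ (-E) * F := le_mul_of_one_le_left hF0.le hDE1
  have e5 : 2 * (C₂ * 2 ^ E * 4 ^ E + 1) * D ^ (-E) * (I + F) =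
      2 * (B + D ^ (-E) * F) + 2 * (C₂ * 2 ^ E * 4 ^ E * D ^ (-E) * F + D ^ (-E) * I) := by
    rw [hB]; ring
  rw [e5]
  linarith

end Iteration

/-! ### Representatives that are absolutely continuous in space -/

/-- A jointly measurable representative `u` of `v`, nonnegative and, at each time, a primitive of
its weak derivative `Du` on the whole line; `N` dominates `u` at each time. Both `u` and `Du` are
set to zero outside of the time interval, and at the exceptional times at which `v` is not a
Sobolev function. -/
structure SobolevRep (T m R : ℝ) (v Dv : ℝ → ℝ → ℝ) (u Du : ℝ × ℝ → ℝ) (N : ℝ → ℝ) : Prop where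
  meas : Measurable u
  meas_D : Measurable Du
  prim : ∀ t, IsPrimitive (fun x => u (t, x)) (fun x => Du (t, x))
  nonneg : ∀ z, 0 ≤ u z
  zero : ∀ z : ℝ × ℝ, z.1 ∉ Ioo 0 T → u z = 0
  D_zero : ∀ z, z ∉ cyl T (Metric.ball m R) → Du z = 0
  memLp_D : MemLp Du 2
  meas_N : Measurable N
  memLp_N : MemLp N 2
  le_N : ∀ z : ℝ × ℝ, u z ≤ N z.1
  ae_eq : ∀ᵐ z ∂(volume.restrict (cyl T (Metric.ball m R))), v z.1 z.2 = u z
  ae_eq_D : ∀ᵐ z ∂(volume.restrict (cyl T (Metric.ball m R))), Dv z.1 z.2 = Du z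

/-- For functions supported in a bounded interval in space, the spatial `L¹` norm is square
integrable in time. -/
lemma memLp_integral_abs {m R : ℝ} {F : ℝ × ℝ → ℝ} (hm : Measurable F) (hF : MemLp F 2)
    (h0 : ∀ z : ℝ × ℝ, z.2 ∉ Metric.ball m R → F z = 0) :
    MemLp (fun t => ∫ x, |F (t, x)|) 2 := by
  have hmeas : Measurable fun t => ∫ x, |F (t, x)| :=
    (StronglyMeasurable.integral_prod_right (f := fun t x => |F (t, x)|)
      hm.norm.stronglyMeasurable).measurable
  have hsq := hF.integrable_sq
  rw [memLp_two_iff_integrable_sq hmeas.aestronglyMeasurable]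
  have hI : Integrable fun t => (volume (Metric.ball m R)).toReal * ∫ x, F (t, x) ^ 2 :=
    (Integrable.integral_prod_left hsq).const_mul _
  refine hI.mono' (hmeas.pow_const 2).aestronglyMeasurable ?_
  filter_upwards [hsq.prod_right_ae] with t ht
  rw [Real.norm_of_nonneg (sq_nonneg _)]
  have hft : MemLp (fun x => F (t, x)) 2 :=
    (memLp_two_iff_integrable_sq (hm.comp (by fun_prop)).aestronglyMeasurable).2 ht
  have h1 : ∫ x, |F (t, x)| = ∫ x in Metric.ball m R, |F (t, x)| :=
    (setIntegral_eq_integral_of_forall_compl_eq_zero fun x hx => by rw [h0 (t, x) hx, abs_zero]).symm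
  have h2 : ∫ x, F (t, x) ^ 2 = ∫ x in Metric.ball m R, F (t, x) ^ 2 :=
    (setIntegral_eq_integral_of_forall_compl_eq_zero fun x hx => by
      rw [h0 (t, x) hx]; norm_num).symm
  rw [h1, h2]
  -- Cauchy–Schwarz on the interval, as the nonnegativity of the variance of `|F (t, ·)|`
  set V := (volume (Metric.ball m R)).toReal with hV
  have hfin : volume (Metric.ball m R) ≠ ∞ := measure_ball_lt_top.ne
  have hi1 : IntegrableOn (fun x => |F (t, x)|) (Metric.ball m R) :=
    (memLp_two_integrableOn hfin (hft.restrict _)).abs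
  have hi2 : IntegrableOn (fun x => F (t, x) ^ 2) (Metric.ball m R) := ht.integrableOn
  set a := ∫ x in Metric.ball m R, |F (t, x)| with ha
  have h3 : 0 ≤ ∫ x in Metric.ball m R, (V * |F (t, x)| - a) ^ 2 := by positivity
  have h4 : ∫ x in Metric.ball m R, (V * |F (t, x)| - a) ^ 2
      = V ^ 2 * (∫ x in Metric.ball m R, F (t, x) ^ 2) - 2 * V * a * a + a ^ 2 * V := by
    have : ∀ x, (V * |F (t, x)| - a) ^ 2
        = V ^ 2 * F (t, x) ^ 2 - 2 * V * a * |F (t, x)| + a ^ 2 := fun x => by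
      rw [← sq_abs (F (t, x))]; ring
    simp only [this]
    rw [integral_add (f := fun x => V ^ 2 * F (t, x) ^ 2 - 2 * V * a * |F (t, x)|)
        (g := fun _ => a ^ 2) ((hi2.const_mul _).sub (hi1.const_mul _)) (integrableOn_const hfin),
      integral_sub (f := fun x => V ^ 2 * F (t, x) ^ 2) (g := fun x => 2 * V * a * |F (t, x)|)
        (hi2.const_mul _) (hi1.const_mul _), integral_const_mul, integral_const_mul,
      setIntegral_const, ← ha, smul_eq_mul, measureReal_def, ← hV]
    ring
  have hV0 : 0 ≤ V := ENNReal.toReal_nonneg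
  rcases hV0.eq_or_lt with hV' | hV'
  · have hz : volume (Metric.ball m R) = 0 := by
      rcases (ENNReal.toReal_eq_zero_iff _).1 (hV.symm.trans hV'.symm) with h | h
      · exact h
      · exact absurd h hfin
    have : a = 0 := by rw [ha, Measure.restrict_eq_zero.2 hz, integral_zero_measure]
    rw [this, ← hV']; norm_num
  · have h5 : 0 ≤ V * (V * (∫ x in Metric.ball m R, F (t, x) ^ 2) - a ^ 2) := by
      rw [h4] at h3; linarith
    have := nonneg_of_mul_nonneg_right h5 hV'
    linarith

/-- A continuous function which is nonnegative a.e. on a ball is nonnegative on its closure. -/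
lemma nonneg_on_closedBall_of_ae {w : ℝ → ℝ} {m R : ℝ} (hR : 0 < R) (hw : Continuous w)
    (h : ∀ᵐ x ∂(volume.restrict (Metric.ball m R)), 0 ≤ w x) :
    ∀ x ∈ Metric.closedBall m R, 0 ≤ w x := by
  intro x hx
  by_contra hlt
  have hopen : IsOpen {y | w y < 0} := isOpen_lt hw continuous_const
  rw [← closure_ball m hR.ne'] at hx
  have hne := mem_closure_iff.1 hx _ hopen (not_le.1 hlt)
  have hpos : 0 < volume ({y | w y < 0} ∩ Metric.ball m R) :=
    (hopen.inter Metric.isOpen_ball).measure_pos _ hne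
  rw [ae_restrict_iff' measurableSet_ball, ae_iff] at h
  refine hpos.ne' (measure_mono_null ?_ h)
  rintro y ⟨h1, h2⟩ h3
  exact absurd (h3 h2) (not_le.2 h1)

/-- A primitive which is nonnegative a.e. on a ball, and whose derivative is zero outside of the
ball, is nonnegative on the whole line. -/
lemma IsPrimitive.nonneg_of_ae {w g : ℝ → ℝ} {m R : ℝ} (hR : 0 < R) (hw : IsPrimitive w g)
    (hg : ∀ x, x ∉ Metric.ball m R → g x = 0)
    (h : ∀ᵐ x ∂(volume.restrict (Metric.ball m R)), 0 ≤ w x) (x : ℝ) : 0 ≤ w x := by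
  have hcl := nonneg_on_closedBall_of_ae hR hw.continuous h
  rcases lt_or_ge x (m - R) with h1 | h1
  · have h2 := hw.sub_eq x (m - R)
    rw [intervalIntegral.integral_zero_ae] at h2
    · have := hcl (m - R) (by rw [Real.closedBall_eq_Icc]; constructor <;> linarith)
      linarith
    · refine Eventually.of_forall fun y hy => hg y fun hyb => ?_
      rw [uIoc_of_le h1.le] at hy
      rw [Real.ball_eq_Ioo] at hyb
      linarith [hy.2, hyb.1]
  rcases lt_or_ge (m + R) x with h3 | h3
  · have h2 := hw.sub_eq (m + R) x
    rw [intervalIntegral.integral_zero_ae] at h2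
    · have := hcl (m + R) (by rw [Real.closedBall_eq_Icc]; constructor <;> linarith)
      linarith
    · refine Eventually.of_forall fun y hy => hg y fun hyb => ?_
      rw [uIoc_of_le h3.le] at hy
      rw [Real.ball_eq_Ioo] at hyb
      linarith [hy.1, hyb.2]
  exact hcl x (by rw [Real.closedBall_eq_Icc]; exact ⟨h1, h3⟩)

/-- Joint measurability of the spatial primitive. -/
lemma measurable_primitive {D : ℝ × ℝ → ℝ} (hD : Measurable D) (m : ℝ) :
    Measurable fun z : ℝ × ℝ => ∫ y in m..z.2, D (z.1, y) := by
  have h1 : ∀ s : Set (ℝ × ℝ), MeasurableSet s →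
      Measurable fun z : ℝ × ℝ => ∫ y, s.indicator (fun _ => (1 : ℝ)) (z.2, y) * D (z.1, y) := by
    intro s hs
    have hm : Measurable fun p : (ℝ × ℝ) × ℝ =>
        s.indicator (fun _ => (1 : ℝ)) (p.1.2, p.2) * D (p.1.1, p.2) :=
      ((measurable_const.indicator hs).comp (by fun_prop)).mul (hD.comp (by fun_prop))
    exact (StronglyMeasurable.integral_prod_right
      (f := fun (z : ℝ × ℝ) (y : ℝ) => s.indicator (fun _ => (1 : ℝ)) (z.2, y) * D (z.1, y))
      hm.stronglyMeasurable).measurable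
  have hs1 : MeasurableSet {p : ℝ × ℝ | m < p.2 ∧ p.2 ≤ p.1} :=
    (measurableSet_lt measurable_const measurable_snd).inter
      (measurableSet_le measurable_snd measurable_fst)
  have hs2 : MeasurableSet {p : ℝ × ℝ | p.1 < p.2 ∧ p.2 ≤ m} :=
    (measurableSet_lt measurable_fst measurable_snd).inter
      (measurableSet_le measurable_snd measurable_const)
  convert (h1 _ hs1).sub (h1 _ hs2) using 1
  funext z
  rw [intervalIntegral, ← integral_indicator measurableSet_Ioc,
    ← integral_indicator measurableSet_Ioc]
  congr 2 <;>
  · funext y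
    simp only [indicator_apply, mem_Ioc, mem_ofPred_eq]
    split_ifs <;> simp

/-- The primitive is normalized by the spatial mean of `v - ∫_m^x Dv`, which is measurable in
time. -/
lemma exists_sobolevRep {T m R : ℝ} (hR : 0 < R) {v Dv : ℝ → ℝ → ℝ}
    (h : IsL2H1 T (Metric.ball m R) v Dv)
    (hnn : ∀ᵐ z ∂(volume.restrict (cyl T (Metric.ball m R))), 0 ≤ v z.1 z.2) :
    ∃ u Du N, SobolevRep T m R v Dv u Du N := by
  obtain ⟨hv, hD, hH⟩ := h
  set B := Metric.ball m R with hB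
  have hBm : MeasurableSet B := measurableSet_ball
  have hBf : volume B ≠ ∞ := measure_ball_lt_top.ne
  have hSm : MeasurableSet (cyl T B) := measurableSet_Ioo.prod hBm
  have hprod : (volume : Measure (ℝ × ℝ)).restrict (cyl T B)
      = (volume.restrict (Ioo 0 T)).prod (volume.restrict B) := by
    rw [Measure.prod_restrict]; rfl
  set V : ℝ × ℝ → ℝ := (cyl T B).indicator (hv.1.mk _) with hVdef
  set D : ℝ × ℝ → ℝ := (cyl T B).indicator (hD.1.mk _) with hDdef
  have hVm : Measurable V := hv.1.stronglyMeasurable_mk.measurable.indicator hSm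
  have hDm : Measurable D := hD.1.stronglyMeasurable_mk.measurable.indicator hSm
  have hVe : ∀ᵐ z ∂(volume.restrict (cyl T B)), v z.1 z.2 = V z := by
    filter_upwards [hv.1.ae_eq_mk, ae_restrict_mem hSm] with z h1 h2
    rw [hVdef, indicator_of_mem h2, ← h1]; rfl
  have hDe : ∀ᵐ z ∂(volume.restrict (cyl T B)), Dv z.1 z.2 = D z := by
    filter_upwards [hD.1.ae_eq_mk, ae_restrict_mem hSm] with z h1 h2
    rw [hDdef, indicator_of_mem h2, ← h1]; rfl
  have hV2 : MemLp V 2 := by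
    rw [hVdef, memLp_indicator_iff_restrict hSm]; exact (memLp_congr_ae hv.1.ae_eq_mk).1 hv
  have hD2 : MemLp D 2 := by
    rw [hDdef, memLp_indicator_iff_restrict hSm]; exact (memLp_congr_ae hD.1.ae_eq_mk).1 hD
  have hV0 : ∀ z : ℝ × ℝ, z.2 ∉ B → V z = 0 := fun z hz =>
    indicator_of_notMem (fun hz' => hz hz'.2) _
  have hD0 : ∀ z : ℝ × ℝ, z.2 ∉ B → D z = 0 := fun z hz =>
    indicator_of_notMem (fun hz' => hz hz'.2) _
  set G : ℝ × ℝ → ℝ := fun z => ∫ y in m..z.2, D (z.1, y) with hG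
  have hGm : Measurable G := measurable_primitive hDm m
  set c : ℝ → ℝ := fun t => (volume B).toReal⁻¹ * ∫ x in B, (V (t, x) - G (t, x)) with hc
  have hcm : Measurable c :=
    ((StronglyMeasurable.integral_prod_right (ν := volume.restrict B)
      (f := fun t x => V (t, x) - G (t, x))
      (hVm.sub hGm).stronglyMeasurable).measurable).const_mul _
  set w : ℝ × ℝ → ℝ := fun z => c z.1 + G z with hw
  have hwm : Measurable w := (hcm.comp measurable_fst).add hGm
  have hBpos : 0 < (volume B).toReal :=
    ENNReal.toReal_pos (Metric.measure_ball_pos _ _ hR).ne' hBf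
  -- the times at which the slices are Sobolev functions
  have hgood : ∀ᵐ t ∂(volume.restrict (Ioo 0 T)), t ∈ Ioo 0 T ∧ IntegrableOn (fun x => V (t, x)) B ∧
      Integrable (fun x => D (t, x)) ∧ (∀ᵐ x ∂(volume.restrict B), V (t, x) = w (t, x)) ∧
      ∀ᵐ x ∂(volume.restrict B), 0 ≤ V (t, x) := by
    have hVe' := hVe; have hDe' := hDe; have hnn' := hnn
    rw [hprod] at hVe' hDe' hnn'
    filter_upwards [hH, ae_restrict_mem measurableSet_Ioo, Measure.ae_ae_of_ae_prod hVe',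
      Measure.ae_ae_of_ae_prod hDe', Measure.ae_ae_of_ae_prod hnn'] with t h1 h2 h3 h4 h5
    have hVi : IntegrableOn (fun x => V (t, x)) B :=
      (memLp_two_integrableOn hBf h1.1).congr h3
    have hDi : IntegrableOn (fun x => D (t, x)) B :=
      (memLp_two_integrableOn hBf h1.2.1).congr h4
    have hind : (fun x => D (t, x)) = B.indicator fun x => D (t, x) := by
      funext x
      by_cases hx : x ∈ B
      · rw [indicator_of_mem hx]
      · rw [indicator_of_notMem hx, hD0 _ hx]
    have hDi' : Integrable fun x => D (t, x) := by
      rw [hind]; exact hDi.integrable_indicator hBm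
    refine ⟨h2, hVi, hDi', ?_, ?_⟩
    · obtain ⟨a, ha⟩ := h1.exists_const hR
      have hDD : B.indicator (Dv t) =ᵐ[volume] fun x => D (t, x) := by
        filter_upwards [(ae_restrict_iff' hBm).1 h4] with x hx
        by_cases hxB : x ∈ B
        · rw [indicator_of_mem hxB, hx hxB]
        · rw [indicator_of_notMem hxB, hD0 _ hxB]
      have ha' : ∀ᵐ x ∂(volume.restrict B), V (t, x) = a + G (t, x) := by
        filter_upwards [ha, h3] with x hx hx3
        rw [← hx3, hx, hG]
        simp only
        congr 1
        exact intervalIntegral.integral_congr_ae (hDD.mono fun y hy _ => hy)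
      have hca : c t = a := by
        rw [hc]
        simp only
        rw [integral_congr_ae (g := fun _ => a) (ha'.mono fun x hx => by simp only [hx]; ring),
          setIntegral_const, smul_eq_mul, measureReal_def]
        field_simp
      filter_upwards [ha'] with x hx
      rw [hx, hw]; simp only [hca]
    · filter_upwards [h3, h5] with x h6 h7
      rw [← h6]; exact h7
  obtain ⟨E, hE, hEm, hEg⟩ := hgood.exists_measurable_mem
  have hEae : ∀ᵐ t ∂(volume.restrict (Ioo 0 T)), t ∈ E := hE
  have hES : MeasurableSet (E ×ˢ (univ : Set ℝ)) := hEm.prod MeasurableSet.univ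
  have hGle : ∀ t ∈ E, ∀ x, |G (t, x)| ≤ ∫ y, |D (t, y)| := by
    intro t ht x
    refine (intervalIntegral.norm_integral_le_integral_norm_uIoc (f := fun y => D (t, y))).trans ?_
    exact setIntegral_le_integral (hEg t ht).2.2.1.norm (Eventually.of_forall fun x => norm_nonneg _)
  have hprim : ∀ t ∈ E, IsPrimitive (fun x => w (t, x)) (fun x => D (t, x)) := by
    intro t ht
    have hDi := (hEg t ht).2.2.1
    refine ⟨hDi, fun x y => ?_⟩
    simp only [hw, hG]
    rw [add_sub_add_left_eq_sub, intervalIntegral.integral_interval_sub_left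
      hDi.intervalIntegrable hDi.intervalIntegrable]
  have hu_mem : ∀ t ∈ E, ∀ x, (E ×ˢ (univ : Set ℝ)).indicator w (t, x) = w (t, x) :=
    fun t ht x => indicator_of_mem (show (t, x) ∈ E ×ˢ univ from ⟨ht, mem_univ _⟩) _
  have hu_not : ∀ t, t ∉ E → ∀ (f : ℝ × ℝ → ℝ) x, (E ×ˢ (univ : Set ℝ)).indicator f (t, x) = 0 :=
    fun t ht f x => indicator_of_notMem (fun h => ht h.1) _
  have hD_mem : ∀ t ∈ E, ∀ x, (E ×ˢ (univ : Set ℝ)).indicator D (t, x) = D (t, x) :=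
    fun t ht x => indicator_of_mem (show (t, x) ∈ E ×ˢ univ from ⟨ht, mem_univ _⟩) _
  have hae_E : ∀ᵐ z ∂(volume.restrict (cyl T B)), z.1 ∈ E := by
    rw [hprod]
    exact Measure.quasiMeasurePreserving_fst.ae hEae
  have hm1 : MemLp (fun t => ∫ x, |V (t, x)|) 2 := memLp_integral_abs hVm hV2 hV0
  have hm2 : MemLp (fun t => ∫ x, |D (t, x)|) 2 := memLp_integral_abs hDm hD2 hD0
  have hmm1 : Measurable fun t => ∫ x, |V (t, x)| :=
    (StronglyMeasurable.integral_prod_right (f := fun t x => |V (t, x)|)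
      hVm.norm.stronglyMeasurable).measurable
  have hmm2 : Measurable fun t => ∫ x, |D (t, x)| :=
    (StronglyMeasurable.integral_prod_right (f := fun t x => |D (t, x)|)
      hDm.norm.stronglyMeasurable).measurable
  have hN0 : ∀ t, 0 ≤ (volume B).toReal⁻¹ * (∫ x, |V (t, x)|) + 2 * ∫ x, |D (t, x)| := fun t => by
    positivity
  refine ⟨(E ×ˢ univ).indicator w, (E ×ˢ univ).indicator D,
    fun t => (volume B).toReal⁻¹ * (∫ x, |V (t, x)|) + 2 * ∫ x, |D (t, x)|, ?_⟩
  refine ⟨hwm.indicator hES, hDm.indicator hES, fun t => ?_, ?_, ?_, ?_, hD2.indicator hES,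
    (hmm1.const_mul _).add (hmm2.const_mul _), (hm1.const_mul _).add (hm2.const_mul _), ?_, ?_, ?_⟩
  · by_cases ht : t ∈ E
    · simp only [hu_mem t ht, hD_mem t ht]; exact hprim t ht
    · simp only [hu_not t ht]
      exact ⟨integrable_zero _ _ _, fun x y => by simp⟩
  · rintro ⟨t, x⟩
    by_cases ht : t ∈ E
    · rw [hu_mem t ht]
      obtain ⟨-, -, -, h4, h5⟩ := hEg t ht
      refine (hprim t ht).nonneg_of_ae hR (fun x hx => hD0 (t, x) hx) ?_ x
      filter_upwards [h4, h5] with x h6 h7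
      rw [← h6]; exact h7
    · rw [hu_not t ht]
  · rintro ⟨t, x⟩ ht
    exact hu_not t (fun h => ht (hEg t h).1) _ _
  · rintro ⟨t, x⟩ hz
    by_cases ht : t ∈ E
    · rw [hD_mem t ht]; exact indicator_of_notMem hz _
    · exact hu_not t ht _ _
  · rintro ⟨t, x⟩
    by_cases ht : t ∈ E
    · rw [hu_mem t ht]
      obtain ⟨-, hVi, hDi, -, -⟩ := hEg t ht
      have hGi : IntegrableOn (fun x => G (t, x)) B := by
        refine IntegrableOn.of_bound hBf.lt_top (hGm.comp (by fun_prop)).aestronglyMeasurable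
          (∫ y, |D (t, y)|) (Eventually.of_forall fun x => hGle t ht x)
      have h1 : c t ≤ (volume B).toReal⁻¹ * ∫ x in B, (|V (t, x)| + ∫ y, |D (t, y)|) := by
        rw [hc]; simp only
        refine mul_le_mul_of_nonneg_left ?_ (inv_nonneg.2 hBpos.le)
        refine integral_mono (hVi.sub hGi) (hVi.abs.add (integrableOn_const hBf)) fun x => ?_
        have := abs_le.1 (hGle t ht x)
        have := le_abs_self (V (t, x))
        dsimp only; linarith
      have h2 : ∫ x in B, (|V (t, x)| + ∫ y, |D (t, y)|)
          = (∫ x, |V (t, x)|) + (volume B).toReal * ∫ y, |D (t, y)| := by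
        rw [integral_add (f := fun x => |V (t, x)|) (g := fun _ => ∫ y, |D (t, y)|) hVi.abs
          (integrableOn_const hBf), setIntegral_const, smul_eq_mul, measureReal_def,
          setIntegral_eq_integral_of_forall_compl_eq_zero fun x hx => by
            rw [hV0 (t, x) hx, abs_zero]]
      rw [h2, mul_add, ← mul_assoc, inv_mul_cancel₀ hBpos.ne', one_mul] at h1
      have := abs_le.1 (hGle t ht x)
      simp only [hw]; linarith
    · rw [hu_not t ht]; exact hN0 t
  · have hmeasE : MeasurableSet {z : ℝ × ℝ | z.1 ∈ E → V z = w z} := by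
      have : {z : ℝ × ℝ | z.1 ∈ E → V z = w z} = (E ×ˢ univ)ᶜ ∪ {z | V z = w z} := by
        ext z; simp only [mem_ofPred_eq, mem_union, mem_compl_iff, mem_prod, mem_univ, and_true]
        tauto
      rw [this]
      exact hES.compl.union (measurableSet_eq_fun hVm hwm)
    have h1 : ∀ᵐ z ∂(volume.restrict (cyl T B)), z.1 ∈ E → V z = w z := by
      rw [hprod]
      refine (Measure.ae_prod_iff_ae_ae hmeasE).2 (Eventually.of_forall fun t => ?_)
      by_cases ht : t ∈ E
      · filter_upwards [(hEg t ht).2.2.2.1] with x hx _ using hx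
      · exact Eventually.of_forall fun x h => absurd h ht
    filter_upwards [hVe, h1, hae_E] with z h2 h3 h4
    rw [h2, h3 h4, hu_mem z.1 h4]
  · filter_upwards [hDe, hae_E] with z h2 h4
    rw [h2, hD_mem z.1 h4]

/-- Every nonnegative weak subsolution has representatives of its data that make it a
`RegularSub`. -/
lemma exists_regularSub {k : ℝ → ℝ} {T m R ν Λ : ℝ} {A : ℝ → ℝ → ℝ} {u₀ : ℝ → ℝ} {v : ℝ → ℝ → ℝ}
    (hT : 0 < T) (hR : 0 < R) (hν : 0 < ν) (hνΛ : ν ≤ Λ)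
    (hsub : IsWeakSubsolution k A u₀ T (Metric.ball m R) v)
    (hnn : ∀ᵐ z ∂(volume.restrict (cyl T (Metric.ball m R))), 0 ≤ v z.1 z.2)
    (hu₀ : MemLp u₀ 2 (volume.restrict (Metric.ball m R)))
    (hnn₀ : ∀ᵐ x ∂(volume.restrict (Metric.ball m R)), 0 ≤ u₀ x)
    (hA : AEStronglyMeasurable (Function.uncurry A) (volume.restrict (cyl T (Metric.ball m R))))
    (hAν : ∀ᵐ z ∂(volume.restrict (cyl T (Metric.ball m R))), ν ≤ A z.1 z.2)
    (hAΛ : ∀ᵐ z ∂(volume.restrict (cyl T (Metric.ball m R))), A z.1 z.2 ≤ Λ) :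
    ∃ A' U₀ u Du N, RegularSub k T m R ν Λ A' U₀ u Du N ∧
      (∀ᵐ z ∂(volume.restrict (cyl T (Metric.ball m R))), v z.1 z.2 = u z) ∧
      ∀ᵐ x ∂(volume.restrict (Metric.ball m R)), u₀ x = U₀ x := by
  obtain ⟨Dv, hZ, hweak⟩ := hsub
  obtain ⟨u, Du, N, h⟩ := exists_sobolevRep hR hZ.1 hnn
  have hBm : MeasurableSet (Metric.ball m R) := measurableSet_ball
  have hSm : MeasurableSet (cyl T (Metric.ball m R)) := measurableSet_Ioo.prod hBm
  have hprod : (volume : Measure (ℝ × ℝ)).restrict (cyl T (Metric.ball m R))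
      = (volume.restrict (Ioo 0 T)).prod (volume.restrict (Metric.ball m R)) := by
    rw [Measure.prod_restrict]; rfl
  set U₀ : ℝ → ℝ := (Metric.ball m R).indicator fun x => max (hu₀.1.mk _ x) 0 with hU₀
  have hU₀m : Measurable U₀ :=
    (hu₀.1.stronglyMeasurable_mk.measurable.max measurable_const).indicator hBm
  have hU₀e : ∀ᵐ x ∂(volume.restrict (Metric.ball m R)), u₀ x = U₀ x := by
    filter_upwards [hu₀.1.ae_eq_mk, ae_restrict_mem hBm, hnn₀] with x h1 h2 h3
    rw [hU₀, indicator_of_mem h2, ← h1, max_eq_left h3]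
  set A' : ℝ × ℝ → ℝ := fun z => max ν (min (hA.mk _ z) Λ) with hA'
  have hA'e : ∀ᵐ z ∂(volume.restrict (cyl T (Metric.ball m R))), A z.1 z.2 = A' z := by
    filter_upwards [hA.ae_eq_mk, hAν, hAΛ] with z h1 h2 h3
    have h4 : hA.mk _ z = A z.1 z.2 := h1.symm
    rw [hA']; simp only [h4]
    rw [min_eq_left h3, max_eq_right h2]
  refine ⟨A', U₀, u, Du, N, ⟨hT, hR, h.meas, h.meas_D, h.prim, h.nonneg, h.zero, h.D_zero, h.memLp_D,
    h.meas_N, h.memLp_N, h.le_N,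
    measurable_const.max (hA.stronglyMeasurable_mk.measurable.min measurable_const), hν,
    fun z => le_max_left _ _, fun z => max_le hνΛ (min_le_right _ _), hU₀m,
    fun x => indicator_nonneg (fun _ _ => le_max_right _ _) _,
    fun x hx => indicator_of_notMem hx _, ?_, ?_⟩, h.ae_eq, hU₀e⟩
  · have h1 : MemLp U₀ 2 (volume.restrict (Metric.ball m R)) := (memLp_congr_ae hU₀e).1 hu₀
    have h2 : U₀ = (Metric.ball m R).indicator U₀ := by
      rw [hU₀, indicator_indicator, inter_self]
    rw [h2, memLp_indicator_iff_restrict hBm]; exact h1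
  · intro ζ ζt Dζ hζ
    refine le_of_eq_of_le (integral_congr_ae ?_) (hweak ζ ζt Dζ hζ)
    -- for almost every `x`, the histories of `v` and `u` at `x` agree at almost every time
    have hslice : ∀ᵐ z ∂(volume.restrict (cyl T (Metric.ball m R))),
        ∀ᵐ τ ∂(volume.restrict (Ioo 0 T)), v τ z.2 = u (τ, z.2) := by
      have h1 := h.ae_eq
      rw [hprod] at h1 ⊢
      have h2 := (Measure.measurePreserving_swap (μ := volume.restrict (Metric.ball m R))
        (ν := volume.restrict (Ioo 0 T))).quasiMeasurePreserving.ae h1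
      exact Measure.quasiMeasurePreserving_snd.ae (Measure.ae_ae_of_ae_prod h2)
    have hslice₀ : ∀ᵐ z ∂(volume.restrict (cyl T (Metric.ball m R))), u₀ z.2 = U₀ z.2 := by
      rw [hprod]; exact Measure.quasiMeasurePreserving_snd.ae hU₀e
    filter_upwards [ae_restrict_mem hSm, hslice, hslice₀, h.ae_eq_D, hA'e] with z h1 h2 h3 h4 h5
    rw [indicator_of_mem h1, h4, h5]
    congr 2
    unfold conv
    refine intervalIntegral.integral_congr_ae ?_
    rw [ae_restrict_iff' measurableSet_Ioo] at h2
    filter_upwards [h2] with τ hτ hτt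
    rw [uIoc_of_le h1.1.1.le] at hτt
    have hτT : τ ∈ Ioo 0 T := ⟨hτt.1, hτt.2.trans_lt h1.1.2⟩
    rw [indicator_of_mem (show (τ, z.2) ∈ cyl T (Metric.ball m R) from ⟨hτT, h1.2⟩), hτ hτT, h3]

/-! ### From representatives to essential suprema -/

lemma ofReal_integral_le {α : Type*} [MeasurableSpace α] {μ : Measure α} (f : α → ℝ) :
    ENNReal.ofReal (∫ x, f x ∂μ) ≤ ∫⁻ x, ENNReal.ofReal (f x) ∂μ := by
  by_cases hf : Integrable f μ
  · rw [integral_eq_lintegral_pos_part_sub_lintegral_neg_part hf]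
    exact (ENNReal.ofReal_le_ofReal (sub_le_self _ ENNReal.toReal_nonneg)).trans
      ENNReal.ofReal_toReal_le
  · rw [integral_undef hf, ENNReal.ofReal_zero]; exact zero_le

section Conclusion

variable {k l : ℝ → ℝ} {T x₀ r ν Λ : ℝ} {A : ℝ × ℝ → ℝ} {u₀ U₀ : ℝ → ℝ} {u Du : ℝ × ℝ → ℝ}
    {N : ℝ → ℝ} {v : ℝ → ℝ → ℝ}

lemma ae_ae_eq_of_ae_cyl
    (hvu : ∀ᵐ z ∂(volume.restrict (cyl T (Metric.ball x₀ r))), v z.1 z.2 = u z) :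
    ∀ᵐ t, t ∈ Ioo 0 T → ∀ᵐ x ∂(volume.restrict (Metric.ball x₀ r)), v t x = u (t, x) := by
  have hprod : (volume : Measure (ℝ × ℝ)).restrict (cyl T (Metric.ball x₀ r))
      = (volume.restrict (Ioo 0 T)).prod (volume.restrict (Metric.ball x₀ r)) := by
    rw [Measure.prod_restrict]; rfl
  rw [hprod] at hvu
  exact (ae_restrict_iff' measurableSet_Ioo).1 (Measure.ae_ae_of_ae_prod hvu)

/-- By continuity, the supremum over a ball is at most the essential supremum. -/
lemma RegularSub.ofReal_ballSup_le (hu : RegularSub k T x₀ r ν Λ A U₀ u Du N) {R t : ℝ} (hR : 0 < R)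
    {f : ℝ → ℝ} (hf : ∀ᵐ x ∂(volume.restrict (Metric.ball x₀ R)), f x = u (t, x)) :
    ENNReal.ofReal (ballSup u x₀ R t)
      ≤ essSup (fun x => ENNReal.ofReal (f x)) (volume.restrict (Metric.ball x₀ R)) := by
  set K := essSup (fun x => ENNReal.ofReal (f x)) (volume.restrict (Metric.ball x₀ R)) with hK
  rcases eq_or_ne K ∞ with h | h
  · rw [h]; exact le_top
  refine ENNReal.ofReal_le_of_le_toReal (ballSup_le hR fun x hx => ?_)
  have h1 : ∀ᵐ x ∂(volume.restrict (Metric.ball x₀ R)), 0 ≤ K.toReal - u (t, x) := by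
    filter_upwards [hf, ENNReal.ae_le_essSup (μ := volume.restrict (Metric.ball x₀ R))
      (fun x => ENNReal.ofReal (f x))] with x h2 h3
    have := (ENNReal.ofReal_le_iff_le_toReal h).1 h3
    linarith
  have := nonneg_on_closedBall_of_ae hR (continuous_const.sub (hu.prim t).continuous) h1 x
    (Metric.ball_subset_closedBall hx)
  exact sub_nonneg.1 this

lemma RegularSub.ofReal_integral_ballSup_le (hu : RegularSub k T x₀ r ν Λ A U₀ u Du N)
    (hvu : ∀ᵐ z ∂(volume.restrict (cyl T (Metric.ball x₀ r))), v z.1 z.2 = u z)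
    {τ a σ : ℝ} (hτ : 0 < τ) (ha : 0 ≤ a) (hσ : 0 < σ) (hσ1 : σ ≤ 1) :
    ENNReal.ofReal (1 / τ * ∫ t in Ioo a T, ballSup u x₀ (r * σ) t)
      ≤ ENNReal.ofReal (1 / τ) * ∫⁻ t in Ioo a T,
        essSup (fun x => ENNReal.ofReal (v t x)) (volume.restrict (Metric.ball x₀ (r * σ))) := by
  rw [ENNReal.ofReal_mul (by positivity)]
  gcongr
  refine (ofReal_integral_le _).trans (lintegral_mono_ae ?_)
  rw [ae_restrict_iff' measurableSet_Ioo]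
  filter_upwards [ae_ae_eq_of_ae_cyl hvu] with t ht htI
  refine hu.ofReal_ballSup_le (mul_pos hu.R_pos hσ) ?_
  exact ae_restrict_of_ae_restrict_of_subset
    (Metric.ball_subset_ball (mul_le_of_le_one_right hu.R_pos.le hσ1))
    (ht ⟨ha.trans_lt htI.1, htI.2⟩)

/-- The initial term of `HistoryBound` is at most its counterpart in `[0, ∞]`. At `a = 0` the
value `kernelVal k a` may be infinite, and finiteness of the product leaves `∫ u₀ = 0`. -/
lemma RegularSub.initial_le (hu : RegularSub k T x₀ r ν Λ A U₀ u Du N)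
    (hU : ∀ᵐ x ∂(volume.restrict (Metric.ball x₀ r)), u₀ x = U₀ x)
    {a t σ : ℝ} (hat : a < t) (hσ1 : σ ≤ 1)
    (hfin : kernelVal k a * ENNReal.ofReal r *
      (∫⁻ x in Metric.ball x₀ (r * σ), ENNReal.ofReal (u₀ x)) ≠ ∞) :
    r * (k t * ∫ x in Metric.ball x₀ (r * σ), U₀ x) ≤ (kernelVal k a * ENNReal.ofReal r *
      (∫⁻ x in Metric.ball x₀ (r * σ), ENNReal.ofReal (u₀ x))).toReal := by
  rw [← ENNReal.ofReal_le_iff_le_toReal hfin, ENNReal.ofReal_mul hu.R_pos.le,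
    ENNReal.ofReal_mul' (integral_nonneg hu.nonneg_u₀), ← mul_assoc,
    mul_comm (kernelVal k a)]
  have h1 : ENNReal.ofReal (k t) ≤ kernelVal k a :=
    le_iSup₂ (f := fun s (_ : s ∈ Ioi a) => ENNReal.ofReal (k s)) t hat
  have h2 : ENNReal.ofReal (∫ x in Metric.ball x₀ (r * σ), U₀ x)
      ≤ ∫⁻ x in Metric.ball x₀ (r * σ), ENNReal.ofReal (u₀ x) := by
    refine (ofReal_integral_le _).trans (lintegral_mono_ae ?_)
    filter_upwards [ae_restrict_of_ae_restrict_of_subset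
      (Metric.ball_subset_ball (mul_le_of_le_one_right hu.R_pos.le hσ1)) hU] with x hx
    rw [hx]
  gcongr

/-- The memory term of `HistoryBound` is at most its counterpart in `[0, ∞]`, by Tonelli. -/
lemma RegularSub.memory_le (hu : RegularSub k T x₀ r ν Λ A U₀ u Du N)
    (hvu : ∀ᵐ z ∂(volume.restrict (cyl T (Metric.ball x₀ r))), v z.1 z.2 = u z)
    {b σ : ℝ} (hb : b ≤ T) (hσ1 : σ ≤ 1)
    (hfin : ENNReal.ofReal r * (∫⁻ τ in Ioo 0 b, ENNReal.ofReal (-deriv k (T - τ)) *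
      ∫⁻ x in Metric.ball x₀ (r * σ), ENNReal.ofReal (v τ x)) ≠ ∞) :
    r * (∫ x in Metric.ball x₀ (r * σ), ∫ a in Ioc 0 b, -deriv k (T - a) * u (a, x))
      ≤ (ENNReal.ofReal r * (∫⁻ τ in Ioo 0 b, ENNReal.ofReal (-deriv k (T - τ)) *
      ∫⁻ x in Metric.ball x₀ (r * σ), ENNReal.ofReal (v τ x))).toReal := by
  rw [← ENNReal.ofReal_le_iff_le_toReal hfin, ENNReal.ofReal_mul hu.R_pos.le]
  gcongr
  have hkm : Measurable fun a => ENNReal.ofReal (-deriv k (T - a)) :=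
    (((measurable_deriv k).comp (by fun_prop)).neg).ennreal_ofReal
  have hm : Measurable fun p : ℝ × ℝ => ENNReal.ofReal (-deriv k (T - p.2)) *
      ENNReal.ofReal (u (p.2, p.1)) :=
    (hkm.comp measurable_snd).mul (hu.meas.comp measurable_swap).ennreal_ofReal
  calc ENNReal.ofReal (∫ x in Metric.ball x₀ (r * σ), ∫ a in Ioc 0 b, -deriv k (T - a) * u (a, x))
      ≤ ∫⁻ x in Metric.ball x₀ (r * σ), ∫⁻ a in Ioc 0 b, ENNReal.ofReal (-deriv k (T - a)) *
          ENNReal.ofReal (u (a, x)) := by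
        refine (ofReal_integral_le _).trans (lintegral_mono fun x => ?_)
        refine (ofReal_integral_le _).trans (lintegral_mono fun a => ?_)
        simp only
        rw [ENNReal.ofReal_mul' (hu.nonneg _)]
    _ = ∫⁻ a in Ioc 0 b, ∫⁻ x in Metric.ball x₀ (r * σ), ENNReal.ofReal (-deriv k (T - a)) *
          ENNReal.ofReal (u (a, x)) := lintegral_lintegral_swap hm.aemeasurable
    _ = ∫⁻ a in Ioo 0 b, ∫⁻ x in Metric.ball x₀ (r * σ), ENNReal.ofReal (-deriv k (T - a)) *
          ENNReal.ofReal (u (a, x)) := by rw [Measure.restrict_congr_set Ioo_ae_eq_Ioc]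
    _ ≤ _ := by
        refine lintegral_mono_ae ?_
        rw [ae_restrict_iff' measurableSet_Ioo]
        filter_upwards [ae_ae_eq_of_ae_cyl hvu] with a ha haI
        have hum : Measurable fun x => ENNReal.ofReal (u (a, x)) :=
          (hu.meas.comp measurable_prodMk_left).ennreal_ofReal
        rw [lintegral_const_mul _ hum]
        refine mul_le_mul_right (lintegral_mono_ae ?_) _
        filter_upwards [ae_restrict_of_ae_restrict_of_subset
          (Metric.ball_subset_ball (mul_le_of_le_one_right hu.R_pos.le hσ1))
          (ha ⟨haI.1, haI.2.trans_le hb⟩)] with x hx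
        rw [hx]

lemma RegularSub.essSup_le_of_boundedOn (hu : RegularSub k T x₀ r ν Λ A U₀ u Du N)
    (hvu : ∀ᵐ z ∂(volume.restrict (cyl T (Metric.ball x₀ r))), v z.1 z.2 = u z)
    {S s K : ℝ} (hs : 0 < s) (hs1 : s ≤ 1) (hST : s * S ≤ T) (h : BoundedOn u T x₀ r S s K) :
    essSup (fun z : ℝ × ℝ => ENNReal.ofReal (v z.1 z.2))
      (volume.restrict (Ioo (T - s * S) T ×ˢ Metric.ball x₀ (r * s))) ≤ ENNReal.ofReal K := by
  refine essSup_le_of_ae_le _ ?_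
  have hsubset : Ioo (T - s * S) T ×ˢ Metric.ball x₀ (r * s) ⊆ cyl T (Metric.ball x₀ r) :=
    prod_mono (Ioo_subset_Ioo_left (by linarith))
      (Metric.ball_subset_ball (mul_le_of_le_one_right hu.R_pos.le hs1))
  have h1 : ∀ᵐ z ∂((volume : Measure (ℝ × ℝ)).restrict
      (Ioo (T - s * S) T ×ˢ Metric.ball x₀ (r * s))), ballSup u x₀ (r * s) z.1 ≤ K := by
    rw [Measure.volume_eq_prod, ← Measure.prod_restrict]
    exact Measure.quasiMeasurePreserving_fst.ae ((ae_restrict_iff' measurableSet_Ioo).2 h)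
  filter_upwards [h1, ae_restrict_of_ae_restrict_of_subset hsubset hvu,
    ae_restrict_mem (measurableSet_Ioo.prod measurableSet_ball)] with z h2 h3 h4
  rw [h3]
  exact ENNReal.ofReal_le_ofReal ((hu.le_ballSup (mul_pos hu.R_pos hs)
    (Metric.ball_subset_closedBall h4.2)).trans h2)

variable {η β Cl Ck ω cη τ : ℝ}

/-- The constant in the local boundedness estimate. -/
noncomputable def boundConst (η β Cl Ck ω cη ν Λ : ℝ) : ℝ :=
  2 * (iterConst β ω (stepConst η Cl Ck ω cη ν Λ) * 2 ^ iterExp β ω * 4 ^ iterExp β ω + 1)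

lemma boundConst_pos (hη : 0 < η) (hcη : 0 ≤ cη) (hCl : 0 < Cl) (hCk : 0 ≤ Ck) (hν : 0 < ν)
    (hΛ : 0 ≤ Λ) : 0 < boundConst η β Cl Ck ω cη ν Λ := by
  have hC₁ : 0 < stepConst η Cl Ck ω cη ν Λ := stepConst_pos hη hcη hCl hCk hν hΛ
  have : 0 ≤ iterConst β ω (stepConst η Cl Ck ω cη ν Λ) := by
    unfold iterConst iterRatio
    positivity
  unfold boundConst
  positivity

/-- The local boundedness estimate for a subsolution with a good representative. -/
lemma KernelScale.essSup_le (hK : AssumptionK0 k l)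
    (ks : KernelScale k l η β Cl Ck ω cη r τ)
    (hη : 0 < η) (hω : 0 < ω) (hβ : 0 < β) (hcη : 0 ≤ cη) (hCl : 0 < Cl) (hCk : 0 ≤ Ck)
    (hu : RegularSub k T x₀ r ν Λ A U₀ u Du N) (hT : η * τ ≤ T)
    (hvu : ∀ᵐ z ∂(volume.restrict (cyl T (Metric.ball x₀ r))), v z.1 z.2 = u z)
    (hU : ∀ᵐ x ∂(volume.restrict (Metric.ball x₀ r)), u₀ x = U₀ x)
    {σ' σ : ℝ} (hσ' : 0 < σ') (hσσ : σ' < σ) (hσ1 : σ ≤ 1) :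
    essSup (fun z : ℝ × ℝ => ENNReal.ofReal (v z.1 z.2))
        (volume.restrict (Ioo (T - σ' * (η * τ)) T ×ˢ Metric.ball x₀ (r * σ')))
      ≤ ENNReal.ofReal (boundConst η β Cl Ck ω cη ν Λ / (σ - σ') ^ iterExp β ω) *
        (ENNReal.ofReal (1 / τ) *
            (∫⁻ t in Ioo (T - σ * (η * τ)) T,
              essSup (fun x => ENNReal.ofReal (v t x))
                (volume.restrict (Metric.ball x₀ (r * σ))))
          + kernelVal k (T - σ * (η * τ)) * ENNReal.ofReal r *
            (∫⁻ x in Metric.ball x₀ (r * σ), ENNReal.ofReal (u₀ x))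
          + ENNReal.ofReal r *
            (∫⁻ τ in Ioo 0 (T - σ' * (η * τ)),
              ENNReal.ofReal (-deriv k (T - τ)) *
                ∫⁻ x in Metric.ball x₀ (r * σ), ENNReal.ofReal (v τ x))) := by
  have hS : 0 < η * τ := mul_pos hη ks.pos
  have hσ : 0 < σ := hσ'.trans hσσ
  have hΛ : 0 ≤ Λ := hu.ν_pos.le.trans ((hu.A_ge 0).trans (hu.A_le 0))
  have hσS : σ * (η * τ) ≤ η * τ := mul_le_of_le_one_left hS.le hσ1
  have hσS' : σ' * (η * τ) ≤ η * τ := mul_le_of_le_one_left hS.le (hσσ.le.trans hσ1)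
  have hB : 0 < boundConst η β Cl Ck ω cη ν Λ := boundConst_pos hη hcη hCl hCk hu.ν_pos hΛ
  have hpow : 0 < (σ - σ') ^ iterExp β ω := Real.rpow_pos_of_pos (sub_pos.2 hσσ) _
  have hI := hu.ofReal_integral_ballSup_le hvu (τ := τ) (a := T - σ * (η * τ)) ks.pos
    (by linarith) hσ hσ1
  have hInit := fun t ht => hu.initial_le hU (a := T - σ * (η * τ)) (t := t) (σ := σ) ht hσ1
  have hMem := hu.memory_le hvu (b := T - σ' * (η * τ)) (σ := σ)
    (by linarith [mul_pos hσ' hS]) hσ1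
  set QI := ENNReal.ofReal (1 / τ) * (∫⁻ t in Ioo (T - σ * (η * τ)) T,
    essSup (fun x => ENNReal.ofReal (v t x)) (volume.restrict (Metric.ball x₀ (r * σ)))) with hQI
  set QH := kernelVal k (T - σ * (η * τ)) * ENNReal.ofReal r *
    (∫⁻ x in Metric.ball x₀ (r * σ), ENNReal.ofReal (u₀ x)) with hQH
  set QM := ENNReal.ofReal r * (∫⁻ τ in Ioo 0 (T - σ' * (η * τ)),
    ENNReal.ofReal (-deriv k (T - τ)) *
      ∫⁻ x in Metric.ball x₀ (r * σ), ENNReal.ofReal (v τ x)) with hQM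
  set D := boundConst η β Cl Ck ω cη ν Λ / (σ - σ') ^ iterExp β ω with hD
  have hDpos : 0 < D := div_pos hB hpow
  rcases eq_or_ne (QI + QH + QM) ∞ with htop | hfin
  · rw [htop, ENNReal.mul_top (ENNReal.ofReal_pos.2 hDpos).ne']
    exact le_top
  have hfM : QM ≠ ∞ := fun h => hfin (by rw [h]; simp)
  have hfH : QH ≠ ∞ := fun h => hfin (by rw [h]; simp)
  have hfI : QI ≠ ∞ := fun h => hfin (by rw [h]; simp)
  have hQ : QI + QH + QM = ENNReal.ofReal (QI.toReal + QH.toReal + QM.toReal) := by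
    rw [← ENNReal.toReal_add hfI hfH, ← ENNReal.toReal_add (ENNReal.add_ne_top.2 ⟨hfI, hfH⟩) hfM,
      ENNReal.ofReal_toReal hfin]
  rw [hQ, ← ENNReal.ofReal_mul hDpos.le]
  set q := QI.toReal + QH.toReal + QM.toReal with hq
  -- the main estimate needs a positive history bound; a small `ε` is added and sent to zero
  have key : ∀ ε : ℝ, 0 < ε → essSup (fun z : ℝ × ℝ => ENNReal.ofReal (v z.1 z.2))
        (volume.restrict (Ioo (T - σ' * (η * τ)) T ×ˢ Metric.ball x₀ (r * σ')))
      ≤ ENNReal.ofReal (D * (q + ε)) := by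
    intro ε hε
    have hH0 : 0 ≤ QH.toReal := ENNReal.toReal_nonneg
    have hM0 : 0 ≤ QM.toReal := ENNReal.toReal_nonneg
    have hF : HistoryBound k U₀ u T x₀ r (η * τ) σ' σ (QH.toReal + QM.toReal + ε) :=
      ⟨by linarith, fun t ht => (hInit t ht hfH).trans (by linarith),
        (hMem hfM).trans (by linarith)⟩
    have hb := ks.boundedOn hK hη hω hβ hcη hCl hCk hu hT hF (by linarith) hσ' hσσ hσ1 rfl
    refine (hu.essSup_le_of_boundedOn hvu hσ' (hσσ.le.trans hσ1) (by linarith) hb).trans ?_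
    refine ENNReal.ofReal_le_ofReal ?_
    have hI' := (ENNReal.ofReal_le_iff_le_toReal hfI).1 hI
    have hDe : 2 * (iterConst β ω (stepConst η Cl Ck ω cη ν Λ) * 2 ^ iterExp β ω *
        4 ^ iterExp β ω + 1) * (σ - σ') ^ (-iterExp β ω) = D := by
      rw [hD, Real.rpow_neg (sub_pos.2 hσσ).le, div_eq_mul_inv, boundConst]
    rw [hDe]
    exact mul_le_mul_of_nonneg_left (by linarith) hDpos.le
  have hlim : Tendsto (fun ε : ℝ => ENNReal.ofReal (D * (q + ε))) (𝓝[>] 0)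
      (𝓝 (ENNReal.ofReal (D * (q + 0)))) := by
    have hc : Continuous fun ε : ℝ => ENNReal.ofReal (D * (q + ε)) :=
      ENNReal.continuous_ofReal.comp (by fun_prop)
    exact (hc.tendsto 0).mono_left nhdsWithin_le_nhds
  rw [add_zero] at hlim
  exact ge_of_tendsto hlim (eventually_mem_nhdsWithin.mono key)

end Conclusion

end Subdiffusion

open Subdiffusion
theorem theorem4p2 :
    ∀ p₀ ω : ℝ, 1 < p₀ → 0 < ω →
    ∃ τ₀ : ℝ, 0 < τ₀ ∧
    ∀ (ν Λ δ η cbar : ℝ) (c : ℝ → ℝ), 0 < ν → 0 < δ → δ < 1 → 0 < η → 1 < cbar →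
    ∃ C : ℝ, 0 < C ∧
    ∀ (k l : ℝ → ℝ) (tK c₀ : ℝ),
      AssumptionK0 k l → AssumptionK1 l p₀ tK cbar → AssumptionK3 k l c₀ ω c →
    ∀ (T : ℝ) (Ω : Set ℝ), 0 < T → IsOpen Ω → IsConnected Ω → Bornology.IsBounded Ω →
    ∀ (A : ℝ → ℝ → ℝ) (u₀ : ℝ → ℝ), AssumptionH T Ω A u₀ ν Λ →
    ∃ rstar : ℝ, 0 < rstar ∧ ENNReal.ofReal rstar < r₀ l ∧
    ∀ r : ℝ, 0 < r → r ≤ rstar →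
    ∀ t₀ : ℝ, 0 < t₀ → t₀ ≤ T → 0 ≤ t₀ - η * Φ l r →
    ∀ x₀ : ℝ, Metric.ball x₀ r ⊆ Ω →
    ∀ u : ℝ → ℝ → ℝ, IsWeakSubsolution k A u₀ t₀ (Metric.ball x₀ r) u →
      (∀ᵐ z ∂(volume.restrict (cyl t₀ (Metric.ball x₀ r))), 0 ≤ u z.1 z.2) →
      (∀ᵐ x ∂(volume.restrict (Metric.ball x₀ r)), 0 ≤ u₀ x) →
    ∀ σ' σ : ℝ, δ ≤ σ' → σ' < σ → σ ≤ 1 →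
      essSup (fun z : ℝ × ℝ => ENNReal.ofReal (u z.1 z.2))
          (volume.restrict (Ioo (t₀ - σ' * η * Φ l r) t₀ ×ˢ Metric.ball x₀ (r * σ')))
        ≤ ENNReal.ofReal (C / (σ - σ') ^ τ₀) *
          (ENNReal.ofReal (1 / Φ l r) *
              (∫⁻ t in Ioo (t₀ - σ * η * Φ l r) t₀,
                essSup (fun x => ENNReal.ofReal (u t x))
                  (volume.restrict (Metric.ball x₀ (r * σ))))
            + kernelVal k (t₀ - σ * η * Φ l r) * ENNReal.ofReal r *
              (∫⁻ x in Metric.ball x₀ (r * σ), ENNReal.ofReal (u₀ x))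
            + ENNReal.ofReal r *
              (∫⁻ τ in Ioo 0 (t₀ - σ' * η * Φ l r),
                ENNReal.ofReal (-deriv k (t₀ - τ)) *
                  ∫⁻ x in Metric.ball x₀ (r * σ), ENNReal.ofReal (u τ x))) := by
  intro p₀ ω hp hω
  have hβ : 0 < 1 - 1 / p₀ := sub_pos.2 ((div_lt_one (by linarith)).2 hp)
  refine ⟨iterExp (1 - 1 / p₀) ω, by unfold iterExp; positivity, ?_⟩
  intro ν Λ δ η cbar c hν hδ _ hη hcbar
  have hcbar0 : 0 < cbar := by linarith
  have hCl : 0 < cbar ^ (1 / p₀) * max 1 η * η ^ (-(1 - 1 / p₀)) :=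
    mul_pos (mul_pos (Real.rpow_pos_of_pos hcbar0 _) (lt_max_of_lt_left one_pos))
      (Real.rpow_pos_of_pos hη _)
  have hCk : 0 ≤ cbar ^ (1 / p₀) * (η / min 1 η) :=
    mul_nonneg (Real.rpow_nonneg hcbar0.le _)
      (div_nonneg hη.le (le_min zero_le_one hη.le))
  -- `c η` is only known to be positive once (K3) holds, whence the absolute value
  refine ⟨boundConst η (1 - 1 / p₀) (cbar ^ (1 / p₀) * max 1 η * η ^ (-(1 - 1 / p₀)))
    (cbar ^ (1 / p₀) * (η / min 1 η)) ω |c η| ν (max ν Λ),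
    boundConst_pos hη (abs_nonneg _) hCl hCk hν (hν.le.trans (le_max_left _ _)), ?_⟩
  intro k l tK c₀ h0 h1 h3 T Ω _ _ _ _ A u₀ hA
  obtain ⟨rstar, hr0, hrr, hks⟩ := h0.exists_kernelScale h1 h3 hη
  refine ⟨rstar, hr0, hrr, ?_⟩
  intro r hr hrs t₀ ht₀ ht₀T hηt x₀ hball v hv hvnn hu₀nn σ' σ hδσ hσσ hσ1
  have ks := hks r hr hrs
  rw [← abs_of_pos (h3.pos_c η hη)] at ks
  have hsub : cyl t₀ (Metric.ball x₀ r) ⊆ cyl T Ω :=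
    prod_mono (Ioo_subset_Ioo_right ht₀T) hball
  have hAm : MemLp (Function.uncurry A) ∞ (volume.restrict (cyl t₀ (Metric.ball x₀ r))) :=
    hA.memLp_A.mono_measure (Measure.restrict_mono hsub le_rfl)
  have hAΛ : ∀ᵐ z ∂(volume.restrict (cyl T Ω)), A z.1 z.2 ≤ max ν Λ := by
    filter_upwards [ae_le_eLpNormEssSup (f := Function.uncurry A)
      (μ := volume.restrict (cyl T Ω))] with z hz
    have h4 := ENNReal.toReal_mono (eLpNorm_exponent_top (f := Function.uncurry A) ▸
      hA.memLp_A.2.ne) hz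
    rw [toReal_enorm, ← eLpNorm_exponent_top, ← hA.Λ_eq] at h4
    exact (le_abs_self _).trans (h4.trans (le_max_right _ _))
  obtain ⟨A', U₀, u, Du, N, hu, hvu, hU⟩ := exists_regularSub ht₀ hr hν (le_max_left ν Λ) hv hvnn
    (hA.memLp_u₀.mono_measure (Measure.restrict_mono hball le_rfl)) hu₀nn hAm.1
    (ae_restrict_of_ae_restrict_of_subset hsub hA.elliptic)
    (ae_restrict_of_ae_restrict_of_subset hsub hAΛ)
  have := ks.essSup_le h0 hη hω hβ (abs_nonneg _) hCl hCk hu (sub_nonneg.1 hηt) hvu hU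
    (hδ.trans_le hδσ) hσσ hσ1
  rwa [← mul_assoc σ' η, ← mul_assoc σ η] at this
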